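/- Let $\mathcal M^m\subset\mathbb R^Q$ be a closed (compact, boundaryless) smooth embedded submanifold with the induced Riemannian metric $g$, and let $\mathcal N^n\subset\mathcal M$ be a closed embedded submanifold, $1\le n<m$. For $p\in\mathcal M$ let $B_s(p)$ be the open geodesic ball of $\mathcal M$. For every $R_0>0$ there are constants $c,C>0$, depending only on $\mathcal M$, $\mathcal N$ and $R_0$ (hence only on $\mathcal M,\mathcal N$ if $\mathcal M$ is connected and one takes $R_0=\operatorname{diam}\mathcal M$), with the following property. Let $\Sigma$ be a compact smooth surface, possibly with boundary, let $\sigma>0$, and let $\Phi:\Sigma\to\mathcal M$ be a smooth immersion with $\Phi(\partial\Sigma)\subseteq\mathcal N$. Let $\operatorname{vol}_\Phi$ and $\operatorname{vol}_{\Phi|_{\partial\Sigma}}$ be the area and length measures of the induced metric $g_\Phi=\Phi^*g$ on $\Sigma$ and $\partial\Sigma$, let $\mathrm{II}^\Phi$ be the second fundamental form of $\Phi$ in $\mathcal M$, let $f:=|\mathrm{II}^\Phi|^2$, and $$E_\sigma(\Phi):=\int_\Sigma\operatorname{vol}_\Phi+\sigma\int_{\partial\Sigma}\operatorname{vol}_{\Phi|_{\partial\Sigma}}+\sigma^4\int_\Sigma|\mathrm{II}^\Phi|^4\,\operatorname{vol}_\Phi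 .$$ Assume that $\Phi$ is $\sigma^5$-critical for $E_\sigma$, i.e. $|dE_\sigma(\Phi)[w]|\le\sigma^5\|w\|_\Phi$ for every smooth section $w$ of $\Phi^*T\mathcal M$ that is the initial velocity $w=\frac{d}{dt}\Phi_t|_{t=0}$ of a smooth family of immersions $\Phi_t:\Sigma\to\mathcal M$ with $\Phi_0=\Phi$ and $\Phi_t(\partial\Sigma)\subseteq\mathcal N$. Here $dE_\sigma(\Phi)[w]=\frac{d}{dt}E_\sigma(\Phi_t)|_{t=0}$, and $\|w\|_\Phi:=\|w\|_{L^\infty}+\|\nabla w\|_{L^\infty}+\|\nabla^2w\|_{L^4}$, where $\nabla$ is the pullback of the Levi-Civita connection and the norms are taken with respect to $g$ and $g_\Phi$. Let $x\in\Sigma$, $p:=\Phi(x)$, let $U\subseteq\Sigma$ be an open neighborhood of $x$, and let $\partial U$ be its topological boundary in $\Sigma$. Define the measures on $\mathcal M$ $$\mu:=(\Phi|_U)_*(\operatorname{vol}_\Phi),\qquad \lambda:=(\Phi|_{\partial\Sigma\cap U})_*(\sigma\operatorname{vol}_{\Phi|_{\partial\Sigma}})+(\Phi|_U)_*(\sigma^4f^2\operatorname{vol}_\Phi),$$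 and assume that for some $0<\delta<1$ $$\lambda(B_t(p))\le\delta\,\mu(B_{5t}(p))\qquad\text{for all radii }t>0 .$$ If $\sigma\le s<r\le R_0$ and $B_r(p)\cap\Phi(\partial U)=\emptyset$, then $$\frac{\mu(B_r(p))}{r^2}\ \ge\ \bigl(c-C\delta\log(r/s)\bigr)\frac{\mu(B_s(p))}{s^2}-C\sigma^2 .$$ -/

import Mathlib

open Set MeasureTheory Filter Topology
open scoped Manifold ContDiff ENNReal InnerProductSpace

noncomputable section

namespace FreeBoundary

/-- The Euclidean space `ℝ^Q` containing the ambient manifold. -/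
abbrev Euc (Q : ℕ) : Type := EuclideanSpace ℝ (Fin Q)

/-! ### Submanifolds of Euclidean space -/

/-- `M` is a smooth embedded `k`-dimensional submanifold (without boundary) of `ℝ^Q`: near each of
its points, a smooth diffeomorphism between open subsets of `ℝ^Q` straightens `M` to the coordinate
`k`-plane where all the coordinates from the `(k+1)`-st on vanish. -/
def IsSmoothSubmanifold {Q : ℕ} (k : ℕ) (M : Set (Euc Q)) : Prop :=
  k ≤ Q ∧ ∀ p ∈ M, ∃ e : OpenPartialHomeomorph (Euc Q) (Euc Q), p ∈ e.source ∧
    ContDiffOn ℝ ∞ e e.source ∧ ContDiffOn ℝ ∞ e.symm e.target ∧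
    ∀ y ∈ e.source, (y ∈ M ↔ ∀ i : Fin Q, k ≤ (i : ℕ) → e y i = 0)

/-- The tangent space `T_p M`, as a subspace of `ℝ^Q`: the velocities at `p` of curves in `M`.
(For a submanifold these already form a linear subspace.) -/
def tanSpace {Q : ℕ} (M : Set (Euc Q)) (p : Euc Q) : Submodule ℝ (Euc Q) :=
  Submodule.span ℝ {v | ∃ γ : ℝ → Euc Q,
    γ 0 = p ∧ (∀ᶠ t in 𝓝 0, γ t ∈ M) ∧ HasDerivAt γ v 0}

/-- Orthogonal projection of `ℝ^Q` onto `T_p M`. -/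
def tanProj {Q : ℕ} (M : Set (Euc Q)) (p : Euc Q) : Euc Q →L[ℝ] Euc Q :=
  (tanSpace M p).starProjection

/-- Riemannian distance on `M` for the metric induced by `ℝ^Q`: the infimum of the lengths of
the `C¹` curves in `M` joining the two points (`∞` if there are none). -/
def geodEDist {Q : ℕ} (M : Set (Euc Q)) (p q : Euc Q) : ℝ≥0∞ :=
  ⨅ (γ : ℝ → Euc Q) (_ : ContDiffOn ℝ 1 γ (Icc 0 1)) (_ : MapsTo γ (Icc 0 1) M)
    (_ : γ 0 = p) (_ : γ 1 = q), ∫⁻ t in Icc (0 : ℝ) 1, ‖deriv γ t‖ₑ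

/-- The open geodesic ball `B_s(p)` of `M`. -/
def geodBall {Q : ℕ} (M : Set (Euc Q)) (p : Euc Q) (s : ℝ) : Set (Euc Q) :=
  {q | q ∈ M ∧ geodEDist M p q < ENNReal.ofReal s}

/-! ### Calculus in a coordinate half-plane

Surfaces with boundary are modelled on the half-plane `{y ∈ ℝ² | 0 ≤ y 0}`; a map defined on
the surface is read in a chart as a map on (a relatively open subset of) this half-plane. -/

/-- The model half-plane, as a subset of `ℝ²`. -/
def halfPlane : Set (Euc 2) := range (𝓡∂ 2)

/-- The coordinate vectors of `ℝ²`. -/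
def coordVec (i : Fin 2) : Euc 2 := EuclideanSpace.single i 1

/-- First coordinate derivative `∂ᵢ φ`. -/
def pd {Q : ℕ} (φ : Euc 2 → Euc Q) (y : Euc 2) (i : Fin 2) : Euc Q :=
  fderivWithin ℝ φ halfPlane y (coordVec i)

/-- Second coordinate derivative `∂ᵢ ∂ⱼ φ`. -/
def pd2 {Q : ℕ} (φ : Euc 2 → Euc Q) (y : Euc 2) (i j : Fin 2) : Euc Q :=
  pd (fun z => pd φ z j) y i

/-- The matrix `g_{ij} = ⟨∂ᵢ φ, ∂ⱼ φ⟩` of the induced metric. -/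
def gram {Q : ℕ} (φ : Euc 2 → Euc Q) (y : Euc 2) : Matrix (Fin 2) (Fin 2) ℝ :=
  Matrix.of fun i j => ⟪pd φ y i, pd φ y j⟫_ℝ

/-- The area density `√(det g)`. -/
def areaDensity {Q : ℕ} (φ : Euc 2 → Euc Q) (y : Euc 2) : ℝ :=
  Real.sqrt (gram φ y).det

/-- Christoffel symbols of the induced metric, `Γᵏᵢⱼ = g^{kl} ⟨∂ᵢ ∂ⱼ φ, ∂ₗ φ⟩`. -/
def christoffel {Q : ℕ} (φ : Euc 2 → Euc Q) (y : Euc 2) (i j k : Fin 2) : ℝ :=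
  ∑ l, (gram φ y)⁻¹ k l * ⟪pd2 φ y i j, pd φ y l⟫_ℝ

/-- `g^{ij} ⟨aᵢ, aⱼ⟩`: squared norm of a vector valued covector. -/
def normSq₁ {Q : ℕ} (G : Matrix (Fin 2) (Fin 2) ℝ) (a : Fin 2 → Euc Q) : ℝ :=
  ∑ i, ∑ j, G⁻¹ i j * ⟪a i, a j⟫_ℝ

/-- `g^{ik} g^{jl} ⟨bᵢⱼ, bₖₗ⟩`: squared norm of a vector valued bilinear form. -/
def normSq₂ {Q : ℕ} (G : Matrix (Fin 2) (Fin 2) ℝ) (b : Fin 2 → Fin 2 → Euc Q) : ℝ :=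
  ∑ i, ∑ j, ∑ k, ∑ l, G⁻¹ i k * G⁻¹ j l * ⟪b i j, b k l⟫_ℝ

/-- Second fundamental form in `M` of the immersion `φ`, on the coordinate vectors: the part normal
to the surface of the covariant derivative `P_{TM} (∂ᵢ ∂ⱼ φ)` in `M` of `∂ⱼ φ` along `∂ᵢ φ`. -/
def secondFF {Q : ℕ} (M : Set (Euc Q)) (φ : Euc 2 → Euc Q) (y : Euc 2) (i j : Fin 2) : Euc Q :=
  (Submodule.span ℝ (range (pd φ y)))ᗮ.starProjection (tanProj M (φ y) (pd2 φ y i j))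

/-- Covariant derivative `∇ᵢ u = P_{TM} (∂ᵢ u)` of a section `u` of `φ^* TM`. -/
def covDeriv {Q : ℕ} (M : Set (Euc Q)) (φ u : Euc 2 → Euc Q) (y : Euc 2) (i : Fin 2) : Euc Q :=
  tanProj M (φ y) (pd u y i)

/-- Second covariant derivative `∇²ᵢⱼ u = ∇ᵢ (∇ⱼ u) - Γᵏᵢⱼ ∇ₖ u` of a section `u` of `φ^* TM`,
for the pullback connection and the Levi-Civita connection of the induced metric. -/
def covDeriv2 {Q : ℕ} (M : Set (Euc Q)) (φ u : Euc 2 → Euc Q) (y : Euc 2) (i j : Fin 2) : Euc Q :=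
  covDeriv M φ (fun z => covDeriv M φ u z j) y i
    - ∑ k, christoffel φ y i j k • covDeriv M φ u y k

/-! ### Immersed surfaces with boundary -/

section Surface

variable {S : Type*} [TopologicalSpace S] [ChartedSpace (EuclideanHalfSpace 2) S] {Q : ℕ}

/-- A map on the surface, read in the chart around `c`. -/
def inChart (Φ : S → Euc Q) (c : S) : Euc 2 → Euc Q :=
  fun y => Φ ((extChartAt (𝓡∂ 2) c).symm y)

/-- `f = |II|²` at the point `x`. -/
def ffSq (M : Set (Euc Q)) (Φ : S → Euc Q) (x : S) : ℝ :=
  let φ := inChart Φ x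
  let y := extChartAt (𝓡∂ 2) x x
  normSq₂ (gram φ y) (secondFF M φ y)

/-- `|∇ w|` at the point `x`, for a section `w` of `Φ^* TM`. -/
def gradNorm (M : Set (Euc Q)) (Φ w : S → Euc Q) (x : S) : ℝ :=
  let φ := inChart Φ x
  let y := extChartAt (𝓡∂ 2) x x
  Real.sqrt (normSq₁ (gram φ y) (covDeriv M φ (inChart w x) y))

/-- `|∇² w|` at the point `x`, for a section `w` of `Φ^* TM`. -/
def hessNorm (M : Set (Euc Q)) (Φ w : S → Euc Q) (x : S) : ℝ :=
  let φ := inChart Φ x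
  let y := extChartAt (𝓡∂ 2) x x
  Real.sqrt (normSq₂ (gram φ y) (covDeriv2 M φ (inChart w x) y))

/-- The smooth maps in the space `𝔐`: smooth immersions of the surface into `M` that
map its boundary to `N`. -/
structure IsAdmissible (M N : Set (Euc Q)) (Φ : S → Euc Q) : Prop where
  smooth : ContMDiff (𝓡∂ 2) 𝓘(ℝ, Euc Q) ∞ Φ
  immersion : ∀ x, Function.Injective (mfderiv (𝓡∂ 2) 𝓘(ℝ, Euc Q) Φ x)
  mem_ambient : ∀ x, Φ x ∈ M
  mem_constraint : ∀ x ∈ (𝓡∂ 2).boundary S, Φ x ∈ N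

/-- A smooth variation of `Φ` within `𝔐`, for small times. -/
structure IsVariation (M N : Set (Euc Q)) (Φ : S → Euc Q) (F : ℝ → S → Euc Q) : Prop where
  start : F 0 = Φ
  smooth : ∃ η > 0, ContMDiffOn (𝓘(ℝ, ℝ).prod (𝓡∂ 2)) 𝓘(ℝ, Euc Q) ∞ (Function.uncurry F)
      (Ioo (-η) η ×ˢ univ) ∧ ∀ t ∈ Ioo (-η) η, IsAdmissible M N (F t)

variable [IsManifold (𝓡∂ 2) ∞ S] [CompactSpace S] [T2Space S]

variable (S) in
/-- A fixed smooth partition of unity subordinate to the domains of the charts. -/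
def chartPU : SmoothPartitionOfUnity S (𝓡∂ 2) S univ :=
  (SmoothPartitionOfUnity.exists_isSubordinate_chartAt_source (𝓡∂ 2) S).choose

variable [MeasurableSpace S]

/-- The area measure `vol_Φ` of the induced metric: in the chart around each `c` it is
`√(det g) dy`, and these local expressions are glued with the partition of unity. -/
def areaMeasure (Φ : S → Euc Q) : Measure S :=
  Measure.sum fun c : S =>
    ((volume.restrict (extChartAt (𝓡∂ 2) c).target).withDensity fun y =>
      ENNReal.ofReal (chartPU S c ((extChartAt (𝓡∂ 2) c).symm y) *
        areaDensity (inChart Φ c) y)).map (extChartAt (𝓡∂ 2) c).symm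

/-- The length measure `vol_{Φ|∂Σ}`, as a measure on the surface carried by its boundary: in
the chart around each `c` the boundary is the line `t ↦ (0, t)`, and the length element
is `|∂_t Φ| dt`. -/
def lengthMeasure (Φ : S → Euc Q) : Measure S :=
  Measure.sum fun c : S =>
    ((volume.restrict {t : ℝ | !₂[0, t] ∈ (extChartAt (𝓡∂ 2) c).target}).withDensity fun t =>
      ENNReal.ofReal (chartPU S c ((extChartAt (𝓡∂ 2) c).symm !₂[0, t]) *
        ‖pd (inChart Φ c) !₂[0, t] 1‖)).map fun t => (extChartAt (𝓡∂ 2) c).symm !₂[0, t]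

/-- `E_σ(Φ) = area(Φ) + σ length(Φ|∂Σ) + σ⁴ ∫ |II|⁴ vol_Φ`. -/
def energy (M : Set (Euc Q)) (σ : ℝ) (Φ : S → Euc Q) : ℝ :=
  (areaMeasure Φ).real univ + σ * (lengthMeasure Φ).real univ
    + σ ^ 4 * ∫ x, ffSq M Φ x ^ 2 ∂(areaMeasure Φ)

/-- The norm `‖w‖_Φ = ‖w‖_{L^∞} + ‖∇w‖_{L^∞} + ‖∇²w‖_{L⁴}`. -/
def sectionNorm (M : Set (Euc Q)) (Φ w : S → Euc Q) : ℝ≥0∞ :=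
  eLpNorm w ∞ (areaMeasure Φ) + eLpNorm (gradNorm M Φ w) ∞ (areaMeasure Φ)
    + eLpNorm (hessNorm M Φ w) 4 (areaMeasure Φ)

/-- `Φ` is `ε`-critical for `E_σ`: it is a smooth element of `𝔐` and
`|dE_σ(Φ)[w]| ≤ ε ‖w‖_Φ` for the velocity `w` at time zero of every smooth variation in `𝔐`. -/
def IsEpsCritical (M N : Set (Euc Q)) (σ ε : ℝ) (Φ : S → Euc Q) : Prop :=
  IsAdmissible M N Φ ∧ ∀ F : ℝ → S → Euc Q, IsVariation M N Φ F →
    ENNReal.ofReal |deriv (fun t => energy M σ (F t)) 0| ≤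
      ENNReal.ofReal ε * sectionNorm M Φ (fun x => deriv (fun t => F t x) 0)

/-- `μ = (Φ|_U)_* vol_Φ`. -/
def muMeasure (Φ : S → Euc Q) (U : Set S) : Measure (Euc Q) :=
  ((areaMeasure Φ).restrict U).map Φ

/-- `λ = (Φ|_{∂Σ ∩ U})_* (σ vol_{Φ|∂Σ}) + (Φ|_U)_* (σ⁴ f² vol_Φ)`. -/
def lambdaMeasure (M : Set (Euc Q)) (σ : ℝ) (Φ : S → Euc Q) (U : Set S) : Measure (Euc Q) :=
  ENNReal.ofReal σ • ((lengthMeasure Φ).restrict ((𝓡∂ 2).boundary S ∩ U)).map Φ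
    + (((areaMeasure Φ).withDensity fun x =>
        ENNReal.ofReal (σ ^ 4 * ffSq M Φ x ^ 2)).restrict U).map Φ

end Surface

end FreeBoundary

end

/-! The theorem is an almost monotonicity formula: almost criticality is tested with truncated
radial vector fields, and the resulting weighted inequality is iterated over dyadic scales.

Testing. Write ρ = |q - p| and κ = (ρ² + s²)^(-1/2), and let X = h(ρ²) V, where h(u) = χ(u/r²) / (u
+ s²) with a cutoff χ, and V is a field tangent to M that agrees with q - p up to O(ρ²). The flow of
X preserves M, and it preserves N provided p ∈ N or the ball B_r(p) misses N. Only the part U of the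
surface is moved; this is smooth because the frontier of U is mapped outside B_r(p). Along every
2-plane the divergence of X is at least -C/r² - Cρκ², and on B_s(p) it exceeds this by 1/(2s²). The
derivatives of X of order 0, 1, 2 are bounded by multiples of κ, κ², κ³. Young's inequality then
bounds the variations of the boundary length and of ∫|II|⁴, weighted as in the energy, by ∫κ² dλ +
σ⁴ ∫κ⁶ dμ, and the term σ⁵‖X‖ by the same quantity plus σ². The outcome is `WeightedBound`, proved
in `weighted_estimate` and `exists_weightedBound`: up to a constant, μ(B_s)/s² is at most μ(B_r)/r²
+ ∫ρκ² dμ + ∫κ² dλ + σ⁴∫κ⁶ dμ + σ².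

Iteration. The weights are comparable to constants on dyadic shells. If D bounds the density ratios
at all dyadic scales, the first integral is O(rD), the last term is O((σ/s)⁴D), and the λ-integral
costs O(δD) per shell, that is δ log(r/s) D in total. Choosing the lower scale where the ratio is
maximal makes D equal to the left side, so for r small and s ≥ Kσ the first and last terms are
absorbed; the λ-term is the logarithmic loss of the theorem (`dyadic_growth`, `ballRatio_growth`).

Free boundary. For p outside N, balls centred at p are used up to the distance to N, and balls
centred at the nearest point of N beyond it; the two runs are chained by inclusions of balls
(`ballRatio_growth_of_mem`, `two_step_growth`). Euclidean and geodesic balls are comparable on a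
compact submanifold, and radii that are not small, up to R, are reached by monotonicity of μ
(`ratio_growth_of_comparison`).

First variation. Area, length and |II|⁴ densities are functions of the 2-jet of the immersion in a
chart and transform simply under reparametrization. Every jet can therefore be normalized to an
orthonormal frame with second derivatives normal to the surface, where the derivatives are computed
by hand. Differentiation under the integral, through a partition of unity, transfers this to the
energy (`first_variation_le`). -/

noncomputable section

namespace FreeBoundary

/-! ### Linear algebra of pairs of vectors -/

section Frames

variable {Q : ℕ}

/-- The Gram matrix of a pair of vectors. -/
def gramOf (a : Fin 2 → Euc Q) : Matrix (Fin 2) (Fin 2) ℝ := Matrix.of fun i j => ⟪a i, a j⟫_ℝ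

/-- The area of the parallelogram spanned by a pair of vectors. -/
def areaOf (a : Fin 2 → Euc Q) : ℝ := Real.sqrt (gramOf a).det

/-- Change of frame. -/
def linChange (T : Matrix (Fin 2) (Fin 2) ℝ) (a : Fin 2 → Euc Q) : Fin 2 → Euc Q :=
  fun i => ∑ k, T k i • a k

/-- Change of frame for a bilinear form. -/
def bilChange (T : Matrix (Fin 2) (Fin 2) ℝ) (b : Fin 2 → Fin 2 → Euc Q) :
    Fin 2 → Fin 2 → Euc Q :=
  fun i j => ∑ k, ∑ l, (T k i * T l j) • b k l

theorem gramOf_linChange (T : Matrix (Fin 2) (Fin 2) ℝ) (a : Fin 2 → Euc Q) :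
    gramOf (linChange T a) = T.transpose * gramOf a * T := by
  ext i j
  simp only [gramOf, linChange, Matrix.mul_apply, Matrix.of_apply, Fin.sum_univ_two,
    Matrix.transpose_apply, inner_add_left, inner_add_right, real_inner_smul_left,
    real_inner_smul_right]
  ring

theorem areaOf_linChange (T : Matrix (Fin 2) (Fin 2) ℝ) (a : Fin 2 → Euc Q) :
    areaOf (linChange T a) = |T.det| * areaOf a := by
  rw [areaOf, gramOf_linChange, Matrix.det_mul, Matrix.det_mul, Matrix.det_transpose,
    show T.det * (gramOf a).det * T.det = T.det ^ 2 * (gramOf a).det by ring,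
    Real.sqrt_mul (sq_nonneg _), Real.sqrt_sq_eq_abs, areaOf]

theorem linChange_mul (S T : Matrix (Fin 2) (Fin 2) ℝ) (a : Fin 2 → Euc Q) :
    linChange T (linChange S a) = linChange (S * T) a := by
  ext1 i
  simp only [linChange, Matrix.mul_apply, Fin.sum_univ_two]
  module

theorem linChange_one (a : Fin 2 → Euc Q) : linChange 1 a = a := by
  ext1 i
  simp [linChange, Matrix.one_apply]

theorem span_linChange_le (T : Matrix (Fin 2) (Fin 2) ℝ) (a : Fin 2 → Euc Q) :
    Submodule.span ℝ (range (linChange T a)) ≤ Submodule.span ℝ (range a) := by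
  rw [Submodule.span_le]
  rintro _ ⟨i, rfl⟩
  exact Submodule.sum_mem _ fun k _ =>
    Submodule.smul_mem _ _ (Submodule.subset_span (mem_range_self k))

theorem span_linChange {T : Matrix (Fin 2) (Fin 2) ℝ} (hT : T.det ≠ 0) (a : Fin 2 → Euc Q) :
    Submodule.span ℝ (range (linChange T a)) = Submodule.span ℝ (range a) := by
  refine le_antisymm (span_linChange_le T a) ?_
  have := span_linChange_le T⁻¹ (linChange T a)
  rwa [linChange_mul, Matrix.mul_nonsing_inv T (isUnit_iff_ne_zero.2 hT), linChange_one] at this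

/-- The inverse Gram matrix is contravariant, so the frame changes cancel against those of the
covariant arguments. This is the source of the invariance of `normSq₁` and `normSq₂`. -/
theorem frame_inverse_change {T : Matrix (Fin 2) (Fin 2) ℝ} (hT : T.det ≠ 0)
    (G : Matrix (Fin 2) (Fin 2) ℝ) :
    T * (T.transpose * G * T)⁻¹ * T.transpose = G⁻¹ := by
  have hT' : T.transpose.det ≠ 0 := by rwa [Matrix.det_transpose]
  rw [Matrix.mul_inv_rev, Matrix.mul_inv_rev, ← Matrix.mul_assoc,
    Matrix.mul_nonsing_inv T (isUnit_iff_ne_zero.2 hT), Matrix.one_mul, Matrix.mul_assoc,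
    Matrix.nonsing_inv_mul _ (isUnit_iff_ne_zero.2 hT'), Matrix.mul_one]

theorem normSq₁_linChange {T : Matrix (Fin 2) (Fin 2) ℝ} (hT : T.det ≠ 0)
    (G : Matrix (Fin 2) (Fin 2) ℝ) (a : Fin 2 → Euc Q) :
    normSq₁ (T.transpose * G * T) (linChange T a) = normSq₁ G a := by
  have h := frame_inverse_change hT G
  set g := (T.transpose * G * T)⁻¹ with hg
  simp only [normSq₁, ← h, ← hg]
  simp only [linChange, Matrix.mul_apply, Fin.sum_univ_two,
    Matrix.transpose_apply, inner_add_left, inner_add_right, real_inner_smul_left,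
    real_inner_smul_right]
  ring

theorem normSq₂_bilChange {T : Matrix (Fin 2) (Fin 2) ℝ} (hT : T.det ≠ 0)
    (G : Matrix (Fin 2) (Fin 2) ℝ) (b : Fin 2 → Fin 2 → Euc Q) :
    normSq₂ (T.transpose * G * T) (bilChange T b) = normSq₂ G b := by
  have h := frame_inverse_change hT G
  set g := (T.transpose * G * T)⁻¹ with hg
  have e : ∀ p r, G⁻¹ p r = ∑ i, ∑ k, T p i * T r k * g i k := by
    intro p r
    rw [← h]
    simp only [Matrix.mul_apply, Fin.sum_univ_two, Matrix.transpose_apply]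
    ring
  have key : ∀ i j k l, ⟪bilChange T b i j, bilChange T b k l⟫_ℝ
      = ∑ p, ∑ q, ∑ r, ∑ s, T p i * T q j * (T r k * T s l) * ⟪b p q, b r s⟫_ℝ := by
    intro i j k l
    simp only [bilChange, sum_inner]
    simp only [inner_sum, real_inner_smul_left, real_inner_smul_right]
    refine Finset.sum_congr rfl fun p _ => Finset.sum_congr rfl fun q _ =>
      Finset.sum_congr rfl fun r _ => Finset.sum_congr rfl fun s _ => ?_
    ring
  simp only [normSq₂, ← hg, key, e]
  generalize (fun p q r s => ⟪b p q, b r s⟫_ℝ) = B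
  simp only [Fin.sum_univ_two]
  ring

theorem normSq₂_one (b : Fin 2 → Fin 2 → Euc Q) :
    normSq₂ 1 b = ∑ i, ∑ j, ‖b i j‖ ^ 2 := by
  simp [normSq₂, Fin.sum_univ_two, Matrix.one_apply]

theorem normSq₁_one (a : Fin 2 → Euc Q) :
    normSq₁ 1 a = ∑ i, ‖a i‖ ^ 2 := by
  simp [normSq₁, Fin.sum_univ_two, Matrix.one_apply]

theorem gramOf_eq_one {u : Fin 2 → Euc Q} (hu : Orthonormal ℝ u) : gramOf u = 1 := by
  ext i j
  rw [gramOf, Matrix.of_apply, orthonormal_iff_ite.1 hu i j, Matrix.one_apply]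

/-- Gram-Schmidt for pairs. -/
theorem exists_orthonormal_linChange {a : Fin 2 → Euc Q} (ha : LinearIndependent ℝ a) :
    ∃ (u : Fin 2 → Euc Q) (T : Matrix (Fin 2) (Fin 2) ℝ), Orthonormal ℝ u ∧ T.det ≠ 0 ∧
      a = linChange T u := by
  let u := InnerProductSpace.gramSchmidtNormed ℝ a
  have hu : Orthonormal ℝ u := InnerProductSpace.gramSchmidtNormed_orthonormal ha
  have hspan : Submodule.span ℝ (range u) = Submodule.span ℝ (range a) :=
    (InnerProductSpace.span_gramSchmidtNormed_range a).trans
      (InnerProductSpace.span_gramSchmidt ℝ a)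
  have hmem : ∀ i, ∃ c : Fin 2 → ℝ, ∑ k, c k • u k = a i := by
    intro i
    have : a i ∈ Submodule.span ℝ (range u) := by
      rw [hspan]; exact Submodule.subset_span (mem_range_self i)
    exact (Submodule.mem_span_range_iff_exists_fun ℝ).1 this
  choose c hc using hmem
  refine ⟨u, Matrix.of fun k i => c i k, hu, ?_, ?_⟩
  · intro h0
    obtain ⟨v, hv, hv0⟩ := Matrix.exists_mulVec_eq_zero_iff.2 h0
    refine hv (funext fun i => Fintype.linearIndependent_iff.1 ha v ?_ i)
    simp only [← hc, Fin.sum_univ_two]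
    have e0 := congrFun hv0 0
    have e1 := congrFun hv0 1
    simp only [Matrix.mulVec, dotProduct, Fin.sum_univ_two, Matrix.of_apply, Pi.zero_apply]
      at e0 e1
    have : (v 0 • (c 0 0 • u 0 + c 0 1 • u 1) + v 1 • (c 1 0 • u 0 + c 1 1 • u 1))
      = (c 0 0 * v 0 + c 1 0 * v 1) • u 0 + (c 0 1 * v 0 + c 1 1 * v 1) • u 1 := by module
    rw [this, e0, e1]; simp
  · ext1 i
    simp [linChange, hc]

theorem gramOf_det_pos {a : Fin 2 → Euc Q} (ha : LinearIndependent ℝ a) :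
    0 < (gramOf a).det := by
  obtain ⟨u, T, hu, hT, rfl⟩ := exists_orthonormal_linChange ha
  rw [gramOf_linChange, gramOf_eq_one hu]
  simp only [Matrix.mul_one, Matrix.det_mul, Matrix.det_transpose]
  exact mul_self_pos.2 hT

/-- The orthogonal projection onto the complement of the span of a frame, in terms of the inverse
Gram matrix. -/
theorem starProjection_span_compl {a : Fin 2 → Euc Q} (ha : LinearIndependent ℝ a) (v : Euc Q) :
    (Submodule.span ℝ (range a))ᗮ.starProjection v
      = v - ∑ k, (∑ l, (gramOf a)⁻¹ k l * ⟪v, a l⟫_ℝ) • a k := by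
  have hd : IsUnit (gramOf a).det := isUnit_iff_ne_zero.2 (gramOf_det_pos ha).ne'
  set w := ∑ k, (∑ l, (gramOf a)⁻¹ k l * ⟪v, a l⟫_ℝ) • a k with hw
  have hmem : w ∈ Submodule.span ℝ (range a) := Submodule.sum_mem _ fun k _ =>
    Submodule.smul_mem _ _ (Submodule.subset_span (mem_range_self k))
  have hort : v - w ∈ (Submodule.span ℝ (range a))ᗮ := by
    rw [Submodule.mem_orthogonal']
    intro x hx
    induction hx using Submodule.span_induction with
    | mem x hx =>
      obtain ⟨i, rfl⟩ := hx
      have h1 : ∀ l, ∑ k, (gramOf a)⁻¹ k l * ⟪a k, a i⟫_ℝ = if i = l then 1 else 0 := by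
        intro l
        have h2 := congrFun (congrFun (Matrix.mul_nonsing_inv (gramOf a) hd) i) l
        have hs : (gramOf a)⁻¹.transpose = (gramOf a)⁻¹ := by
          rw [Matrix.transpose_nonsing_inv]
          congr 1
          ext p q
          simp [gramOf, real_inner_comm]
        rw [Matrix.mul_apply, Matrix.one_apply] at h2
        rw [← h2]
        refine Finset.sum_congr rfl fun k _ => ?_
        rw [mul_comm, gramOf, Matrix.of_apply, real_inner_comm]
      rw [inner_sub_left, hw, sum_inner]
      simp only [real_inner_smul_left, Finset.sum_mul]
      rw [Finset.sum_comm]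
      have : ∀ l, ∑ k, (gramOf a)⁻¹ k l * ⟪v, a l⟫_ℝ * ⟪a k, a i⟫_ℝ
          = ⟪v, a l⟫_ℝ * if i = l then 1 else 0 := by
        intro l
        rw [← h1 l, Finset.mul_sum]
        exact Finset.sum_congr rfl fun k _ => by ring
      simp [this]
    | zero => simp
    | add x y _ _ hx hy => rw [inner_add_right, hx, hy, add_zero]
    | smul c x _ hx => rw [inner_smul_right, hx, mul_zero]
  have := Submodule.eq_starProjection_of_mem_orthogonal' (K := (Submodule.span ℝ (range a))ᗮ)
    (u := v) (v := v - w) (z := w) hort (Submodule.le_orthogonal_orthogonal _ hmem) (by abel)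
  exact this

theorem starProjection_span_compl_self (a : Fin 2 → Euc Q) (k : Fin 2) :
    (Submodule.span ℝ (range a))ᗮ.starProjection (a k) = 0 := by
  rw [Submodule.starProjection_orthogonal_apply_eq_zero]
  exact Submodule.subset_span (mem_range_self k)

end Frames

/-! ### Two-jets of immersions and the invariant functionals on them -/

section Jets

variable {Q : ℕ}

/-- `|II|²` of a frame `a` and second derivatives `b`, for the tangential projection `P`. -/
def ffOf (P : Euc Q →L[ℝ] Euc Q) (a : Fin 2 → Euc Q) (b : Fin 2 → Fin 2 → Euc Q) : ℝ :=
  normSq₂ (gramOf a) fun i j => (Submodule.span ℝ (range a))ᗮ.starProjection (P (b i j))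

/-- Two-jets of maps from the plane: value, first and second coordinate derivatives. -/
abbrev Jet (Q : ℕ) : Type := Euc Q × (Fin 2 → Euc Q) × (Fin 2 → Fin 2 → Euc Q)

/-- Reparametrization of a jet. -/
def jetChange (T : Matrix (Fin 2) (Fin 2) ℝ) (Γ : Fin 2 → Fin 2 → Fin 2 → ℝ) (j : Jet Q) : Jet Q :=
  (j.1, linChange T j.2.1, fun i k => bilChange T j.2.2 i k + ∑ p, Γ i k p • j.2.1 p)

/-- Composition of a jet with a map of the ambient space. -/
def pushJet (g : Euc Q → Euc Q) (j : Jet Q) : Jet Q :=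
  (g j.1, fun i => fderiv ℝ g j.1 (j.2.1 i),
    fun i k => fderiv ℝ (fderiv ℝ g) j.1 (j.2.1 i) (j.2.1 k) + fderiv ℝ g j.1 (j.2.2 i k))

/-- Composition on the left with an ambient map commutes with reparametrization on the right. A jet
may thus be normalized before it is deformed, with the same `T` and `Γ` for all times. -/
theorem pushJet_jetChange (g : Euc Q → Euc Q) (T : Matrix (Fin 2) (Fin 2) ℝ)
    (Γ : Fin 2 → Fin 2 → Fin 2 → ℝ) (j : Jet Q) :
    pushJet g (jetChange T Γ j) = jetChange T Γ (pushJet g j) := by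
  refine Prod.ext rfl (Prod.ext ?_ ?_)
  · ext1 i
    simp [pushJet, jetChange, linChange]
  · ext1 i
    ext1 k
    simp only [pushJet, jetChange, linChange, bilChange, map_add, map_smul,
      Fin.sum_univ_two, add_apply, smul_apply]
    module

/-- The terms with `Γ` are combinations of the frame: `P` fixes them and the projection normal to
the surface annihilates them. What remains changes as a bilinear form, whose norm is invariant. -/
theorem ffOf_jetChange {P : Euc Q →L[ℝ] Euc Q} {T : Matrix (Fin 2) (Fin 2) ℝ} (hT : T.det ≠ 0)
    (Γ : Fin 2 → Fin 2 → Fin 2 → ℝ) {j : Jet Q} (hP : ∀ i, P (j.2.1 i) = j.2.1 i) :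
    ffOf P (jetChange T Γ j).2.1 (jetChange T Γ j).2.2 = ffOf P j.2.1 j.2.2 := by
  have : (fun i k => (Submodule.span ℝ (range j.2.1))ᗮ.starProjection
      (P ((jetChange T Γ j).2.2 i k))) = bilChange T fun i k =>
        (Submodule.span ℝ (range j.2.1))ᗮ.starProjection (P (j.2.2 i k)) := by
    ext1 i
    ext1 k
    simp only [jetChange, bilChange, map_add, map_sum, map_smul, hP,
      starProjection_span_compl_self, smul_zero, Finset.sum_const_zero, add_zero]
  have hs : ∀ v, (Submodule.span ℝ (range (linChange T j.2.1)))ᗮ.starProjection v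
      = (Submodule.span ℝ (range j.2.1))ᗮ.starProjection v := by
    intro v
    congr! 2
    rw [span_linChange hT]
  rw [ffOf, show (jetChange T Γ j).2.1 = linChange T j.2.1 from rfl]
  simp only [hs]
  rw [this, gramOf_linChange, normSq₂_bilChange hT, ffOf]

/-- Independence of a pair of vectors is detected by the Gram determinant. -/
theorem linearIndependent_of_gramOf_det_ne {a : Fin 2 → Euc Q} (h : (gramOf a).det ≠ 0) :
    LinearIndependent ℝ a := by
  rw [Fintype.linearIndependent_iff]
  intro v hv
  by_contra! hne
  obtain ⟨i, hi⟩ := hne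
  refine h (Matrix.exists_mulVec_eq_zero_iff.1 ⟨v, fun h0 => hi (congrFun h0 i), ?_⟩)
  ext k
  have : ⟪a k, ∑ i, v i • a i⟫_ℝ = 0 := by rw [hv, inner_zero_right]
  simpa [Matrix.mulVec, dotProduct, gramOf, Fin.sum_univ_two, inner_add_right,
    real_inner_smul_right, mul_comm] using this

/-- `ffOf` as a rational expression in the inner products. -/
theorem ffOf_eq {P : Euc Q →L[ℝ] Euc Q} {a : Fin 2 → Euc Q} (ha : LinearIndependent ℝ a)
    (b : Fin 2 → Fin 2 → Euc Q) :
    ffOf P a b = ∑ i, ∑ j, ∑ k, ∑ l, (gramOf a)⁻¹ i k * (gramOf a)⁻¹ j l *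
      (⟪P (b i j), P (b k l)⟫_ℝ - ∑ p, ∑ q, (gramOf a)⁻¹ p q *
        (⟪P (b k l), a q⟫_ℝ * ⟪P (b i j), a p⟫_ℝ)) := by
  rw [ffOf, normSq₂]
  refine Finset.sum_congr rfl fun i _ => Finset.sum_congr rfl fun j _ =>
      Finset.sum_congr rfl fun k _ => Finset.sum_congr rfl fun l _ => ?_
  rw [Submodule.inner_starProjection_left_eq_right, Submodule.starProjection_eq_self_iff.2
    (Submodule.starProjection_apply_mem _ _), starProjection_span_compl ha, inner_sub_right,
    inner_sum]
  simp only [real_inner_smul_right, Finset.sum_mul, mul_assoc]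

theorem gramOf_inv_eq (a : Fin 2 → Euc Q) (i k : Fin 2) :
    (gramOf a)⁻¹ i k = ((gramOf a).det)⁻¹ * (gramOf a).adjugate i k := by
  rw [Matrix.inv_def, Matrix.smul_apply, smul_eq_mul, Ring.inverse_eq_inv']

theorem contDiff_gramOf_apply (i k : Fin 2) :
    ContDiff ℝ ∞ fun a : Fin 2 → Euc Q => gramOf a i k := by
  simp only [gramOf, Matrix.of_apply]
  exact (contDiff_apply ℝ (Euc Q) i).inner ℝ (contDiff_apply ℝ (Euc Q) k)

theorem contDiff_gramOf_det : ContDiff ℝ ∞ fun a : Fin 2 → Euc Q => (gramOf a).det := by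
  simp only [Matrix.det_fin_two]
  have := contDiff_gramOf_apply (Q := Q)
  exact ((this 0 0).mul (this 1 1)).sub ((this 0 1).mul (this 1 0))

theorem contDiffAt_gramOf_inv {a : Fin 2 → Euc Q} (ha : LinearIndependent ℝ a) (i k : Fin 2) :
    ContDiffAt ℝ ∞ (fun a : Fin 2 → Euc Q => (gramOf a)⁻¹ i k) a := by
  simp only [gramOf_inv_eq]
  refine (contDiff_gramOf_det.contDiffAt.inv (gramOf_det_pos ha).ne').mul ?_
  have := contDiff_gramOf_apply (Q := Q)
  simp only [Matrix.adjugate_fin_two]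
  fin_cases i <;> fin_cases k <;> simp <;> first | exact (this _ _).contDiffAt | exact (this _ _).neg.contDiffAt

theorem contDiffAt_areaOf {a : Fin 2 → Euc Q} (ha : LinearIndependent ℝ a) :
    ContDiffAt ℝ ∞ (areaOf (Q := Q)) a :=
  contDiff_gramOf_det.contDiffAt.sqrt (gramOf_det_pos ha).ne'

theorem eventually_linearIndependent {a : Fin 2 → Euc Q} (ha : LinearIndependent ℝ a) :
    ∀ᶠ a' in 𝓝 a, LinearIndependent ℝ a' := by
  have := (contDiff_gramOf_det (Q := Q)).continuous.continuousAt.eventually_ne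
    (gramOf_det_pos ha).ne'
  exact this.mono fun a' h => linearIndependent_of_gramOf_det_ne h

/-- The definition involves the projection onto a varying span, which is not visibly smooth. Near an
independent frame it equals a rational expression in inner products with nonvanishing denominator.
-/
theorem contDiffAt_ffOf {z : (Euc Q →L[ℝ] Euc Q) × (Fin 2 → Euc Q) × (Fin 2 → Fin 2 → Euc Q)}
    (hz : LinearIndependent ℝ z.2.1) :
    ContDiffAt ℝ ∞ (fun z : (Euc Q →L[ℝ] Euc Q) × (Fin 2 → Euc Q) × (Fin 2 → Fin 2 → Euc Q) =>
      ffOf z.1 z.2.1 z.2.2) z := by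
  have hev : (fun z : (Euc Q →L[ℝ] Euc Q) × (Fin 2 → Euc Q) × (Fin 2 → Fin 2 → Euc Q) =>
      ffOf z.1 z.2.1 z.2.2) =ᶠ[𝓝 z] fun z => ∑ i, ∑ j, ∑ k, ∑ l,
      (gramOf z.2.1)⁻¹ i k * (gramOf z.2.1)⁻¹ j l *
      (⟪z.1 (z.2.2 i j), z.1 (z.2.2 k l)⟫_ℝ - ∑ p, ∑ q, (gramOf z.2.1)⁻¹ p q *
        (⟪z.1 (z.2.2 k l), z.2.1 q⟫_ℝ * ⟪z.1 (z.2.2 i j), z.2.1 p⟫_ℝ)) := by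
    have : Tendsto (fun z : (Euc Q →L[ℝ] Euc Q) × (Fin 2 → Euc Q) ×
      (Fin 2 → Fin 2 → Euc Q) => z.2.1) (𝓝 z) (𝓝 z.2.1) := by
        exact (continuous_fst.comp continuous_snd).continuousAt
    filter_upwards [this.eventually (eventually_linearIndependent hz)] with w hw
    exact ffOf_eq hw _
  refine ContDiffAt.congr_of_eventuallyEq ?_ hev
  have hg : ∀ i k, ContDiffAt ℝ ∞ (fun z : (Euc Q →L[ℝ] Euc Q) × (Fin 2 → Euc Q) ×
      (Fin 2 → Fin 2 → Euc Q) => (gramOf z.2.1)⁻¹ i k) z := fun i k =>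
    (contDiffAt_gramOf_inv hz i k).comp z (contDiff_fst.comp contDiff_snd).contDiffAt
  have hv : ∀ i j, ContDiffAt ℝ ∞ (fun z : (Euc Q →L[ℝ] Euc Q) × (Fin 2 → Euc Q) ×
      (Fin 2 → Fin 2 → Euc Q) => z.1 (z.2.2 i j)) z := fun i j => by fun_prop
  have ha : ∀ i, ContDiffAt ℝ ∞ (fun z : (Euc Q →L[ℝ] Euc Q) × (Fin 2 → Euc Q) ×
      (Fin 2 → Fin 2 → Euc Q) => z.2.1 i) z := fun i => by fun_prop
  refine ContDiffAt.sum fun i _ => ContDiffAt.sum fun j _ => ContDiffAt.sum fun k _ =>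
    ContDiffAt.sum fun l _ => ((hg i k).mul (hg j l)).mul (((hv i j).inner ℝ (hv k l)).sub
      (ContDiffAt.sum fun p _ => ContDiffAt.sum fun q _ => (hg p q).mul
        (((hv k l).inner ℝ (ha q)).mul ((hv i j).inner ℝ (ha p)))))

theorem hasDerivAt_real_inner {f g : ℝ → Euc Q} {f' g' : Euc Q} {x : ℝ}
    (hf : HasDerivAt f f' x) (hg : HasDerivAt g g' x) :
    HasDerivAt (fun t => ⟪f t, g t⟫_ℝ) (⟪f', g x⟫_ℝ + ⟪f x, g'⟫_ℝ) x := by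
  rw [add_comm]
  exact hf.inner ℝ hg

/-- The derivative of the inverse Gram matrix at an orthonormal frame. -/
theorem hasDerivAt_gramOf_inv {a : ℝ → Fin 2 → Euc Q} {a' : Fin 2 → Euc Q}
    (ha : ∀ i, HasDerivAt (fun t => a t i) (a' i) 0) (ho : Orthonormal ℝ (a 0)) (i k : Fin 2) :
    HasDerivAt (fun t => (gramOf (a t))⁻¹ i k) (-(⟪a' i, a 0 k⟫_ℝ + ⟪a 0 i, a' k⟫_ℝ)) 0 := by
  have hg : ∀ i k, HasDerivAt (fun t => gramOf (a t) i k)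
      (⟪a' i, a 0 k⟫_ℝ + ⟪a 0 i, a' k⟫_ℝ) 0 := by
    intro i k
    exact hasDerivAt_real_inner (ha i) (ha k)
  have h1 := gramOf_eq_one ho
  have hd : HasDerivAt (fun t => (gramOf (a t)).det)
      ((⟪a' 0, a 0 0⟫_ℝ + ⟪a 0 0, a' 0⟫_ℝ) + (⟪a' 1, a 0 1⟫_ℝ + ⟪a 0 1, a' 1⟫_ℝ)) 0 := by
    simp only [Matrix.det_fin_two]
    refine (((hg 0 0).fun_mul (hg 1 1)).fun_sub ((hg 0 1).fun_mul (hg 1 0))).congr_deriv ?_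
    simp [h1]
  simp only [gramOf_inv_eq, Matrix.adjugate_fin_two]
  have hdi := hd.fun_inv (by simp [h1])
  fin_cases i <;> fin_cases k
  · refine (hdi.fun_mul (hg 1 1)).congr_deriv ?_
    simp [h1]
    ring
  · refine (hdi.fun_mul (hg 0 1).fun_neg).congr_deriv ?_
    simp [h1]
  · refine (hdi.fun_mul (hg 1 0).fun_neg).congr_deriv ?_
    simp [h1]
  · refine (hdi.fun_mul (hg 0 0)).congr_deriv ?_
    simp [h1]
    ring

theorem hasDerivAt_areaOf {a : ℝ → Fin 2 → Euc Q} {a' : Fin 2 → Euc Q}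
    (ha : ∀ i, HasDerivAt (fun t => a t i) (a' i) 0) (ho : Orthonormal ℝ (a 0)) :
    HasDerivAt (fun t => areaOf (a t)) (⟪a' 0, a 0 0⟫_ℝ + ⟪a' 1, a 0 1⟫_ℝ) 0 := by
  have hg : ∀ i k, HasDerivAt (fun t => gramOf (a t) i k)
      (⟪a' i, a 0 k⟫_ℝ + ⟪a 0 i, a' k⟫_ℝ) 0 := by
    intro i k
    exact hasDerivAt_real_inner (ha i) (ha k)
  have h1 := gramOf_eq_one ho
  have hd : HasDerivAt (fun t => (gramOf (a t)).det)
      ((⟪a' 0, a 0 0⟫_ℝ + ⟪a 0 0, a' 0⟫_ℝ) + (⟪a' 1, a 0 1⟫_ℝ + ⟪a 0 1, a' 1⟫_ℝ)) 0 := by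
    simp only [Matrix.det_fin_two]
    refine (((hg 0 0).fun_mul (hg 1 1)).fun_sub ((hg 0 1).fun_mul (hg 1 0))).congr_deriv ?_
    simp [h1]
  refine (hd.sqrt (by simp [h1])).congr_deriv ?_
  rw [h1, real_inner_comm (a' 0), real_inner_comm (a' 1), Matrix.det_one, Real.sqrt_one]
  ring

/-- `ffOf` at an orthonormal frame with normal second derivatives. -/
theorem ffOf_orthonormal {P : Euc Q →L[ℝ] Euc Q} {a : Fin 2 → Euc Q} (ho : Orthonormal ℝ a)
    {b : Fin 2 → Fin 2 → Euc Q} (hb : ∀ i j k, ⟪P (b i j), a k⟫_ℝ = 0) :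
    ffOf P a b = ∑ i, ∑ j, ‖P (b i j)‖ ^ 2 := by
  rw [ffOf_eq ho.linearIndependent, gramOf_eq_one ho]
  simp [hb, Matrix.one_apply, Fin.sum_univ_two]

/-- The derivative of `ffOf` at an orthonormal frame with normal second derivatives. -/
theorem hasDerivAt_ffOf {P : ℝ → Euc Q →L[ℝ] Euc Q} {a : ℝ → Fin 2 → Euc Q}
    {b : ℝ → Fin 2 → Fin 2 → Euc Q} {a' : Fin 2 → Euc Q} {v' : Fin 2 → Fin 2 → Euc Q}
    (ha : ∀ i, HasDerivAt (fun t => a t i) (a' i) 0) (ho : Orthonormal ℝ (a 0))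
    (hv : ∀ i j, HasDerivAt (fun t => P t (b t i j)) (v' i j) 0)
    (hb : ∀ i j k, ⟪P 0 (b 0 i j), a 0 k⟫_ℝ = 0)
    {ℓ w : ℝ} (hℓ : ∀ i, ‖a' i‖ ≤ ℓ) (hw : ∀ i j, ‖v' i j‖ ≤ w) :
    ∃ D, HasDerivAt (fun t => ffOf (P t) (a t) (b t)) D 0 ∧
      |D| ≤ 64 * ℓ * ffOf (P 0) (a 0) (b 0) + 32 * w * Real.sqrt (ffOf (P 0) (a 0) (b 0)) := by
  have hG := hasDerivAt_gramOf_inv ha ho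
  have hac : ContinuousAt a 0 := continuousAt_pi.2 fun i => (ha i).continuousAt
  have hev : (fun t => ffOf (P t) (a t) (b t)) =ᶠ[𝓝 0] fun t => ∑ i, ∑ j, ∑ k, ∑ l,
      (gramOf (a t))⁻¹ i k * (gramOf (a t))⁻¹ j l *
      (⟪P t (b t i j), P t (b t k l)⟫_ℝ - ∑ p, ∑ q, (gramOf (a t))⁻¹ p q *
        (⟪P t (b t k l), a t q⟫_ℝ * ⟪P t (b t i j), a t p⟫_ℝ)) := by
    filter_upwards [hac.eventually (eventually_linearIndependent ho.linearIndependent)] with t ht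
    exact ffOf_eq ht _
  set v := fun i j => P 0 (b 0 i j) with hv0
  -- The tangential correction is a product of two factors that both vanish at time 0, because the
  -- second derivatives are normal there. Hence it does not contribute to the derivative.
  have hR : ∀ i j k l, HasDerivAt (fun t => ∑ p, ∑ q, (gramOf (a t))⁻¹ p q *
        (⟪P t (b t k l), a t q⟫_ℝ * ⟪P t (b t i j), a t p⟫_ℝ)) 0 0 := by
    intro i j k l
    refine HasDerivAt.congr_deriv (f' := ∑ p : Fin 2, ∑ q : Fin 2, (0 : ℝ)) ?_ (by simp)
    refine HasDerivAt.fun_sum fun p _ => HasDerivAt.fun_sum fun q _ => ?_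
    refine ((hG p q).fun_mul ((hasDerivAt_real_inner (hv k l) (ha q)).fun_mul (hasDerivAt_real_inner (hv i j) (ha p)))).congr_deriv ?_
    simp [hb]
  have hD := HasDerivAt.fun_sum (u := Finset.univ) fun (i : Fin 2) _ =>
    HasDerivAt.fun_sum (u := Finset.univ) fun (j : Fin 2) _ =>
    HasDerivAt.fun_sum (u := Finset.univ) fun (k : Fin 2) _ =>
    HasDerivAt.fun_sum (u := Finset.univ) fun (l : Fin 2) _ =>
    (((hG i k).fun_mul (hG j l)).fun_mul ((hasDerivAt_real_inner (hv i j) (hv k l)).fun_sub (hR i j k l)))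
  have hF : ffOf (P 0) (a 0) (b 0) = ∑ i, ∑ j, ‖v i j‖ ^ 2 := ffOf_orthonormal ho hb
  refine ⟨_, hD.congr_of_eventuallyEq hev, ?_⟩
  have hF0 : 0 ≤ ffOf (P 0) (a 0) (b 0) := by rw [hF]; positivity
  set F := ffOf (P 0) (a 0) (b 0) with hFdef
  have hvF : ∀ i j, ‖v i j‖ ≤ Real.sqrt F := by
    intro i j
    apply Real.le_sqrt_of_sq_le
    rw [hF]
    exact (Finset.single_le_sum (f := fun j => ‖v i j‖ ^ 2) (fun _ _ => by positivity)
      (Finset.mem_univ j)).trans (Finset.single_le_sum (f := fun i => ∑ j, ‖v i j‖ ^ 2)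
        (fun _ _ => by positivity) (Finset.mem_univ i))
  have hℓ0 : 0 ≤ ℓ := (norm_nonneg _).trans (hℓ 0)
  have hw0 : 0 ≤ w := (norm_nonneg _).trans (hw 0 0)
  have hsq := Real.mul_self_sqrt hF0
  have hg' : ∀ i k, |⟪a' i, a 0 k⟫_ℝ + ⟪a 0 i, a' k⟫_ℝ| ≤ 2 * ℓ := by
    intro i k
    have h1 := abs_real_inner_le_norm (a' i) (a 0 k)
    have h2 := abs_real_inner_le_norm (a 0 i) (a' k)
    rw [ho.1 k, mul_one] at h1
    rw [ho.1 i, one_mul] at h2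
    calc _ ≤ _ := abs_add_le _ _
      _ ≤ 2 * ℓ := by linarith [hℓ i, hℓ k]
  have hvv : ∀ i j k l, |⟪v i j, v k l⟫_ℝ| ≤ F := by
    intro i j k l
    refine (abs_real_inner_le_norm _ _).trans ?_
    rw [← hsq]
    exact mul_le_mul (hvF i j) (hvF k l) (norm_nonneg _) (Real.sqrt_nonneg _)
  have hvw : ∀ i j k l, |⟪v i j, v' k l⟫_ℝ| ≤ w * Real.sqrt F := by
    intro i j k l
    refine (abs_real_inner_le_norm _ _).trans ?_
    rw [mul_comm]
    exact mul_le_mul (hw k l) (hvF i j) (norm_nonneg _) hw0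
  have hwv : ∀ i j k l, |⟪v' i j, v k l⟫_ℝ| ≤ w * Real.sqrt F := by
    intro i j k l
    rw [real_inner_comm]
    exact hvw _ _ _ _
  have h1 : ∀ i k, |(1 : Matrix (Fin 2) (Fin 2) ℝ) i k| ≤ 1 := by
    intro i k
    rw [Matrix.one_apply]
    split_ifs <;> simp
  -- There are 16 index quadruples. Each contributes at most 4ℓF from the two inverse Gram factors
  -- and 2w√F from the inner product, which gives the constants 64 and 32.
  have hterm : ∀ i j k l : Fin 2,
      |(-(⟪a' i, a 0 k⟫_ℝ + ⟪a 0 i, a' k⟫_ℝ) * (1 : Matrix (Fin 2) (Fin 2) ℝ) j l +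
        (1 : Matrix (Fin 2) (Fin 2) ℝ) i k * -(⟪a' j, a 0 l⟫_ℝ + ⟪a 0 j, a' l⟫_ℝ)) *
        ⟪v i j, v k l⟫_ℝ + (1 : Matrix (Fin 2) (Fin 2) ℝ) i k *
        (1 : Matrix (Fin 2) (Fin 2) ℝ) j l * (⟪v' i j, v k l⟫_ℝ + ⟪v i j, v' k l⟫_ℝ)|
      ≤ 4 * ℓ * F + 2 * (w * Real.sqrt F) := by
    intro i j k l
    have e1 : |-(⟪a' i, a 0 k⟫_ℝ + ⟪a 0 i, a' k⟫_ℝ) * (1 : Matrix (Fin 2) (Fin 2) ℝ) j l| ≤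
        2 * ℓ := by
      rw [abs_mul, abs_neg]
      exact (mul_le_of_le_one_right (abs_nonneg _) (h1 _ _)).trans (hg' _ _)
    have e2 : |(1 : Matrix (Fin 2) (Fin 2) ℝ) i k * -(⟪a' j, a 0 l⟫_ℝ + ⟪a 0 j, a' l⟫_ℝ)| ≤
        2 * ℓ := by
      rw [abs_mul, abs_neg]
      exact (mul_le_of_le_one_left (abs_nonneg _) (h1 _ _)).trans (hg' _ _)
    refine (abs_add_le _ _).trans (add_le_add ?_ ?_)
    · rw [abs_mul]
      refine mul_le_mul ((abs_add_le _ _).trans ?_) (hvv _ _ _ _) (abs_nonneg _) (by positivity)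
      linarith
    · rw [abs_mul, abs_mul]
      refine (mul_le_of_le_one_left (abs_nonneg _)
        (mul_le_one₀ (h1 _ _) (abs_nonneg _) (h1 _ _))).trans ((abs_add_le _ _).trans ?_)
      linarith [hvw i j k l, hwv i j k l]
  rw [gramOf_eq_one ho, inv_one]
  have hR0 : ∀ i j k l : Fin 2, ∑ p, ∑ q, (1 : Matrix (Fin 2) (Fin 2) ℝ) p q *
        (⟪P 0 (b 0 k l), a 0 q⟫_ℝ * ⟪P 0 (b 0 i j), a 0 p⟫_ℝ) = 0 := by
    intro i j k l
    simp [hb]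
  simp only [hR0, sub_zero]
  calc _ ≤ ∑ i : Fin 2, ∑ j : Fin 2, ∑ k : Fin 2, ∑ l : Fin 2,
        (4 * ℓ * F + 2 * (w * Real.sqrt F)) := by
        refine (Finset.abs_sum_le_sum_abs _ _).trans (Finset.sum_le_sum fun i _ => ?_)
        refine (Finset.abs_sum_le_sum_abs _ _).trans (Finset.sum_le_sum fun j _ => ?_)
        refine (Finset.abs_sum_le_sum_abs _ _).trans (Finset.sum_le_sum fun k _ => ?_)
        refine (Finset.abs_sum_le_sum_abs _ _).trans (Finset.sum_le_sum fun l _ => ?_)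
        exact hterm i j k l
    _ = _ := by simp; ring

end Jets

/-! ### Variations of the ambient space and their action on jets -/

section AmbientVariation

variable {Q : ℕ}

/-- Time and space derivatives are both slots of the second derivative of the uncurried family, and
that second derivative is symmetric. -/
theorem hasDerivAt_fderiv_swap {E F : Type*} [NormedAddCommGroup E] [NormedSpace ℝ E]
    [NormedAddCommGroup F] [NormedSpace ℝ F] {G : ℝ → E → F}
    (hG : ContDiff ℝ ∞ (Function.uncurry G)) {X : E → F}
    (hX : ∀ q, HasDerivAt (fun t => G t q) (X q) 0) (q v : E) :
    HasDerivAt (fun t => fderiv ℝ (G t) q v) (fderiv ℝ X q v) 0 := by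
  set H := Function.uncurry G with hH
  have hd : ∀ z, DifferentiableAt ℝ H z := fun z => hG.differentiable (by simp) z
  have hd1 : ContDiff ℝ ∞ (fderiv ℝ H) := hG.fderiv_right (by simp)
  have hd2 : ∀ z, DifferentiableAt ℝ (fderiv ℝ H) z := fun z => hd1.differentiable (by simp) z
  have e1 : ∀ t q, fderiv ℝ (G t) q v = fderiv ℝ H (t, q) (0, v) := by
    intro t q
    have h1 : HasFDerivAt (fun y : E => (t, y)) (ContinuousLinearMap.inr ℝ ℝ E) q :=
      hasFDerivAt_prodMk_right t q
    have := ((hd (t, q)).hasFDerivAt.comp q h1).fderiv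
    rw [show (H ∘ fun y : E => (t, y)) = G t from rfl] at this
    rw [this]
    simp
  have e2 : X = fun q => fderiv ℝ H (0, q) (1, 0) := by
    ext1 q
    have h1 : HasDerivAt (fun t : ℝ => (t, q)) ((1 : ℝ), (0 : E)) 0 :=
      (hasDerivAt_id 0).prodMk (hasDerivAt_const 0 q)
    have h2 : HasDerivAt (H ∘ fun t : ℝ => (t, q)) (fderiv ℝ H (0, q) (1, 0)) 0 :=
      (hd (0, q)).hasFDerivAt.comp_hasDerivAt (0 : ℝ) h1
    exact (hX q).unique h2
  have hsym : IsSymmSndFDerivAt ℝ H (0, q) :=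
    hG.contDiffAt.isSymmSndFDerivAt (by
      rw [minSmoothness_of_isRCLikeNormedField]
      exact ENat.LEInfty.out)
  have h3 : fderiv ℝ X q v = fderiv ℝ (fderiv ℝ H) (0, q) (0, v) (1, 0) := by
    have h1 : HasFDerivAt (fun y : E => ((0 : ℝ), y)) (ContinuousLinearMap.inr ℝ ℝ E) q :=
      hasFDerivAt_prodMk_right 0 q
    have h2 := ((hd2 (0, q)).hasFDerivAt.comp q h1).clm_apply
      (hasFDerivAt_const ((1 : ℝ), (0 : E)) q)
    rw [e2]
    have h4 := h2.fderiv
    simp only [Function.comp_def] at h4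
    rw [h4]
    simp
  rw [h3, hsym.eq]
  simp only [e1]
  have h1 : HasDerivAt (fun t : ℝ => (t, q)) ((1 : ℝ), (0 : E)) 0 :=
    (hasDerivAt_id 0).prodMk (hasDerivAt_const 0 q)
  have h5 : HasDerivAt (fun t => fderiv ℝ H (t, q)) (fderiv ℝ (fderiv ℝ H) (0, q) (1, 0)) 0 :=
    (hd2 (0, q)).hasFDerivAt.comp_hasDerivAt (0 : ℝ) h1
  refine (h5.clm_apply (hasDerivAt_const (0 : ℝ) ((0 : ℝ), v))).congr_deriv ?_
  rw [map_zero, add_zero]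

/-- A smooth family of maps of `ℝ^Q` preserving `M` and `N`, starting from the identity, constant
outside of the compact set `K`. -/
structure IsAmbientVariation (M N K : Set (Euc Q)) (G : ℝ → Euc Q → Euc Q) : Prop where
  smooth : ContDiff ℝ ∞ (Function.uncurry G)
  zero : ∀ q, G 0 q = q
  mapsTo_ambient : ∀ t, MapsTo (G t) M M
  mapsTo_constraint : ∀ t, MapsTo (G t) N N
  compact : IsCompact K
  support : ∀ t, ∀ q ∉ K, G t q = q

/-- The initial velocity of a family of maps. -/
def velocity (G : ℝ → Euc Q → Euc Q) (q : Euc Q) : Euc Q := deriv (fun t => G t q) 0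

namespace IsAmbientVariation

variable {M N K : Set (Euc Q)} {G : ℝ → Euc Q → Euc Q}

theorem contDiff_apply (hG : IsAmbientVariation M N K G) (t : ℝ) : ContDiff ℝ ∞ (G t) :=
  hG.smooth.comp (contDiff_prodMk_right t)

theorem hasDerivAt (hG : IsAmbientVariation M N K G) (q : Euc Q) :
    HasDerivAt (fun t => G t q) (velocity G q) 0 := by
  have : ContDiff ℝ ∞ (fun t => G t q) := hG.smooth.comp (contDiff_prodMk_left q)
  exact (this.differentiable (by simp) 0).hasDerivAt

theorem contDiff_velocity (hG : IsAmbientVariation M N K G) : ContDiff ℝ ∞ (velocity G) := by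
  have e2 : velocity G = fun q => fderiv ℝ (Function.uncurry G) (0, q) (1, 0) := by
    ext1 q
    have h1 : HasDerivAt (fun t : ℝ => (t, q)) ((1 : ℝ), (0 : Euc Q)) 0 :=
      (hasDerivAt_id 0).prodMk (hasDerivAt_const 0 q)
    have h2 : HasDerivAt (Function.uncurry G ∘ fun t : ℝ => (t, q))
        (fderiv ℝ (Function.uncurry G) (0, q) (1, 0)) 0 :=
      (hG.smooth.differentiable (by simp) (0, q)).hasFDerivAt.comp_hasDerivAt (0 : ℝ) h1
    exact (hG.hasDerivAt q).unique h2
  rw [e2]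
  exact ((hG.smooth.fderiv_right (m := ∞) (by simp)).comp
    (contDiff_prodMk_right 0)).clm_apply contDiff_const

theorem velocity_eq_zero (hG : IsAmbientVariation M N K G) {q : Euc Q} (hq : q ∉ K) :
    velocity G q = 0 := by
  simp [velocity, fun t => hG.support t q hq]

theorem hasDerivAt_fderiv (hG : IsAmbientVariation M N K G) (q v : Euc Q) :
    HasDerivAt (fun t => fderiv ℝ (G t) q v) (fderiv ℝ (velocity G) q v) 0 :=
  hasDerivAt_fderiv_swap hG.smooth hG.hasDerivAt q v

theorem hasDerivAt_fderiv_fderiv (hG : IsAmbientVariation M N K G) (q u v : Euc Q) :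
    HasDerivAt (fun t => fderiv ℝ (fderiv ℝ (G t)) q u v)
      (fderiv ℝ (fderiv ℝ (velocity G)) q u v) 0 := by
  have key : ∀ {g : Euc Q → Euc Q}, ContDiff ℝ ∞ g →
      fderiv ℝ (fun q => fderiv ℝ g q v) q u = fderiv ℝ (fderiv ℝ g) q u v := by
    intro g hg
    have h1 : DifferentiableAt ℝ (fderiv ℝ g) q :=
      (hg.fderiv_right (m := ∞) (by simp)).differentiable (by simp) q
    have := (h1.hasFDerivAt.clm_apply (hasFDerivAt_const v q)).fderiv
    rw [this]
    simp
  have hs : ContDiff ℝ ∞ (Function.uncurry fun t q => fderiv ℝ (G t) q v) := by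
    have e1 : (Function.uncurry fun t q => fderiv ℝ (G t) q v)
        = fun z => fderiv ℝ (Function.uncurry G) z (0, v) := by
      ext1 ⟨t, q⟩
      have h1 : HasFDerivAt (fun y : Euc Q => (t, y)) (ContinuousLinearMap.inr ℝ ℝ (Euc Q)) q :=
        hasFDerivAt_prodMk_right t q
      have := ((hG.smooth.differentiable (by simp) (t, q)).hasFDerivAt.comp q h1).fderiv
      rw [show (Function.uncurry G ∘ fun y : Euc Q => (t, y)) = G t from rfl] at this
      simp [this]
    rw [e1]
    exact (hG.smooth.fderiv_right (m := ∞) (by simp)).clm_apply contDiff_const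
  have := hasDerivAt_fderiv_swap hs (fun q => hG.hasDerivAt_fderiv q v) q u
  rw [key hG.contDiff_velocity] at this
  simpa only [fun t => key (hG.contDiff_apply t)] using this

theorem fderiv_zero (hG : IsAmbientVariation M N K G) (q : Euc Q) :
    fderiv ℝ (G 0) q = ContinuousLinearMap.id ℝ (Euc Q) := by
  rw [show G 0 = id from funext hG.zero, fderiv_id]

theorem pushJet_zero (hG : IsAmbientVariation M N K G) (j : Jet Q) : pushJet (G 0) j = j := by
  have h0 : G 0 = id := funext hG.zero
  have h1 : fderiv ℝ (G 0) = fun _ => ContinuousLinearMap.id ℝ (Euc Q) :=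
    funext hG.fderiv_zero
  refine Prod.ext (hG.zero _) (Prod.ext ?_ ?_)
  · simp [pushJet, h1]
  · simp only [pushJet, h1]
    simp

theorem hasDerivAt_pushJet_snd (hG : IsAmbientVariation M N K G) (j : Jet Q) (i : Fin 2) :
    HasDerivAt (fun t => (pushJet (G t) j).2.1 i) (fderiv ℝ (velocity G) j.1 (j.2.1 i)) 0 :=
  hG.hasDerivAt_fderiv _ _

theorem hasDerivAt_pushJet_thd (hG : IsAmbientVariation M N K G) (j : Jet Q) (i k : Fin 2) :
    HasDerivAt (fun t => (pushJet (G t) j).2.2 i k)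
      (fderiv ℝ (fderiv ℝ (velocity G)) j.1 (j.2.1 i) (j.2.1 k)
        + fderiv ℝ (velocity G) j.1 (j.2.2 i k)) 0 :=
  (hG.hasDerivAt_fderiv_fderiv _ _ _).add (hG.hasDerivAt_fderiv _ _)

end IsAmbientVariation

/-- A map preserving `M` sends curves in `M` to curves in `M`, hence velocities to velocities;
linearity extends this to the span. -/
theorem fderiv_mem_tanSpace {M : Set (Euc Q)} {g : Euc Q → Euc Q} {q : Euc Q}
    (hg : DifferentiableAt ℝ g q) (hM : MapsTo g M M) {v : Euc Q} (hv : v ∈ tanSpace M q) :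
    fderiv ℝ g q v ∈ tanSpace M (g q) := by
  induction hv using Submodule.span_induction with
  | mem v hv =>
    obtain ⟨γ, h0, hγ, hd⟩ := hv
    refine Submodule.subset_span ⟨g ∘ γ, by simp [h0], hγ.mono fun t ht => hM ht, ?_⟩
    subst h0
    exact hg.hasFDerivAt.comp_hasDerivAt 0 hd
  | zero => simp
  | add x y _ _ hx hy => rw [map_add]; exact Submodule.add_mem _ hx hy
  | smul c x _ hx => rw [map_smul]; exact Submodule.smul_mem _ _ hx

/-- Properties of the jets of immersions into `M`, with respect to a smooth extension `pr` of the
tangential projection of `M`. -/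
structure IsTangentJet (M : Set (Euc Q)) (pr : Euc Q → Euc Q →L[ℝ] Euc Q) (j : Jet Q) : Prop where
  mem : j.1 ∈ M
  indep : LinearIndependent ℝ j.2.1
  tangent : ∀ i, j.2.1 i ∈ tanSpace M j.1
  second : ∀ i k, j.2.2 i k = pr j.1 (j.2.2 i k) + fderiv ℝ pr j.1 (j.2.1 i) (j.2.1 k)

theorem tanProj_eq_self {M : Set (Euc Q)} {q v : Euc Q} (h : v ∈ tanSpace M q) :
    tanProj M q v = v :=
  Submodule.starProjection_eq_self_iff.2 h

theorem norm_tanProj_le (M : Set (Euc Q)) (q v : Euc Q) : ‖tanProj M q v‖ ≤ ‖v‖ :=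
  Submodule.norm_starProjection_apply_le _ _

theorem inner_tanProj_of_mem {M : Set (Euc Q)} {q v w : Euc Q} (h : w ∈ tanSpace M q) :
    ⟪tanProj M q v, w⟫_ℝ = ⟪v, w⟫_ℝ := by
  rw [tanProj, Submodule.inner_starProjection_left_eq_right]
  congr 1
  exact tanProj_eq_self h

/-- Every tangent jet is a reparametrization of one with an orthonormal frame and normal second
derivatives. -/
theorem IsTangentJet.exists_normalized {M : Set (Euc Q)} {pr : Euc Q → Euc Q →L[ℝ] Euc Q}
    (hpr : ∀ q ∈ M, pr q = tanProj M q) {j : Jet Q} (hj : IsTangentJet M pr j) :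
    ∃ (T : Matrix (Fin 2) (Fin 2) ℝ) (Γ : Fin 2 → Fin 2 → Fin 2 → ℝ) (j₀ : Jet Q),
      T.det ≠ 0 ∧ j = jetChange T Γ j₀ ∧ IsTangentJet M pr j₀ ∧ Orthonormal ℝ j₀.2.1 ∧
      (∀ i k l, ⟪j₀.2.2 i k, j₀.2.1 l⟫_ℝ = 0) ∧
      ∀ i k, (Submodule.span ℝ (range j.2.1))ᗮ.starProjection (j.2.2 i k)
        = bilChange T j₀.2.2 i k := by
  obtain ⟨q, a, b⟩ := j
  obtain ⟨u, T, hu, hT, rfl⟩ := exists_orthonormal_linChange hj.indep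
  have hinv : T⁻¹ * T = 1 := Matrix.nonsing_inv_mul T (isUnit_iff_ne_zero.2 hT)
  have hinv' : T * T⁻¹ = 1 := Matrix.mul_nonsing_inv T (isUnit_iff_ne_zero.2 hT)
  have huT : u = linChange T⁻¹ (linChange T u) := by rw [linChange_mul, hinv', linChange_one]
  set c := bilChange T⁻¹ b with hc
  have hcb : ∀ i k, b i k = bilChange T c i k := by
    intro i k
    have e : ∀ p q, ∑ r, T⁻¹ p r * T r q = (1 : Matrix (Fin 2) (Fin 2) ℝ) p q := by
      intro p q; rw [← hinv, Matrix.mul_apply]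
    have : bilChange T c i k = ∑ p, ∑ q, ((∑ r, T⁻¹ p r * T r i) * ∑ r, T⁻¹ q r * T r k) • b p q := by
      simp only [hc, bilChange, Fin.sum_univ_two]
      module
    rw [this]
    simp only [e, Matrix.one_apply]
    simp
  -- Expressed in the orthonormal frame, the second derivatives are stripped of their components
  -- along the surface. The removed components become the `Γ` of the reparametrization.
  let b₀ : Fin 2 → Fin 2 → Euc Q := fun i k => c i k - ∑ p, ⟪c i k, u p⟫_ℝ • u p
  have hut : ∀ i, u i ∈ tanSpace M q := by
    intro i
    rw [huT]
    exact Submodule.sum_mem _ fun k _ => Submodule.smul_mem _ _ (hj.tangent k)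
  have hPu : ∀ i, pr q (u i) = u i := fun i => by
    rw [hpr q hj.mem, tanProj_eq_self (hut i)]
  have hb₀ : ∀ i k l, ⟪b₀ i k, u l⟫_ℝ = 0 := by
    intro i k l
    simp only [b₀, inner_sub_left, sum_inner, real_inner_smul_left, orthonormal_iff_ite.1 hu]
    simp
  have hjc : ((q, linChange T u, b) : Jet Q) = jetChange T
      (fun i k p => ∑ k', ∑ l, T k' i * T l k * ⟪c k' l, u p⟫_ℝ) (q, u, b₀) := by
    refine Prod.ext rfl (Prod.ext rfl ?_)
    funext i k
    simp only [jetChange, hcb i k, bilChange, b₀, Fin.sum_univ_two]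
    module
  refine ⟨T, _, (q, u, b₀), hT, hjc, ⟨hj.mem, hu.linearIndependent, hut, ?_⟩, hu, hb₀, ?_⟩
  · intro i k
    have hs := hj.second
    simp only at hs ⊢
    have hci : c i k = pr q (c i k) + fderiv ℝ pr q (u i) (u k) := by
      have e2 : fderiv ℝ pr q (u i) (u k)
          = bilChange T⁻¹ (fun i k => fderiv ℝ pr q (linChange T u i) (linChange T u k)) i k := by
        conv_lhs => rw [huT]
        simp only [linChange, bilChange, Fin.sum_univ_two, map_add, map_smul,
          add_apply, smul_apply]
        module
      have e1 : pr q (c i k) = bilChange T⁻¹ (fun i k => pr q (b i k)) i k := by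
        simp [hc, bilChange]
      rw [e1, e2, hc]
      simp only [bilChange, ← Finset.sum_add_distrib, ← smul_add]
      refine Finset.sum_congr rfl fun p _ => Finset.sum_congr rfl fun r _ => ?_
      rw [← hs p r]
    have : pr q (b₀ i k) = pr q (c i k) - ∑ p, ⟪c i k, u p⟫_ℝ • u p := by
      simp only [b₀, map_sub, map_sum, map_smul, hPu]
    rw [this]
    simp only [b₀]
    nth_rewrite 1 [hci]
    abel
  · intro i k
    have hs : ∀ v, (Submodule.span ℝ (range (linChange T u)))ᗮ.starProjection v
        = (Submodule.span ℝ (range u))ᗮ.starProjection v := by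
      intro v
      congr! 2
      rw [span_linChange hT]
    have e0 : b i k = (jetChange T (fun i k p => ∑ k', ∑ l, T k' i * T l k * ⟪c k' l, u p⟫_ℝ)
      (q, u, b₀)).2.2 i k := by rw [← hjc]
    change (Submodule.span ℝ (range (linChange T u)))ᗮ.starProjection (b i k) = _
    have hfix : ∀ i k, (Submodule.span ℝ (range u))ᗮ.starProjection (b₀ i k) = b₀ i k := by
      intro i k
      rw [starProjection_span_compl hu.linearIndependent]
      simp [hb₀]
    rw [hs, e0]
    simp only [jetChange, bilChange, map_add, map_sum, map_smul, hfix,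
      starProjection_span_compl_self, smul_zero, Finset.sum_const_zero, add_zero]

variable {M N K : Set (Euc Q)} {G : ℝ → Euc Q → Euc Q} {pr : Euc Q → Euc Q →L[ℝ] Euc Q}

/-- The second derivatives split into a part tangent to `M`, which at a normalized jet is the second
fundamental form of the surface, and a part normal to `M`, which is the derivative of the tangential
projection applied to two unit vectors. So |II| controls all second derivatives up to the additive
constant `c`. -/
theorem IsTangentJet.normal_bound (hpr : ∀ q ∈ M, pr q = tanProj M q) {j : Jet Q}
    (hj : IsTangentJet M pr j) (ho : Orthonormal ℝ j.2.1)
    (hn : ∀ i k l, ⟪j.2.2 i k, j.2.1 l⟫_ℝ = 0) {c : ℝ} (hc : ‖fderiv ℝ pr j.1‖ ≤ c) (i k : Fin 2) :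
    ‖j.2.2 i k‖ ≤ Real.sqrt (ffOf (pr j.1) j.2.1 j.2.2) + c := by
  have hPn : ∀ i k l, ⟪pr j.1 (j.2.2 i k), j.2.1 l⟫_ℝ = 0 := by
    intro i k l
    rw [hpr _ hj.mem, inner_tanProj_of_mem (hj.tangent l), hn]
  rw [ffOf_orthonormal ho hPn]
  have h1 : ‖pr j.1 (j.2.2 i k)‖ ≤ Real.sqrt (∑ i, ∑ k, ‖pr j.1 (j.2.2 i k)‖ ^ 2) := by
    apply Real.le_sqrt_of_sq_le
    exact (Finset.single_le_sum (f := fun k => ‖pr j.1 (j.2.2 i k)‖ ^ 2) (fun _ _ => by positivity)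
      (Finset.mem_univ k)).trans (Finset.single_le_sum
        (f := fun i => ∑ k, ‖pr j.1 (j.2.2 i k)‖ ^ 2) (fun _ _ => by positivity) (Finset.mem_univ i))
  have h2 : ‖fderiv ℝ pr j.1 (j.2.1 i) (j.2.1 k)‖ ≤ c := by
    refine (ContinuousLinearMap.le_opNorm _ _).trans ?_
    rw [ho.1 k, mul_one]
    refine (ContinuousLinearMap.le_opNorm _ _).trans ?_
    rwa [ho.1 i, mul_one]
  rw [hj.second i k]
  exact (norm_add_le _ _).trans (add_le_add h1 h2)

/-- First variation of the area density. -/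
theorem IsAmbientVariation.hasDerivAt_area (hG : IsAmbientVariation M N K G)
    (hpr : ∀ q ∈ M, pr q = tanProj M q) {j : Jet Q} (hj : IsTangentJet M pr j) :
    ∃ D, HasDerivAt (fun t => areaOf (pushJet (G t) j).2.1) D 0 ∧
      ∀ L : ℝ, (∀ u : Fin 2 → Euc Q, Orthonormal ℝ u → L ≤
        ⟪fderiv ℝ (velocity G) j.1 (u 0), u 0⟫_ℝ + ⟪fderiv ℝ (velocity G) j.1 (u 1), u 1⟫_ℝ) →
      L * areaOf j.2.1 ≤ D := by
  -- Normalization multiplies the area density by |det T| at all times, so the inequality only has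
  -- to be checked at an orthonormal frame, where the derivative is a trace.
  obtain ⟨T, Γ, j₀, hT, rfl, hj₀, ho, -, -⟩ := hj.exists_normalized hpr
  have h0 : (pushJet (G 0) j₀).2.1 = j₀.2.1 := by rw [hG.pushJet_zero]
  have hd := hasDerivAt_areaOf (a := fun t => (pushJet (G t) j₀).2.1)
    (hG.hasDerivAt_pushJet_snd j₀) (by rwa [h0])
  simp only [pushJet_jetChange]
  have ea : ∀ j' : Jet Q, areaOf (jetChange T Γ j').2.1 = |T.det| * areaOf j'.2.1 :=
    fun j' => areaOf_linChange T _
  simp only [ea]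
  refine ⟨_, hd.const_mul _, fun L hL => ?_⟩
  have h1 : areaOf j₀.2.1 = 1 := by rw [areaOf, gramOf_eq_one ho]; simp
  have h2 : (jetChange T Γ j₀).1 = j₀.1 := rfl
  rw [h1, mul_one, mul_comm, h0]
  exact mul_le_mul_of_nonneg_left (by simpa [h2] using hL _ ho) (abs_nonneg _)

/-- First variation of `|II|⁴` times the area density. -/
theorem IsAmbientVariation.hasDerivAt_ff (hG : IsAmbientVariation M N K G)
    (hpr : ∀ q ∈ M, pr q = tanProj M q) (hprs : ContDiff ℝ ∞ pr) {j : Jet Q}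
    (hj : IsTangentJet M pr j) {c x₀ ℓ d : ℝ} (hc : ‖fderiv ℝ pr j.1‖ ≤ c)
    (hx : ‖velocity G j.1‖ ≤ x₀) (hℓ : ‖fderiv ℝ (velocity G) j.1‖ ≤ ℓ)
    (hd : ‖fderiv ℝ (fderiv ℝ (velocity G)) j.1‖ ≤ d) :
    ∃ D, HasDerivAt (fun t => ffOf (pr (G t j.1)) (pushJet (G t) j).2.1 (pushJet (G t) j).2.2 ^ 2 *
        areaOf (pushJet (G t) j).2.1) D 0 ∧
      |D| ≤ (130 * ℓ * ffOf (pr j.1) j.2.1 j.2.2 ^ 2 +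
        64 * ((c * x₀ + ℓ) * (Real.sqrt (ffOf (pr j.1) j.2.1 j.2.2) + c) + d) *
          (ffOf (pr j.1) j.2.1 j.2.2 * Real.sqrt (ffOf (pr j.1) j.2.1 j.2.2))) * areaOf j.2.1 := by
  obtain ⟨T, Γ, j₀, hT, rfl, hj₀, ho, hn, -⟩ := hj.exists_normalized hpr
  have hq : (jetChange T Γ j₀).1 = j₀.1 := rfl
  rw [hq] at hc hx hℓ hd ⊢
  have h0 : pushJet (G 0) j₀ = j₀ := hG.pushJet_zero j₀
  have hGm : ∀ t, G t j₀.1 ∈ M := fun t => hG.mapsTo_ambient t hj₀.mem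
  have hfix : ∀ t i, pr (G t j₀.1) ((pushJet (G t) j₀).2.1 i) = (pushJet (G t) j₀).2.1 i := by
    intro t i
    rw [hpr _ (hGm t)]
    exact tanProj_eq_self (fderiv_mem_tanSpace ((hG.contDiff_apply t).differentiable (by simp) _)
      (hG.mapsTo_ambient t) (hj₀.tangent i))
  have ef : ∀ t, ffOf (pr (G t j₀.1)) (pushJet (G t) (jetChange T Γ j₀)).2.1
      (pushJet (G t) (jetChange T Γ j₀)).2.2 =
      ffOf (pr (G t j₀.1)) (pushJet (G t) j₀).2.1 (pushJet (G t) j₀).2.2 := by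
    intro t
    rw [pushJet_jetChange, ffOf_jetChange hT Γ (hfix t)]
  have ef0 : ffOf (pr j₀.1) (jetChange T Γ j₀).2.1 (jetChange T Γ j₀).2.2
      = ffOf (pr j₀.1) j₀.2.1 j₀.2.2 := by
    have := ef 0
    rwa [hG.pushJet_zero, hG.pushJet_zero, hG.zero] at this
  have ea : ∀ j' : Jet Q, areaOf (jetChange T Γ j').2.1 = |T.det| * areaOf j'.2.1 :=
    fun j' => areaOf_linChange T _
  simp only [ef, ef0]
  simp only [pushJet_jetChange, ea]
  have h1 : areaOf j₀.2.1 = 1 := by rw [areaOf, gramOf_eq_one ho]; simp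
  rw [h1, mul_one]
  set f := ffOf (pr j₀.1) j₀.2.1 j₀.2.2 with hf
  have hf0 : 0 ≤ f := by
    rw [hf, ffOf_orthonormal ho fun i k l => by
      rw [hpr _ hj₀.mem, inner_tanProj_of_mem (hj₀.tangent l), hn]]
    positivity
  have hc0 : 0 ≤ c := (norm_nonneg (fderiv ℝ pr j₀.1)).trans hc
  have hx0 : 0 ≤ x₀ := (norm_nonneg _).trans hx
  have hℓ0 : 0 ≤ ℓ := (norm_nonneg _).trans hℓ
  have hd0 : 0 ≤ d := (norm_nonneg (fderiv ℝ (fderiv ℝ (velocity G)) j₀.1)).trans hd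
  have hb := hj₀.normal_bound hpr ho hn hc
  have hP1 : ∀ v, ‖pr j₀.1 v‖ ≤ ‖v‖ := fun v => by rw [hpr _ hj₀.mem]; exact norm_tanProj_le _ _ _
  -- the derivative of the tangential part of the second derivatives
  have hPt : HasDerivAt (fun t => pr (G t j₀.1)) (fderiv ℝ pr j₀.1 (velocity G j₀.1)) 0 := by
    have h2 := (hprs.differentiable (by simp) (G 0 j₀.1)).hasFDerivAt.comp_hasDerivAt (0 : ℝ)
      (hG.hasDerivAt j₀.1)
    rw [hG.zero] at h2
    exact h2
  have hv := fun i k => hPt.clm_apply (hG.hasDerivAt_pushJet_thd j₀ i k)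
  have hℓv : ∀ v, ‖fderiv ℝ (velocity G) j₀.1 v‖ ≤ ℓ * ‖v‖ := fun v =>
    (ContinuousLinearMap.le_opNorm _ _).trans (mul_le_mul_of_nonneg_right hℓ (norm_nonneg _))
  -- The value of `w` collects three contributions: the motion of the projection, at most c x₀ times
  -- the second derivatives; the first derivative of the velocity applied to them; and the second
  -- derivative of the velocity on the unit frame.
  obtain ⟨D, hD, hDb⟩ := hasDerivAt_ffOf (P := fun t => pr (G t j₀.1))
    (a := fun t => (pushJet (G t) j₀).2.1) (b := fun t => (pushJet (G t) j₀).2.2)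
    (ℓ := ℓ) (w := (c * x₀ + ℓ) * (Real.sqrt f + c) + d)
    (hG.hasDerivAt_pushJet_snd j₀) (by rwa [h0]) hv
    (by
      intro i k l
      rw [h0, hG.zero, hpr _ hj₀.mem, inner_tanProj_of_mem (hj₀.tangent l), hn])
    (by
      intro i
      simpa [ho.1 i] using hℓv (j₀.2.1 i))
    (by
      intro i k
      rw [h0, hG.zero]
      have t1 : ‖fderiv ℝ pr j₀.1 (velocity G j₀.1) (j₀.2.2 i k)‖ ≤ c * x₀ * (Real.sqrt f + c) := by
        refine (ContinuousLinearMap.le_opNorm _ _).trans (mul_le_mul ?_ (hb i k) (norm_nonneg _)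
          (by positivity))
        exact (ContinuousLinearMap.le_opNorm _ _).trans (mul_le_mul hc hx (norm_nonneg _) hc0)
      have t2 : ‖fderiv ℝ (fderiv ℝ (velocity G)) j₀.1 (j₀.2.1 i) (j₀.2.1 k)‖ ≤ d := by
        refine (ContinuousLinearMap.le_opNorm _ _).trans ?_
        rw [ho.1 k, mul_one]
        refine (ContinuousLinearMap.le_opNorm _ _).trans ?_
        rwa [ho.1 i, mul_one]
      have t3 : ‖fderiv ℝ (velocity G) j₀.1 (j₀.2.2 i k)‖ ≤ ℓ * (Real.sqrt f + c) :=
        (hℓv _).trans (mul_le_mul_of_nonneg_left (hb i k) hℓ0)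
      have t4 := (hP1 (fderiv ℝ (fderiv ℝ (velocity G)) j₀.1 (j₀.2.1 i) (j₀.2.1 k)
        + fderiv ℝ (velocity G) j₀.1 (j₀.2.2 i k))).trans (norm_add_le _ _)
      refine (norm_add_le _ _).trans ?_
      linarith)
  have hA := hasDerivAt_areaOf (a := fun t => (pushJet (G t) j₀).2.1)
    (hG.hasDerivAt_pushJet_snd j₀) (by rwa [h0])
  have hall := ((hD.fun_pow 2).fun_mul (hA.const_mul |T.det|))
  refine ⟨_, hall, ?_⟩
  simp only [h0, hG.zero, ← hf] at hDb ⊢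
  rw [h1]
  set A := ⟪fderiv ℝ (velocity G) j₀.1 (j₀.2.1 0), j₀.2.1 0⟫_ℝ +
    ⟪fderiv ℝ (velocity G) j₀.1 (j₀.2.1 1), j₀.2.1 1⟫_ℝ with hAdef
  have hAb : |A| ≤ 2 * ℓ := by
    have : ∀ i, |⟪fderiv ℝ (velocity G) j₀.1 (j₀.2.1 i), j₀.2.1 i⟫_ℝ| ≤ ℓ := by
      intro i
      refine (abs_real_inner_le_norm _ _).trans ?_
      have := hℓv (j₀.2.1 i)
      rwa [ho.1 i, mul_one] at this ⊢
    refine (abs_add_le _ _).trans ?_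
    linarith [this 0, this 1]
  -- In 2fD the bound for D gives 128ℓf² and 64wf√f; the variation of area adds 2ℓf². Hence the
  -- constants 130 and 64.
  have e : (2 : ℕ) * f ^ (2 - 1) * D * (|T.det| * 1) + f ^ 2 * (|T.det| * A)
      = (2 * f * D + f ^ 2 * A) * |T.det| := by push_cast; ring
  rw [e, abs_mul, abs_abs]
  refine mul_le_mul_of_nonneg_right ?_ (abs_nonneg _)
  have b1 : |2 * f * D| = 2 * f * |D| := by rw [abs_mul, abs_of_nonneg (by positivity)]
  have b2 : |f ^ 2 * A| ≤ f ^ 2 * (2 * ℓ) := by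
    rw [abs_mul, abs_of_nonneg (by positivity)]
    exact mul_le_mul_of_nonneg_left hAb (by positivity)
  have b3 := mul_le_mul_of_nonneg_left hDb (show 0 ≤ 2 * f by positivity)
  refine (abs_add_le _ _).trans ?_
  rw [b1]
  linarith

end AmbientVariation

/-! ### Straightening charts and tangential projections -/

section Submanifolds

variable {Q : ℕ}

/-- A local diffeomorphism of `ℝ^Q` straightening `M` to the linear subspace `W`. -/
structure IsStraightening (e : OpenPartialHomeomorph (Euc Q) (Euc Q)) (M : Set (Euc Q))
    (W : Submodule ℝ (Euc Q)) : Prop where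
  smooth : ContDiffOn ℝ ∞ e e.source
  smooth_symm : ContDiffOn ℝ ∞ e.symm e.target
  mem_iff : ∀ y ∈ e.source, (y ∈ M ↔ e y ∈ W)

theorem IsSmoothSubmanifold.exists_isStraightening {k : ℕ} {M : Set (Euc Q)}
    (hM : IsSmoothSubmanifold k M) : ∃ W : Submodule ℝ (Euc Q), ∀ p ∈ M,
      ∃ e : OpenPartialHomeomorph (Euc Q) (Euc Q), p ∈ e.source ∧ IsStraightening e M W := by
  refine ⟨⨅ (i : Fin Q) (_ : k ≤ (i : ℕ)), (EuclideanSpace.proj (𝕜 := ℝ) i).toLinearMap.ker, ?_⟩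
  intro p hp
  obtain ⟨e, he, h1, h2, h3⟩ := hM.2 p hp
  refine ⟨e, he, h1, h2, fun y hy => ?_⟩
  rw [h3 y hy]
  simp [Submodule.mem_iInf]

namespace IsStraightening

variable {e : OpenPartialHomeomorph (Euc Q) (Euc Q)} {M : Set (Euc Q)} {W : Submodule ℝ (Euc Q)}

theorem contDiffAt (he : IsStraightening e M W) {q : Euc Q} (hq : q ∈ e.source) :
    ContDiffAt ℝ ∞ e q :=
  he.smooth.contDiffAt (e.open_source.mem_nhds hq)

theorem contDiffAt_symm (he : IsStraightening e M W) {z : Euc Q} (hz : z ∈ e.target) :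
    ContDiffAt ℝ ∞ e.symm z :=
  he.smooth_symm.contDiffAt (e.open_target.mem_nhds hz)

theorem fderiv_symm_fderiv (he : IsStraightening e M W) {q : Euc Q} (hq : q ∈ e.source)
    (v : Euc Q) : fderiv ℝ e.symm (e q) (fderiv ℝ e q v) = v := by
  have h1 := ((he.contDiffAt_symm (e.map_source hq)).differentiableAt (by simp)).hasFDerivAt.comp q
    ((he.contDiffAt hq).differentiableAt (by simp)).hasFDerivAt
  have h2 : (e.symm ∘ e) =ᶠ[𝓝 q] id := by
    filter_upwards [e.open_source.mem_nhds hq] with y hy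
    exact e.left_inv hy
  have := (h1.congr_of_eventuallyEq h2.symm).unique (hasFDerivAt_id q)
  exact congrArg (fun L : Euc Q →L[ℝ] Euc Q => L v) this

theorem fderiv_fderiv_symm (he : IsStraightening e M W) {q : Euc Q} (hq : q ∈ e.source)
    (v : Euc Q) : fderiv ℝ e q (fderiv ℝ e.symm (e q) v) = v := by
  have h1 := ((he.contDiffAt (e.map_target (e.map_source hq))).differentiableAt
    (by simp)).hasFDerivAt.comp (e q)
    ((he.contDiffAt_symm (e.map_source hq)).differentiableAt (by simp)).hasFDerivAt
  have h2 : (e ∘ e.symm) =ᶠ[𝓝 (e q)] id := by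
    filter_upwards [e.open_target.mem_nhds (e.map_source hq)] with y hy
    exact e.right_inv hy
  have := (h1.congr_of_eventuallyEq h2.symm).unique (hasFDerivAt_id (e q))
  rw [e.left_inv hq] at this
  exact congrArg (fun L : Euc Q →L[ℝ] Euc Q => L v) this

/-- Derivatives of functions with values in a subspace stay in the subspace. -/
theorem _root_.FreeBoundary.fderivWithin_mem_submodule {E : Type*} [NormedAddCommGroup E]
    [NormedSpace ℝ E] {s : Set E} {x : E}
    (hs : UniqueDiffWithinAt ℝ s x) (hx : x ∈ s) {f : E → Euc Q} (W : Submodule ℝ (Euc Q))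
    (hf : DifferentiableWithinAt ℝ f s x) (hW : ∀ᶠ y in 𝓝[s] x, f y ∈ W) (v : E) :
    fderivWithin ℝ f s x v ∈ W := by
  have h1 := (Wᗮ.starProjection).hasFDerivAt.comp_hasFDerivWithinAt x hf.hasFDerivWithinAt
  have h2 : (Wᗮ.starProjection ∘ f) =ᶠ[𝓝[s] x] fun _ => 0 := by
    filter_upwards [hW] with y hy
    exact Submodule.starProjection_orthogonal_apply_eq_zero hy
  have h3 := h1.congr_of_eventuallyEq h2.symm (h2.self_of_nhdsWithin hx).symm
  have h4 := hs.eq h3 (hasFDerivWithinAt_const (0 : Euc Q) x s)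
  have h5 := congrArg (fun L : E →L[ℝ] Euc Q => L v) h4
  have h6 := (Submodule.starProjection_apply_eq_zero_iff (K := Wᗮ)).1 h5
  rwa [Submodule.orthogonal_orthogonal] at h6

/-- In straightened coordinates a curve in `M` is a curve in the linear space `W`, so its velocity
lies in `W`. Conversely a vector of `W` is the velocity of a segment, pulled back to `M`. In
particular the velocities already form a linear space. -/
theorem mem_tanSpace_iff (he : IsStraightening e M W) {q : Euc Q} (hq : q ∈ e.source)
    (hqM : q ∈ M) (v : Euc Q) : v ∈ tanSpace M q ↔ fderiv ℝ e q v ∈ W := by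
  constructor
  · intro hv
    induction hv using Submodule.span_induction with
    | mem v hv =>
      obtain ⟨γ, h0, hγ, hd⟩ := hv
      subst h0
      have h1 := ((he.contDiffAt hq).differentiableAt (by simp)).hasFDerivAt.comp_hasDerivAt 0 hd
      have h2 := fderivWithin_mem_submodule (s := univ) (x := (0 : ℝ)) uniqueDiffWithinAt_univ
        (mem_univ _) W (f := e ∘ γ) h1.differentiableAt.differentiableWithinAt (by
          rw [nhdsWithin_univ]
          filter_upwards [hγ, hd.continuousAt.eventually (e.open_source.mem_nhds hq)] with t ht ht'
          exact (he.mem_iff _ ht').1 ht) 1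
      rwa [fderivWithin_univ, h1.hasFDerivAt.fderiv, ContinuousLinearMap.toSpanSingleton_apply,
        one_smul] at h2
    | zero => simp
    | add x y _ _ hx hy => rw [map_add]; exact Submodule.add_mem _ hx hy
    | smul c x _ hx => rw [map_smul]; exact Submodule.smul_mem _ _ hx
  · intro hv
    refine Submodule.subset_span ⟨fun t => e.symm (e q + t • fderiv ℝ e q v), ?_, ?_, ?_⟩
    · simp [e.left_inv hq]
    · have hc : ContinuousAt (fun t : ℝ => e q + t • fderiv ℝ e q v) 0 := by fun_prop
      have ht : e.target ∈ 𝓝 (e q + (0 : ℝ) • fderiv ℝ e q v) := by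
        simpa using e.open_target.mem_nhds (e.map_source hq)
      filter_upwards [hc.eventually ht] with t ht
      rw [he.mem_iff _ (e.map_target ht), e.right_inv ht]
      exact Submodule.add_mem _ ((he.mem_iff q hq).1 hqM) (Submodule.smul_mem _ _ hv)
    · have h1 : HasDerivAt (fun t : ℝ => e q + t • fderiv ℝ e q v) (fderiv ℝ e q v) 0 := by
        simpa using ((hasDerivAt_id (0 : ℝ)).smul_const (fderiv ℝ e q v)).const_add (e q)
      have h2 : HasFDerivAt e.symm (fderiv ℝ e.symm (e q)) (e q + (0 : ℝ) • fderiv ℝ e q v) := by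
        simpa using ((he.contDiffAt_symm (e.map_source hq)).differentiableAt (by simp)).hasFDerivAt
      have h3 := h2.comp_hasDerivAt 0 h1
      rwa [he.fderiv_symm_fderiv hq] at h3

theorem contDiffAt_fderiv_symm (he : IsStraightening e M W) {q : Euc Q} (hq : q ∈ e.source) :
    ContDiffAt ℝ ∞ (fun q => fderiv ℝ e.symm (e q)) q :=
  ((he.contDiffAt_symm (e.map_source hq)).fderiv_right (m := ∞) (by simp)).comp q
    (he.contDiffAt hq)

end IsStraightening

/-- The orthogonal projection onto the image `A W` in terms of `A`. -/
def imageProj (W : Submodule ℝ (Euc Q)) (A : Euc Q →L[ℝ] Euc Q) : Euc Q →L[ℝ] Euc Q :=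
  A * W.starProjection * Ring.inverse (W.starProjection * (star A * A) * W.starProjection
    + (1 - W.starProjection)) * W.starProjection * star A

/-- With P the projection onto `W`, the operator P A*A P + (1 - P) is injective: pairing a kernel
element x with Px gives |APx|² = 0, so Px = 0, and then x = 0. In finite dimension it is invertible.
-/
theorem isUnit_imageProj_aux (W : Submodule ℝ (Euc Q)) {A : Euc Q →L[ℝ] Euc Q}
    (hA : Function.Injective A) : IsUnit (W.starProjection * (star A * A) * W.starProjection
    + (1 - W.starProjection)) := by
  rw [ContinuousLinearMap.isUnit_iff_bijective]
  set B := W.starProjection * (star A * A) * W.starProjection + (1 - W.starProjection) with hB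
  have hinj : Function.Injective B.toLinearMap := by
    rw [injective_iff_map_eq_zero]
    intro x hx
    have hx' : W.starProjection (star A (A (W.starProjection x))) + (x - W.starProjection x) = 0 :=
      hx
    have h1 : ⟪W.starProjection (star A (A (W.starProjection x))), W.starProjection x⟫_ℝ = 0 := by
      have h2 : ⟪W.starProjection (star A (A (W.starProjection x))) + (x - W.starProjection x),
        W.starProjection x⟫_ℝ = 0 := by rw [hx', inner_zero_left]
      rw [inner_add_left] at h2
      have h3 : ⟪x - W.starProjection x, W.starProjection x⟫_ℝ = 0 :=
        Submodule.starProjection_inner_eq_zero x _ (Submodule.starProjection_apply_mem W x)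
      linarith
    have h4 : A (W.starProjection x) = 0 := by
      rw [Submodule.inner_starProjection_left_eq_right, Submodule.starProjection_eq_self_iff.2
        (Submodule.starProjection_apply_mem W x), ContinuousLinearMap.star_eq_adjoint,
        ContinuousLinearMap.adjoint_inner_left] at h1
      exact inner_self_eq_zero.1 h1
    have h5 : W.starProjection x = 0 := hA (by rw [h4, map_zero])
    rw [h5, map_zero, map_zero, map_zero, zero_add, sub_zero] at hx'
    exact hx'
  exact ⟨hinj, (LinearMap.injective_iff_surjective (f := B.toLinearMap)).1 hinj⟩

theorem contDiffAt_imageProj (W : Submodule ℝ (Euc Q)) {A : Euc Q →L[ℝ] Euc Q}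
    (hA : Function.Injective A) : ContDiffAt ℝ ∞ (imageProj W) A := by
  have hstar : ContDiff ℝ ∞ (fun A : Euc Q →L[ℝ] Euc Q => star A) :=
    (starL' ℝ (A := Euc Q →L[ℝ] Euc Q)).contDiff
  obtain ⟨u, hu⟩ := isUnit_imageProj_aux W hA
  have h1 : ContDiffAt ℝ ∞ (fun A : Euc Q →L[ℝ] Euc Q => Ring.inverse
      (W.starProjection * (star A * A) * W.starProjection + (1 - W.starProjection))) A := by
    refine ContDiffAt.comp A (g := Ring.inverse) (f := fun A : Euc Q →L[ℝ] Euc Q =>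
      W.starProjection * (star A * A) * W.starProjection + (1 - W.starProjection)) ?_ ?_
    · have := contDiffAt_ringInverse ℝ (n := ∞) u
      rwa [hu] at this
    · exact (((contDiff_const.mul (hstar.mul contDiff_id)).mul contDiff_const).add
        contDiff_const).contDiffAt
  exact ((((contDiff_id.mul contDiff_const).contDiffAt.mul h1).mul contDiffAt_const).mul
    hstar.contDiffAt)

/-- This is the least squares formula: the inverse solves the normal equations for the point of `A
W` closest to the given vector. -/
theorem imageProj_eq (W T : Submodule ℝ (Euc Q)) {A : Euc Q →L[ℝ] Euc Q}
    (hA : Function.Injective A) (hT : ∀ v, v ∈ T ↔ ∃ w ∈ W, A w = v) :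
    imageProj W A = T.starProjection := by
  have hu := isUnit_imageProj_aux W hA
  set B := W.starProjection * (star A * A) * W.starProjection + (1 - W.starProjection) with hB
  ext1 v
  refine (Submodule.eq_starProjection_of_mem_orthogonal (K := T) ?_ ?_).symm
  · exact (hT _).2 ⟨_, Submodule.starProjection_apply_mem W _, rfl⟩
  · rw [Submodule.mem_orthogonal']
    intro x hx
    obtain ⟨w, hw, rfl⟩ := (hT x).1 hx
    set z := Ring.inverse B (W.starProjection (star A v)) with hz
    have hBz : B z = W.starProjection (star A v) := by
      have := Ring.mul_inverse_cancel B hu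
      exact congrArg (fun L : Euc Q →L[ℝ] Euc Q => L (W.starProjection (star A v))) this
    have hBz' : W.starProjection (star A (A (W.starProjection z))) + (z - W.starProjection z)
        = W.starProjection (star A v) := hBz
    have e : imageProj W A v = A (W.starProjection z) := rfl
    rw [e, inner_sub_left]
    have hw' : W.starProjection w = w := Submodule.starProjection_eq_self_iff.2 hw
    have a1 : ⟪v, A w⟫_ℝ = ⟪W.starProjection (star A v), w⟫_ℝ := by
      rw [Submodule.inner_starProjection_left_eq_right, hw', ContinuousLinearMap.star_eq_adjoint,
        ContinuousLinearMap.adjoint_inner_left]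
    have a2 : ⟪A (W.starProjection z), A w⟫_ℝ
        = ⟪W.starProjection (star A (A (W.starProjection z))), w⟫_ℝ := by
      rw [Submodule.inner_starProjection_left_eq_right, hw', ContinuousLinearMap.star_eq_adjoint,
        ContinuousLinearMap.adjoint_inner_left]
    have a3 : ⟪z - W.starProjection z, w⟫_ℝ = 0 := Submodule.starProjection_inner_eq_zero z w hw
    rw [a1, a2, ← hBz', inner_add_left, a3]
    ring

/-- The tangential projection of a submanifold extends to a smooth map on `ℝ^Q`. -/
theorem IsSmoothSubmanifold.exists_smooth_tanProj {k : ℕ} {M : Set (Euc Q)}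
    (hM : IsSmoothSubmanifold k M) (hMc : IsClosed M) :
    ∃ pr : Euc Q → Euc Q →L[ℝ] Euc Q, ContDiff ℝ ∞ pr ∧ ∀ q ∈ M, pr q = tanProj M q := by
  classical
  obtain ⟨W, hW⟩ := hM.exists_isStraightening
  -- The values are prescribed on M and free elsewhere. Both conditions are convex, so local smooth
  -- solutions, given by `imageProj` near M and by 0 away from it, can be glued with a partition of
  -- unity.
  let t : Euc Q → Set (Euc Q →L[ℝ] Euc Q) := fun q => {L | q ∈ M → L = tanProj M q}
  have ht : ∀ q, Convex ℝ (t q) := by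
    intro q
    by_cases hq : q ∈ M
    · have : t q = {tanProj M q} := by ext L; simp [t, hq]
      rw [this]
      exact convex_singleton _
    · have : t q = univ := by ext L; simp [t, hq]
      rw [this]
      exact convex_univ
  obtain ⟨g, hg⟩ := exists_contMDiffMap_forall_mem_convex_of_local (n := ⊤) (𝓘(ℝ, Euc Q)) ht
    (fun q => by
      by_cases hq : q ∈ M
      · obtain ⟨e, heq, he⟩ := hW q hq
        refine ⟨e.source, e.open_source.mem_nhds heq,
          fun q => imageProj W (fderiv ℝ e.symm (e q)), ?_, ?_⟩
        · rw [contMDiffOn_iff_contDiffOn]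
          intro y hy
          have hinj : Function.Injective (fderiv ℝ e.symm (e y)) :=
            Function.LeftInverse.injective (g := fderiv ℝ e y) (he.fderiv_fderiv_symm hy)
          exact ((contDiffAt_imageProj W hinj).comp y
            (he.contDiffAt_fderiv_symm hy)).contDiffWithinAt
        · intro y hy hyM
          have hinj : Function.Injective (fderiv ℝ e.symm (e y)) :=
            Function.LeftInverse.injective (g := fderiv ℝ e y) (he.fderiv_fderiv_symm hy)
          refine imageProj_eq W _ hinj fun v => ?_
          rw [he.mem_tanSpace_iff hy hyM]
          constructor
          · intro hv
            exact ⟨_, hv, he.fderiv_symm_fderiv hy v⟩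
          · rintro ⟨w, hw, rfl⟩
            rwa [he.fderiv_fderiv_symm hy]
      · refine ⟨Mᶜ, hMc.isOpen_compl.mem_nhds hq, fun _ => 0, contMDiffOn_const, ?_⟩
        intro y hy hyM
        exact absurd hyM hy)
  exact ⟨g, g.contMDiff.contDiff, fun q hq => hg q hq⟩

end Submanifolds

/-! ### Jets of maps on the half-plane -/

section HalfPlane

variable {Q : ℕ}

/-- The two-jet at `y` of a map on the half-plane. -/
def jetAt (φ : Euc 2 → Euc Q) (y : Euc 2) : Jet Q := (φ y, pd φ y, pd2 φ y)

theorem uniqueDiffOn_halfPlane : UniqueDiffOn ℝ halfPlane := (𝓡∂ 2).uniqueDiffOn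

theorem pd_congr {φ ψ : Euc 2 → Euc Q} {y : Euc 2} (hy : y ∈ halfPlane)
    (h : φ =ᶠ[𝓝[halfPlane] y] ψ) : pd φ y = pd ψ y := by
  ext1 i
  rw [pd, pd, h.fderivWithin_eq (h.self_of_nhdsWithin hy)]

theorem pd_eventuallyEq {φ ψ : Euc 2 → Euc Q} {y : Euc 2}
    (h : φ =ᶠ[𝓝[halfPlane] y] ψ) : pd φ =ᶠ[𝓝[halfPlane] y] pd ψ := by
  filter_upwards [eventually_eventually_nhdsWithin.2 h, self_mem_nhdsWithin] with z hz hzH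
  exact pd_congr hzH hz

theorem jetAt_congr {φ ψ : Euc 2 → Euc Q} {y : Euc 2} (hy : y ∈ halfPlane)
    (h : φ =ᶠ[𝓝[halfPlane] y] ψ) : jetAt φ y = jetAt ψ y := by
  refine Prod.ext (h.self_of_nhdsWithin hy) (Prod.ext (pd_congr hy h) ?_)
  funext i k
  refine congrFun (pd_congr hy ?_) i
  filter_upwards [pd_eventuallyEq h] with z hz
  rw [hz]

/-- The set `s` is kept general because the outer map is either an ambient map, with `s` everything,
or a map on the half-plane composed with a change of charts, whose derivatives at boundary points
are one-sided. -/
theorem pd_comp_within {F : Type*} [NormedAddCommGroup F] [NormedSpace ℝ F] {s : Set F}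
    {ψ : F → Euc Q} {φ : Euc 2 → F} {y : Euc 2} (hy : y ∈ halfPlane)
    (hφ : DifferentiableWithinAt ℝ φ halfPlane y) (hψ : DifferentiableWithinAt ℝ ψ s (φ y))
    (hm : ∀ᶠ z in 𝓝[halfPlane] y, φ z ∈ s) (i : Fin 2) :
    pd (fun z => ψ (φ z)) y i =
      fderivWithin ℝ ψ s (φ y) (fderivWithin ℝ φ halfPlane y (coordVec i)) := by
  have h1 := hψ.hasFDerivWithinAt.comp_of_tendsto y hφ.hasFDerivWithinAt
    (tendsto_nhdsWithin_iff.2 ⟨hφ.continuousWithinAt, hm⟩)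
  rw [pd]
  have h2 := h1.fderivWithin (uniqueDiffOn_halfPlane y hy)
  rw [show (fun z => ψ (φ z)) = ψ ∘ φ from rfl, h2]
  rfl

theorem pd2_comp_within {F : Type*} [NormedAddCommGroup F] [NormedSpace ℝ F] {s : Set F}
    (hs : UniqueDiffOn ℝ s) {ψ : F → Euc Q} {φ : Euc 2 → F} {y : Euc 2} (hy : y ∈ halfPlane)
    (hφ : ContDiffWithinAt ℝ 2 φ halfPlane y) (hψ : ContDiffWithinAt ℝ 2 ψ s (φ y))
    (hm : ∀ᶠ z in 𝓝[halfPlane] y, φ z ∈ s) (i j : Fin 2) :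
    pd2 (fun z => ψ (φ z)) y i j =
      fderivWithin ℝ (fderivWithin ℝ ψ s) s (φ y) (fderivWithin ℝ φ halfPlane y (coordVec i))
        (fderivWithin ℝ φ halfPlane y (coordVec j)) + fderivWithin ℝ ψ s (φ y)
        (fderivWithin ℝ (fun z => fderivWithin ℝ φ halfPlane z (coordVec j)) halfPlane y
          (coordVec i)) := by
  have hys : φ y ∈ s := hm.self_of_nhdsWithin hy
  have ht : Tendsto φ (𝓝[halfPlane] y) (𝓝[s] (φ y)) :=
    tendsto_nhdsWithin_iff.2 ⟨hφ.continuousWithinAt, hm⟩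
  have hψ1 : ∀ᶠ w in 𝓝[s] (φ y), ContDiffWithinAt ℝ 2 ψ s w := by
    have := hψ.eventually (by simp)
    rwa [insert_eq_of_mem hys] at this
  have hφ1 : ∀ᶠ w in 𝓝[halfPlane] y, ContDiffWithinAt ℝ 2 φ halfPlane w := by
    have := hφ.eventually (by simp)
    rwa [insert_eq_of_mem hy] at this
  have hev : (fun z => pd (fun z => ψ (φ z)) z j) =ᶠ[𝓝[halfPlane] y]
      fun z => fderivWithin ℝ ψ s (φ z) (fderivWithin ℝ φ halfPlane z (coordVec j)) := by
    filter_upwards [ht.eventually hψ1, hφ1, eventually_eventually_nhdsWithin.2 hm,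
      self_mem_nhdsWithin] with z h1 h2 h3 h4
    exact pd_comp_within h4 (h2.differentiableWithinAt (by simp))
      (h1.differentiableWithinAt (by simp)) h3 j
  rw [pd2, pd_congr hy hev]
  have hD : DifferentiableWithinAt ℝ (fderivWithin ℝ ψ s) s (φ y) :=
    (hψ.fderivWithin_right (m := 1) hs (by norm_num) hys).differentiableWithinAt (by simp)
  have hE : DifferentiableWithinAt ℝ (fun z => fderivWithin ℝ φ halfPlane z (coordVec j))
      halfPlane y :=
    ((hφ.fderivWithin_right (m := 1) uniqueDiffOn_halfPlane (by norm_num) hy).clm_apply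
      contDiffWithinAt_const).differentiableWithinAt (by simp)
  have h1 := hD.hasFDerivWithinAt.comp_of_tendsto y
    (hφ.differentiableWithinAt (by simp)).hasFDerivWithinAt ht
  have h2 := h1.clm_apply hE.hasFDerivWithinAt
  have h3 := h2.fderivWithin (uniqueDiffOn_halfPlane y hy)
  rw [pd]
  simp only [Function.comp_def] at h3
  rw [h3]
  simp [add_comm]

theorem jetAt_comp {g : Euc Q → Euc Q} (hg : ContDiff ℝ ∞ g) {φ : Euc 2 → Euc Q} {y : Euc 2}
    (hy : y ∈ halfPlane) (hφ : ContDiffWithinAt ℝ 2 φ halfPlane y) :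
    jetAt (fun z => g (φ z)) y = pushJet g (jetAt φ y) := by
  have hg2 : ContDiff ℝ 2 g := hg.of_le ENat.LEInfty.out
  refine Prod.ext rfl (Prod.ext ?_ ?_)
  · funext i
    have := pd_comp_within (s := univ) hy (hφ.differentiableWithinAt (by simp))
      (hg2.contDiffWithinAt.differentiableWithinAt (by simp)) (by simp) i
    rw [fderivWithin_univ] at this
    exact this
  · funext i k
    have := pd2_comp_within (s := univ) uniqueDiffOn_univ hy hφ hg2.contDiffWithinAt (by simp) i k
    simp only [fderivWithin_univ] at this
    exact this

theorem sum_coordVec (v : Euc 2) : v = ∑ k, v k • coordVec k := by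
  ext i
  fin_cases i <;> simp [coordVec, Fin.sum_univ_two]

/-- First and second order chain rule, expanded in coordinate vectors: the first derivatives of τ
give `T` and its second derivatives give `Γ`. -/
theorem jetAt_reparam {φ : Euc 2 → Euc Q} {τ : Euc 2 → Euc 2} {y : Euc 2}
    (hy : y ∈ halfPlane) (hτ : ContDiffWithinAt ℝ 2 τ halfPlane y)
    (hm : ∀ᶠ z in 𝓝[halfPlane] y, τ z ∈ halfPlane)
    (hφ : ContDiffWithinAt ℝ 2 φ halfPlane (τ y)) :
    jetAt (fun z => φ (τ z)) y =
      jetChange (Matrix.of fun k i => pd τ y i k) (fun i k p => pd2 τ y i k p)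
        (jetAt φ (τ y)) := by
  have hys : τ y ∈ halfPlane := hm.self_of_nhdsWithin hy
  refine Prod.ext rfl (Prod.ext ?_ ?_)
  · funext i
    have := pd_comp_within (s := halfPlane) hy (hτ.differentiableWithinAt (by simp))
      (hφ.differentiableWithinAt (by simp)) hm i
    change pd (fun z => φ (τ z)) y i = _
    rw [this]
    simp only [jetChange, linChange, Matrix.of_apply, jetAt]
    rw [show fderivWithin ℝ τ halfPlane y (coordVec i) = pd τ y i from rfl]
    conv_lhs => rw [sum_coordVec (pd τ y i)]
    simp [pd]
  · funext i k
    have := pd2_comp_within (s := halfPlane) uniqueDiffOn_halfPlane hy hτ hφ hm i k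
    change pd2 (fun z => φ (τ z)) y i k = _
    rw [this]
    simp only [jetChange, bilChange, Matrix.of_apply, jetAt]
    have e1 : ∀ i, fderivWithin ℝ τ halfPlane y (coordVec i) = pd τ y i := fun _ => rfl
    have e2 : fderivWithin ℝ (fun z => fderivWithin ℝ τ halfPlane z (coordVec k)) halfPlane y
      (coordVec i) = pd2 τ y i k := rfl
    have e3 : ∀ p q, pd2 φ (τ y) p q
        = fderivWithin ℝ (fderivWithin ℝ φ halfPlane) halfPlane (τ y) (coordVec p) (coordVec q) := by
      intro p q
      have hD : DifferentiableWithinAt ℝ (fderivWithin ℝ φ halfPlane) halfPlane (τ y) :=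
        (hφ.fderivWithin_right (m := 1) uniqueDiffOn_halfPlane (by norm_num)
          hys).differentiableWithinAt (by simp)
      have h2 := hD.hasFDerivWithinAt.clm_apply (hasFDerivWithinAt_const (coordVec q) _ _)
      have h3 := h2.fderivWithin (uniqueDiffOn_halfPlane _ hys)
      change fderivWithin ℝ (fun z => fderivWithin ℝ φ halfPlane z (coordVec q)) halfPlane (τ y)
        (coordVec p) = _
      rw [h3]
      simp
    rw [e1, e1, e2]
    conv_lhs => rw [sum_coordVec (pd τ y i), sum_coordVec (pd τ y k), sum_coordVec (pd2 τ y i k)]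
    simp only [Fin.sum_univ_two, map_add, map_smul, add_apply, smul_apply, e3, pd]
    module

theorem contDiffWithinAt_pd {φ : Euc 2 → Euc Q} {y : Euc 2}
    (hy : y ∈ halfPlane) (hφ : ContDiffWithinAt ℝ ∞ φ halfPlane y) (i : Fin 2) :
    ContDiffWithinAt ℝ ∞ (fun z => pd φ z i) halfPlane y :=
  (hφ.fderivWithin_right (m := ∞) uniqueDiffOn_halfPlane (by simp) hy).clm_apply
    contDiffWithinAt_const

theorem continuousWithinAt_jetAt {φ : Euc 2 → Euc Q} {y : Euc 2}
    (hy : y ∈ halfPlane) (hφ : ContDiffWithinAt ℝ ∞ φ halfPlane y) :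
    ContinuousWithinAt (jetAt φ) halfPlane y := by
  refine hφ.continuousWithinAt.prodMk (ContinuousWithinAt.prodMk ?_ ?_)
  · exact continuousWithinAt_pi.2 fun i => (contDiffWithinAt_pd hy hφ i).continuousWithinAt
  · refine continuousWithinAt_pi.2 fun i => continuousWithinAt_pi.2 fun k => ?_
    exact (contDiffWithinAt_pd hy (contDiffWithinAt_pd hy hφ k) i).continuousWithinAt

/-- The derivatives of a map into `M` are tangent to `M`. -/
theorem pd_mem_tanSpace {k : ℕ} {M : Set (Euc Q)} (hM : IsSmoothSubmanifold k M)
    {φ : Euc 2 → Euc Q} {y : Euc 2} (hy : y ∈ halfPlane)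
    (hφ : DifferentiableWithinAt ℝ φ halfPlane y) (hφM : ∀ᶠ z in 𝓝[halfPlane] y, φ z ∈ M)
    (i : Fin 2) : pd φ y i ∈ tanSpace M (φ y) := by
  obtain ⟨W, hW⟩ := hM.exists_isStraightening
  have hyM := hφM.self_of_nhdsWithin hy
  obtain ⟨e, hes, he⟩ := hW (φ y) hyM
  rw [he.mem_tanSpace_iff hes hyM]
  have hed := (he.contDiffAt hes).differentiableAt (by simp)
  have h1 := hed.hasFDerivAt.comp_hasFDerivWithinAt y hφ.hasFDerivWithinAt
  have h2 := fderivWithin_mem_submodule (uniqueDiffOn_halfPlane y hy) hy W (f := e ∘ φ)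
    h1.differentiableWithinAt (by
      filter_upwards [hφM, hφ.continuousWithinAt.eventually (e.open_source.mem_nhds hes)]
        with z h1 h2
      exact (he.mem_iff _ h2).1 h1) (coordVec i)
  rwa [h1.fderivWithin (uniqueDiffOn_halfPlane y hy)] at h2

/-- Coordinate derivatives of a map into M are tangent to M, hence fixed by the projection along the
map. The product rule applied to this identity yields the relation between the second derivatives
and the derivative of `pr`. -/
theorem isTangentJet_jetAt {k : ℕ} {M : Set (Euc Q)} (hM : IsSmoothSubmanifold k M)
    {pr : Euc Q → Euc Q →L[ℝ] Euc Q} (hprs : ContDiff ℝ ∞ pr) (hpr : ∀ q ∈ M, pr q = tanProj M q)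
    {φ : Euc 2 → Euc Q} {y : Euc 2} (hy : y ∈ halfPlane)
    (hφ : ContDiffWithinAt ℝ ∞ φ halfPlane y) (hφM : ∀ᶠ z in 𝓝[halfPlane] y, φ z ∈ M)
    (hi : LinearIndependent ℝ (pd φ y)) : IsTangentJet M pr (jetAt φ y) := by
  have hφ1 : ∀ᶠ w in 𝓝[halfPlane] y, ContDiffWithinAt ℝ 2 φ halfPlane w := by
    have := (hφ.of_le (m := 2) ENat.LEInfty.out).eventually (by simp)
    rwa [insert_eq_of_mem hy] at this
  refine ⟨hφM.self_of_nhdsWithin hy, hi,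
    pd_mem_tanSpace hM hy (hφ.differentiableWithinAt (by simp)) hφM, fun i k => ?_⟩
  have hev : (fun z => pd φ z k) =ᶠ[𝓝[halfPlane] y] fun z => pr (φ z) (pd φ z k) := by
    filter_upwards [hφ1, eventually_eventually_nhdsWithin.2 hφM, self_mem_nhdsWithin]
      with z h1 h2 h3
    rw [hpr _ (h2.self_of_nhdsWithin h3)]
    exact (tanProj_eq_self
      (pd_mem_tanSpace hM h3 (h1.differentiableWithinAt (by simp)) h2 k)).symm
  change pd2 φ y i k = pr (φ y) (pd2 φ y i k) + fderiv ℝ pr (φ y) (pd φ y i) (pd φ y k)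
  have h1 := (hprs.differentiable (by simp) (φ y)).hasFDerivAt.comp_hasFDerivWithinAt y
    (hφ.differentiableWithinAt (by simp)).hasFDerivWithinAt
  have h2 := h1.clm_apply
    ((contDiffWithinAt_pd hy hφ k).differentiableWithinAt (by simp)).hasFDerivWithinAt
  have h3 := h2.fderivWithin (uniqueDiffOn_halfPlane y hy)
  have h4 : pd2 φ y i k = pd (fun z => pr (φ z) (pd φ z k)) y i := congrFun (pd_congr hy hev) i
  rw [h4]
  conv_lhs => rw [pd]
  simp only [Function.comp_def] at h3
  rw [h3]
  simp only [add_apply, ContinuousLinearMap.comp_apply, ContinuousLinearMap.flip_apply]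
  rw [← pd_congr hy hev]
  rfl

end HalfPlane

/-! ### Norms of covariant derivatives of restricted vector fields -/

section CovariantDerivatives

variable {Q : ℕ} {k : ℕ} {M : Set (Euc Q)} {pr : Euc Q → Euc Q →L[ℝ] Euc Q}

theorem tanProj_tanProj (M : Set (Euc Q)) (q v : Euc Q) :
    tanProj M q (tanProj M q v) = tanProj M q v :=
  tanProj_eq_self (Submodule.starProjection_apply_mem _ _)

theorem pd_field_comp {X : Euc Q → Euc Q} (hX : ContDiff ℝ ∞ X) {φ : Euc 2 → Euc Q}
    {y : Euc 2} (hy : y ∈ halfPlane) (hφ : DifferentiableWithinAt ℝ φ halfPlane y) (i : Fin 2) :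
    pd (fun z => X (φ z)) y i = fderiv ℝ X (φ y) (pd φ y i) := by
  have := pd_comp_within (s := univ) hy hφ
    (hX.contDiffWithinAt.differentiableWithinAt (by simp)) (by simp) i
  rw [fderivWithin_univ] at this
  exact this

theorem normSq₁_covDeriv_le (hpr : ∀ q ∈ M, pr q = tanProj M q)
    {X : Euc Q → Euc Q} (hX : ContDiff ℝ ∞ X) {φ : Euc 2 → Euc Q} {y : Euc 2}
    (hy : y ∈ halfPlane) (hφ : ContDiffWithinAt ℝ ∞ φ halfPlane y)
    (hj : IsTangentJet M pr (jetAt φ y)) {ℓ : ℝ} (hℓ : ‖fderiv ℝ X (φ y)‖ ≤ ℓ) :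
    normSq₁ (gram φ y) (covDeriv M φ (fun z => X (φ z)) y) ≤ 2 * ℓ ^ 2 := by
  obtain ⟨T, Γ, j₀, hT, he, hj₀, ho, -, -⟩ := hj.exists_normalized hpr
  have ha : pd φ y = linChange T j₀.2.1 := congrArg (fun j : Jet Q => j.2.1) he
  have h1 : covDeriv M φ (fun z => X (φ z)) y
      = linChange T fun i => tanProj M (φ y) (fderiv ℝ X (φ y) (j₀.2.1 i)) := by
    funext i
    rw [covDeriv, pd_field_comp hX hy (hφ.differentiableWithinAt (by simp)), ha]
    simp [linChange]
  have hg : gram φ y = T.transpose * 1 * T := by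
    rw [← gramOf_eq_one ho, ← gramOf_linChange, ← ha]
    rfl
  rw [h1, hg, normSq₁_linChange hT, normSq₁_one]
  have hb : ∀ i, ‖tanProj M (φ y) (fderiv ℝ X (φ y) (j₀.2.1 i))‖ ^ 2 ≤ ℓ ^ 2 := by
    intro i
    refine pow_le_pow_left₀ (norm_nonneg _) ((norm_tanProj_le _ _ _).trans ?_) 2
    refine (ContinuousLinearMap.le_opNorm _ _).trans ?_
    rwa [ho.1 i, mul_one]
  rw [Fin.sum_univ_two]
  linarith [hb 0, hb 1]

/-- The Christoffel term removes exactly the image under DX of the surface-tangential part of ∂ᵢ∂ₖφ.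
Only its normal part survives, so the Hessian of a restricted field is controlled by |II| and not by
the parametrization. -/
theorem covDeriv2_field (hprs : ContDiff ℝ ∞ pr)
    (hpr : ∀ q ∈ M, pr q = tanProj M q) {X : Euc Q → Euc Q} (hX : ContDiff ℝ ∞ X)
    {φ : Euc 2 → Euc Q} {y : Euc 2}
    (hy : y ∈ halfPlane) (hφ : ContDiffWithinAt ℝ ∞ φ halfPlane y)
    (hφM : ∀ᶠ z in 𝓝[halfPlane] y, φ z ∈ M) (hi : LinearIndependent ℝ (pd φ y)) (i k : Fin 2) :
    covDeriv2 M φ (fun z => X (φ z)) y i k = tanProj M (φ y)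
      (fderiv ℝ pr (φ y) (pd φ y i) (fderiv ℝ X (φ y) (pd φ y k))
        + fderiv ℝ (fderiv ℝ X) (φ y) (pd φ y i) (pd φ y k) + fderiv ℝ X (φ y)
          ((Submodule.span ℝ (range (pd φ y)))ᗮ.starProjection (pd2 φ y i k))) := by
  have hφ1 : ∀ᶠ w in 𝓝[halfPlane] y, ContDiffWithinAt ℝ 2 φ halfPlane w := by
    have := (hφ.of_le (m := 2) ENat.LEInfty.out).eventually (by simp)
    rwa [insert_eq_of_mem hy] at this
  have hyM := hφM.self_of_nhdsWithin hy
  have hev : (fun z => covDeriv M φ (fun z => X (φ z)) z k) =ᶠ[𝓝[halfPlane] y]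
      fun z => pr (φ z) (fderiv ℝ X (φ z) (pd φ z k)) := by
    filter_upwards [hφ1, hφM, self_mem_nhdsWithin] with z h1 h2 h3
    rw [covDeriv, pd_field_comp hX h3 (h1.differentiableWithinAt (by simp)), hpr _ h2]
  have hdφ := (hφ.differentiableWithinAt (by simp)).hasFDerivWithinAt
  have h1 := (hprs.differentiable (by simp) (φ y)).hasFDerivAt.comp_hasFDerivWithinAt y hdφ
  have h2 := ((hX.fderiv_right (m := ∞) (by simp)).differentiable (by simp)
    (φ y)).hasFDerivAt.comp_hasFDerivWithinAt y hdφ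
  have h3 := h1.clm_apply (h2.clm_apply
    ((contDiffWithinAt_pd hy hφ k).differentiableWithinAt (by simp)).hasFDerivWithinAt)
  have h4 := h3.fderivWithin (uniqueDiffOn_halfPlane y hy)
  have h5 : pd (fun z => covDeriv M φ (fun z => X (φ z)) z k) y i
      = fderiv ℝ pr (φ y) (pd φ y i) (fderiv ℝ X (φ y) (pd φ y k)) + pr (φ y)
        (fderiv ℝ (fderiv ℝ X) (φ y) (pd φ y i) (pd φ y k) + fderiv ℝ X (φ y) (pd2 φ y i k)) := by
    rw [pd_congr hy hev]
    conv_lhs => rw [pd]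
    simp only [Function.comp_def] at h4
    rw [h4]
    simp only [add_apply, ContinuousLinearMap.comp_apply, ContinuousLinearMap.flip_apply]
    rw [add_comm, add_comm (fderiv ℝ (fderiv ℝ X) (φ y) (pd φ y i) (pd φ y k))]
    rfl
  have hc : ∀ l, covDeriv M φ (fun z => X (φ z)) y l
      = tanProj M (φ y) (fderiv ℝ X (φ y) (pd φ y l)) := fun l => by
    rw [covDeriv, pd_field_comp hX hy (hφ.differentiableWithinAt (by simp))]
  rw [covDeriv2, covDeriv, h5, hpr _ hyM, starProjection_span_compl hi]
  simp only [hc, map_add, map_sub, map_sum, map_smul, tanProj_tanProj]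
  rw [add_assoc, add_sub_assoc, add_sub_assoc]
  rfl

/-- Both sides are invariant, so the estimate is made at a normalized jet, where each of the four
entries is bounded separately by means of `IsTangentJet.normal_bound`. -/
theorem normSq₂_covDeriv2_le (hprs : ContDiff ℝ ∞ pr)
    (hpr : ∀ q ∈ M, pr q = tanProj M q) {X : Euc Q → Euc Q} (hX : ContDiff ℝ ∞ X)
    {φ : Euc 2 → Euc Q} {y : Euc 2}
    (hy : y ∈ halfPlane) (hφ : ContDiffWithinAt ℝ ∞ φ halfPlane y)
    (hφM : ∀ᶠ z in 𝓝[halfPlane] y, φ z ∈ M) (hj : IsTangentJet M pr (jetAt φ y))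
    {c ℓ d : ℝ} (hc : ‖fderiv ℝ pr (φ y)‖ ≤ c) (hℓ : ‖fderiv ℝ X (φ y)‖ ≤ ℓ)
    (hd : ‖fderiv ℝ (fderiv ℝ X) (φ y)‖ ≤ d) :
    normSq₂ (gram φ y) (covDeriv2 M φ (fun z => X (φ z)) y) ≤
      4 * (c * ℓ + d + ℓ * (Real.sqrt (ffOf (tanProj M (φ y)) (pd φ y) (pd2 φ y)) + c)) ^ 2 := by
  obtain ⟨T, Γ, j₀, hT, he, hj₀, ho, hn, hb⟩ := hj.exists_normalized hpr
  have hq : φ y = j₀.1 := congrArg (fun j : Jet Q => j.1) he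
  have ha : pd φ y = linChange T j₀.2.1 := congrArg (fun j : Jet Q => j.2.1) he
  have hb' : ∀ i k, (Submodule.span ℝ (range (pd φ y)))ᗮ.starProjection (pd2 φ y i k)
    = bilChange T j₀.2.2 i k := hb
  have h1 : covDeriv2 M φ (fun z => X (φ z)) y
      = bilChange T fun i k => tanProj M (φ y)
      (fderiv ℝ pr (φ y) (j₀.2.1 i) (fderiv ℝ X (φ y) (j₀.2.1 k))
        + fderiv ℝ (fderiv ℝ X) (φ y) (j₀.2.1 i) (j₀.2.1 k) + fderiv ℝ X (φ y)
          (j₀.2.2 i k)) := by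
    funext i k
    rw [covDeriv2_field hprs hpr hX hy hφ hφM hj.indep, hb', ha]
    simp only [linChange, bilChange, Fin.sum_univ_two, map_add, map_smul, add_apply, smul_apply]
    module
  have hg : gram φ y = T.transpose * 1 * T := by
    rw [← gramOf_eq_one ho, ← gramOf_linChange, ← ha]
    rfl
  have hf : ffOf (tanProj M (φ y)) (pd φ y) (pd2 φ y) = ffOf (pr j₀.1) j₀.2.1 j₀.2.2 := by
    have h2 : ffOf (pr j₀.1) (jetChange T Γ j₀).2.1 (jetChange T Γ j₀).2.2
        = ffOf (pr j₀.1) j₀.2.1 j₀.2.2 := ffOf_jetChange hT Γ fun i => by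
      rw [hpr _ hj₀.mem, tanProj_eq_self (hj₀.tangent i)]
    rw [← h2, ← he, hpr _ hj₀.mem, hq]
    rfl
  have hbn := hj₀.normal_bound hpr ho hn (hq ▸ hc)
  rw [h1, hg, normSq₂_bilChange hT, normSq₂_one, hf]
  set r := Real.sqrt (ffOf (pr j₀.1) j₀.2.1 j₀.2.2)
  have hℓ0 : 0 ≤ ℓ := (norm_nonneg _).trans hℓ
  have hc0 : 0 ≤ c := (norm_nonneg (fderiv ℝ pr (φ y))).trans hc
  have hℓv : ∀ v, ‖fderiv ℝ X (φ y) v‖ ≤ ℓ * ‖v‖ := fun v =>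
    (ContinuousLinearMap.le_opNorm _ _).trans (mul_le_mul_of_nonneg_right hℓ (norm_nonneg _))
  have key : ∀ i k, ‖tanProj M (φ y)
      (fderiv ℝ pr (φ y) (j₀.2.1 i) (fderiv ℝ X (φ y) (j₀.2.1 k))
        + fderiv ℝ (fderiv ℝ X) (φ y) (j₀.2.1 i) (j₀.2.1 k) + fderiv ℝ X (φ y)
          (j₀.2.2 i k))‖ ^ 2 ≤ (c * ℓ + d + ℓ * (r + c)) ^ 2 := by
    intro i k
    refine pow_le_pow_left₀ (norm_nonneg _) ((norm_tanProj_le _ _ _).trans ?_) 2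
    refine (norm_add_le _ _).trans (add_le_add ((norm_add_le _ _).trans (add_le_add ?_ ?_)) ?_)
    · refine (ContinuousLinearMap.le_opNorm _ _).trans (mul_le_mul ?_ ?_ (norm_nonneg _) hc0)
      · refine (ContinuousLinearMap.le_opNorm _ _).trans ?_
        rwa [ho.1 i, mul_one]
      · simpa [ho.1 k] using hℓv (j₀.2.1 k)
    · refine (ContinuousLinearMap.le_opNorm _ _).trans ?_
      rw [ho.1 k, mul_one]
      refine (ContinuousLinearMap.le_opNorm _ _).trans ?_
      rwa [ho.1 i, mul_one]
    · exact (hℓv _).trans (mul_le_mul_of_nonneg_left (hbn i k) hℓ0)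
  simp only [Fin.sum_univ_two]
  linarith [key 0 0, key 0 1, key 1 0, key 1 1]

end CovariantDerivatives

/-! ### Immersed surfaces in charts -/

section SurfaceCharts

variable {S : Type*} [TopologicalSpace S] [ChartedSpace (EuclideanHalfSpace 2) S]
  {Q : ℕ} {k : ℕ} {M N : Set (Euc Q)} {Φ : S → Euc Q}

theorem target_subset_halfPlane (c : S) : (extChartAt (𝓡∂ 2) c).target ⊆ halfPlane :=
  extChartAt_target_subset_range c

theorem target_mem_nhdsWithin_halfPlane {c : S} {y : Euc 2}
    (hy : y ∈ (extChartAt (𝓡∂ 2) c).target) : (extChartAt (𝓡∂ 2) c).target ∈ 𝓝[halfPlane] y :=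
  extChartAt_target_mem_nhdsWithin_of_mem hy

theorem IsAdmissible.eventually_mem (hΦ : IsAdmissible M N Φ) (c : S) (y : Euc 2) :
    ∀ᶠ z in 𝓝[halfPlane] y, inChart Φ c z ∈ M := Eventually.of_forall fun _ => hΦ.mem_ambient _

variable [IsManifold (𝓡∂ 2) ∞ S]

theorem contDiffWithinAt_inChart (hΦ : ContMDiff (𝓡∂ 2) 𝓘(ℝ, Euc Q) ∞ Φ) {c : S} {y : Euc 2}
    (hy : y ∈ (extChartAt (𝓡∂ 2) c).target) :
    ContDiffWithinAt ℝ ∞ (inChart Φ c) halfPlane y := by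
  have h := hΦ.comp_contMDiffOn (contMDiffOn_extChartAt_symm (I := 𝓡∂ 2) (n := ∞) c)
  have h2 := (contMDiffOn_iff_contDiffOn.1 h) y hy
  exact h2.mono_of_mem_nhdsWithin (target_mem_nhdsWithin_halfPlane hy)

theorem IsAdmissible.linearIndependent_pd (hΦ : IsAdmissible M N Φ) {c : S} {y : Euc 2}
    (hy : y ∈ (extChartAt (𝓡∂ 2) c).target) : LinearIndependent ℝ (pd (inChart Φ c) y) := by
  have h1 := isInvertible_mfderivWithin_extChartAt_symm (I := 𝓡∂ 2) hy
  have hyr : y ∈ range (𝓡∂ 2) := target_subset_halfPlane c hy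
  have h2 : mfderivWithin 𝓘(ℝ, Euc 2) 𝓘(ℝ, Euc Q) (Φ ∘ (extChartAt (𝓡∂ 2) c).symm)
      (range (𝓡∂ 2)) y = (mfderiv (𝓡∂ 2) 𝓘(ℝ, Euc Q) Φ ((extChartAt (𝓡∂ 2) c).symm y)).comp
        (mfderivWithin 𝓘(ℝ, Euc 2) (𝓡∂ 2) (extChartAt (𝓡∂ 2) c).symm (range (𝓡∂ 2)) y) := by
    refine mfderiv_comp_mfderivWithin y ?_ ?_ ?_
    · exact hΦ.smooth.mdifferentiable (by simp) _
    · exact mdifferentiableWithinAt_extChartAt_symm hy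
    · exact (uniqueDiffOn_halfPlane y hyr).uniqueMDiffWithinAt
  rw [mfderivWithin_eq_fderivWithin] at h2
  have hinj : Function.Injective (fderivWithin ℝ (inChart Φ c) halfPlane y) := by
    have h3 : fderivWithin ℝ (inChart Φ c) halfPlane y = _ := h2
    rw [h3]
    exact (hΦ.immersion _).comp h1.injective
  have hcv : LinearIndependent ℝ coordVec := by
    have h3 := (EuclideanSpace.basisFun (Fin 2) ℝ).orthonormal.linearIndependent
    have h4 : ⇑(EuclideanSpace.basisFun (Fin 2) ℝ) = coordVec := by
      ext1 i
      simp [coordVec]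
    rwa [h4] at h3
  exact hcv.map' (fderivWithin ℝ (inChart Φ c) halfPlane y).toLinearMap
    (LinearMap.ker_eq_bot.2 hinj)

theorem IsAdmissible.isTangentJet (hM : IsSmoothSubmanifold k M)
    {pr : Euc Q → Euc Q →L[ℝ] Euc Q} (hprs : ContDiff ℝ ∞ pr) (hpr : ∀ q ∈ M, pr q = tanProj M q)
    (hΦ : IsAdmissible M N Φ) {c : S} {y : Euc 2} (hy : y ∈ (extChartAt (𝓡∂ 2) c).target) :
    IsTangentJet M pr (jetAt (inChart Φ c) y) :=
  isTangentJet_jetAt hM hprs hpr (target_subset_halfPlane c hy)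
    (contDiffWithinAt_inChart hΦ.smooth hy) (hΦ.eventually_mem c y) (hΦ.linearIndependent_pd hy)

theorem jetAt_inChart_change (hΦ : ContMDiff (𝓡∂ 2) 𝓘(ℝ, Euc Q) ∞ Φ) {c d x : S}
    (hc : x ∈ (extChartAt (𝓡∂ 2) c).source) (hd : x ∈ (extChartAt (𝓡∂ 2) d).source) :
    ∃ T Γ, jetAt (inChart Φ c) (extChartAt (𝓡∂ 2) c x)
      = jetChange T Γ (jetAt (inChart Φ d) (extChartAt (𝓡∂ 2) d x)) := by
  set y := extChartAt (𝓡∂ 2) c x with hy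
  have hyt : y ∈ (extChartAt (𝓡∂ 2) c).target := (extChartAt (𝓡∂ 2) c).map_source hc
  have hyH := target_subset_halfPlane c hyt
  let τ : Euc 2 → Euc 2 := fun z => extChartAt (𝓡∂ 2) d ((extChartAt (𝓡∂ 2) c).symm z)
  have hxy : (extChartAt (𝓡∂ 2) c).symm y = x := (extChartAt (𝓡∂ 2) c).left_inv hc
  have hτy : τ y = extChartAt (𝓡∂ 2) d x := by simp only [τ, hxy]
  have hτ : ContDiffWithinAt ℝ ∞ τ halfPlane y := by
    have h1 : ContMDiffWithinAt 𝓘(ℝ, Euc 2) (𝓡∂ 2) ∞ (extChartAt (𝓡∂ 2) c).symm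
        (extChartAt (𝓡∂ 2) c).target y := contMDiffOn_extChartAt_symm c y hyt
    have h2 : ContMDiffAt (𝓡∂ 2) 𝓘(ℝ, Euc 2) ∞ (extChartAt (𝓡∂ 2) d)
        ((extChartAt (𝓡∂ 2) c).symm y) := by
      rw [hxy]
      exact contMDiffAt_extChartAt' (by simpa using hd)
    have h3 := h2.comp_contMDiffWithinAt y h1
    exact (contMDiffWithinAt_iff_contDiffWithinAt.1 h3).mono_of_mem_nhdsWithin
      (target_mem_nhdsWithin_halfPlane hyt)
  have hcs : ContinuousWithinAt (extChartAt (𝓡∂ 2) c).symm halfPlane y :=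
    (continuousAt_extChartAt_symm'' hyt).continuousWithinAt
  have hsrc : ∀ᶠ z in 𝓝[halfPlane] y, (extChartAt (𝓡∂ 2) c).symm z ∈
      (extChartAt (𝓡∂ 2) d).source := by
    refine hcs.eventually ?_
    rw [hxy]
    exact extChartAt_source_mem_nhds' hd
  have hm : ∀ᶠ z in 𝓝[halfPlane] y, τ z ∈ halfPlane := hsrc.mono fun z hz =>
    target_subset_halfPlane d ((extChartAt (𝓡∂ 2) d).map_source hz)
  have hφ : ContDiffWithinAt ℝ ∞ (inChart Φ d) halfPlane (τ y) := by
    rw [hτy]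
    exact contDiffWithinAt_inChart hΦ ((extChartAt (𝓡∂ 2) d).map_source hd)
  have hev : inChart Φ c =ᶠ[𝓝[halfPlane] y] fun z => inChart Φ d (τ z) := by
    filter_upwards [hsrc] with z hz
    simp only [inChart, τ, (extChartAt (𝓡∂ 2) d).left_inv hz]
  have h := jetAt_reparam hyH (hτ.of_le ENat.LEInfty.out) hm (hφ.of_le ENat.LEInfty.out)
  rw [← jetAt_congr hyH hev, hτy] at h
  exact ⟨_, _, h⟩

/-- `|II|²` can be computed in any chart. -/
theorem IsAdmissible.ffSq_eq (hM : IsSmoothSubmanifold k M) (hΦ : IsAdmissible M N Φ) {c x : S}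
    (hc : x ∈ (extChartAt (𝓡∂ 2) c).source) :
    ffSq M Φ x = ffOf (tanProj M (Φ x)) (pd (inChart Φ c) (extChartAt (𝓡∂ 2) c x))
      (pd2 (inChart Φ c) (extChartAt (𝓡∂ 2) c x)) := by
  have hx := mem_extChartAt_source (I := 𝓡∂ 2) x
  obtain ⟨T, Γ, h⟩ := jetAt_inChart_change hΦ.smooth hc hx
  have hyc := (extChartAt (𝓡∂ 2) c).map_source hc
  have hyx := (extChartAt (𝓡∂ 2) x).map_source hx
  have h1 : pd (inChart Φ c) (extChartAt (𝓡∂ 2) c x)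
      = linChange T (pd (inChart Φ x) (extChartAt (𝓡∂ 2) x x)) :=
    congrArg (fun j : Jet Q => j.2.1) h
  have hval : inChart Φ x (extChartAt (𝓡∂ 2) x x) = Φ x := by
    simp only [inChart, (extChartAt (𝓡∂ 2) x).left_inv hx]
  have hT : T.det ≠ 0 := by
    intro h0
    have h2 := gramOf_det_pos (hΦ.linearIndependent_pd hyc)
    rw [h1, gramOf_linChange, Matrix.det_mul, h0, mul_zero] at h2
    exact lt_irrefl _ h2
  have hfix : ∀ i, tanProj M (Φ x) (pd (inChart Φ x) (extChartAt (𝓡∂ 2) x x) i)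
      = pd (inChart Φ x) (extChartAt (𝓡∂ 2) x x) i := by
    intro i
    rw [← hval]
    exact tanProj_eq_self (pd_mem_tanSpace hM (target_subset_halfPlane x hyx)
      ((contDiffWithinAt_inChart hΦ.smooth hyx).differentiableWithinAt (by simp))
      (hΦ.eventually_mem x _) i)
  have h2 := ffOf_jetChange hT Γ (j := jetAt (inChart Φ x) (extChartAt (𝓡∂ 2) x x)) hfix
  rw [← h] at h2
  rw [show ffOf (tanProj M (Φ x)) (pd (inChart Φ c) (extChartAt (𝓡∂ 2) c x))
      (pd2 (inChart Φ c) (extChartAt (𝓡∂ 2) c x)) = _ from h2, ffSq]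
  simp only [normSq₂, secondFF, hval]
  rfl

theorem IsAdmissible.ffSq_symm_eq (hM : IsSmoothSubmanifold k M) (hΦ : IsAdmissible M N Φ)
    {pr : Euc Q → Euc Q →L[ℝ] Euc Q} (hpr : ∀ q ∈ M, pr q = tanProj M q)
    {c : S} {y : Euc 2} (hy : y ∈ (extChartAt (𝓡∂ 2) c).target) :
    ffSq M Φ ((extChartAt (𝓡∂ 2) c).symm y) =
      ffOf (pr (jetAt (inChart Φ c) y).1) (jetAt (inChart Φ c) y).2.1
        (jetAt (inChart Φ c) y).2.2 := by
  rw [hΦ.ffSq_eq hM ((extChartAt (𝓡∂ 2) c).map_target hy), (extChartAt (𝓡∂ 2) c).right_inv hy,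
    show (jetAt (inChart Φ c) y).1 = Φ ((extChartAt (𝓡∂ 2) c).symm y) from rfl,
    hpr _ (hΦ.mem_ambient _)]
  rfl

theorem continuousOn_jetAt_inChart (hΦ : ContMDiff (𝓡∂ 2) 𝓘(ℝ, Euc Q) ∞ Φ) (c : S) :
    ContinuousOn (jetAt (inChart Φ c)) (extChartAt (𝓡∂ 2) c).target := fun _ hy =>
  (continuousWithinAt_jetAt (target_subset_halfPlane c hy)
    (contDiffWithinAt_inChart hΦ hy)).mono (target_subset_halfPlane c)

/-- `ffSq` is evaluated in a chart that moves with the point. By invariance it can be read near a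
point in one fixed chart, as a smooth function of a continuous jet. -/
theorem IsAdmissible.continuous_ffSq (hM : IsSmoothSubmanifold k M) (hMc : IsClosed M)
    (hΦ : IsAdmissible M N Φ) : Continuous (ffSq M Φ) := by
  obtain ⟨pr, hprs, hpr⟩ := hM.exists_smooth_tanProj hMc
  rw [continuous_iff_continuousAt]
  intro c
  have hcs := mem_extChartAt_source (I := 𝓡∂ 2) c
  have hev : ffSq M Φ =ᶠ[𝓝 c] fun x => ffOf
      (pr (jetAt (inChart Φ c) (extChartAt (𝓡∂ 2) c x)).1)
      (jetAt (inChart Φ c) (extChartAt (𝓡∂ 2) c x)).2.1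
        (jetAt (inChart Φ c) (extChartAt (𝓡∂ 2) c x)).2.2 := by
    filter_upwards [extChartAt_source_mem_nhds (I := 𝓡∂ 2) c] with x hx
    have := hΦ.ffSq_symm_eq hM hpr ((extChartAt (𝓡∂ 2) c).map_source hx)
    rwa [(extChartAt (𝓡∂ 2) c).left_inv hx] at this
  refine ContinuousAt.congr ?_ hev.symm
  have hy := (extChartAt (𝓡∂ 2) c).map_source hcs
  have h1 : ContinuousAt (fun x => jetAt (inChart Φ c) (extChartAt (𝓡∂ 2) c x)) c := by
    have h2 := (continuousOn_jetAt_inChart hΦ.smooth c) _ hy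
    refine h2.tendsto.comp (tendsto_nhdsWithin_iff.2 ⟨continuousAt_extChartAt c, ?_⟩)
    filter_upwards [extChartAt_source_mem_nhds (I := 𝓡∂ 2) c] with x hx
    exact (extChartAt (𝓡∂ 2) c).map_source hx
  have h3 := (contDiffAt_ffOf (z := (pr (jetAt (inChart Φ c) (extChartAt (𝓡∂ 2) c c)).1,
    (jetAt (inChart Φ c) (extChartAt (𝓡∂ 2) c c)).2.1,
      (jetAt (inChart Φ c) (extChartAt (𝓡∂ 2) c c)).2.2))
        (hΦ.linearIndependent_pd hy)).continuousAt
  exact h3.comp (f := fun x => (pr (jetAt (inChart Φ c) (extChartAt (𝓡∂ 2) c x)).1,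
    (jetAt (inChart Φ c) (extChartAt (𝓡∂ 2) c x)).2.1,
      (jetAt (inChart Φ c) (extChartAt (𝓡∂ 2) c x)).2.2))
    ((hprs.continuous.continuousAt.comp h1.fst).prodMk (h1.snd.fst.prodMk h1.snd.snd))

end SurfaceCharts

/-! ### Measures given by densities in charts -/

section ParametricIntegral

/-- Differentiation under the integral sign for integrands that are smooth functions of a parameter
and of continuous data on a compact set. -/
theorem hasDerivAt_integral_of_jets {Y V : Type*} [TopologicalSpace Y] [T2Space Y]
    [MeasurableSpace Y] [OpensMeasurableSpace Y] {ν : Measure Y} [IsFiniteMeasureOnCompacts ν]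
    [NormedAddCommGroup V] [NormedSpace ℝ V] {K A : Set Y} (hK : IsCompact K)
    (hA : MeasurableSet A) {J : Y → V} (hJ : ContinuousOn J K) {ρ : Y → ℝ} (hρ : ContinuousOn ρ K)
    {Ψ : ℝ → V → ℝ} (hΨ : ∀ y ∈ K, ContDiffAt ℝ 1 (Function.uncurry Ψ) (0, J y)) :
    IntegrableOn (fun y => ρ y * deriv (fun t => Ψ t (J y)) 0) (K ∩ A) ν ∧
    HasDerivAt (fun t => ∫ y in K ∩ A, ρ y * Ψ t (J y) ∂ν)
      (∫ y in K ∩ A, ρ y * deriv (fun t => Ψ t (J y)) 0 ∂ν) 0 := by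
  have hKm : MeasurableSet K := hK.measurableSet
  set O : Set (ℝ × V) := {z | ContDiffAt ℝ 1 (Function.uncurry Ψ) z} with hO
  have hOo : IsOpen O := isOpen_iff_mem_nhds.2 fun z hz =>
    ContDiffAt.eventually (n := 1) hz (by simp)
  have hJK : IsCompact (J '' K) := hK.image_of_continuousOn hJ
  -- Compactness of the set of jets provides one time interval on which `Ψ` is C¹ at all of them,
  -- and hence a constant dominating the time derivative.
  obtain ⟨u, v, hu, hv, h0u, hJv, huv⟩ := generalized_tube_lemma (isCompact_singleton (x := (0 : ℝ)))
    hJK hOo (by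
      rintro ⟨t, w⟩ ⟨ht, y, hy, rfl⟩
      rw [mem_singleton_iff] at ht
      subst ht
      exact hΨ y hy)
  obtain ⟨η, hη, hηu⟩ := Metric.isOpen_iff.1 hu 0 (h0u rfl)
  have hI : Icc (-(η / 2)) (η / 2) ⊆ u := fun t ht => hηu (by
    rw [Metric.mem_ball, dist_zero_right, Real.norm_eq_abs, abs_lt]
    exact ⟨by linarith [ht.1], by linarith [ht.2]⟩)
  have hmem : ∀ t ∈ Icc (-(η / 2)) (η / 2), ∀ y ∈ K, ((t, J y) : ℝ × V) ∈ O := fun t ht y hy =>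
    huv ⟨hI ht, hJv ⟨y, hy, rfl⟩⟩
  have hder : ∀ t ∈ Icc (-(η / 2)) (η / 2), ∀ y ∈ K,
      HasDerivAt (fun t => Ψ t (J y)) (fderiv ℝ (Function.uncurry Ψ) (t, J y) (1, 0)) t := by
    intro t ht y hy
    have h1 : HasDerivAt (fun t : ℝ => (t, J y)) ((1 : ℝ), (0 : V)) t :=
      (hasDerivAt_id t).prodMk (hasDerivAt_const t (J y))
    have h2 : HasDerivAt (Function.uncurry Ψ ∘ fun t : ℝ => (t, J y))
        (fderiv ℝ (Function.uncurry Ψ) (t, J y) (1, 0)) t :=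
      (ContDiffAt.differentiableAt (n := 1) (hmem t ht y hy) (by simp)).hasFDerivAt.comp_hasDerivAt t h1
    exact h2
  have hcont : ContinuousOn (fun z : ℝ × Y => fderiv ℝ (Function.uncurry Ψ) (z.1, J z.2) (1, 0))
      (Icc (-(η / 2)) (η / 2) ×ˢ K) := by
    have h1 : ContinuousOn (fderiv ℝ (Function.uncurry Ψ)) O := fun z hz =>
      ((ContDiffAt.fderiv_right (m := 0) (n := 1) hz (by simp)).continuousAt).continuousWithinAt
    have h2 : ContinuousOn (fun z : ℝ × Y => (z.1, J z.2)) (Icc (-(η / 2)) (η / 2) ×ˢ K) :=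
      continuousOn_fst.prodMk (hJ.comp continuousOn_snd fun z hz => hz.2)
    exact (h1.comp h2 fun z hz => hmem _ hz.1 _ hz.2).clm_apply continuousOn_const
  obtain ⟨C, hC⟩ := (isCompact_Icc.prod hK).exists_bound_of_continuousOn hcont
  obtain ⟨R, hR⟩ := hK.exists_bound_of_continuousOn hρ
  have hmem0 : (0 : ℝ) ∈ Icc (-(η / 2)) (η / 2) := ⟨by linarith, by linarith⟩
  have hΨc : ∀ t ∈ Icc (-(η / 2)) (η / 2), ContinuousOn (fun y => ρ y * Ψ t (J y)) K := by
    intro t ht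
    refine hρ.mul ?_
    have h1 : ContinuousOn (Function.uncurry Ψ) O := fun z hz =>
      (ContDiffAt.continuousAt (n := 1) hz).continuousWithinAt
    exact h1.comp (continuousOn_const.prodMk hJ) fun y hy => hmem t ht y hy
  have hsub : ν.restrict (K ∩ A) ≤ ν.restrict K := Measure.restrict_mono inter_subset_left le_rfl
  have hfin : ν K ≠ ⊤ := hK.measure_lt_top.ne
  have hd0 : ContinuousOn (fun y => ρ y * deriv (fun t => Ψ t (J y)) 0) K := by
    refine hρ.mul (ContinuousOn.congr (f := fun y =>
      fderiv ℝ (Function.uncurry Ψ) (0, J y) (1, 0)) ?_ fun y hy => (hder 0 hmem0 y hy).deriv)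
    exact hcont.comp (f := fun y : Y => ((0 : ℝ), y)) (continuousOn_const.prodMk continuousOn_id)
      fun y hy => ⟨hmem0, hy⟩
  have hKA : MeasurableSet (K ∩ A) := hKm.inter hA
  have main := hasDerivAt_integral_of_dominated_loc_of_deriv_le (μ := ν.restrict (K ∩ A))
    (F := fun t y => ρ y * Ψ t (J y)) (x₀ := (0 : ℝ)) (s := Ioo (-(η / 2)) (η / 2))
    (bound := fun _ => R * C)
    (F' := fun t y => ρ y * deriv (fun t => Ψ t (J y)) t)
    (Ioo_mem_nhds (by linarith) (by linarith))
    (by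
      filter_upwards [Ioo_mem_nhds (a := -(η / 2)) (b := η / 2) (by linarith) (by linarith)]
        with t ht
      exact ((hΨc t (Ioo_subset_Icc_self ht)).aestronglyMeasurable hKm).mono_measure hsub)
    (((hΨc 0 hmem0).integrableOn_compact hK).mono_set inter_subset_left)
    (((hd0).aestronglyMeasurable hKm).mono_measure hsub)
    (by
      refine (ae_restrict_iff' hKA).2 (Eventually.of_forall fun y hy t ht => ?_)
      rw [norm_mul, (hder t (Ioo_subset_Icc_self ht) y hy.1).deriv]
      exact mul_le_mul (hR y hy.1) (hC (t, y) ⟨Ioo_subset_Icc_self ht, hy.1⟩) (norm_nonneg _)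
        ((norm_nonneg _).trans (hR y hy.1)))
    (by
      refine integrableOn_const (s := K ∩ A) (μ := ν) ?_
      exact ne_top_of_le_ne_top hfin (measure_mono inter_subset_left))
    (by
      refine (ae_restrict_iff' hKA).2 (Eventually.of_forall fun y hy t ht => ?_)
      have := hder t (Ioo_subset_Icc_self ht) y hy.1
      rw [this.deriv]
      exact this.const_mul (ρ y))
  exact main

end ParametricIntegral

/-! ### Reduction of chart measures to finite sums over compact sets -/

section ChartMeasures

variable {S : Type*} [TopologicalSpace S] [ChartedSpace (EuclideanHalfSpace 2) S]

theorem measurableSet_target (c : S) : MeasurableSet (extChartAt (𝓡∂ 2) c).target := by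
  rw [extChartAt_target]
  exact (((chartAt _ c).open_target.preimage (𝓡∂ 2).continuous_symm).measurableSet).inter
    (𝓡∂ 2).isClosed_range.measurableSet

variable [IsManifold (𝓡∂ 2) ∞ S] [CompactSpace S] [T2Space S]

/-- The image in the chart around `c` of the support of the partition function. -/
def chartSupp (c : S) : Set (Euc 2) := extChartAt (𝓡∂ 2) c '' tsupport (chartPU S c)

theorem tsupport_chartPU_subset (c : S) :
    tsupport (chartPU S c) ⊆ (extChartAt (𝓡∂ 2) c).source := by
  rw [extChartAt_source]
  exact (SmoothPartitionOfUnity.exists_isSubordinate_chartAt_source (𝓡∂ 2) S).choose_spec c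

theorem isCompact_chartSupp (c : S) : IsCompact (chartSupp c) :=
  (isClosed_tsupport _).isCompact.image_of_continuousOn
    ((continuousOn_extChartAt c).mono (tsupport_chartPU_subset c))

theorem chartSupp_subset (c : S) : chartSupp c ⊆ (extChartAt (𝓡∂ 2) c).target := by
  rintro _ ⟨x, hx, rfl⟩
  exact (extChartAt (𝓡∂ 2) c).map_source (tsupport_chartPU_subset c hx)

theorem chartPU_eq_zero {c : S} {y : Euc 2} (hy : y ∈ (extChartAt (𝓡∂ 2) c).target)
    (h : y ∉ chartSupp c) : chartPU S c ((extChartAt (𝓡∂ 2) c).symm y) = 0 := by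
  by_contra h0
  refine h ⟨(extChartAt (𝓡∂ 2) c).symm y, subset_tsupport _ h0, (extChartAt (𝓡∂ 2) c).right_inv hy⟩

theorem finite_chartPU : {c : S | (Function.support (chartPU S c)).Nonempty}.Finite :=
  (chartPU S).locallyFinite.finite_nonempty_of_compact

variable (S) in
/-- The charts that contribute. -/
def chartIndex : Finset S := (finite_chartPU (S := S)).toFinset

theorem chartPU_of_notMem {c : S} (hc : c ∉ chartIndex S) (x : S) : chartPU S c x = 0 := by
  by_contra h
  exact hc ((finite_chartPU (S := S)).mem_toFinset.2 ⟨x, h⟩)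

variable {Y : Type*} [TopologicalSpace Y] {ι : Y → Euc 2} {D : S → Euc 2 → ℝ}

theorem isCompact_preimage_chartSupp (hι : IsClosedEmbedding ι) (c : S) : IsCompact (ι ⁻¹' chartSupp c) :=
  hι.isCompact_preimage (isCompact_chartSupp c)

theorem continuousOn_symm_comp (hι : IsClosedEmbedding ι) (c : S) :
    ContinuousOn (fun y => (extChartAt (𝓡∂ 2) c).symm (ι y)) (ι ⁻¹' chartSupp c) :=
  (continuousOn_extChartAt_symm c).comp hι.continuous.continuousOn
    fun _ hy => chartSupp_subset c hy

theorem continuousOn_chartPU (hι : IsClosedEmbedding ι) (c : S) :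
    ContinuousOn (fun y => chartPU S c ((extChartAt (𝓡∂ 2) c).symm (ι y)))
      (ι ⁻¹' chartSupp c) :=
  (chartPU S c).2.continuous.comp_continuousOn (continuousOn_symm_comp hι c)

theorem continuousOn_chartDensity (hι : IsClosedEmbedding ι)
    (hD : ∀ c, ContinuousOn (D c) (extChartAt (𝓡∂ 2) c).target) (c : S) :
    ContinuousOn (fun y => chartPU S c ((extChartAt (𝓡∂ 2) c).symm (ι y)) * D c (ι y))
      (ι ⁻¹' chartSupp c) :=
  (continuousOn_chartPU hι c).mul ((hD c).comp hι.continuous.continuousOn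
    fun _ hy => chartSupp_subset c hy)

variable [MeasurableSpace S]

/-- The measure on the surface which in the chart around `c` has density `D c` with respect to the
image of the volume under `ι`. -/
def chartMeasure {Y : Type*} [MeasureSpace Y] (ι : Y → Euc 2) (D : S → Euc 2 → ℝ) : Measure S :=
  Measure.sum fun c : S =>
    ((volume.restrict {y | ι y ∈ (extChartAt (𝓡∂ 2) c).target}).withDensity fun y =>
      ENNReal.ofReal (chartPU S c ((extChartAt (𝓡∂ 2) c).symm (ι y)) * D c (ι y))).map
        fun y => (extChartAt (𝓡∂ 2) c).symm (ι y)

variable {Q : ℕ} in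
theorem areaMeasure_eq (Φ : S → Euc Q) :
    areaMeasure Φ = chartMeasure (fun y => y) fun c y => areaDensity (inChart Φ c) y := rfl

variable {Q : ℕ} in
theorem lengthMeasure_eq (Φ : S → Euc Q) :
    lengthMeasure Φ = chartMeasure (fun t : ℝ => !₂[0, t]) fun c y => ‖pd (inChart Φ c) y 1‖ := rfl

variable {Y : Type*} [TopologicalSpace Y] [MeasureSpace Y] [T2Space Y] [BorelSpace Y]
  {ι : Y → Euc 2} {D : S → Euc 2 → ℝ}

/-- The density vanishes off the compact support of the partition function, and compactness of the
surface leaves finitely many charts. After this reduction all data are continuous on compact sets.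
Area and length are the cases where `ι` is the identity of the plane and the boundary line. -/
theorem chartMeasure_eq_sum (hι : IsClosedEmbedding ι) : chartMeasure ι D = ∑ c ∈ chartIndex S,
    ((volume.restrict (ι ⁻¹' chartSupp c)).withDensity fun y =>
      ENNReal.ofReal (chartPU S c ((extChartAt (𝓡∂ 2) c).symm (ι y)) * D c (ι y))).map
        fun y => (extChartAt (𝓡∂ 2) c).symm (ι y) := by
  have hk : ∀ c : S, ((volume.restrict {y | ι y ∈ (extChartAt (𝓡∂ 2) c).target}).withDensity fun y =>
      ENNReal.ofReal (chartPU S c ((extChartAt (𝓡∂ 2) c).symm (ι y)) * D c (ι y))) =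
      (volume.restrict (ι ⁻¹' chartSupp c)).withDensity fun y =>
      ENNReal.ofReal (chartPU S c ((extChartAt (𝓡∂ 2) c).symm (ι y)) * D c (ι y)) := by
    intro c
    have hm : MeasurableSet (ι ⁻¹' chartSupp c) := (isCompact_preimage_chartSupp hι c).measurableSet
    have hT : MeasurableSet {y | ι y ∈ (extChartAt (𝓡∂ 2) c).target} :=
      hι.continuous.measurable (measurableSet_target c)
    set f : Y → ℝ≥0∞ := fun y =>
      ENNReal.ofReal (chartPU S c ((extChartAt (𝓡∂ 2) c).symm (ι y)) * D c (ι y)) with hf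
    have h1 : f =ᵐ[volume.restrict {y | ι y ∈ (extChartAt (𝓡∂ 2) c).target}]
        (ι ⁻¹' chartSupp c).indicator f := by
      refine (ae_restrict_iff' hT).2 (Eventually.of_forall fun y hy => ?_)
      by_cases hyK : y ∈ ι ⁻¹' chartSupp c
      · rw [indicator_of_mem hyK]
      · rw [indicator_of_notMem hyK]
        simp only [hf]
        rw [chartPU_eq_zero hy hyK, zero_mul, ENNReal.ofReal_zero]
    rw [withDensity_congr_ae h1, withDensity_indicator hm, Measure.restrict_restrict hm]
    congr 2
    exact inter_eq_left.2 fun y hy => chartSupp_subset c hy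
  ext A hA
  rw [chartMeasure, Measure.sum_apply _ hA, Measure.finsetSum_apply]
  rw [tsum_eq_sum (s := chartIndex S)]
  · simp only [hk]
  · intro c hc
    have : (fun y => ENNReal.ofReal (chartPU S c ((extChartAt (𝓡∂ 2) c).symm (ι y)) * D c (ι y)))
        = 0 := by
      ext1 y
      simp [chartPU_of_notMem hc]
    rw [this, withDensity_zero]
    simp

variable [IsLocallyFiniteMeasure (volume : Measure Y)]

theorem isFiniteMeasure_chartMeasure (hι : IsClosedEmbedding ι)
    (hD : ∀ c, ContinuousOn (D c) (extChartAt (𝓡∂ 2) c).target) : IsFiniteMeasure (chartMeasure ι D) := by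
  rw [chartMeasure_eq_sum hι]
  have : ∀ c : S, IsFiniteMeasure (((volume.restrict (ι ⁻¹' chartSupp c)).withDensity fun y =>
      ENNReal.ofReal (chartPU S c ((extChartAt (𝓡∂ 2) c).symm (ι y)) * D c (ι y))).map
        fun y => (extChartAt (𝓡∂ 2) c).symm (ι y)) := by
    intro c
    have h1 := ((continuousOn_chartDensity hι hD c).integrableOn_compact (μ := volume)
      (isCompact_preimage_chartSupp hι c))
    have := isFiniteMeasure_withDensity_ofReal h1.2
    infer_instance
  infer_instance

variable [BorelSpace S]

theorem integral_chartMeasure (hι : IsClosedEmbedding ι)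
    (hD : ∀ c, ContinuousOn (D c) (extChartAt (𝓡∂ 2) c).target) (hD0 : ∀ c, ∀ y ∈ (extChartAt (𝓡∂ 2) c).target, 0 ≤ D c y)
    {g : S → ℝ} (hg : Measurable g) {b : ℝ} (hb : ∀ x, |g x| ≤ b) :
    Integrable g (chartMeasure ι D) ∧ (∀ c ∈ chartIndex S, IntegrableOn (fun y =>
      chartPU S c ((extChartAt (𝓡∂ 2) c).symm (ι y)) *
        (D c (ι y) * g ((extChartAt (𝓡∂ 2) c).symm (ι y)))) (ι ⁻¹' chartSupp c)) ∧
    ∫ x, g x ∂(chartMeasure ι D) = ∑ c ∈ chartIndex S, ∫ y in ι ⁻¹' chartSupp c,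
      chartPU S c ((extChartAt (𝓡∂ 2) c).symm (ι y)) *
        (D c (ι y) * g ((extChartAt (𝓡∂ 2) c).symm (ι y))) := by
  have hfin := isFiniteMeasure_chartMeasure hι hD
  have hint : Integrable g (chartMeasure ι D) :=
    Integrable.of_bound hg.aestronglyMeasurable b (Eventually.of_forall hb)
  have hm : ∀ c : S, MeasurableSet (ι ⁻¹' chartSupp c) := fun c =>
    (isCompact_preimage_chartSupp hι c).measurableSet
  have hpos : ∀ c : S, ∀ y ∈ ι ⁻¹' chartSupp c,
      0 ≤ chartPU S c ((extChartAt (𝓡∂ 2) c).symm (ι y)) * D c (ι y) := fun c y hy =>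
    mul_nonneg ((chartPU S).nonneg c _) (hD0 c _ (chartSupp_subset c hy))
  have hae : ∀ c : S, AEMeasurable (fun y => ENNReal.ofReal
      (chartPU S c ((extChartAt (𝓡∂ 2) c).symm (ι y)) * D c (ι y)))
      (volume.restrict (ι ⁻¹' chartSupp c)) := fun c =>
    ((continuousOn_chartDensity hι hD c).aemeasurable (hm c)).ennreal_ofReal
  have hsym : ∀ c : S, AEMeasurable (fun y => (extChartAt (𝓡∂ 2) c).symm (ι y))
      ((volume.restrict (ι ⁻¹' chartSupp c)).withDensity fun y => ENNReal.ofReal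
      (chartPU S c ((extChartAt (𝓡∂ 2) c).symm (ι y)) * D c (ι y))) := fun c =>
    ((continuousOn_symm_comp hι c).aemeasurable (hm c)).mono_ac (withDensity_absolutelyContinuous _ _)
  have hi : ∀ c ∈ chartIndex S, Integrable g (((volume.restrict (ι ⁻¹' chartSupp c)).withDensity
      fun y => ENNReal.ofReal
        (chartPU S c ((extChartAt (𝓡∂ 2) c).symm (ι y)) * D c (ι y))).map
        fun y => (extChartAt (𝓡∂ 2) c).symm (ι y)) := by
    intro c hc
    rw [chartMeasure_eq_sum hι] at hint
    exact (integrable_finsetSum_measure.1 hint) c hc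
  have hcongr : ∀ c : S, (fun y => (ENNReal.ofReal
        (chartPU S c ((extChartAt (𝓡∂ 2) c).symm (ι y)) * D c (ι y))).toReal •
        g ((extChartAt (𝓡∂ 2) c).symm (ι y))) =ᵐ[volume.restrict (ι ⁻¹' chartSupp c)]
      fun y => chartPU S c ((extChartAt (𝓡∂ 2) c).symm (ι y)) *
        (D c (ι y) * g ((extChartAt (𝓡∂ 2) c).symm (ι y))) := by
    intro c
    refine (ae_restrict_iff' (hm c)).2 (Eventually.of_forall fun y hy => ?_)
    simp only
    rw [ENNReal.toReal_ofReal (hpos c y hy), smul_eq_mul, mul_assoc]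
  refine ⟨hint, fun c hc => ?_, ?_⟩
  · have h1 := (integrable_map_measure hg.aestronglyMeasurable (hsym c)).1 (hi c hc)
    have h2 := (integrable_withDensity_iff_integrable_smul₀' (hae c)
      (Eventually.of_forall fun _ => ENNReal.ofReal_lt_top)).1 h1
    exact h2.congr (hcongr c)
  · rw [chartMeasure_eq_sum hι, integral_finsetSum_measure hi]
    refine Finset.sum_congr rfl fun c _ => ?_
    rw [integral_map (hsym c) hg.aestronglyMeasurable,
      integral_withDensity_eq_integral_toReal_smul₀ (hae c)
      (Eventually.of_forall fun _ => ENNReal.ofReal_lt_top), integral_congr_ae (hcongr c)]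

end ChartMeasures

/-! ### Differentiation of chart integrals along variations supported in an open set -/

section ChartMeasureVariation

variable {S : Type*} [TopologicalSpace S] [ChartedSpace (EuclideanHalfSpace 2) S]
  [IsManifold (𝓡∂ 2) ∞ S] [CompactSpace S] [T2Space S] [MeasurableSpace S] [BorelSpace S]
  {Y : Type*} [TopologicalSpace Y] [MeasureSpace Y] [T2Space Y] [BorelSpace Y]
  [IsLocallyFiniteMeasure (volume : Measure Y)] {ι : Y → Euc 2}
  {V : Type*} [NormedAddCommGroup V] [NormedSpace ℝ V]

theorem setIntegral_chartMeasure (hι : IsClosedEmbedding ι) {D : S → Euc 2 → ℝ}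
    (hD : ∀ c, ContinuousOn (D c) (extChartAt (𝓡∂ 2) c).target)
    (hD0 : ∀ c, ∀ y ∈ (extChartAt (𝓡∂ 2) c).target, 0 ≤ D c y)
    {g : S → ℝ} (hg : Measurable g) {b : ℝ} (hb : ∀ x, |g x| ≤ b) {U : Set S}
    (hU : MeasurableSet U) {O : S → Set Y} (hO : ∀ c, MeasurableSet (O c))
    (hOU : ∀ c, ∀ y ∈ ι ⁻¹' chartSupp c, (y ∈ O c ↔ (extChartAt (𝓡∂ 2) c).symm (ι y) ∈ U)) :
    (∀ c ∈ chartIndex S, IntegrableOn (fun y =>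
      chartPU S c ((extChartAt (𝓡∂ 2) c).symm (ι y)) *
        (D c (ι y) * g ((extChartAt (𝓡∂ 2) c).symm (ι y)))) (ι ⁻¹' chartSupp c ∩ O c)) ∧
    ∫ x in U, g x ∂(chartMeasure ι D) = ∑ c ∈ chartIndex S, ∫ y in ι ⁻¹' chartSupp c ∩ O c,
      chartPU S c ((extChartAt (𝓡∂ 2) c).symm (ι y)) *
        (D c (ι y) * g ((extChartAt (𝓡∂ 2) c).symm (ι y))) := by
  have h0 := integral_chartMeasure hι hD hD0 hg hb
  refine ⟨fun c hc => (h0.2.1 c hc).mono_set inter_subset_left, ?_⟩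
  rw [← integral_indicator hU]
  have h1 := integral_chartMeasure hι hD hD0 (hg.indicator hU) (b := b) (fun x => by
    by_cases hx : x ∈ U
    · rw [indicator_of_mem hx]; exact hb x
    · rw [indicator_of_notMem hx, abs_zero]; exact (abs_nonneg _).trans (hb x))
  rw [h1.2.2]
  refine Finset.sum_congr rfl fun c _ => ?_
  have hK : MeasurableSet (ι ⁻¹' chartSupp c) := (isCompact_preimage_chartSupp hι c).measurableSet
  rw [inter_comm, ← Measure.restrict_restrict (hO c), ← integral_indicator (hO c)]
  refine setIntegral_congr_fun hK fun y hy => ?_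
  by_cases hx : y ∈ O c
  · simp only [indicator_of_mem hx, indicator_of_mem ((hOU c y hy).1 hx)]
  · simp only [indicator_of_notMem hx, indicator_of_notMem (fun h => hx ((hOU c y hy).2 h)),
      mul_zero]

/-- Differentiation of integrals against chart measures, for variations localized in `U`. -/
theorem hasDerivAt_integral_chartMeasure (hι : IsClosedEmbedding ι) {J : S → Euc 2 → V}
    (hJ : ∀ c, ContinuousOn (J c) (extChartAt (𝓡∂ 2) c).target) {Ψ : ℝ → V → ℝ}
    (hΨ : ∀ c, ∀ y ∈ (extChartAt (𝓡∂ 2) c).target,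
      ContDiffAt ℝ 1 (Function.uncurry Ψ) (0, J c y)) {U : Set S} (hU : IsOpen U)
    {D : ℝ → S → Euc 2 → ℝ} {g : ℝ → S → ℝ} {η : ℝ} (hη : 0 < η)
    (hD : ∀ t, |t| < η → ∀ c, ContinuousOn (D t c) (extChartAt (𝓡∂ 2) c).target)
    (hD0 : ∀ t, |t| < η → ∀ c, ∀ y ∈ (extChartAt (𝓡∂ 2) c).target, 0 ≤ D t c y)
    (hg : ∀ t, |t| < η → Continuous (g t))
    (heq : ∀ t, |t| < η → ∀ c, ∀ y ∈ (extChartAt (𝓡∂ 2) c).target,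
      ((extChartAt (𝓡∂ 2) c).symm y ∈ U →
        D t c y * g t ((extChartAt (𝓡∂ 2) c).symm y) = Ψ t (J c y)) ∧
      ((extChartAt (𝓡∂ 2) c).symm y ∉ U →
        D t c y * g t ((extChartAt (𝓡∂ 2) c).symm y) = Ψ 0 (J c y))) :
    ∃ d, HasDerivAt (fun t => ∫ x, g t x ∂(chartMeasure ι (D t))) d 0 ∧
      (∀ h : S → ℝ, Measurable h → (∃ b, ∀ x, |h x| ≤ b) →
        (∀ c, ∀ y ∈ (extChartAt (𝓡∂ 2) c).target, (extChartAt (𝓡∂ 2) c).symm y ∈ U →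
          h ((extChartAt (𝓡∂ 2) c).symm y) * D 0 c y ≤ deriv (fun t => Ψ t (J c y)) 0) →
        ∫ x in U, h x ∂(chartMeasure ι (D 0)) ≤ d) ∧
      (∀ h : S → ℝ, Measurable h → (∃ b, ∀ x, |h x| ≤ b) →
        (∀ c, ∀ y ∈ (extChartAt (𝓡∂ 2) c).target, (extChartAt (𝓡∂ 2) c).symm y ∈ U →
          deriv (fun t => Ψ t (J c y)) 0 ≤ h ((extChartAt (𝓡∂ 2) c).symm y) * D 0 c y) →
        d ≤ ∫ x in U, h x ∂(chartMeasure ι (D 0))) := by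
  have hKc := fun c : S => isCompact_preimage_chartSupp hι c
  have hKm := fun c : S => (hKc c).measurableSet
  -- The inverse chart is continuous only on the compact support, so `U` pulls back to a relatively
  -- open set; `O` is an open set with the same trace.
  have hsel : ∀ c : S, ∃ O : Set Y, IsOpen O ∧ ∀ y ∈ ι ⁻¹' chartSupp c,
      (y ∈ O ↔ (extChartAt (𝓡∂ 2) c).symm (ι y) ∈ U) := by
    intro c
    obtain ⟨O, hO, hOe⟩ := continuousOn_iff'.1 (continuousOn_symm_comp hι c) U hU
    refine ⟨O, hO, fun y hy => ?_⟩
    have := Set.ext_iff.1 hOe y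
    simp only [mem_inter_iff, mem_preimage] at this
    constructor
    · intro h; exact (this.2 ⟨h, hy⟩).1
    · intro h; exact (this.1 ⟨h, hy⟩).1
  choose O hO hOU using hsel
  have hJK : ∀ c, ContinuousOn (fun y => J c (ι y)) (ι ⁻¹' chartSupp c) := fun c =>
    (hJ c).comp hι.continuous.continuousOn fun _ hy => chartSupp_subset c hy
  have hder := fun c : S => hasDerivAt_integral_of_jets (ν := (volume : Measure Y)) (hKc c)
    (hO c).measurableSet (hJK c) (continuousOn_chartPU hι c) (Ψ := Ψ)
    fun y hy => hΨ c _ (chartSupp_subset c hy)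
  refine ⟨∑ c ∈ chartIndex S, ∫ y in ι ⁻¹' chartSupp c ∩ O c,
    chartPU S c ((extChartAt (𝓡∂ 2) c).symm (ι y)) * deriv (fun t => Ψ t (J c (ι y))) 0,
    ?_, ?_, ?_⟩
  · have hev : (fun t => ∫ x, g t x ∂(chartMeasure ι (D t))) =ᶠ[𝓝 0] fun t =>
        ∑ c ∈ chartIndex S, ((∫ y in ι ⁻¹' chartSupp c ∩ O c,
          chartPU S c ((extChartAt (𝓡∂ 2) c).symm (ι y)) * Ψ t (J c (ι y))) +
          ∫ y in ι ⁻¹' chartSupp c \ O c,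
          chartPU S c ((extChartAt (𝓡∂ 2) c).symm (ι y)) * Ψ 0 (J c (ι y))) := by
      filter_upwards [Ioo_mem_nhds (a := -η) (b := η) (by linarith) (by linarith)] with t ht
      have ht' : |t| < η := abs_lt.2 ht
      obtain ⟨b, hb⟩ := (isCompact_univ (X := S)).exists_bound_of_continuousOn
        (hg t ht').continuousOn
      have h1 := integral_chartMeasure hι (hD t ht') (hD0 t ht') (hg t ht').measurable
        (b := b) fun x => hb x (mem_univ x)
      rw [h1.2.2]
      refine Finset.sum_congr rfl fun c hc => ?_
      rw [← integral_inter_add_sdiff (hO c).measurableSet (h1.2.1 c hc)]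
      congr 1
      · refine setIntegral_congr_fun ((hKm c).inter (hO c).measurableSet) fun y hy => ?_
        have := (heq t ht' c (ι y) (chartSupp_subset c hy.1)).1 ((hOU c y hy.1).1 hy.2)
        simp only [this]
      · refine setIntegral_congr_fun ((hKm c).diff (hO c).measurableSet) fun y hy => ?_
        have := (heq t ht' c (ι y) (chartSupp_subset c hy.1)).2
          fun h => hy.2 ((hOU c y hy.1).2 h)
        simp only [this]
    refine HasDerivAt.congr_of_eventuallyEq ?_ hev
    exact HasDerivAt.fun_sum fun c _ => (hder c).2.add_const _
  · rintro h hm ⟨b, hb⟩ hle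
    have h0 : |(0 : ℝ)| < η := by rwa [abs_zero]
    have h1 := setIntegral_chartMeasure hι (hD 0 h0) (hD0 0 h0) hm hb hU.measurableSet
      (fun c => (hO c).measurableSet) hOU
    rw [h1.2]
    refine Finset.sum_le_sum fun c hc => setIntegral_mono_on (h1.1 c hc) (hder c).1
      ((hKm c).inter (hO c).measurableSet) fun y hy => ?_
    refine mul_le_mul_of_nonneg_left ?_ ((chartPU S).nonneg c _)
    rw [mul_comm]
    exact hle c (ι y) (chartSupp_subset c hy.1) ((hOU c y hy.1).1 hy.2)
  · rintro h hm ⟨b, hb⟩ hle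
    have h0 : |(0 : ℝ)| < η := by rwa [abs_zero]
    have h1 := setIntegral_chartMeasure hι (hD 0 h0) (hD0 0 h0) hm hb hU.measurableSet
      (fun c => (hO c).measurableSet) hOU
    rw [h1.2]
    refine Finset.sum_le_sum fun c hc => setIntegral_mono_on (hder c).1 (h1.1 c hc)
      ((hKm c).inter (hO c).measurableSet) fun y hy => ?_
    refine mul_le_mul_of_nonneg_left ?_ ((chartPU S).nonneg c _)
    rw [mul_comm (D 0 c (ι y))]
    exact hle c (ι y) (chartSupp_subset c hy.1) ((hOU c y hy.1).1 hy.2)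

end ChartMeasureVariation

/-! ### Localized variations of immersed surfaces -/

section LocalizedVariation

variable {Q : ℕ} {M N K : Set (Euc Q)} {G : ℝ → Euc Q → Euc Q}

namespace IsAmbientVariation

theorem fderiv_apply_eq (hG : IsAmbientVariation M N K G) (t : ℝ) (q v : Euc Q) :
    fderiv ℝ (G t) q v = fderiv ℝ (Function.uncurry G) (t, q) (0, v) := by
  have h1 : HasFDerivAt (fun y : Euc Q => (t, y)) (ContinuousLinearMap.inr ℝ ℝ (Euc Q)) q :=
    hasFDerivAt_prodMk_right t q
  have := ((hG.smooth.differentiable (by simp) (t, q)).hasFDerivAt.comp q h1).fderiv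
  rw [show (Function.uncurry G ∘ fun y : Euc Q => (t, y)) = G t from rfl] at this
  simp [this]

theorem fderiv_fderiv_apply_eq (hG : IsAmbientVariation M N K G) (t : ℝ) (q u v : Euc Q) :
    fderiv ℝ (fderiv ℝ (G t)) q u v
      = fderiv ℝ (fderiv ℝ (Function.uncurry G)) (t, q) (0, u) (0, v) := by
  have h0 : ContDiff ℝ ∞ (fderiv ℝ (Function.uncurry G)) := hG.smooth.fderiv_right (by simp)
  have h1 : HasFDerivAt (fun y : Euc Q => (t, y)) (ContinuousLinearMap.inr ℝ ℝ (Euc Q)) q :=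
    hasFDerivAt_prodMk_right t q
  have h2 := ((h0.differentiable (by simp) (t, q)).hasFDerivAt.comp q h1).clm_apply
    (hasFDerivAt_const ((0 : ℝ), v) q)
  have h3 : DifferentiableAt ℝ (fderiv ℝ (G t)) q :=
    ((hG.contDiff_apply t).fderiv_right (m := ∞) (by simp)).differentiable (by simp) q
  have h4 := h3.hasFDerivAt.clm_apply (hasFDerivAt_const v q)
  simp only [hG.fderiv_apply_eq] at h4
  have h5 := congrArg (fun L : Euc Q →L[ℝ] Euc Q => L u) (h4.unique h2)
  simpa using h5

theorem contDiff_pushJet (hG : IsAmbientVariation M N K G) :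
    ContDiff ℝ ∞ fun z : ℝ × Jet Q => pushJet (G z.1) z.2 := by
  have h1 : ContDiff ℝ ∞ (fderiv ℝ (Function.uncurry G)) := hG.smooth.fderiv_right (by simp)
  have h2 : ContDiff ℝ ∞ (fderiv ℝ (fderiv ℝ (Function.uncurry G))) := h1.fderiv_right (by simp)
  have hp : ContDiff ℝ ∞ fun z : ℝ × Jet Q => (z.1, z.2.1) := by fun_prop
  refine (hG.smooth.comp hp).prodMk (ContDiff.prodMk ?_ ?_)
  · rw [contDiff_pi]
    intro i
    simp only [hG.fderiv_apply_eq]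
    exact (h1.comp hp).clm_apply (by fun_prop)
  · rw [contDiff_pi]
    intro i
    rw [contDiff_pi]
    intro k
    simp only [hG.fderiv_apply_eq, hG.fderiv_fderiv_apply_eq]
    exact (((h2.comp hp).clm_apply (by fun_prop)).clm_apply (by fun_prop)).add
      ((h1.comp hp).clm_apply (by fun_prop))

/-- On the compact set K the derivative stays within distance less than 1 of the identity for small
times, by the tube lemma. Off K the map is locally the identity. -/
theorem exists_injective_fderiv (hG : IsAmbientVariation M N K G) :
    ∃ η > 0, ∀ t, |t| < η → ∀ q, Function.Injective (fderiv ℝ (G t) q) := by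
  have h1 : ContDiff ℝ ∞ (fderiv ℝ (Function.uncurry G)) := hG.smooth.fderiv_right (by simp)
  have hc : Continuous fun z : ℝ × Euc Q => (fderiv ℝ (Function.uncurry G) z).comp
      (ContinuousLinearMap.inr ℝ ℝ (Euc Q)) - ContinuousLinearMap.id ℝ (Euc Q) :=
    (h1.continuous.clm_comp continuous_const).sub continuous_const
  have e : ∀ t q, (fderiv ℝ (Function.uncurry G) (t, q)).comp
      (ContinuousLinearMap.inr ℝ ℝ (Euc Q)) = fderiv ℝ (G t) q := by
    intro t q
    ext1 v
    rw [hG.fderiv_apply_eq]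
    rfl
  have hO : IsOpen {z : ℝ × Euc Q | ‖(fderiv ℝ (Function.uncurry G) z).comp
      (ContinuousLinearMap.inr ℝ ℝ (Euc Q)) - ContinuousLinearMap.id ℝ (Euc Q)‖ < 1} :=
    isOpen_lt hc.norm continuous_const
  obtain ⟨u, v, hu, hv, h0u, hKv, huv⟩ := generalized_tube_lemma
    (isCompact_singleton (x := (0 : ℝ))) hG.compact hO (by
      rintro ⟨t, q⟩ ⟨ht, -⟩
      rw [mem_singleton_iff] at ht
      subst ht
      simp [e, hG.fderiv_zero])
  obtain ⟨η, hη, hηu⟩ := Metric.isOpen_iff.1 hu 0 (h0u rfl)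
  refine ⟨η, hη, fun t ht q => ?_⟩
  by_cases hq : q ∈ K
  · have h2 : ‖fderiv ℝ (G t) q - ContinuousLinearMap.id ℝ (Euc Q)‖ < 1 := by
      have : ((t, q) : ℝ × Euc Q) ∈ u ×ˢ v := ⟨hηu (by simpa using ht), hKv hq⟩
      have h3 := huv this
      rwa [mem_ofPred_eq, e] at h3
    rw [injective_iff_map_eq_zero]
    intro x hx
    by_contra hx0
    have h3 := (fderiv ℝ (G t) q - ContinuousLinearMap.id ℝ (Euc Q)).le_opNorm x
    rw [sub_apply, hx, zero_sub, norm_neg] at h3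
    have h4 : 0 < ‖x‖ := norm_pos_iff.2 hx0
    have h5 : ‖x‖ ≤ ‖fderiv ℝ (G t) q - ContinuousLinearMap.id ℝ (Euc Q)‖ * ‖x‖ := h3
    nlinarith
  · have : G t =ᶠ[𝓝 q] id := by
      filter_upwards [hG.compact.isClosed.isOpen_compl.mem_nhds hq] with z hz
      exact hG.support t z hz
    rw [this.fderiv_eq, fderiv_id]
    exact Function.injective_id

end IsAmbientVariation

variable {S : Type*} {Φ : S → Euc Q} {U : Set S}

open Classical in
/-- The variation moving the part `U` of the surface by the ambient variation `G`. -/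
def localVar (G : ℝ → Euc Q → Euc Q) (Φ : S → Euc Q) (U : Set S) (t : ℝ) (x : S) : Euc Q :=
  if x ∈ U then G t (Φ x) else Φ x

theorem localVar_of_mem {t : ℝ} {x : S} (hx : x ∈ U) : localVar G Φ U t x = G t (Φ x) :=
  if_pos hx

theorem localVar_of_notMem {t : ℝ} {x : S} (hx : x ∉ U) : localVar G Φ U t x = Φ x :=
  if_neg hx

open Classical in
theorem IsAmbientVariation.deriv_localVar (hG : IsAmbientVariation M N K G) (x : S) :
    deriv (fun t => localVar G Φ U t x) 0 = if x ∈ U then velocity G (Φ x) else 0 := by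
  by_cases hx : x ∈ U
  · simp only [localVar_of_mem hx, if_pos hx]
    exact (hG.hasDerivAt _).deriv
  · simp [localVar_of_notMem hx, if_neg hx]

variable [TopologicalSpace S]

/-- The points of the closure of U that lie over K form a closed set, contained in the interior of U
since the frontier is not mapped into K. Its complement is therefore a neighbourhood of every point
outside U, and nothing moves there. This makes cutting off at U smooth. -/
theorem IsAmbientVariation.eventually_localVar (hG : IsAmbientVariation M N K G)
    (hΦ : Continuous Φ) (hKU : ∀ x ∈ frontier U, Φ x ∉ K) {x : S} (hx : x ∉ U) :
    ∀ᶠ x' in 𝓝 x, ∀ t, localVar G Φ U t x' = Φ x' := by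
  have hZ : IsClosed (closure U ∩ Φ ⁻¹' K) :=
    isClosed_closure.inter (hG.compact.isClosed.preimage hΦ)
  have hxZ : x ∉ closure U ∩ Φ ⁻¹' K := fun h =>
    hKU x ⟨h.1, fun hi => hx (interior_subset hi)⟩ h.2
  filter_upwards [hZ.isOpen_compl.mem_nhds hxZ] with x' hx' t
  by_cases hU : x' ∈ U
  · rw [localVar_of_mem hU]
    exact hG.support t _ fun hK => hx' ⟨subset_closure hU, hK⟩
  · exact localVar_of_notMem hU

variable [ChartedSpace (EuclideanHalfSpace 2) S]

theorem jetAt_localVar_of_notMem (hG : IsAmbientVariation M N K G)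
    (hΦ : IsAdmissible M N Φ) (hKU : ∀ x ∈ frontier U, Φ x ∉ K) (t : ℝ) {c : S} {y : Euc 2}
    (hy : y ∈ (extChartAt (𝓡∂ 2) c).target) (hyU : (extChartAt (𝓡∂ 2) c).symm y ∉ U) :
    jetAt (inChart (localVar G Φ U t) c) y = jetAt (inChart Φ c) y := by
  have hcs : ContinuousWithinAt (extChartAt (𝓡∂ 2) c).symm halfPlane y :=
    (continuousAt_extChartAt_symm'' hy).continuousWithinAt
  refine jetAt_congr (target_subset_halfPlane c hy) ?_
  filter_upwards [hcs.eventually (hG.eventually_localVar hΦ.smooth.continuous hKU hyU)] with z hz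
  exact hz t

/-- Localized ambient variations are admissible variations. -/
theorem IsAmbientVariation.isVariation (hG : IsAmbientVariation M N K G)
    (hΦ : IsAdmissible M N Φ) (hU : IsOpen U) (hKU : ∀ x ∈ frontier U, Φ x ∉ K) :
    IsVariation M N Φ (localVar G Φ U) ∧
      ∃ η > 0, ∀ t, |t| < η → IsAdmissible M N (localVar G Φ U t) := by
  obtain ⟨η, hη, hinj⟩ := hG.exists_injective_fderiv
  have hadm : ∀ t, |t| < η → IsAdmissible M N (localVar G Φ U t) := by
    intro t ht
    have hloc : ∀ x, (localVar G Φ U t =ᶠ[𝓝 x] fun x => G t (Φ x)) ∨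
        localVar G Φ U t =ᶠ[𝓝 x] Φ := by
      intro x
      by_cases hx : x ∈ U
      · left
        filter_upwards [hU.mem_nhds hx] with z hz
        exact localVar_of_mem hz
      · right
        filter_upwards [hG.eventually_localVar hΦ.smooth.continuous hKU hx] with z hz
        exact hz t
    have hGm : ContMDiff 𝓘(ℝ, Euc Q) 𝓘(ℝ, Euc Q) ∞ (G t) := (hG.contDiff_apply t).contMDiff
    refine ⟨fun x => ?_, fun x => ?_, fun x => ?_, fun x hx => ?_⟩
    · rcases hloc x with h | h
      · exact ((hGm.comp hΦ.smooth) x).congr_of_eventuallyEq h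
      · exact (hΦ.smooth x).congr_of_eventuallyEq h
    · rcases hloc x with h | h
      · rw [h.mfderiv_eq]
        have h1 := mfderiv_comp x (hGm.mdifferentiable (by simp) (Φ x))
          (hΦ.smooth.mdifferentiable (by simp) x)
        rw [show (fun x => G t (Φ x)) = G t ∘ Φ from rfl, h1, mfderiv_eq_fderiv]
        exact (hinj t ht (Φ x)).comp (hΦ.immersion x)
      · rw [h.mfderiv_eq]
        exact hΦ.immersion x
    · by_cases hx : x ∈ U
      · rw [localVar_of_mem hx]
        exact hG.mapsTo_ambient t (hΦ.mem_ambient x)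
      · rw [localVar_of_notMem hx]
        exact hΦ.mem_ambient x
    · by_cases hxU : x ∈ U
      · rw [localVar_of_mem hxU]
        exact hG.mapsTo_constraint t (hΦ.mem_constraint x hx)
      · rw [localVar_of_notMem hxU]
        exact hΦ.mem_constraint x hx
  refine ⟨⟨?_, η, hη, ?_, fun t ht => hadm t (abs_lt.2 ht)⟩, η, hη, hadm⟩
  · ext1 x
    by_cases hx : x ∈ U
    · rw [localVar_of_mem hx, hG.zero]
    · rw [localVar_of_notMem hx]
  · rintro ⟨t, x⟩ -
    refine ContMDiffAt.contMDiffWithinAt ?_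
    by_cases hx : x ∈ U
    · have h1 : ContMDiff (𝓘(ℝ, ℝ).prod (𝓡∂ 2)) 𝓘(ℝ, Euc Q) ∞
          (fun z : ℝ × S => Function.uncurry G (z.1, Φ z.2)) :=
        hG.smooth.contMDiff.comp (contMDiff_fst.prodMk_space (hΦ.smooth.comp contMDiff_snd))
      refine (h1 (t, x)).congr_of_eventuallyEq ?_
      have : ∀ᶠ z : ℝ × S in 𝓝 (t, x), z.2 ∈ U :=
        continuous_snd.continuousAt.eventually (hU.mem_nhds hx)
      filter_upwards [this] with z hz
      exact localVar_of_mem hz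
    · have h1 : ContMDiff (𝓘(ℝ, ℝ).prod (𝓡∂ 2)) 𝓘(ℝ, Euc Q) ∞ (fun z : ℝ × S => Φ z.2) :=
        hΦ.smooth.comp contMDiff_snd
      refine (h1 (t, x)).congr_of_eventuallyEq ?_
      have : ∀ᶠ z : ℝ × S in 𝓝 (t, x), ∀ t, localVar G Φ U t z.2 = Φ z.2 :=
        continuous_snd.continuousAt.eventually
          (hG.eventually_localVar hΦ.smooth.continuous hKU hx)
      filter_upwards [this] with z hz
      exact hz z.1

variable [IsManifold (𝓡∂ 2) ∞ S]

theorem jetAt_localVar_of_mem (hG : IsAmbientVariation M N K G) (hΦ : IsAdmissible M N Φ)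
    (hU : IsOpen U) (t : ℝ) {c : S} {y : Euc 2} (hy : y ∈ (extChartAt (𝓡∂ 2) c).target)
    (hyU : (extChartAt (𝓡∂ 2) c).symm y ∈ U) :
    jetAt (inChart (localVar G Φ U t) c) y = pushJet (G t) (jetAt (inChart Φ c) y) := by
  have hcs : ContinuousWithinAt (extChartAt (𝓡∂ 2) c).symm halfPlane y :=
    (continuousAt_extChartAt_symm'' hy).continuousWithinAt
  have hev : inChart (localVar G Φ U t) c =ᶠ[𝓝[halfPlane] y] fun z => G t (inChart Φ c z) := by
    filter_upwards [hcs.eventually (hU.mem_nhds hyU)] with z hz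
    exact localVar_of_mem hz
  rw [jetAt_congr (target_subset_halfPlane c hy) hev]
  exact jetAt_comp (hG.contDiff_apply t) (target_subset_halfPlane c hy)
    ((contDiffWithinAt_inChart hΦ.smooth hy).of_le ENat.LEInfty.out)

end LocalizedVariation

/-! ### The first variation inequality -/

section FirstVariation

variable {Q : ℕ} {M N K : Set (Euc Q)} {G : ℝ → Euc Q → Euc Q} {k : ℕ}
  {pr : Euc Q → Euc Q →L[ℝ] Euc Q}

theorem hasDerivAt_norm {f : ℝ → Euc Q} {f' : Euc Q} (hf : HasDerivAt f f' 0) (h0 : f 0 ≠ 0) :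
    ∃ d, HasDerivAt (fun t => ‖f t‖) d 0 ∧ |d| ≤ ‖f'‖ := by
  have h1 := (hasDerivAt_real_inner hf hf).sqrt (by
    rw [real_inner_self_eq_norm_sq]; exact pow_ne_zero _ (norm_ne_zero_iff.2 h0))
  have e : (fun t => ‖f t‖) = fun t => Real.sqrt ⟪f t, f t⟫_ℝ := by
    ext1 t
    rw [real_inner_self_eq_norm_sq, Real.sqrt_sq (norm_nonneg _)]
  rw [← e, real_inner_self_eq_norm_sq, Real.sqrt_sq (norm_nonneg _)] at h1
  refine ⟨_, h1, ?_⟩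
  have hp : 0 < ‖f 0‖ := norm_pos_iff.2 h0
  rw [real_inner_comm, ← two_mul, mul_div_mul_left _ _ two_ne_zero, abs_div, abs_of_pos hp,
    div_le_iff₀ hp, mul_comm]
  exact abs_real_inner_le_norm _ _

theorem isClosedEmbedding_boundaryLine : IsClosedEmbedding fun t : ℝ => (!₂[0, t] : Euc 2) := by
  refine Isometry.isClosedEmbedding (Isometry.of_dist_eq fun s t => ?_)
  rw [EuclideanSpace.dist_eq]
  simp [Fin.sum_univ_two, Real.sqrt_sq_eq_abs, Real.dist_eq]

variable {S : Type*} [TopologicalSpace S] [ChartedSpace (EuclideanHalfSpace 2) S]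
  [IsManifold (𝓡∂ 2) ∞ S] {Φ : S → Euc Q} {U : Set S}

theorem areaDensity_eq (φ : Euc 2 → Euc Q) (y : Euc 2) :
    areaDensity φ y = areaOf (jetAt φ y).2.1 := rfl

theorem IsAdmissible.continuousOn_areaDensity (hΦ : IsAdmissible M N Φ) (c : S) :
    ContinuousOn (areaDensity (inChart Φ c)) (extChartAt (𝓡∂ 2) c).target := by
  have h1 : Continuous (areaOf (Q := Q)) :=
    Real.continuous_sqrt.comp contDiff_gramOf_det.continuous
  exact h1.comp_continuousOn
    ((continuousOn_jetAt_inChart hΦ.smooth c).snd.fst)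

theorem IsAdmissible.continuousOn_norm_pd (hΦ : IsAdmissible M N Φ) (c : S) :
    ContinuousOn (fun y => ‖pd (inChart Φ c) y 1‖) (extChartAt (𝓡∂ 2) c).target :=
  (continuousOn_pi.1 (continuousOn_jetAt_inChart hΦ.smooth c).snd.fst 1).norm

variable [CompactSpace S] [T2Space S] [MeasurableSpace S] [BorelSpace S]

theorem IsAdmissible.isFiniteMeasure_area (hΦ : IsAdmissible M N Φ) :
    IsFiniteMeasure (areaMeasure Φ) := by
  rw [areaMeasure_eq]
  exact isFiniteMeasure_chartMeasure IsClosedEmbedding.id hΦ.continuousOn_areaDensity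

theorem IsAdmissible.isFiniteMeasure_length (hΦ : IsAdmissible M N Φ) :
    IsFiniteMeasure (lengthMeasure Φ) := by
  rw [lengthMeasure_eq]
  exact isFiniteMeasure_chartMeasure isClosedEmbedding_boundaryLine hΦ.continuousOn_norm_pd

/-- First variation of the area. -/
theorem hasDerivAt_area_localVar (hM : IsSmoothSubmanifold k M) (hprs : ContDiff ℝ ∞ pr)
    (hpr : ∀ q ∈ M, pr q = tanProj M q) (hG : IsAmbientVariation M N K G)
    (hΦ : IsAdmissible M N Φ) (hU : IsOpen U) (hKU : ∀ x ∈ frontier U, Φ x ∉ K)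
    {L : Euc Q → ℝ} (hLm : Measurable L) {b : ℝ} (hLb : ∀ q, |L q| ≤ b)
    (hL : ∀ q ∈ M, ∀ u : Fin 2 → Euc Q, Orthonormal ℝ u → L q ≤
        ⟪fderiv ℝ (velocity G) q (u 0), u 0⟫_ℝ + ⟪fderiv ℝ (velocity G) q (u 1), u 1⟫_ℝ) :
    ∃ d, HasDerivAt (fun t => (areaMeasure (localVar G Φ U t)).real univ) d 0 ∧
      ∫ x in U, L (Φ x) ∂(areaMeasure Φ) ≤ d := by
  obtain ⟨-, η, hη, hadm⟩ := hG.isVariation hΦ hU hKU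
  have h0 : localVar G Φ U 0 = Φ := (hG.isVariation hΦ hU hKU).1.start
  have hjet := fun (c : S) (y : Euc 2) (hy : y ∈ (extChartAt (𝓡∂ 2) c).target) =>
    hΦ.isTangentJet hM hprs hpr hy
  obtain ⟨d, hd, hlow, -⟩ := hasDerivAt_integral_chartMeasure (ι := fun y : Euc 2 => y)
    (S := S) IsClosedEmbedding.id (J := fun c => jetAt (inChart Φ c))
    (continuousOn_jetAt_inChart hΦ.smooth)
    (Ψ := fun t j => areaOf (pushJet (G t) j).2.1) (U := U)
    (D := fun t c y => areaDensity (inChart (localVar G Φ U t) c) y) (g := fun _ _ => 1)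
    (by
      intro c y hy
      have h1 : ContDiffAt ℝ ∞ (areaOf (Q := Q)) (pushJet (G 0) (jetAt (inChart Φ c) y)).2.1 := by
        rw [hG.pushJet_zero]
        exact contDiffAt_areaOf (hjet c y hy).indep
      have h2 := h1.comp ((0 : ℝ), jetAt (inChart Φ c) y)
        (f := fun z : ℝ × Jet Q => (pushJet (G z.1) z.2).2.1)
        ((contDiff_fst.comp contDiff_snd).comp hG.contDiff_pushJet).contDiffAt
      exact h2.of_le ENat.LEInfty.out) hU hη
    (fun t ht => (hadm t ht).continuousOn_areaDensity)
    (fun t _ c y _ => Real.sqrt_nonneg _) (fun _ _ => continuous_const)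
    (by
      intro t ht c y hy
      refine ⟨fun hyU => ?_, fun hyU => ?_⟩
      · rw [mul_one, areaDensity_eq, jetAt_localVar_of_mem hG hΦ hU t hy hyU]
      · rw [mul_one, areaDensity_eq, jetAt_localVar_of_notMem hG hΦ hKU t hy hyU,
          hG.pushJet_zero])
  refine ⟨d, ?_, ?_⟩
  · simp only [areaMeasure_eq]
    simpa only [integral_const, smul_eq_mul, mul_one] using hd
  · have := hlow (fun x => L (Φ x)) (hLm.comp hΦ.smooth.continuous.measurable)
      ⟨b, fun x => hLb _⟩ (by
        intro c y hy _
        obtain ⟨D, hD, hDL⟩ := hG.hasDerivAt_area hpr (hjet c y hy)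
        rw [hD.deriv, h0, areaDensity_eq]
        exact hDL _ (hL _ (hΦ.mem_ambient _)))
    rwa [h0] at this

/-- First variation of the boundary length. -/
theorem hasDerivAt_length_localVar (hM : IsSmoothSubmanifold k M) (hprs : ContDiff ℝ ∞ pr)
    (hpr : ∀ q ∈ M, pr q = tanProj M q) (hG : IsAmbientVariation M N K G)
    (hΦ : IsAdmissible M N Φ) (hU : IsOpen U) (hKU : ∀ x ∈ frontier U, Φ x ∉ K)
    {ℓ : Euc Q → ℝ} (hℓm : Measurable ℓ) {b : ℝ} (hℓb : ∀ q, |ℓ q| ≤ b)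
    (hℓ : ∀ q ∈ M, ‖fderiv ℝ (velocity G) q‖ ≤ ℓ q) :
    ∃ d, HasDerivAt (fun t => (lengthMeasure (localVar G Φ U t)).real univ) d 0 ∧
      -d ≤ ∫ x in U, ℓ (Φ x) ∂(lengthMeasure Φ) := by
  obtain ⟨-, η, hη, hadm⟩ := hG.isVariation hΦ hU hKU
  have h0 : localVar G Φ U 0 = Φ := (hG.isVariation hΦ hU hKU).1.start
  have hjet := fun (c : S) (y : Euc 2) (hy : y ∈ (extChartAt (𝓡∂ 2) c).target) =>
    hΦ.isTangentJet hM hprs hpr hy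
  have hne : ∀ (c : S) (y : Euc 2), y ∈ (extChartAt (𝓡∂ 2) c).target →
      (pushJet (G 0) (jetAt (inChart Φ c) y)).2.1 1 ≠ 0 := by
    intro c y hy
    rw [hG.pushJet_zero]
    exact (hjet c y hy).indep.ne_zero 1
  obtain ⟨d, hd, hlow, -⟩ := hasDerivAt_integral_chartMeasure
    (S := S) isClosedEmbedding_boundaryLine (J := fun c => jetAt (inChart Φ c))
    (continuousOn_jetAt_inChart hΦ.smooth)
    (Ψ := fun t j => ‖(pushJet (G t) j).2.1 1‖) (U := U)
    (D := fun t c y => ‖pd (inChart (localVar G Φ U t) c) y 1‖) (g := fun _ _ => 1)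
    (by
      intro c y hy
      have h2 : ContDiffAt ℝ ∞ (fun z : ℝ × Jet Q => (pushJet (G z.1) z.2).2.1 1)
          ((0 : ℝ), jetAt (inChart Φ c) y) :=
        ((contDiff_apply ℝ (Euc Q) (1 : Fin 2)).comp
          ((contDiff_fst.comp contDiff_snd).comp hG.contDiff_pushJet)).contDiffAt
      exact (h2.norm ℝ (hne c y hy)).of_le ENat.LEInfty.out) hU hη
    (fun t ht => (hadm t ht).continuousOn_norm_pd)
    (fun t _ c y _ => norm_nonneg _) (fun _ _ => continuous_const)
    (by
      intro t ht c y hy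
      have e : ∀ φ : Euc 2 → Euc Q, pd φ y 1 = (jetAt φ y).2.1 1 := fun _ => rfl
      refine ⟨fun hyU => ?_, fun hyU => ?_⟩
      · rw [mul_one, e, jetAt_localVar_of_mem hG hΦ hU t hy hyU]
      · rw [mul_one, e, jetAt_localVar_of_notMem hG hΦ hKU t hy hyU,
          hG.pushJet_zero])
  refine ⟨d, ?_, ?_⟩
  · simp only [lengthMeasure_eq]
    simpa only [integral_const, smul_eq_mul, mul_one] using hd
  · have := hlow (fun x => -ℓ (Φ x)) (hℓm.comp hΦ.smooth.continuous.measurable).neg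
      ⟨b, fun x => by rw [abs_neg]; exact hℓb _⟩ (by
        intro c y hy _
        obtain ⟨D, hD, hDL⟩ := hasDerivAt_norm (hG.hasDerivAt_pushJet_snd _ 1) (hne c y hy)
        rw [hD.deriv, h0]
        have h2 := hDL.trans ((ContinuousLinearMap.le_opNorm _ _).trans
          (mul_le_mul_of_nonneg_right (hℓ _ (hΦ.mem_ambient _)) (norm_nonneg _)))
        have h3 := (abs_le.1 h2).1
        rw [neg_mul]
        exact h3)
    rw [integral_neg, h0] at this
    rw [lengthMeasure_eq]
    linarith

/-- First variation of `∫ |II|⁴`. -/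
theorem hasDerivAt_ff_localVar (hM : IsSmoothSubmanifold k M) (hMc : IsClosed M)
    (hprs : ContDiff ℝ ∞ pr)
    (hpr : ∀ q ∈ M, pr q = tanProj M q) (hG : IsAmbientVariation M N K G)
    (hΦ : IsAdmissible M N Φ) (hU : IsOpen U) (hKU : ∀ x ∈ frontier U, Φ x ∉ K)
    {c₀ : ℝ} (hc₀ : ∀ q ∈ M, ‖fderiv ℝ pr q‖ ≤ c₀) {x₀ ℓ d₀ : Euc Q → ℝ}
    (hx : ∀ q ∈ M, ‖velocity G q‖ ≤ x₀ q) (hℓ : ∀ q ∈ M, ‖fderiv ℝ (velocity G) q‖ ≤ ℓ q)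
    (hd₀ : ∀ q ∈ M, ‖fderiv ℝ (fderiv ℝ (velocity G)) q‖ ≤ d₀ q)
    {h : S → ℝ} (hm : Measurable h) {b : ℝ} (hb : ∀ x, |h x| ≤ b)
    (hh : ∀ x ∈ U, 130 * ℓ (Φ x) * ffSq M Φ x ^ 2 +
        64 * ((c₀ * x₀ (Φ x) + ℓ (Φ x)) * (Real.sqrt (ffSq M Φ x) + c₀) + d₀ (Φ x)) *
          (ffSq M Φ x * Real.sqrt (ffSq M Φ x)) ≤ h x) :
    ∃ d, HasDerivAt (fun t => ∫ x, ffSq M (localVar G Φ U t) x ^ 2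
        ∂(areaMeasure (localVar G Φ U t))) d 0 ∧
      -d ≤ ∫ x in U, h x ∂(areaMeasure Φ) := by
  obtain ⟨-, η, hη, hadm⟩ := hG.isVariation hΦ hU hKU
  have h0 : localVar G Φ U 0 = Φ := (hG.isVariation hΦ hU hKU).1.start
  have hjet := fun (c : S) (y : Euc 2) (hy : y ∈ (extChartAt (𝓡∂ 2) c).target) =>
    hΦ.isTangentJet hM hprs hpr hy
  obtain ⟨d, hd, hlow, -⟩ := hasDerivAt_integral_chartMeasure (ι := fun y : Euc 2 => y)
    (S := S) IsClosedEmbedding.id (J := fun c => jetAt (inChart Φ c))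
    (continuousOn_jetAt_inChart hΦ.smooth)
    (Ψ := fun t j => ffOf (pr (G t j.1)) (pushJet (G t) j).2.1 (pushJet (G t) j).2.2 ^ 2 *
        areaOf (pushJet (G t) j).2.1) (U := U)
    (D := fun t c y => areaDensity (inChart (localVar G Φ U t) c) y)
    (g := fun t x => ffSq M (localVar G Φ U t) x ^ 2)
    (by
      intro c y hy
      have hin : LinearIndependent ℝ (pushJet (G 0) (jetAt (inChart Φ c) y)).2.1 := by
        rw [hG.pushJet_zero]
        exact (hjet c y hy).indep
      have hp := hG.contDiff_pushJet
      have h2 := (contDiffAt_areaOf hin).comp ((0 : ℝ), jetAt (inChart Φ c) y)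
        (f := fun z : ℝ × Jet Q => (pushJet (G z.1) z.2).2.1)
        ((contDiff_fst.comp contDiff_snd).comp hp).contDiffAt
      have h3 := (contDiffAt_ffOf (z := (pr (G 0 (jetAt (inChart Φ c) y).1),
        (pushJet (G 0) (jetAt (inChart Φ c) y)).2.1, (pushJet (G 0) (jetAt (inChart Φ c) y)).2.2))
          hin).comp ((0 : ℝ), jetAt (inChart Φ c) y)
        (f := fun z : ℝ × Jet Q => (pr (G z.1 z.2.1), (pushJet (G z.1) z.2).2.1,
          (pushJet (G z.1) z.2).2.2))
        ((hprs.comp (contDiff_fst.comp hp)).prodMk ((contDiff_snd.comp hp))).contDiffAt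
      exact ((h3.pow 2).mul h2).of_le ENat.LEInfty.out) hU hη
    (fun t ht => (hadm t ht).continuousOn_areaDensity)
    (fun t _ c y _ => Real.sqrt_nonneg _)
    (fun t ht => ((hadm t ht).continuous_ffSq hM hMc).pow 2)
    (by
      intro t ht c y hy
      rw [(hadm t ht).ffSq_symm_eq hM hpr hy, areaDensity_eq, mul_comm]
      refine ⟨fun hyU => ?_, fun hyU => ?_⟩
      · rw [jetAt_localVar_of_mem hG hΦ hU t hy hyU]
        rfl
      · rw [jetAt_localVar_of_notMem hG hΦ hKU t hy hyU, hG.pushJet_zero, hG.zero])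
  refine ⟨d, ?_, ?_⟩
  · simpa only [areaMeasure_eq] using hd
  · have := hlow (fun x => -h x) hm.neg
      ⟨b, fun x => by rw [abs_neg]; exact hb _⟩ (by
        intro c y hy hyU
        have hyM := hΦ.mem_ambient ((extChartAt (𝓡∂ 2) c).symm y)
        obtain ⟨D, hD, hDL⟩ := hG.hasDerivAt_ff hpr hprs (hjet c y hy) (hc₀ _ hyM) (hx _ hyM)
          (hℓ _ hyM) (hd₀ _ hyM)
        rw [hD.deriv, h0, areaDensity_eq]
        rw [← hΦ.ffSq_symm_eq hM hpr hy] at hDL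
        have h2 := hDL.trans (mul_le_mul_of_nonneg_right (hh _ hyU) (Real.sqrt_nonneg _))
        have h3 := (abs_le.1 h2).1
        rw [neg_mul]
        exact h3)
    rw [integral_neg, h0] at this
    rw [areaMeasure_eq]
    linarith

/-- The derivative of the energy is d₁ + σ d₂ + σ⁴ d₃, and criticality bounds it above by εZ. The
lower bound for d₁ by the divergence, and those for d₂ and d₃ by the sizes of the field and of its
derivatives, are inserted. -/
theorem first_variation_le (hM : IsSmoothSubmanifold k M) (hMc : IsClosed M)
    (hprs : ContDiff ℝ ∞ pr)
    (hpr : ∀ q ∈ M, pr q = tanProj M q) (hG : IsAmbientVariation M N K G) {σ ε : ℝ} (hσ : 0 < σ)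
    (hε : 0 ≤ ε) (hΦ : IsEpsCritical M N σ ε Φ) (hU : IsOpen U)
    (hKU : ∀ x ∈ frontier U, Φ x ∉ K)
    {c₀ : ℝ} (hc₀ : ∀ q ∈ M, ‖fderiv ℝ pr q‖ ≤ c₀) {L x₀ ℓ d₀ : Euc Q → ℝ}
    (hx : ∀ q ∈ M, ‖velocity G q‖ ≤ x₀ q) (hℓ : ∀ q ∈ M, ‖fderiv ℝ (velocity G) q‖ ≤ ℓ q)
    (hd₀ : ∀ q ∈ M, ‖fderiv ℝ (fderiv ℝ (velocity G)) q‖ ≤ d₀ q)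
    (hL : ∀ q ∈ M, ∀ u : Fin 2 → Euc Q, Orthonormal ℝ u → L q ≤
        ⟪fderiv ℝ (velocity G) q (u 0), u 0⟫_ℝ + ⟪fderiv ℝ (velocity G) q (u 1), u 1⟫_ℝ)
    (hLm : Measurable L) {b₁ : ℝ} (hLb : ∀ q, |L q| ≤ b₁)
    (hℓm : Measurable ℓ) {b₂ : ℝ} (hℓb : ∀ q, |ℓ q| ≤ b₂)
    {h : S → ℝ} (hm : Measurable h) {b : ℝ} (hb : ∀ x, |h x| ≤ b)
    (hh : ∀ x ∈ U, 130 * ℓ (Φ x) * ffSq M Φ x ^ 2 +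
        64 * ((c₀ * x₀ (Φ x) + ℓ (Φ x)) * (Real.sqrt (ffSq M Φ x) + c₀) + d₀ (Φ x)) *
          (ffSq M Φ x * Real.sqrt (ffSq M Φ x)) ≤ h x)
    {Z : ℝ} (hZ0 : 0 ≤ Z)
    (hZ : sectionNorm M Φ (fun x => deriv (fun t => localVar G Φ U t x) 0) ≤ ENNReal.ofReal Z) :
    ∫ x in U, L (Φ x) ∂(areaMeasure Φ) ≤ σ * ∫ x in U, ℓ (Φ x) ∂(lengthMeasure Φ)
      + σ ^ 4 * ∫ x in U, h x ∂(areaMeasure Φ) + ε * Z := by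
  obtain ⟨d₁, hd₁, h1⟩ := hasDerivAt_area_localVar hM hprs hpr hG hΦ.1 hU hKU hLm hLb hL
  obtain ⟨d₂, hd₂, h2⟩ := hasDerivAt_length_localVar hM hprs hpr hG hΦ.1 hU hKU hℓm hℓb hℓ
  obtain ⟨d₃, hd₃, h3⟩ := hasDerivAt_ff_localVar hM hMc hprs hpr hG hΦ.1 hU hKU hc₀ hx hℓ hd₀
    hm hb hh
  have hE : HasDerivAt (fun t => energy M σ (localVar G Φ U t)) (d₁ + σ * d₂ + σ ^ 4 * d₃) 0 :=
    (hd₁.fun_add (hd₂.const_mul σ)).fun_add (hd₃.const_mul (σ ^ 4))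
  have hcr := hΦ.2 _ (hG.isVariation hΦ.1 hU hKU).1
  rw [hE.deriv] at hcr
  have h4 : |d₁ + σ * d₂ + σ ^ 4 * d₃| ≤ ε * Z := by
    have := hcr.trans (mul_le_mul_right hZ _)
    rw [← ENNReal.ofReal_mul hε] at this
    exact (ENNReal.ofReal_le_ofReal_iff (by positivity)).1 this
  have h5 := (abs_le.1 h4).2
  have h6 := mul_le_mul_of_nonneg_left h2 hσ.le
  have h7 := mul_le_mul_of_nonneg_left h3 (show 0 ≤ σ ^ 4 by positivity)
  linarith

end FirstVariation

/-! ### The norm of the velocity of a localized variation -/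

section SectionNorm

variable {Q : ℕ} {M N K : Set (Euc Q)} {G : ℝ → Euc Q → Euc Q} {k : ℕ}
  {pr : Euc Q → Euc Q →L[ℝ] Euc Q}

theorem covDeriv_eventuallyEq {φ u v : Euc 2 → Euc Q} {y : Euc 2}
    (h : u =ᶠ[𝓝[halfPlane] y] v) :
    covDeriv M φ u =ᶠ[𝓝[halfPlane] y] covDeriv M φ v := by
  filter_upwards [pd_eventuallyEq h] with z hz
  funext i
  rw [covDeriv, covDeriv, hz]

theorem covDeriv2_congr {φ u v : Euc 2 → Euc Q} {y : Euc 2} (hy : y ∈ halfPlane)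
    (h : u =ᶠ[𝓝[halfPlane] y] v) : covDeriv2 M φ u y = covDeriv2 M φ v y := by
  funext i j
  have h1 := covDeriv_eventuallyEq (M := M) (φ := φ) h
  have h2 : (fun z => covDeriv M φ u z j) =ᶠ[𝓝[halfPlane] y] fun z => covDeriv M φ v z j := by
    filter_upwards [h1] with z hz
    rw [hz]
  rw [covDeriv2, covDeriv2, (covDeriv_eventuallyEq h2).self_of_nhdsWithin hy,
    h1.self_of_nhdsWithin hy]

variable {S : Type*} [TopologicalSpace S] [ChartedSpace (EuclideanHalfSpace 2) S]
  [IsManifold (𝓡∂ 2) ∞ S] {Φ w : S → Euc Q} {U : Set S}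

theorem IsAdmissible.gradNorm_le (hM : IsSmoothSubmanifold k M) (hprs : ContDiff ℝ ∞ pr)
    (hpr : ∀ q ∈ M, pr q = tanProj M q) (hΦ : IsAdmissible M N Φ) {X : Euc Q → Euc Q}
    (hX : ContDiff ℝ ∞ X) {x : S} (hw : w =ᶠ[𝓝 x] fun z => X (Φ z)) {ℓ : ℝ}
    (hℓ : ‖fderiv ℝ X (Φ x)‖ ≤ ℓ) : gradNorm M Φ w x ≤ 2 * ℓ := by
  have hx := mem_extChartAt_source (I := 𝓡∂ 2) x
  have hy := (extChartAt (𝓡∂ 2) x).map_source hx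
  have hyH := target_subset_halfPlane x hy
  have hval : (extChartAt (𝓡∂ 2) x).symm (extChartAt (𝓡∂ 2) x x) = x :=
    (extChartAt (𝓡∂ 2) x).left_inv hx
  have hcs : ContinuousWithinAt (extChartAt (𝓡∂ 2) x).symm halfPlane (extChartAt (𝓡∂ 2) x x) :=
    (continuousAt_extChartAt_symm'' hy).continuousWithinAt
  have hev : inChart w x =ᶠ[𝓝[halfPlane] (extChartAt (𝓡∂ 2) x x)]
      fun z => X (inChart Φ x z) := by
    rw [ContinuousWithinAt, hval] at hcs
    exact hcs.eventually hw
  have hℓ0 : 0 ≤ ℓ := (norm_nonneg _).trans hℓ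
  rw [gradNorm]
  refine Real.sqrt_le_iff.2 ⟨by positivity, ?_⟩
  rw [(covDeriv_eventuallyEq hev).self_of_nhdsWithin hyH]
  refine (normSq₁_covDeriv_le hpr hX hyH (contDiffWithinAt_inChart hΦ.smooth hy)
    (hΦ.isTangentJet hM hprs hpr hy) (ℓ := ℓ) ?_).trans (by nlinarith)
  rwa [inChart, hval]

theorem IsAdmissible.hessNorm_le (hM : IsSmoothSubmanifold k M) (hprs : ContDiff ℝ ∞ pr)
    (hpr : ∀ q ∈ M, pr q = tanProj M q) (hΦ : IsAdmissible M N Φ) {X : Euc Q → Euc Q}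
    (hX : ContDiff ℝ ∞ X) {x : S} (hw : w =ᶠ[𝓝 x] fun z => X (Φ z)) {c₀ ℓ d₀ : ℝ}
    (hc₀ : ‖fderiv ℝ pr (Φ x)‖ ≤ c₀)
    (hℓ : ‖fderiv ℝ X (Φ x)‖ ≤ ℓ) (hd₀ : ‖fderiv ℝ (fderiv ℝ X) (Φ x)‖ ≤ d₀) :
    hessNorm M Φ w x ≤ 2 * (c₀ * ℓ + d₀ + ℓ * (Real.sqrt (ffSq M Φ x) + c₀)) := by
  have hx := mem_extChartAt_source (I := 𝓡∂ 2) x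
  have hy := (extChartAt (𝓡∂ 2) x).map_source hx
  have hyH := target_subset_halfPlane x hy
  have hval : (extChartAt (𝓡∂ 2) x).symm (extChartAt (𝓡∂ 2) x x) = x :=
    (extChartAt (𝓡∂ 2) x).left_inv hx
  have hcs : ContinuousWithinAt (extChartAt (𝓡∂ 2) x).symm halfPlane (extChartAt (𝓡∂ 2) x x) :=
    (continuousAt_extChartAt_symm'' hy).continuousWithinAt
  have hev : inChart w x =ᶠ[𝓝[halfPlane] (extChartAt (𝓡∂ 2) x x)]
      fun z => X (inChart Φ x z) := by
    rw [ContinuousWithinAt, hval] at hcs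
    exact hcs.eventually hw
  have hval' : inChart Φ x (extChartAt (𝓡∂ 2) x x) = Φ x := by rw [inChart, hval]
  have hℓ0 : 0 ≤ ℓ := (norm_nonneg _).trans hℓ
  have hd0 : 0 ≤ d₀ := (norm_nonneg (fderiv ℝ (fderiv ℝ X) (Φ x))).trans hd₀
  have hc0 : 0 ≤ c₀ := (norm_nonneg (fderiv ℝ pr (Φ x))).trans hc₀
  rw [hessNorm]
  refine Real.sqrt_le_iff.2 ⟨by positivity, ?_⟩
  rw [covDeriv2_congr hyH hev, hΦ.ffSq_eq hM hx]
  refine (normSq₂_covDeriv2_le hprs hpr hX hyH (contDiffWithinAt_inChart hΦ.smooth hy)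
    (hΦ.eventually_mem x _) (hΦ.isTangentJet hM hprs hpr hy) (c := c₀) (ℓ := ℓ) (d := d₀)
    ?_ ?_ ?_).trans (le_of_eq ?_)
  · rwa [hval']
  · rwa [hval']
  · rwa [hval']
  · rw [hval']
    ring

variable [CompactSpace S] [T2Space S] [MeasurableSpace S] [BorelSpace S]

/-- Near points of U the velocity is the restriction of an ambient field, and near all other points
it is zero, so pointwise bounds hold everywhere. Only the Hessian involves |II|, and it is measured
in L⁴. -/
theorem sectionNorm_localVar_le (hM : IsSmoothSubmanifold k M)
    (hprs : ContDiff ℝ ∞ pr)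
    (hpr : ∀ q ∈ M, pr q = tanProj M q) (hG : IsAmbientVariation M N K G)
    (hΦ : IsAdmissible M N Φ) (hU : IsOpen U)
    (hKU : ∀ x ∈ frontier U, Φ x ∉ K)
    {c₀ : ℝ} (hc₀ : ∀ q ∈ M, ‖fderiv ℝ pr q‖ ≤ c₀) {A B : ℝ} {ℓ d₀ : Euc Q → ℝ}
    (hA : ∀ q ∈ M, ‖velocity G q‖ ≤ A) (hB : ∀ q ∈ M, ‖fderiv ℝ (velocity G) q‖ ≤ B)
    (hℓ : ∀ q ∈ M, ‖fderiv ℝ (velocity G) q‖ ≤ ℓ q)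
    (hd₀ : ∀ q ∈ M, ‖fderiv ℝ (fderiv ℝ (velocity G)) q‖ ≤ d₀ q)
    {H : S → ℝ} (hm : Measurable H) {b : ℝ} (hb : ∀ x, |H x| ≤ b)
    (hH : ∀ x ∈ U, 2 * (c₀ * ℓ (Φ x) + d₀ (Φ x) + ℓ (Φ x) *
      (Real.sqrt (ffSq M Φ x) + c₀)) ≤ H x) :
    sectionNorm M Φ (fun x => deriv (fun t => localVar G Φ U t x) 0) ≤
      ENNReal.ofReal (A + 2 * B + (∫ x in U, H x ^ 4 ∂(areaMeasure Φ)) ^ (1 / 4 : ℝ)) := by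
  -- A point of the surface supplies a point of M, from which the constants are seen to be
  -- nonnegative. For an empty surface all norms vanish.
  rcases isEmpty_or_nonempty S with hS | ⟨⟨x₁⟩⟩
  · have : areaMeasure Φ = 0 := Measure.eq_zero_of_isEmpty _
    simp [sectionNorm, this]
  have := hΦ.isFiniteMeasure_area
  have hA0 : 0 ≤ A := (norm_nonneg _).trans (hA _ (hΦ.mem_ambient x₁))
  have hB0 : 0 ≤ B := (norm_nonneg _).trans (hB _ (hΦ.mem_ambient x₁))
  have hc0 : 0 ≤ c₀ := (norm_nonneg (fderiv ℝ pr _)).trans (hc₀ _ (hΦ.mem_ambient x₁))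
  have hw1 : ∀ x ∈ U, (fun x => deriv (fun t => localVar G Φ U t x) 0) =ᶠ[𝓝 x]
      fun z => velocity G (Φ z) := by
    intro x hx
    filter_upwards [hU.mem_nhds hx] with z hz
    rw [hG.deriv_localVar, if_pos hz]
  have hw2 : ∀ x ∉ U, (fun x => deriv (fun t => localVar G Φ U t x) 0) =ᶠ[𝓝 x]
      fun z => (fun _ : Euc Q => (0 : Euc Q)) (Φ z) := by
    intro x hx
    filter_upwards [hG.eventually_localVar hΦ.smooth.continuous hKU hx] with z hz
    simp [hz]
  have hn : ∀ x, ‖deriv (fun t => localVar G Φ U t x) 0‖ ≤ A := by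
    intro x
    by_cases hx : x ∈ U
    · exact (congrArg norm (hw1 x hx).self_of_nhds).trans_le (hA _ (hΦ.mem_ambient x))
    · exact (congrArg norm (hw2 x hx).self_of_nhds).trans_le (by simpa using hA0)
  have hg : ∀ x, ‖gradNorm M Φ (fun x => deriv (fun t => localVar G Φ U t x) 0) x‖ ≤ 2 * B := by
    intro x
    refine (Real.norm_of_nonneg (Real.sqrt_nonneg _)).trans_le ?_
    by_cases hx : x ∈ U
    · exact hΦ.gradNorm_le hM hprs hpr hG.contDiff_velocity (hw1 x hx) (hB _ (hΦ.mem_ambient x))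
    · exact hΦ.gradNorm_le hM hprs hpr contDiff_const (hw2 x hx) (by simpa using hB0)
  have hh : ∀ x, ‖hessNorm M Φ (fun x => deriv (fun t => localVar G Φ U t x) 0) x‖
      ≤ U.indicator H x := by
    intro x
    refine (Real.norm_of_nonneg (Real.sqrt_nonneg _)).trans_le ?_
    by_cases hx : x ∈ U
    · rw [indicator_of_mem hx]
      have hxM := hΦ.mem_ambient x
      exact (hΦ.hessNorm_le hM hprs hpr hG.contDiff_velocity (hw1 x hx) (hc₀ _ hxM) (hℓ _ hxM)
        (hd₀ _ hxM)).trans (hH x hx)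
    · rw [indicator_of_notMem hx]
      have h0 : fderiv ℝ (fun _ : Euc Q => (0 : Euc Q)) = fun _ => 0 := by ext1 q; simp
      refine (hΦ.hessNorm_le hM hprs hpr contDiff_const (hw2 x hx) (hc₀ _ (hΦ.mem_ambient x))
        (ℓ := 0) (d₀ := 0) ?_ ?_).trans (by simp)
      · rw [h0, norm_zero]
      · rw [h0, fderiv_fun_const]
        exact (norm_zero (E := Euc Q →L[ℝ] Euc Q →L[ℝ] Euc Q)).le
  have hHp : ∀ x, 0 ≤ U.indicator H x := fun x => (norm_nonneg _).trans (hh x)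
  have hI : 0 ≤ ∫ x in U, H x ^ 4 ∂(areaMeasure Φ) := integral_nonneg fun x => by positivity
  rw [sectionNorm, ENNReal.ofReal_add (by positivity) (by positivity),
    ENNReal.ofReal_add hA0 (by positivity)]
  refine add_le_add (add_le_add ?_ ?_) ?_
  · rw [eLpNorm_exponent_top]
    refine eLpNormEssSup_le_of_ae_bound (Eventually.of_forall hn)
  · rw [eLpNorm_exponent_top]
    refine eLpNormEssSup_le_of_ae_bound (Eventually.of_forall hg)
  · refine (eLpNorm_mono_real hh).trans ?_
    rw [eLpNorm_eq_lintegral_rpow_enorm_toReal (by simp) (by simp),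
      ← ENNReal.ofReal_rpow_of_nonneg hI (by norm_num)]
    have e4 : (4 : ℝ≥0∞).toReal = 4 := by simp
    rw [e4]
    refine ENNReal.rpow_le_rpow ?_ (by norm_num)
    rw [ofReal_integral_eq_lintegral_ofReal, ← lintegral_indicator hU.measurableSet]
    · refine lintegral_mono fun x => ?_
      by_cases hx : x ∈ U
      · have h0 := hHp x
        simp only [indicator_of_mem hx] at h0 ⊢
        rw [Real.enorm_of_nonneg h0, ENNReal.ofReal_rpow_of_nonneg h0 (by norm_num)]
        norm_cast
      · simp [indicator_of_notMem hx]
    · refine Measure.integrableOn_of_bounded (M := b ^ 4) (measure_ne_top _ _)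
        (hm.pow_const 4).aestronglyMeasurable (Eventually.of_forall fun x => ?_)
      rw [norm_pow, Real.norm_eq_abs]
      exact pow_le_pow_left₀ (abs_nonneg _) (hb x) 4
    · exact Eventually.of_forall fun x => by positivity

end SectionNorm

/-! ### Charts adapted to a submanifold and a constraint -/

section AdaptedCharts

variable {Q : ℕ} {M N K : Set (Euc Q)}

/-- Inverse function theorem. The source is cut down to points of `O` with invertible derivative, so
that the inverse is smooth on its whole target. -/
theorem exists_smooth_localInverse {H : Euc Q → Euc Q} {O : Set (Euc Q)} (hO : IsOpen O)
    (hH : ContDiffOn ℝ ∞ H O) {a : Euc Q} (ha : a ∈ O)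
    (hd : HasFDerivAt H (ContinuousLinearMap.id ℝ (Euc Q)) a) :
    ∃ h : OpenPartialHomeomorph (Euc Q) (Euc Q), ⇑h = H ∧ a ∈ h.source ∧ h.source ⊆ O ∧
      ContDiffOn ℝ ∞ h.symm h.target := by
  have hHa := hH.contDiffAt (hO.mem_nhds ha)
  have hd' : HasFDerivAt H ((ContinuousLinearEquiv.refl ℝ (Euc Q) : Euc Q ≃L[ℝ] Euc Q) :
    Euc Q →L[ℝ] Euc Q) a := hd
  let h₀ := hHa.toOpenPartialHomeomorph H hd' (by simp)
  have hO' : IsOpen (O ∩ fderiv ℝ H ⁻¹' {L | IsUnit L}) :=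
    (hH.continuousOn_fderiv_of_isOpen hO (by simp)).isOpen_inter_preimage hO Units.isOpen
  refine ⟨h₀.restrOpen _ hO', rfl, ⟨hHa.mem_toOpenPartialHomeomorph_source hd' (by simp), ha, ?_⟩,
    fun x hx => hx.2.1, ?_⟩
  · rw [mem_preimage, hd.fderiv]
    exact isUnit_one
  · intro z hz
    refine ContDiffAt.contDiffWithinAt ?_
    have hs := (h₀.restrOpen _ hO').map_target hz
    obtain ⟨u, hu⟩ := hs.2.2
    have h1 := hH.contDiffAt (hO.mem_nhds hs.2.1)
    refine (h₀.restrOpen _ hO').contDiffAt_symm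
      (f₀' := ContinuousLinearEquiv.unitsEquiv ℝ (Euc Q) u) hz ?_ h1
    have h2 := (h1.differentiableAt (by simp)).hasFDerivAt
    rw [← hu] at h2
    exact h2

/-- A chart straightening `M` and either straightening `N` or avoiding it. -/
structure IsAdaptedChart (M N : Set (Euc Q)) (e : OpenPartialHomeomorph (Euc Q) (Euc Q)) : Prop where
  ambient : ∃ W, IsStraightening e M W
  constraint : (∃ W, IsStraightening e N W) ∨ Disjoint e.source N

theorem IsStraightening.restrOpen {e : OpenPartialHomeomorph (Euc Q) (Euc Q)}
    {W : Submodule ℝ (Euc Q)} (he : IsStraightening e M W) {O : Set (Euc Q)} (hO : IsOpen O) :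
    IsStraightening (e.restrOpen O hO) M W :=
  ⟨he.smooth.mono inter_subset_left, he.smooth_symm.mono fun _ hz => hz.1,
    fun y hy => he.mem_iff y hy.1⟩

/-- Let `f` straighten N to V, let π be the projection onto V, and let φ be a chart of M read in the
coordinates of `f`. The map H = φ - φ∘π + π is the identity on V, so it still straightens N. Since
φ(πy) and πy both lie in the subspace to which φ straightens M, it also straightens M. Tangency of N
to M is what places V inside that subspace. -/
theorem exists_isAdaptedChart {m n : ℕ} (hM : IsSmoothSubmanifold m M)
    (hN : IsSmoothSubmanifold n N) (hNc : IsClosed N) (hNM : N ⊆ M) {p : Euc Q} (hp : p ∈ M) :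
    ∃ e, p ∈ e.source ∧ IsAdaptedChart M N e := by
  obtain ⟨W, hW⟩ := hM.exists_isStraightening
  obtain ⟨V, hV⟩ := hN.exists_isStraightening
  obtain ⟨e, hpe, he⟩ := hW p hp
  by_cases hpN : p ∈ N
  swap
  · exact ⟨e.restrOpen _ hNc.isOpen_compl, ⟨hpe, hpN⟩, ⟨W, he.restrOpen _⟩,
      Or.inr (disjoint_left.2 fun x hx hxN => hx.2 hxN)⟩
  obtain ⟨f, hpf, hf⟩ := hV p hpN
  let π := V.starProjection
  -- The factor B normalizes the derivative of φ at f p to the identity. Then DH = 1 - π + π = 1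
  -- there, and H is locally invertible.
  let B := (fderiv ℝ f p).comp (fderiv ℝ e.symm (e p))
  let φ : Euc Q → Euc Q := fun y => B (e (f.symm y))
  let H : Euc Q → Euc Q := fun y => φ y - φ (π y) + π y
  have hfpV : f p ∈ V := (hf.mem_iff p hpf).1 hpN
  have hπp : π (f p) = f p := Submodule.starProjection_eq_self_iff.2 hfpV
  have hπV : ∀ y, π y ∈ V := fun y => Submodule.starProjection_apply_mem _ _
  let O₁ := f.target ∩ f.symm ⁻¹' e.source
  have hO₁ : IsOpen O₁ := f.isOpen_inter_preimage_symm e.open_source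
  let O := O₁ ∩ π ⁻¹' O₁
  have hO : IsOpen O := hO₁.inter (hO₁.preimage π.continuous)
  have hp₁ : f p ∈ O₁ := ⟨f.map_source hpf, by rwa [mem_preimage, f.left_inv hpf]⟩
  have hpO : f p ∈ O := ⟨hp₁, by rwa [mem_preimage, hπp]⟩
  have hφ : ContDiffOn ℝ ∞ φ O₁ := B.contDiff.comp_contDiffOn
    (he.smooth.comp (hf.smooth_symm.mono inter_subset_left) fun y hy => hy.2)
  have hH : ContDiffOn ℝ ∞ H O :=
    ((hφ.mono inter_subset_left).sub (hφ.comp π.contDiff.contDiffOn fun y hy => hy.2)).add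
      π.contDiff.contDiffOn
  have hBinj : ∀ v, fderiv ℝ e p (fderiv ℝ f.symm (f p) (B v)) = v := by
    intro v
    simp only [B, ContinuousLinearMap.comp_apply]
    rw [hf.fderiv_symm_fderiv hpf, he.fderiv_fderiv_symm hpe]
  have hφd : HasFDerivAt φ (ContinuousLinearMap.id ℝ (Euc Q)) (f p) := by
    have h1 := ((hf.contDiffAt_symm (f.map_source hpf)).differentiableAt (by simp)).hasFDerivAt
    have h2 : HasFDerivAt e (fderiv ℝ e p) (f.symm (f p)) := by
      rw [f.left_inv hpf]
      exact ((he.contDiffAt hpe).differentiableAt (by simp)).hasFDerivAt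
    refine (B.hasFDerivAt.comp (f p) (h2.comp (f p) h1)).congr_fderiv ?_
    ext1 v
    simp only [B, ContinuousLinearMap.comp_apply]
    rw [he.fderiv_symm_fderiv hpe, hf.fderiv_fderiv_symm hpf]
    rfl
  have hHd : HasFDerivAt H (ContinuousLinearMap.id ℝ (Euc Q)) (f p) := by
    have h1 : HasFDerivAt (fun y => φ (π y)) π (f p) := by
      have h2 : HasFDerivAt φ (ContinuousLinearMap.id ℝ (Euc Q)) (π (f p)) := by rwa [hπp]
      exact (h2.comp (f p) π.hasFDerivAt).congr_fderiv (ContinuousLinearMap.id_comp _)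
    exact ((hφd.fun_sub h1).fun_add π.hasFDerivAt).congr_fderiv (by simp)
  obtain ⟨h, hhH, hph, hhO, hhs⟩ := exists_smooth_localInverse hO hH hpO hHd
  have hHV : ∀ y ∈ V, H y = y := by
    intro y hy
    have : π y = y := Submodule.starProjection_eq_self_iff.2 hy
    simp [H, this]
  let T := W.map B.toLinearMap
  have hBT : ∀ w, B w ∈ T ↔ w ∈ W := by
    intro w
    refine ⟨?_, fun hw => Submodule.mem_map_of_mem hw⟩
    rintro ⟨w', hw', hww⟩
    have h1 := congrArg (fun v => fderiv ℝ e p (fderiv ℝ f.symm (f p) v)) hww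
    simp only [ContinuousLinearMap.coe_coe, hBinj] at h1
    rwa [← h1]
  have hVT : ∀ v ∈ V, v ∈ T := by
    intro v hv
    have h1 : fderiv ℝ f.symm (f p) v ∈ tanSpace N p := by
      rw [hf.mem_tanSpace_iff hpf hpN, hf.fderiv_fderiv_symm hpf]
      exact hv
    have h2 : tanSpace N p ≤ tanSpace M p := by
      refine Submodule.span_mono ?_
      rintro v ⟨γ, h0, hγ, hd⟩
      exact ⟨γ, h0, hγ.mono fun t ht => hNM ht, hd⟩
    have h3 := (he.mem_tanSpace_iff hpe hp _).1 (h2 h1)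
    refine ⟨_, h3, ?_⟩
    simp only [B, ContinuousLinearMap.coe_coe, ContinuousLinearMap.comp_apply]
    rw [he.fderiv_symm_fderiv hpe, hf.fderiv_fderiv_symm hpf]
  have hπN : ∀ y ∈ O, f.symm (π y) ∈ N := by
    intro y hy
    have h1 := f.map_target hy.2.1
    rw [hf.mem_iff _ h1, f.right_inv hy.2.1]
    exact hπV y
  have hHM : ∀ y ∈ O, H y ∈ T ↔ f.symm y ∈ M := by
    intro y hy
    have h1 : φ (π y) ∈ T := (hBT _).2 ((he.mem_iff _ hy.2.2).1 (hNM (hπN y hy)))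
    have h2 : π y ∈ T := hVT _ (hπV y)
    rw [he.mem_iff _ hy.1.2, ← hBT]
    simp only [H]
    rw [Submodule.add_mem_iff_left _ h2, Submodule.sub_mem_iff_left _ h1]
  let g := f.trans h
  -- The source is restricted to points whose image under H stays in the domain of injectivity. If
  -- H(y) ∈ V then H(H(y)) = H(y), and injectivity gives H(y) = y, hence y ∈ V.
  have hgO := g.isOpen_inter_preimage h.open_source
  let e' := g.restrOpen _ hgO
  have hsrc : ∀ x ∈ e'.source, x ∈ f.source ∧ f x ∈ h.source ∧ H (f x) ∈ h.source := by
    intro x hx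
    refine ⟨hx.1.1, hx.1.2, ?_⟩
    have h1 := hx.2.2
    rwa [mem_preimage, OpenPartialHomeomorph.coe_trans, hhH] at h1
  have hval : ∀ x, e' x = H (f x) := by
    intro x
    rw [← hhH]
    rfl
  have hs1 : ContDiffOn ℝ ∞ e' e'.source := by
    refine ContDiffOn.congr (f := fun x => H (f x)) ?_ fun x _ => hval x
    exact hH.comp (hf.smooth.mono fun x hx => (hsrc x hx).1) fun x hx => hhO (hsrc x hx).2.1
  have hs2 : ContDiffOn ℝ ∞ e'.symm e'.target := by
    have : ContDiffOn ℝ ∞ (fun z => f.symm (h.symm z)) g.target := by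
      refine hf.smooth_symm.comp (hhs.mono fun z hz => ?_) fun z hz => ?_
      · exact hz.1
      · exact hz.2
    exact this.mono fun z hz => hz.1
  refine ⟨e', ⟨⟨hpf, hph⟩, ⟨hpf, hph⟩, ?_⟩, ⟨T, hs1, hs2, fun x hx => ?_⟩,
    Or.inl ⟨V, hs1, hs2, fun x hx => ?_⟩⟩
  · rw [mem_preimage, OpenPartialHomeomorph.coe_trans, hhH, Function.comp_apply, hHV _ hfpV]
    exact hph
  · obtain ⟨h1, h2, h3⟩ := hsrc x hx
    rw [hval, hHM _ (hhO h2), f.left_inv h1]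
  · obtain ⟨h1, h2, h3⟩ := hsrc x hx
    rw [hval, hf.mem_iff _ h1]
    refine ⟨fun hV' => by rwa [hHV _ hV'], fun hV' => ?_⟩
    have h4 : h (H (f x)) = h (f x) := by rw [hhH, hHV _ hV']
    rw [← h.injOn h3 h2 h4]
    exact hV'

/-- Moving the points of a chart radially with respect to a center. -/
theorem IsAdaptedChart.exists_isAmbientVariation {e : OpenPartialHomeomorph (Euc Q) (Euc Q)}
    (he : IsAdaptedChart M N e) {p : Euc Q} (hp : p ∈ M) (hpe : p ∈ e.source) (hK : IsCompact K)
    (hKe : K ⊆ e.source) (hpK : p ∈ N ∨ Disjoint K N) {η : Euc Q → ℝ} (hη : ContDiff ℝ ∞ η)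
    (hηK : ∀ q ∉ K, η q = 0) : ∃ G, IsAmbientVariation M N K G ∧
      velocity G = fun q => η q • fderiv ℝ e.symm (e q) (e q - e p) := by
  classical
  obtain ⟨W, hW⟩ := he.ambient
  -- In the chart, points move along lines through e p. Such motions preserve every linear subspace
  -- containing e p, hence M, and also N when p ∈ N.
  let m : ℝ → Euc Q → Euc Q := fun τ q => e q + (τ * η q) • (e q - e p)
  have hmc : ∀ q ∈ e.source, ∀ τ, ContDiffAt ℝ ∞ (fun z : ℝ × Euc Q => m z.1 z.2) (τ, q) := by
    intro q hq τ
    have h1 : ContDiffAt ℝ ∞ (fun z : ℝ × Euc Q => e z.2) (τ, q) :=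
      ContDiffAt.comp (τ, q) (hW.contDiffAt hq) contDiffAt_snd
    have h2 : ContDiffAt ℝ ∞ (fun z : ℝ × Euc Q => η z.2) (τ, q) :=
      (hη.comp contDiff_snd).contDiffAt
    exact h1.add ((contDiffAt_fst.mul h2).smul (h1.sub contDiffAt_const))
  have hO : IsOpen {z : ℝ × Euc Q | z.2 ∈ e.source ∧ m z.1 z.2 ∈ e.target} := by
    have h1 : IsOpen {z : ℝ × Euc Q | z.2 ∈ e.source} := e.open_source.preimage continuous_snd
    have h2 : ContinuousOn (fun z : ℝ × Euc Q => m z.1 z.2) {z : ℝ × Euc Q | z.2 ∈ e.source} :=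
      fun z hz => (hmc z.2 hz z.1).continuousAt.continuousWithinAt
    exact h2.isOpen_inter_preimage h1 e.open_target
  obtain ⟨u, v, hu, hv, h0u, hKv, huv⟩ := generalized_tube_lemma
    (isCompact_singleton (x := (0 : ℝ))) hK hO (by
      rintro ⟨τ, q⟩ ⟨hτ, hq⟩
      rw [mem_singleton_iff] at hτ
      subst hτ
      refine ⟨hKe hq, ?_⟩
      simpa [m] using e.map_source (hKe hq))
  obtain ⟨t₀, ht₀, htu⟩ := Metric.isOpen_iff.1 hu 0 (h0u rfl)
  -- A bounded reparametrization of time with derivative 1 at 0: the amplitude t₀/2 keeps the motion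
  -- inside the chart for all real times without altering the initial velocity.
  let θ : ℝ → ℝ := fun t => t₀ / 2 * Real.sin (2 / t₀ * t)
  have hθs : ContDiff ℝ ∞ θ := contDiff_const.mul (Real.contDiff_sin.comp
    (contDiff_const.mul contDiff_id))
  have hθ0 : θ 0 = 0 := by simp [θ]
  have hθd : HasDerivAt θ 1 0 := by
    have h1 : HasDerivAt (fun t : ℝ => 2 / t₀ * t) (2 / t₀) 0 := by
      simpa using (hasDerivAt_id (0 : ℝ)).const_mul (2 / t₀)
    refine (h1.sin.const_mul (t₀ / 2)).congr_deriv ?_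
    simp
    field_simp
  have hθu : ∀ t, θ t ∈ u := by
    intro t
    refine htu ?_
    rw [mem_ball_zero_iff, Real.norm_eq_abs, abs_mul, abs_of_pos (half_pos ht₀)]
    nlinarith [Real.abs_sin_le_one (2 / t₀ * t)]
  have htgt : ∀ q ∈ e.source, ∀ t, m (θ t) q ∈ e.target := by
    intro q hq t
    by_cases hqK : q ∈ K
    · exact (huv (show (θ t, q) ∈ u ×ˢ v from ⟨hθu t, hKv hqK⟩)).2
    · simpa [m, hηK q hqK] using e.map_source hq
  let G : ℝ → Euc Q → Euc Q := fun t q => if q ∈ e.source then e.symm (m (θ t) q) else q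
  have hGs : ∀ t, ∀ q ∈ e.source, G t q = e.symm (m (θ t) q) := fun t q hq => if_pos hq
  have hGK : ∀ t, ∀ q ∉ K, G t q = q := by
    intro t q hq
    by_cases hqe : q ∈ e.source
    · rw [hGs t q hqe]
      simpa [m, hηK q hq] using e.left_inv hqe
    · exact if_neg hqe
  have hpres : ∀ {A : Set (Euc Q)} {V : Submodule ℝ (Euc Q)}, IsStraightening e A V → p ∈ A →
      ∀ t, MapsTo (G t) A A := by
    intro A V hA hpA t q hqA
    by_cases hq : q ∈ e.source
    · rw [hGs t q hq, hA.mem_iff _ (e.map_target (htgt q hq t)), e.right_inv (htgt q hq t)]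
      have h1 := (hA.mem_iff q hq).1 hqA
      exact V.add_mem h1 (V.smul_mem _ (V.sub_mem h1 ((hA.mem_iff p hpe).1 hpA)))
    · rwa [show G t q = q from if_neg hq]
  refine ⟨G, ⟨?_, fun q => ?_, hpres hW hp, ?_, hK, hGK⟩, ?_⟩
  · rw [contDiff_iff_contDiffAt]
    rintro ⟨t, q⟩
    by_cases hq : q ∈ e.source
    · have h1 : ContDiffAt ℝ ∞ (fun z : ℝ × Euc Q => e.symm (m (θ z.1) z.2)) (t, q) := by
        have h2 : ContDiffAt ℝ ∞ (fun z : ℝ × Euc Q => m (θ z.1) z.2) (t, q) :=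
          (hmc q hq (θ t)).comp (t, q) (f := fun z : ℝ × Euc Q => (θ z.1, z.2))
            ((hθs.comp contDiff_fst).prodMk contDiff_snd).contDiffAt
        exact (hW.contDiffAt_symm (htgt q hq t)).comp (t, q) h2
      refine h1.congr_of_eventuallyEq ?_
      filter_upwards [(e.open_source.preimage continuous_snd).mem_nhds
        (show (t, q) ∈ Prod.snd ⁻¹' e.source from hq)] with z hz
      exact hGs z.1 z.2 hz
    · refine contDiffAt_snd.congr_of_eventuallyEq ?_
      filter_upwards [(hK.isClosed.isOpen_compl.preimage continuous_snd).mem_nhds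
        (show (t, q) ∈ Prod.snd ⁻¹' Kᶜ from fun h => hq (hKe h))] with z hz
      exact hGK z.1 z.2 hz
  · by_cases hq : q ∈ e.source
    · rw [hGs 0 q hq]
      simpa [m, hθ0] using e.left_inv hq
    · exact if_neg hq
  -- Either the centre lies on N, and lines through it preserve the straightened N, or nothing moves
  -- on N at all.
  · rcases hpK with hpN | hKN
    · rcases he.constraint with ⟨V, hV⟩ | hd
      · exact hpres hV hpN
      · exact absurd hpN (disjoint_left.1 hd hpe)
    · intro t q hq
      rwa [hGK t q (disjoint_right.1 hKN hq)]
  · ext1 q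
    by_cases hq : q ∈ e.source
    · have h1 : HasDerivAt (fun t => m (θ t) q) (η q • (e q - e p)) 0 := by
        refine (((hθd.mul_const (η q)).smul_const (e q - e p)).const_add (e q)).congr_deriv ?_
        simp
      have hm0 : m (θ 0) q = e q := by simp [m, hθ0]
      have h2 : HasFDerivAt e.symm (fderiv ℝ e.symm (e q)) (m (θ 0) q) := by
        rw [hm0]
        exact ((hW.contDiffAt_symm (e.map_source hq)).differentiableAt (by simp)).hasFDerivAt
      have h3 := h2.comp_hasDerivAt (0 : ℝ) h1
      have h4 : (fun t => G t q) = e.symm ∘ fun t => m (θ t) q := by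
        ext1 t
        exact hGs t q hq
      rw [velocity, h4, h3.deriv, map_smul]
    · have hqK : q ∉ K := fun h => hq (hKe h)
      simp only [velocity, hGK _ q hqK, deriv_const, hηK q hqK, zero_smul]

end AdaptedCharts

/-! ### Radial vector fields tangent to a submanifold and a constraint -/

section RadialFields

variable {Q : ℕ} {M N : Set (Euc Q)}

/-- `V` is close to the radial vector field `q ↦ q - p`, and the vector fields `η • V` generate
deformations preserving `M` and `N`. -/
structure IsRadialField (M N : Set (Euc Q)) (p : Euc Q) (r C : ℝ) (V : Euc Q → Euc Q) : Prop where
  smooth : ContDiffOn ℝ ∞ V (Metric.ball p r)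
  norm_sub_le : ∀ q ∈ Metric.ball p r, ‖V q - (q - p)‖ ≤ C * ‖q - p‖ ^ 2
  norm_fderiv_sub_le : ∀ q ∈ Metric.ball p r,
    ‖fderiv ℝ V q - ContinuousLinearMap.id ℝ (Euc Q)‖ ≤ C * ‖q - p‖
  norm_fderiv_fderiv_le : ∀ q ∈ Metric.ball p r, ‖fderiv ℝ (fderiv ℝ V) q‖ ≤ C
  variation : ∀ K ⊆ Metric.ball p r, IsCompact K → (p ∈ N ∨ Disjoint K N) →
    ∀ η : Euc Q → ℝ, ContDiff ℝ ∞ η → (∀ q ∉ K, η q = 0) →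
      ∃ G, IsAmbientVariation M N K G ∧ velocity G = fun q => η q • V q

theorem IsRadialField.mono {p : Euc Q} {r r' C C' : ℝ} {V : Euc Q → Euc Q}
    (hV : IsRadialField M N p r C V) (hr : r' ≤ r) (hC : C ≤ C') :
    IsRadialField M N p r' C' V := by
  have hb := Metric.ball_subset_ball (x := p) hr
  refine ⟨hV.smooth.mono hb, fun q hq => (hV.norm_sub_le q (hb hq)).trans ?_,
    fun q hq => (hV.norm_fderiv_sub_le q (hb hq)).trans ?_,
    fun q hq => (hV.norm_fderiv_fderiv_le q (hb hq)).trans hC,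
    fun K hK => hV.variation K (hK.trans hb)⟩
  · exact mul_le_mul_of_nonneg_right hC (by positivity)
  · exact mul_le_mul_of_nonneg_right hC (by positivity)

/-- The field is the pullback by the chart of the linear radial field centred at e p. It vanishes at
p with derivative the identity there. Its second derivative depends continuously on centre and
point, so it is bounded near (p₀, p₀), and two applications of the mean value inequality give the
other estimates uniformly in the centre. -/
theorem IsAdaptedChart.exists_isRadialField {e : OpenPartialHomeomorph (Euc Q) (Euc Q)}
    (he : IsAdaptedChart M N e) {p₀ : Euc Q} (hp₀ : p₀ ∈ e.source) :
    ∃ C > 0, ∃ r > 0, ∀ p ∈ M ∩ Metric.ball p₀ r, ∃ V, IsRadialField M N p r C V := by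
  obtain ⟨W, hW⟩ := he.ambient
  let Ψ : Euc Q → Euc Q → Euc Q := fun p q => fderiv ℝ e.symm (e q) (e q - e p)
  have hΨ : ∀ p ∈ e.source, ∀ q ∈ e.source, ContDiffAt ℝ ∞ (Function.uncurry Ψ) (p, q) := by
    intro p hp q hq
    have h1 : ContDiffAt ℝ ∞ (fun z : Euc Q × Euc Q => fderiv ℝ e.symm (e z.2)) (p, q) :=
      ContDiffAt.comp (p, q) (g := fun q => fderiv ℝ e.symm (e q)) (f := Prod.snd)
        (hW.contDiffAt_fderiv_symm hq) contDiffAt_snd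
    have h2 : ContDiffAt ℝ ∞ (fun z : Euc Q × Euc Q => e z.2) (p, q) :=
      ContDiffAt.comp (p, q) (hW.contDiffAt hq) contDiffAt_snd
    have h3 : ContDiffAt ℝ ∞ (fun z : Euc Q × Euc Q => e z.1) (p, q) :=
      ContDiffAt.comp (p, q) (hW.contDiffAt hp) contDiffAt_fst
    exact h1.clm_apply (h2.sub h3)
  have hΨ1 : ∀ p ∈ e.source, ∀ q ∈ e.source,
      ContDiffAt ℝ ∞ (fun z : Euc Q × Euc Q => fderiv ℝ (Ψ z.1) z.2) (p, q) := by
    intro p hp q hq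
    refine ContDiffAt.fderiv (f := fun (z : Euc Q × Euc Q) q' => Ψ z.1 q') (n := ∞) ?_
      contDiffAt_snd (by simp)
    exact (hΨ p hp q hq).comp ((p, q), q)
      (f := fun w : (Euc Q × Euc Q) × Euc Q => (w.1.1, w.2)) (by fun_prop)
  have hΨ2 : ContDiffAt ℝ ∞ (fun z : Euc Q × Euc Q => fderiv ℝ (fderiv ℝ (Ψ z.1)) z.2)
      (p₀, p₀) := by
    refine ContDiffAt.fderiv (f := fun (z : Euc Q × Euc Q) q' => fderiv ℝ (Ψ z.1) q') (n := ∞) ?_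
      contDiffAt_snd (by simp)
    exact (hΨ1 p₀ hp₀ p₀ hp₀).comp ((p₀, p₀), p₀)
      (f := fun w : (Euc Q × Euc Q) × Euc Q => (w.1.1, w.2)) (by fun_prop)
  set C := ‖fderiv ℝ (fderiv ℝ (Ψ p₀)) p₀‖ + 1 with hC
  have hCpos : 0 < C := by positivity
  have hev : ∀ᶠ z : Euc Q × Euc Q in 𝓝 (p₀, p₀), ‖fderiv ℝ (fderiv ℝ (Ψ z.1)) z.2‖ < C ∧
      z.1 ∈ e.source ∧ z.2 ∈ e.source := by
    have hn : ContinuousAt (fun z : Euc Q × Euc Q => ‖fderiv ℝ (fderiv ℝ (Ψ z.1)) z.2‖)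
        (p₀, p₀) := (continuous_norm (E := Euc Q →L[ℝ] Euc Q →L[ℝ] Euc Q)).continuousAt.comp
      hΨ2.continuousAt
    refine (hn.eventually (gt_mem_nhds (lt_add_one _))).and ?_
    exact (e.open_source.prod e.open_source).mem_nhds ⟨hp₀, hp₀⟩
  obtain ⟨ρ, hρ, hb⟩ := Metric.eventually_nhds_iff_ball.1 hev
  refine ⟨C, hCpos, ρ / 2, half_pos hρ, ?_⟩
  rintro p ⟨hpM, hp⟩
  have hprod : ∀ q ∈ Metric.ball p (ρ / 2), (p, q) ∈ Metric.ball (p₀, p₀) ρ := by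
    intro q hq
    rw [Metric.mem_ball] at hp hq
    rw [Metric.mem_ball, Prod.dist_eq, max_lt_iff]
    refine ⟨by linarith, ?_⟩
    linarith [dist_triangle q p p₀]
  have hps : p ∈ e.source := (hb _ (hprod p (Metric.mem_ball_self (half_pos hρ)))).2.1
  have hqs : ∀ q ∈ Metric.ball p (ρ / 2), q ∈ e.source := fun q hq => (hb _ (hprod q hq)).2.2
  have hs : ∀ q ∈ Metric.ball p (ρ / 2), ContDiffAt ℝ ∞ (Ψ p) q := by
    intro q hq
    have := (hΨ p hps q (hqs q hq)).comp q (f := fun q' => (p, q')) (by fun_prop)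
    exact this
  have hdp : fderiv ℝ (Ψ p) p = ContinuousLinearMap.id ℝ (Euc Q) := by
    have h1 := ((hW.contDiffAt_fderiv_symm hps).differentiableAt (by simp)).hasFDerivAt
    have h2 := ((hW.contDiffAt hps).differentiableAt (by simp)).hasFDerivAt.sub_const (e p)
    have h3 := (h1.clm_apply h2).fderiv
    refine h3.trans ?_
    ext1 v
    simp only [sub_self, map_zero, add_zero, ContinuousLinearMap.comp_apply]
    exact hW.fderiv_symm_fderiv hps v
  have hd2 : ∀ q ∈ Metric.ball p (ρ / 2), ‖fderiv ℝ (fderiv ℝ (Ψ p)) q‖ ≤ C :=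
    fun q hq => (hb _ (hprod q hq)).1.le
  have hd1 : ∀ q ∈ Metric.ball p (ρ / 2),
      ‖fderiv ℝ (Ψ p) q - ContinuousLinearMap.id ℝ (Euc Q)‖ ≤ C * ‖q - p‖ := by
    intro q hq
    rw [← hdp]
    exact (convex_ball p (ρ / 2)).norm_image_sub_le_of_norm_fderiv_le (f := fderiv ℝ (Ψ p))
      (fun z hz => ((hs z hz).fderiv_right (m := ∞) (by simp)).differentiableAt (by simp))
      hd2 (Metric.mem_ball_self (half_pos hρ)) hq
  refine ⟨Ψ p, fun q hq => (hs q hq).contDiffWithinAt, fun q hq => ?_, hd1, hd2, ?_⟩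
  · have hsub : Metric.closedBall p ‖q - p‖ ⊆ Metric.ball p (ρ / 2) := by
      refine Metric.closedBall_subset_ball ?_
      rwa [← dist_eq_norm]
    have h1 := (convex_closedBall p ‖q - p‖).norm_image_sub_le_of_norm_hasFDerivWithin_le
      (f := fun z => Ψ p z - z) (C := C * ‖q - p‖)
      (f' := fun z => fderiv ℝ (Ψ p) z - ContinuousLinearMap.id ℝ (Euc Q))
      (fun z hz => (((hs z (hsub hz)).differentiableAt (by simp)).hasFDerivAt.fun_sub
        (hasFDerivAt_id z)).hasFDerivWithinAt)
      (fun z hz => (hd1 z (hsub hz)).trans (mul_le_mul_of_nonneg_left (by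
        rw [← dist_eq_norm]
        exact hz) hCpos.le))
      (Metric.mem_closedBall_self (norm_nonneg _))
      (show q ∈ Metric.closedBall p ‖q - p‖ by rw [Metric.mem_closedBall, dist_eq_norm])
    have h2 : Ψ p p = 0 := by simp [Ψ]
    rw [h2] at h1
    calc ‖Ψ p q - (q - p)‖ = ‖Ψ p q - q - (0 - p)‖ := by congr 1; abel
      _ ≤ C * ‖q - p‖ * ‖q - p‖ := h1
      _ = C * ‖q - p‖ ^ 2 := by ring
  · intro K hK hKc hpK η hη hηK
    exact he.exists_isAmbientVariation hpM hps hKc (fun q hq => hqs q (hK hq)) hpK hη hηK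

theorem exists_isRadialField {m n : ℕ} (hMc : IsCompact M) (hM : IsSmoothSubmanifold m M)
    (hN : IsSmoothSubmanifold n N) (hNc : IsClosed N) (hNM : N ⊆ M) :
    ∃ C > 0, ∃ r > 0, ∀ p ∈ M, ∃ V, IsRadialField M N p r C V := by
  have h := hMc.induction_on (p := fun s => ∃ C > 0, ∃ r > 0, ∀ p ∈ M ∩ s, ∃ V,
    IsRadialField M N p r C V) ⟨1, one_pos, 1, one_pos, by simp⟩
    (fun s t hst ⟨C, hC, r, hr, h⟩ => ⟨C, hC, r, hr, fun p hp => h p ⟨hp.1, hst hp.2⟩⟩) ?_ ?_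
  · obtain ⟨C, hC, r, hr, h⟩ := h
    exact ⟨C, hC, r, hr, fun p hp => h p ⟨hp, hp⟩⟩
  · rintro s t ⟨C, hC, r, hr, h⟩ ⟨C', hC', r', hr', h'⟩
    refine ⟨max C C', lt_max_of_lt_left hC, min r r', lt_min hr hr', ?_⟩
    rintro p ⟨hpM, hp | hp⟩
    · obtain ⟨V, hV⟩ := h p ⟨hpM, hp⟩
      exact ⟨V, hV.mono (min_le_left _ _) (le_max_left _ _)⟩
    · obtain ⟨V, hV⟩ := h' p ⟨hpM, hp⟩
      exact ⟨V, hV.mono (min_le_right _ _) (le_max_right _ _)⟩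
  · intro p₀ hp₀
    obtain ⟨e, hpe, he⟩ := exists_isAdaptedChart hM hN hNc hNM hp₀
    obtain ⟨C, hC, r, hr, h⟩ := he.exists_isRadialField hpe
    exact ⟨Metric.ball p₀ r, mem_nhdsWithin_of_mem_nhds (Metric.ball_mem_nhds _ hr),
      C, hC, r, hr, h⟩

end RadialFields

/-! ### Cutoff functions -/

section Cutoff

/-- In the variable u = ρ²/r² the plateau [0, 1/3] contains the values u ≤ 1/4 reached on B_s when
2s ≤ r, and the support ends at 2/3, strictly inside B_r. -/
theorem exists_cutoff : ∃ χ : ℝ → ℝ, ContDiff ℝ ∞ χ ∧ (∀ u, 0 ≤ χ u) ∧ (∀ u, χ u ≤ 1) ∧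
    (∀ u ≤ 1 / 3, χ u = 1) ∧ (∀ u ≥ 2 / 3, χ u = 0) ∧ (∀ u, deriv χ u ≤ 0) ∧
    (∀ u > 2 / 3, deriv χ u = 0 ∧ deriv (deriv χ) u = 0) ∧
    ∃ c > 0, ∀ u, |deriv χ u| ≤ c ∧ |deriv (deriv χ) u| ≤ c := by
  let χ : ℝ → ℝ := fun u => Real.smoothTransition (2 - 3 * u)
  have hs : ContDiff ℝ ∞ χ := Real.smoothTransition.contDiff.comp (by fun_prop)
  have h1 : ∀ u ≤ 1 / 3, χ u = 1 := fun u hu =>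
    Real.smoothTransition.one_of_one_le (by linarith)
  have h0 : ∀ u ≥ 2 / 3, χ u = 0 := fun u hu =>
    Real.smoothTransition.zero_of_nonpos (by linarith)
  have hanti : Antitone χ := fun a b hab => Real.smoothTransition.monotone (by linarith)
  have hd0 : ∀ u > 2 / 3, deriv χ u = 0 := by
    intro u hu
    have : χ =ᶠ[𝓝 u] fun _ => 0 := by
      filter_upwards [lt_mem_nhds hu] with v hv
      exact h0 v hv.le
    rw [this.deriv_eq, deriv_const]
  have hd1 : ∀ u < 1 / 3, deriv χ u = 0 := by
    intro u hu
    have : χ =ᶠ[𝓝 u] fun _ => 1 := by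
      filter_upwards [gt_mem_nhds hu] with v hv
      exact h1 v hv.le
    rw [this.deriv_eq, deriv_const]
  have hdd : ∀ u, (2 / 3 < u ∨ u < 1 / 3) → deriv (deriv χ) u = 0 := by
    intro u hu
    have : deriv χ =ᶠ[𝓝 u] fun _ => 0 := by
      rcases hu with hu | hu
      · filter_upwards [lt_mem_nhds hu] with v hv
        exact hd0 v hv
      · filter_upwards [gt_mem_nhds hu] with v hv
        exact hd1 v hv
    rw [this.deriv_eq, deriv_const]
  have hc1 : ContDiff ℝ ∞ (deriv χ) := (contDiff_infty_iff_deriv.1 hs).2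
  have hc2 : ContDiff ℝ ∞ (deriv (deriv χ)) := (contDiff_infty_iff_deriv.1 hc1).2
  obtain ⟨c₁, hc₁⟩ := (isCompact_Icc (a := (1 / 3 : ℝ)) (b := 2 / 3)).exists_bound_of_continuousOn
    hc1.continuous.continuousOn
  obtain ⟨c₂, hc₂⟩ := (isCompact_Icc (a := (1 / 3 : ℝ)) (b := 2 / 3)).exists_bound_of_continuousOn
    hc2.continuous.continuousOn
  refine ⟨χ, hs, fun u => Real.smoothTransition.nonneg _, fun u => Real.smoothTransition.le_one _,
    h1, h0, fun u => hanti.deriv_nonpos, fun u hu => ⟨hd0 u hu, hdd u (Or.inl hu)⟩,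
    max (max c₁ c₂) 1, lt_max_of_lt_right one_pos, fun u => ?_⟩
  by_cases hu : u ∈ Icc (1 / 3 : ℝ) (2 / 3)
  · exact ⟨(hc₁ u hu).trans ((le_max_left _ _).trans (le_max_left _ _)),
      (hc₂ u hu).trans ((le_max_right _ _).trans (le_max_left _ _))⟩
  · have hu' : 2 / 3 < u ∨ u < 1 / 3 := by
      rw [mem_Icc, not_and_or, not_le, not_le] at hu
      exact hu.symm
    have hz : deriv χ u = 0 := by
      rcases hu' with h | h
      · exact hd0 u h
      · exact hd1 u h
    rw [hz, hdd u hu', abs_zero]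
    have : (0 : ℝ) ≤ max (max c₁ c₂) 1 := le_max_of_le_right zero_le_one
    exact ⟨this, this⟩

/-- The truncation at scale `r` of `u ↦ (u + s²)⁻¹`, with bounds for its derivatives. -/
theorem exists_radial_weight : ∃ c > 0, ∀ r s : ℝ, 0 < s → 2 * s ≤ r →
    ∃ h h₁ h₂ : ℝ → ℝ, (∀ u, 0 ≤ u → HasDerivAt h (h₁ u) u ∧ HasDerivAt h₁ (h₂ u) u) ∧
      (∀ u, 0 ≤ u → ContDiffAt ℝ ∞ h u) ∧
      (∀ u, 2 / 3 * r ^ 2 ≤ u → h u = 0) ∧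
      (∀ u, 0 ≤ u → 0 ≤ h u ∧ h u ≤ (u + s ^ 2)⁻¹ ∧ |h₁ u| ≤ c * (u + s ^ 2)⁻¹ ^ 2 ∧
        |h₂ u| ≤ c * (u + s ^ 2)⁻¹ ^ 3) ∧
      (∀ u, 0 ≤ u → ∀ τ, 0 ≤ τ → τ ≤ u → - (c / r ^ 2) ≤ 2 * h u + 2 * h₁ u * τ) ∧
      (∀ u, 0 ≤ u → u ≤ s ^ 2 → ∀ τ, 0 ≤ τ → τ ≤ u →
        1 / (2 * s ^ 2) - c / r ^ 2 ≤ 2 * h u + 2 * h₁ u * τ) := by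
  obtain ⟨χ, hs, h0, h1, hin, hout, hneg, hdout, c, hc, hb⟩ := exists_cutoff
  -- The constant is dictated by the second derivative of the weight: the three terms of the product
  -- rule contribute 4c, 4c and 2.
  refine ⟨8 * c + 2, by positivity, fun r s hs0 hsr => ?_⟩
  have hr : 0 < r := by linarith
  have hr2 : 0 < r ^ 2 := by positivity
  have hs2 : 0 < s ^ 2 := by positivity
  have hd : Differentiable ℝ χ := hs.differentiable (by simp)
  have hdd : Differentiable ℝ (deriv χ) := (contDiff_infty_iff_deriv.1 hs).2.differentiable (by simp)
  let h : ℝ → ℝ := fun u => χ (u / r ^ 2) * (u + s ^ 2)⁻¹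
  let h₁ : ℝ → ℝ := fun u => deriv χ (u / r ^ 2) / r ^ 2 * (u + s ^ 2)⁻¹
    - χ (u / r ^ 2) * (u + s ^ 2)⁻¹ ^ 2
  let h₂ : ℝ → ℝ := fun u => deriv (deriv χ) (u / r ^ 2) / r ^ 2 / r ^ 2 * (u + s ^ 2)⁻¹
    - 2 * (deriv χ (u / r ^ 2) / r ^ 2) * (u + s ^ 2)⁻¹ ^ 2 + 2 * χ (u / r ^ 2) * (u + s ^ 2)⁻¹ ^ 3
  have hk : ∀ u, 0 ≤ u → 0 < (u + s ^ 2)⁻¹ := fun u hu => by positivity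
  -- Where the cutoff is active, u + s² ≤ 2r², so each factor r⁻² produced by differentiating the
  -- cutoff can be traded for 2(u + s²)⁻¹.
  have hkr : ∀ u, 0 ≤ u → u / r ^ 2 ≤ 2 / 3 → (r ^ 2)⁻¹ ≤ 2 * (u + s ^ 2)⁻¹ := by
    intro u hu hur
    rw [div_le_iff₀ hr2] at hur
    have h2 : u + s ^ 2 ≤ 2 * r ^ 2 := by nlinarith
    have h3 : (2 * r ^ 2)⁻¹ ≤ (u + s ^ 2)⁻¹ := inv_anti₀ (by positivity) h2
    rw [mul_inv] at h3
    linarith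
  have hD1 : ∀ u, 0 ≤ u → |deriv χ (u / r ^ 2)| * (r ^ 2)⁻¹ ≤ 2 * c * (u + s ^ 2)⁻¹ := by
    intro u hu
    have hku := hk u hu
    by_cases hur : u / r ^ 2 ≤ 2 / 3
    · calc |deriv χ (u / r ^ 2)| * (r ^ 2)⁻¹ ≤ c * (2 * (u + s ^ 2)⁻¹) :=
          mul_le_mul (hb _).1 (hkr u hu hur) (by positivity) hc.le
        _ = _ := by ring
    · rw [(hdout _ (not_le.1 hur)).1, abs_zero, zero_mul]
      positivity
  have hD2 : ∀ u, 0 ≤ u →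
      |deriv (deriv χ) (u / r ^ 2)| * (r ^ 2)⁻¹ * (r ^ 2)⁻¹ ≤ 4 * c * (u + s ^ 2)⁻¹ ^ 2 := by
    intro u hu
    have hku := hk u hu
    by_cases hur : u / r ^ 2 ≤ 2 / 3
    · have h2 := hkr u hu hur
      calc |deriv (deriv χ) (u / r ^ 2)| * (r ^ 2)⁻¹ * (r ^ 2)⁻¹
          ≤ c * (2 * (u + s ^ 2)⁻¹) * (2 * (u + s ^ 2)⁻¹) :=
          mul_le_mul (mul_le_mul (hb _).2 h2 (by positivity) hc.le) h2 (by positivity)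
            (by positivity)
        _ = _ := by ring
    · rw [(hdout _ (not_le.1 hur)).2, abs_zero, zero_mul, zero_mul]
      positivity
  have hχ : ∀ u, HasDerivAt (fun u => χ (u / r ^ 2)) (deriv χ (u / r ^ 2) / r ^ 2) u := by
    intro u
    refine ((hd _).hasDerivAt.comp u ((hasDerivAt_id u).div_const (r ^ 2))).congr_deriv ?_
    simp [div_eq_mul_inv]
  have hχ' : ∀ u, HasDerivAt (fun u => deriv χ (u / r ^ 2) / r ^ 2)
      (deriv (deriv χ) (u / r ^ 2) / r ^ 2 / r ^ 2) u := by
    intro u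
    refine (((hdd _).hasDerivAt.comp u
      ((hasDerivAt_id u).div_const (r ^ 2))).div_const (r ^ 2)).congr_deriv ?_
    simp [div_eq_mul_inv]
  have hinv : ∀ u, 0 ≤ u → HasDerivAt (fun u => (u + s ^ 2)⁻¹) (-(u + s ^ 2)⁻¹ ^ 2) u := by
    intro u hu
    refine (((hasDerivAt_id u).add_const (s ^ 2)).inv (by simp; positivity)).congr_deriv ?_
    simp [div_eq_mul_inv]
  -- Here τ stands for the squared length of the projection of q - p to a 2-plane. The part of h₁
  -- from the kernel is nonpositive, so τ = u is the worst case, and then it cancels against h up to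
  -- χ s² (u + s²)⁻². The part from the cutoff is bounded by c/r².
  have hlow : ∀ u, 0 ≤ u → ∀ τ, 0 ≤ τ → τ ≤ u →
      2 * χ (u / r ^ 2) * s ^ 2 * (u + s ^ 2)⁻¹ ^ 2 - 2 * c / r ^ 2
        ≤ 2 * h u + 2 * h₁ u * τ := by
    intro u hu τ hτ hτu
    have hku := hk u hu
    have huk : u * (u + s ^ 2)⁻¹ ≤ 1 := by
      rw [← div_eq_mul_inv, div_le_one (by positivity)]
      linarith
    have e1 : χ (u / r ^ 2) * (u + s ^ 2)⁻¹ - χ (u / r ^ 2) * (u + s ^ 2)⁻¹ ^ 2 * u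
        = χ (u / r ^ 2) * s ^ 2 * (u + s ^ 2)⁻¹ ^ 2 := by
      field_simp
      ring
    have e2 : χ (u / r ^ 2) * (u + s ^ 2)⁻¹ ^ 2 * τ ≤ χ (u / r ^ 2) * (u + s ^ 2)⁻¹ ^ 2 * u :=
      mul_le_mul_of_nonneg_left hτu (mul_nonneg (h0 _) (by positivity))
    have e3 : -(c / r ^ 2) ≤ deriv χ (u / r ^ 2) / r ^ 2 * (u + s ^ 2)⁻¹ * τ := by
      have h2 : (u + s ^ 2)⁻¹ * τ ≤ 1 := by nlinarith
      have h3 : 0 ≤ (u + s ^ 2)⁻¹ * τ := by positivity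
      have h4 : -(c / r ^ 2) ≤ deriv χ (u / r ^ 2) / r ^ 2 := by
        rw [← neg_div]
        exact div_le_div_of_nonneg_right (abs_le.1 (hb _).1).1 hr2.le
      have h5 : deriv χ (u / r ^ 2) / r ^ 2 ≤ 0 := div_nonpos_of_nonpos_of_nonneg (hneg _) hr2.le
      nlinarith
    have e4 : 2 * c / r ^ 2 = 2 * (c / r ^ 2) := by ring
    simp only [h, h₁]
    rw [e4]
    linarith
  refine ⟨h, h₁, h₂, fun u hu => ⟨?_, ?_⟩, fun u hu => ?_, fun u hu => ?_,
    fun u hu => ⟨?_, ?_, ?_, ?_⟩, fun u hu τ hτ hτu => ?_, fun u hu hus τ hτ hτu => ?_⟩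
  · refine ((hχ u).mul (hinv u hu)).congr_deriv ?_
    simp only [h₁]
    ring
  · refine (((hχ' u).mul (hinv u hu)).fun_sub ((hχ u).mul ((hinv u hu).pow 2))).congr_deriv ?_
    simp only [h₂, Pi.pow_apply]
    push_cast
    ring
  · have h2 : ContDiffAt ℝ ∞ (fun u => χ (u / r ^ 2)) u :=
      (hs.comp (contDiff_id.div_const _)).contDiffAt
    exact h2.mul ((contDiffAt_id.add contDiffAt_const).inv (by simp; positivity))
  · have h2 : 2 / 3 ≤ u / r ^ 2 := by rwa [le_div_iff₀ hr2]
    simp [h, hout _ h2]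
  · exact mul_nonneg (h0 _) (hk u hu).le
  · exact mul_le_of_le_one_left (hk u hu).le (h1 _)
  · have hku := hk u hu
    have h2 := hD1 u hu
    calc |h₁ u| ≤ |deriv χ (u / r ^ 2) / r ^ 2 * (u + s ^ 2)⁻¹|
          + |χ (u / r ^ 2) * (u + s ^ 2)⁻¹ ^ 2| := abs_sub _ _
      _ = |deriv χ (u / r ^ 2)| * (r ^ 2)⁻¹ * (u + s ^ 2)⁻¹
          + χ (u / r ^ 2) * (u + s ^ 2)⁻¹ ^ 2 := by
        rw [abs_mul, abs_div, abs_of_pos hr2, abs_of_pos hku, abs_mul, abs_of_nonneg (h0 _),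
          abs_of_pos (pow_pos hku 2), div_eq_mul_inv]
      _ ≤ 2 * c * (u + s ^ 2)⁻¹ * (u + s ^ 2)⁻¹ + 1 * (u + s ^ 2)⁻¹ ^ 2 :=
        add_le_add (mul_le_mul_of_nonneg_right h2 hku.le)
          (mul_le_mul_of_nonneg_right (h1 _) (by positivity))
      _ ≤ _ := by nlinarith [pow_pos hku 2, mul_pos hc (pow_pos hku 2)]
  · have hku := hk u hu
    have h2 := hD1 u hu
    have h3 := hD2 u hu
    calc |h₂ u| ≤ |deriv (deriv χ) (u / r ^ 2) / r ^ 2 / r ^ 2 * (u + s ^ 2)⁻¹|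
          + |2 * (deriv χ (u / r ^ 2) / r ^ 2) * (u + s ^ 2)⁻¹ ^ 2|
          + |2 * χ (u / r ^ 2) * (u + s ^ 2)⁻¹ ^ 3| :=
          (abs_add_le _ _).trans (add_le_add_left (abs_sub _ _) _)
      _ = |deriv (deriv χ) (u / r ^ 2)| * (r ^ 2)⁻¹ * (r ^ 2)⁻¹ * (u + s ^ 2)⁻¹
          + 2 * (|deriv χ (u / r ^ 2)| * (r ^ 2)⁻¹) * (u + s ^ 2)⁻¹ ^ 2
          + 2 * χ (u / r ^ 2) * (u + s ^ 2)⁻¹ ^ 3 := by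
        rw [abs_mul, abs_div, abs_div, abs_of_pos hr2, abs_of_pos hku, abs_mul, abs_mul, abs_mul,
          abs_mul, abs_div, abs_of_nonneg (h0 _), abs_of_pos (pow_pos hku 3), abs_of_pos hr2,
          abs_of_pos (pow_pos hku 2), abs_of_pos (two_pos : (0 : ℝ) < 2)]
        simp only [div_eq_mul_inv]
      _ ≤ 4 * c * (u + s ^ 2)⁻¹ ^ 2 * (u + s ^ 2)⁻¹
          + 2 * (2 * c * (u + s ^ 2)⁻¹) * (u + s ^ 2)⁻¹ ^ 2
          + 2 * 1 * (u + s ^ 2)⁻¹ ^ 3 := by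
        gcongr
        exact h1 _
      _ = _ := by ring
  · have h2 := hlow u hu τ hτ hτu
    have h3 : 0 ≤ 2 * χ (u / r ^ 2) * s ^ 2 * (u + s ^ 2)⁻¹ ^ 2 := by
      have := h0 (u / r ^ 2)
      positivity
    have h4 : 2 * c / r ^ 2 ≤ (8 * c + 2) / r ^ 2 :=
      div_le_div_of_nonneg_right (by linarith) hr2.le
    linarith
  · have h2 := hlow u hu τ hτ hτu
    have h3 : u / r ^ 2 ≤ 1 / 3 := by
      rw [div_le_iff₀ hr2]
      nlinarith
    rw [hin _ h3] at h2
    have h4 : 2 * c / r ^ 2 ≤ (8 * c + 2) / r ^ 2 :=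
      div_le_div_of_nonneg_right (by linarith) hr2.le
    -- For u ≤ s² the denominator is at most 2s², so 2s²(u + s²)⁻² is at least 2s²/(4s⁴).
    have h5 : 1 / (2 * s ^ 2) ≤ 2 * 1 * s ^ 2 * (u + s ^ 2)⁻¹ ^ 2 := by
      have h6 : (2 * s ^ 2)⁻¹ ≤ (u + s ^ 2)⁻¹ := inv_anti₀ (by positivity) (by linarith)
      have h7 : (2 * s ^ 2)⁻¹ ^ 2 ≤ (u + s ^ 2)⁻¹ ^ 2 := pow_le_pow_left₀ (by positivity) h6 2
      calc 1 / (2 * s ^ 2) = 2 * 1 * s ^ 2 * (2 * s ^ 2)⁻¹ ^ 2 := by field_simp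
        _ ≤ _ := mul_le_mul_of_nonneg_left h7 (by positivity)
    linarith

end Cutoff

/-! ### Truncated radial deformations -/

section RadialDeformations

variable {Q : ℕ}

/-- The inverse of the regularized distance `√(|q - p|² + s²)`. -/
def radialWeight (p : Euc Q) (s : ℝ) (q : Euc Q) : ℝ := (Real.sqrt (‖q - p‖ ^ 2 + s ^ 2))⁻¹

theorem radialWeight_pos (p : Euc Q) {s : ℝ} (hs : 0 < s) (q : Euc Q) :
    0 < radialWeight p s q := by
  rw [radialWeight]
  positivity

theorem radialWeight_sq (p : Euc Q) (s : ℝ) (q : Euc Q) :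
    radialWeight p s q ^ 2 = (‖q - p‖ ^ 2 + s ^ 2)⁻¹ := by
  rw [radialWeight, inv_pow, Real.sq_sqrt (by positivity)]

theorem radialWeight_le (p : Euc Q) {s : ℝ} (hs : 0 < s) (q : Euc Q) :
    radialWeight p s q ≤ s⁻¹ :=
  inv_anti₀ hs (Real.le_sqrt_of_sq_le (by nlinarith [sq_nonneg ‖q - p‖]))

theorem norm_mul_radialWeight_le (p : Euc Q) (s : ℝ) (q : Euc Q) :
    ‖q - p‖ * radialWeight p s q ≤ 1 := by
  rw [radialWeight, ← div_eq_mul_inv]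
  exact div_le_one_of_le₀ (Real.le_sqrt_of_sq_le (by nlinarith [sq_nonneg s])) (Real.sqrt_nonneg _)

theorem continuous_radialWeight (p : Euc Q) {s : ℝ} (hs : 0 < s) :
    Continuous (radialWeight p s) := by
  have h1 : Continuous fun q : Euc Q => Real.sqrt (‖q - p‖ ^ 2 + s ^ 2) := by fun_prop
  exact h1.inv₀ fun q => by positivity

/-- At scales at most 1 the weight is bounded below, so lower powers of it are absorbed into higher
ones throughout the estimates. -/
theorem half_le_radialWeight {p q : Euc Q} {s : ℝ} (hs : 0 < s) (hs1 : s ≤ 1)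
    (hq : ‖q - p‖ ≤ 1) : 1 / 2 ≤ radialWeight p s q := by
  rw [radialWeight, one_div]
  refine inv_anti₀ (by positivity) ?_
  rw [Real.sqrt_le_iff]
  refine ⟨by norm_num, ?_⟩
  nlinarith [norm_nonneg (q - p)]

/-- The real inner product as a continuous bilinear map. -/
def innerCLM (Q : ℕ) : Euc Q →L[ℝ] Euc Q →L[ℝ] ℝ :=
  LinearMap.mkContinuous₂ (innerₗ (Euc Q)) 1 fun x y => by
    simpa using norm_inner_le_norm (𝕜 := ℝ) x y

theorem innerCLM_apply (x y : Euc Q) : innerCLM Q x y = ⟪x, y⟫_ℝ := rfl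

theorem norm_innerCLM_apply_le (x : Euc Q) : ‖innerCLM Q x‖ ≤ ‖x‖ :=
  ContinuousLinearMap.opNorm_le_bound _ (norm_nonneg _) fun y => norm_inner_le_norm x y

theorem hasFDerivAt_norm_sub_sq (p q : Euc Q) :
    HasFDerivAt (fun q => ‖q - p‖ ^ 2) ((2 : ℝ) • innerCLM Q (q - p)) q := by
  refine (((hasFDerivAt_id q).sub_const p).norm_sq).congr_fderiv ?_
  ext1 v
  simp [innerCLM_apply]

/-- Bounds for the first two derivatives of a radial function. -/
theorem radial_function_bounds {h h₁ h₂ : ℝ → ℝ}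
    (hd : ∀ u, 0 ≤ u → HasDerivAt h (h₁ u) u ∧ HasDerivAt h₁ (h₂ u) u) (p q : Euc Q) :
    fderiv ℝ (fun q => h (‖q - p‖ ^ 2)) q = (2 * h₁ (‖q - p‖ ^ 2)) • innerCLM Q (q - p) ∧
      ‖fderiv ℝ (fderiv ℝ fun q => h (‖q - p‖ ^ 2)) q‖ ≤
        2 * |h₁ (‖q - p‖ ^ 2)| + 4 * |h₂ (‖q - p‖ ^ 2)| * ‖q - p‖ ^ 2 := by
  have e1 : ∀ q, HasFDerivAt (fun q => h (‖q - p‖ ^ 2))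
      ((2 * h₁ (‖q - p‖ ^ 2)) • innerCLM Q (q - p)) q := by
    intro q
    refine ((hd _ (sq_nonneg _)).1.comp_hasFDerivAt q
      (hasFDerivAt_norm_sub_sq p q)).congr_fderiv ?_
    rw [smul_smul, mul_comm]
  refine ⟨(e1 q).fderiv, ?_⟩
  have e2 : (fderiv ℝ fun q => h (‖q - p‖ ^ 2))
      = fun q => (2 * h₁ (‖q - p‖ ^ 2)) • innerCLM Q (q - p) := funext fun q => (e1 q).fderiv
  have e3 : HasFDerivAt (fun q => 2 * h₁ (‖q - p‖ ^ 2))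
      ((4 * h₂ (‖q - p‖ ^ 2)) • innerCLM Q (q - p)) q := by
    refine (((hd _ (sq_nonneg _)).2.comp_hasFDerivAt q
      (hasFDerivAt_norm_sub_sq p q)).const_mul 2).congr_fderiv ?_
    rw [smul_smul, smul_smul]
    congr 1
    ring
  have e4 : HasFDerivAt (fun q => innerCLM Q (q - p)) (innerCLM Q) q :=
    ((innerCLM Q).hasFDerivAt.comp q ((hasFDerivAt_id q).sub_const p)).congr_fderiv
      (ContinuousLinearMap.comp_id _)
  rw [e2, (e3.fun_smul e4).fderiv]
  refine ContinuousLinearMap.opNorm_le_bound _ (by positivity) fun v => ?_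
  have n1 := norm_innerCLM_apply_le (q - p)
  have n2 := norm_innerCLM_apply_le v
  have n3 := (innerCLM Q (q - p)).le_of_opNorm_le n1 v
  simp only [add_apply, smul_apply, ContinuousLinearMap.smulRight_apply, smul_eq_mul]
  calc ‖(2 * h₁ (‖q - p‖ ^ 2)) • innerCLM Q v
        + (4 * h₂ (‖q - p‖ ^ 2) * innerCLM Q (q - p) v) • innerCLM Q (q - p)‖
      ≤ ‖(2 * h₁ (‖q - p‖ ^ 2)) • innerCLM Q v‖
        + ‖(4 * h₂ (‖q - p‖ ^ 2) * innerCLM Q (q - p) v) • innerCLM Q (q - p)‖ := norm_add_le _ _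
    _ = 2 * |h₁ (‖q - p‖ ^ 2)| * ‖innerCLM Q v‖
        + 4 * |h₂ (‖q - p‖ ^ 2)| * ‖innerCLM Q (q - p) v‖ * ‖innerCLM Q (q - p)‖ := by
      simp only [norm_smul, norm_mul, Real.norm_eq_abs, Nat.abs_ofNat]
    _ ≤ 2 * |h₁ (‖q - p‖ ^ 2)| * ‖v‖
        + 4 * |h₂ (‖q - p‖ ^ 2)| * (‖q - p‖ * ‖v‖) * ‖q - p‖ := by gcongr
    _ = _ := by ring

/-- Bounds for the first two derivatives of `η • V`. -/
theorem norm_fderiv_fderiv_smul_le {η : Euc Q → ℝ} {V : Euc Q → Euc Q} {q : Euc Q}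
    (hη : ContDiff ℝ ∞ η) (hV : ContDiffAt ℝ ∞ V q) :
    fderiv ℝ (fun q => η q • V q) q = η q • fderiv ℝ V q + (fderiv ℝ η q).smulRight (V q) ∧
      ‖fderiv ℝ (fderiv ℝ fun q => η q • V q) q‖ ≤ |η q| * ‖fderiv ℝ (fderiv ℝ V) q‖
        + 2 * (‖fderiv ℝ η q‖ * ‖fderiv ℝ V q‖) + ‖fderiv ℝ (fderiv ℝ η) q‖ * ‖V q‖ := by
  have hηd := hη.differentiable (by simp)
  have h1 : ∀ q, DifferentiableAt ℝ V q → fderiv ℝ (fun q => η q • V q) q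
      = η q • fderiv ℝ V q + (fderiv ℝ η q).smulRight (V q) := fun q hq =>
    ((hηd q).hasFDerivAt.fun_smul hq.hasFDerivAt).fderiv
  refine ⟨h1 q (hV.differentiableAt (by simp)), ?_⟩
  have hev : (fderiv ℝ fun q => η q • V q) =ᶠ[𝓝 q] fun q => η q • fderiv ℝ V q
      + ContinuousLinearMap.smulRightL ℝ (Euc Q) (Euc Q) (fderiv ℝ η q) (V q) := by
    have h2 : ∀ᶠ z in 𝓝 q, ContDiffAt ℝ 1 V z :=
      (hV.of_le ENat.LEInfty.out).eventually (by simp)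
    filter_upwards [h2] with z hz
    exact h1 z (hz.differentiableAt (by simp))
  have h3 := ((hηd q).hasFDerivAt.fun_smul
    ((hV.fderiv_right (m := ∞) (by simp)).differentiableAt (by simp)).hasFDerivAt).fun_add
      (ContinuousLinearMap.hasFDerivAt_of_bilinear
        (ContinuousLinearMap.smulRightL ℝ (Euc Q) (Euc Q))
        (((hη.fderiv_right (m := ∞) (by simp)).differentiable (by simp) q).hasFDerivAt)
        ((hV.differentiableAt (by simp)).hasFDerivAt))
  rw [hev.fderiv_eq, h3.fderiv]
  refine ContinuousLinearMap.opNorm_le_bound _ (by positivity) fun v => ?_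
  have n1 := (fderiv ℝ (fderiv ℝ V) q).le_opNorm v
  have n2 := (fderiv ℝ η q).le_opNorm v
  have n3 := (fderiv ℝ V q).le_opNorm v
  have n4 := (fderiv ℝ (fderiv ℝ η) q).le_opNorm v
  refine (norm_add_le _ _).trans ((add_le_add (norm_add_le _ _) (norm_add_le _ _)).trans ?_)
  have m1 : ‖(η q • fderiv ℝ (fderiv ℝ V) q) v‖ = |η q| * ‖fderiv ℝ (fderiv ℝ V) q v‖ := by
    rw [smul_apply, norm_smul, Real.norm_eq_abs]
  have m2 : ‖((fderiv ℝ η q).smulRight (fderiv ℝ V q)) v‖ = ‖fderiv ℝ η q v‖ * ‖fderiv ℝ V q‖ := by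
    rw [ContinuousLinearMap.smulRight_apply, norm_smul]
  have m3 : ‖(ContinuousLinearMap.precompR (Euc Q)
      (ContinuousLinearMap.smulRightL ℝ (Euc Q) (Euc Q)) (fderiv ℝ η q)) (fderiv ℝ V q) v‖
      = ‖fderiv ℝ η q‖ * ‖fderiv ℝ V q v‖ := ContinuousLinearMap.norm_smulRight_apply _ _
  have m4 : ‖(ContinuousLinearMap.precompL (Euc Q)
      (ContinuousLinearMap.smulRightL ℝ (Euc Q) (Euc Q)) (fderiv ℝ (fderiv ℝ η) q)) (V q) v‖
      = ‖fderiv ℝ (fderiv ℝ η) q v‖ * ‖V q‖ := ContinuousLinearMap.norm_smulRight_apply _ _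
  refine (add_le_add (add_le_add m1.le m2.le) (add_le_add m3.le m4.le)).trans ?_
  calc |η q| * ‖fderiv ℝ (fderiv ℝ V) q v‖ + ‖fderiv ℝ η q v‖ * ‖fderiv ℝ V q‖
        + (‖fderiv ℝ η q‖ * ‖fderiv ℝ V q v‖ + ‖fderiv ℝ (fderiv ℝ η) q v‖ * ‖V q‖)
      ≤ |η q| * (‖fderiv ℝ (fderiv ℝ V) q‖ * ‖v‖) + ‖fderiv ℝ η q‖ * ‖v‖ * ‖fderiv ℝ V q‖
        + (‖fderiv ℝ η q‖ * (‖fderiv ℝ V q‖ * ‖v‖)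
          + ‖fderiv ℝ (fderiv ℝ η) q‖ * ‖v‖ * ‖V q‖) := by gcongr
    _ = _ := by ring

/-- Lower bound for the divergence along a plane of a truncated radial vector field. -/
theorem inner_add_inner_ge {x w : Euc Q} {A D : Euc Q →L[ℝ] Euc Q} {a b c κ C₀ : ℝ} (hC₀ : 0 ≤ C₀)
    (hc : 0 ≤ c) (hκ : 0 ≤ κ)
    (hA : ‖A - ContinuousLinearMap.id ℝ (Euc Q)‖ ≤ C₀ * ‖x‖) (hw : ‖w - x‖ ≤ C₀ * ‖x‖ ^ 2)
    (ha : 0 ≤ a) (haκ : a ≤ κ ^ 2) (hb : |b| ≤ c * κ ^ 4) (hxκ : ‖x‖ * κ ≤ 1)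
    (hD : ∀ v, D v = a • A v + (2 * b * ⟪x, v⟫_ℝ) • w) {u : Fin 2 → Euc Q}
    (hu : Orthonormal ℝ u) :
    2 * a + 2 * b * (⟪x, u 0⟫_ℝ ^ 2 + ⟪x, u 1⟫_ℝ ^ 2) - (2 + 4 * c) * C₀ * (‖x‖ * κ ^ 2) ≤
      ⟪D (u 0), u 0⟫_ℝ + ⟪D (u 1), u 1⟫_ℝ := by
  have hx := norm_nonneg x
  have hDX : ∀ v, ‖v‖ = 1 → a * (1 - C₀ * ‖x‖) + 2 * b * ⟪x, v⟫_ℝ ^ 2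
      - 2 * (c * κ ^ 4) * ‖x‖ * (C₀ * ‖x‖ ^ 2) ≤ ⟪D v, v⟫_ℝ := by
    intro v hv
    have e2 : 1 - C₀ * ‖x‖ ≤ ⟪A v, v⟫_ℝ := by
      have h1 : ⟪A v, v⟫_ℝ = ⟪(A - ContinuousLinearMap.id ℝ (Euc Q)) v, v⟫_ℝ + 1 := by
        rw [sub_apply, ContinuousLinearMap.id_apply, inner_sub_left,
          real_inner_self_eq_norm_sq, hv]
        ring
      have h2 := abs_real_inner_le_norm ((A - ContinuousLinearMap.id ℝ (Euc Q)) v) v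
      have h3 := (A - ContinuousLinearMap.id ℝ (Euc Q)).le_of_opNorm_le hA v
      rw [hv, mul_one] at h2 h3
      linarith [(abs_le.1 h2).1]
    have e3 : |⟪w - x, v⟫_ℝ| ≤ C₀ * ‖x‖ ^ 2 := by
      have h1 := abs_real_inner_le_norm (w - x) v
      rw [hv, mul_one] at h1
      exact h1.trans hw
    have e4 : |⟪x, v⟫_ℝ| ≤ ‖x‖ := by
      have h1 := abs_real_inner_le_norm x v
      rwa [hv, mul_one] at h1
    have e5 : |2 * b * ⟪x, v⟫_ℝ * ⟪w - x, v⟫_ℝ| ≤ 2 * (c * κ ^ 4) * ‖x‖ * (C₀ * ‖x‖ ^ 2) := by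
      rw [abs_mul, abs_mul, abs_mul, abs_of_pos (two_pos : (0 : ℝ) < 2)]
      gcongr
    have e6 : ⟪w, v⟫_ℝ = ⟪w - x, v⟫_ℝ + ⟪x, v⟫_ℝ := by rw [← inner_add_left, sub_add_cancel]
    rw [hD, inner_add_left, real_inner_smul_left, real_inner_smul_left, e6]
    have e7 := mul_le_mul_of_nonneg_left e2 ha
    have e8 := (abs_le.1 e5).1
    calc _ ≤ a * ⟪A v, v⟫_ℝ + (2 * b * ⟪x, v⟫_ℝ ^ 2
          + 2 * b * ⟪x, v⟫_ℝ * ⟪w - x, v⟫_ℝ) := by linarith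
      _ = _ := by ring
  have d0 := hDX (u 0) (hu.1 0)
  have d1 := hDX (u 1) (hu.1 1)
  -- Both errors measure the deviation of the field from the exact radial one. The bound |x|κ ≤ 1
  -- reduces the cubic error to the same size |x|κ² as the linear one.
  have herr : 2 * a * (C₀ * ‖x‖) + 4 * (c * κ ^ 4) * ‖x‖ * (C₀ * ‖x‖ ^ 2)
      ≤ (2 + 4 * c) * C₀ * (‖x‖ * κ ^ 2) := by
    calc _ ≤ 2 * κ ^ 2 * (C₀ * ‖x‖) + 4 * (c * κ ^ 4) * ‖x‖ * (C₀ * ‖x‖ ^ 2) := by gcongr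
      _ = 2 * κ ^ 2 * (C₀ * ‖x‖) + 4 * c * C₀ * κ ^ 2 * ‖x‖ * (‖x‖ * κ) ^ 2 := by ring
      _ ≤ 2 * κ ^ 2 * (C₀ * ‖x‖) + 4 * c * C₀ * κ ^ 2 * ‖x‖ * 1 := by
        gcongr
        exact pow_le_one₀ (by positivity) hxκ
      _ = _ := by ring
  linarith

/-- Scaling in the product rule: the weight and its two derivatives are of order κ², κ³, κ⁴, and the
field is of order ρ ≤ 1/κ with bounded derivatives, so the product has derivatives of order κ, κ²,
κ³. The one term of order κ² in the last estimate is raised to κ³ using 2κ ≥ 1. -/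
theorem radial_products_le {a vn vd vdd e₁ e₂ c κ ρ C₀ : ℝ} (hC₀ : 0 ≤ C₀) (hc : 0 ≤ c)
    (ha : 0 ≤ a) (haκ : a ≤ κ ^ 2) (hvn : 0 ≤ vn) (hvnρ : vn ≤ (1 + C₀) * ρ) (hvd : 0 ≤ vd)
    (hvd' : vd ≤ 1 + C₀) (hvdd : vdd ≤ C₀) (he₁' : e₁ ≤ 2 * c * κ ^ 3)
    (he₂' : e₂ ≤ 6 * c * κ ^ 4) (hκ : 1 / 2 ≤ κ) (hρκ : ρ * κ ≤ 1) :
    a * vn ≤ 20 * (c + 1) * (1 + C₀) * κ ∧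
      a * vd + e₁ * vn ≤ 20 * (c + 1) * (1 + C₀) * κ ^ 2 ∧
      a * vdd + 2 * (e₁ * vd) + e₂ * vn ≤ 20 * (c + 1) * (1 + C₀) * κ ^ 3 := by
  have hκ0 : 0 < κ := by linarith
  have hcC : 0 ≤ c * C₀ := mul_nonneg hc hC₀
  refine ⟨?_, ?_, ?_⟩
  · calc a * vn ≤ κ ^ 2 * ((1 + C₀) * ρ) := mul_le_mul haκ hvnρ hvn (by positivity)
      _ = (1 + C₀) * κ * (ρ * κ) := by ring
      _ ≤ (1 + C₀) * κ := mul_le_of_le_one_right (by positivity) hρκ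
      _ ≤ _ := mul_le_mul_of_nonneg_right (by linarith) hκ0.le
  · calc a * vd + e₁ * vn ≤ κ ^ 2 * (1 + C₀) + 2 * c * κ ^ 3 * ((1 + C₀) * ρ) :=
        add_le_add (mul_le_mul haκ hvd' hvd (by positivity))
          (mul_le_mul he₁' hvnρ hvn (by positivity))
      _ = κ ^ 2 * (1 + C₀) + 2 * c * (1 + C₀) * κ ^ 2 * (ρ * κ) := by ring
      _ ≤ κ ^ 2 * (1 + C₀) + 2 * c * (1 + C₀) * κ ^ 2 :=
        add_le_add le_rfl (mul_le_of_le_one_right (by positivity) hρκ)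
      _ = (1 + C₀ + 2 * c + 2 * (c * C₀)) * κ ^ 2 := by ring
      _ ≤ _ := mul_le_mul_of_nonneg_right (by linarith) (by positivity)
  · calc a * vdd + 2 * (e₁ * vd) + e₂ * vn
        ≤ κ ^ 2 * C₀ + 2 * (2 * c * κ ^ 3 * (1 + C₀)) + 6 * c * κ ^ 4 * ((1 + C₀) * ρ) := by
          refine add_le_add (add_le_add ?_ ?_) ?_
          · exact (mul_le_mul_of_nonneg_left hvdd ha).trans (mul_le_mul_of_nonneg_right haκ hC₀)
          · exact mul_le_mul_of_nonneg_left (mul_le_mul he₁' hvd' hvd (by positivity)) two_pos.le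
          · exact mul_le_mul he₂' hvnρ hvn (by positivity)
      _ = κ ^ 2 * C₀ * 1 + 4 * c * (1 + C₀) * κ ^ 3
          + 6 * c * (1 + C₀) * κ ^ 3 * (ρ * κ) := by ring
      _ ≤ κ ^ 2 * C₀ * (2 * κ) + 4 * c * (1 + C₀) * κ ^ 3 + 6 * c * (1 + C₀) * κ ^ 3 := by
        refine add_le_add (add_le_add ?_ le_rfl) (mul_le_of_le_one_right (by positivity) hρκ)
        exact mul_le_mul_of_nonneg_left (by linarith) (by positivity)
      _ = (2 * C₀ + 10 * c + 10 * (c * C₀)) * κ ^ 3 := by ring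
      _ ≤ _ := mul_le_mul_of_nonneg_right (by linarith) (by positivity)

/-- The deformation by a truncation at scale `r` of the vector field `(|q - p|² + s²)⁻¹ (q - p)`. -/
theorem exists_radial_deformation {C₀ : ℝ} (hC₀ : 0 ≤ C₀) : ∃ C > 0,
    ∀ (M N : Set (Euc Q)) (p : Euc Q) (r₀ : ℝ) (V : Euc Q → Euc Q),
      IsRadialField M N p r₀ C₀ V → r₀ ≤ 1 → ∀ s r, 0 < s → 2 * s ≤ r → r ≤ r₀ →
      (p ∈ N ∨ Disjoint (Metric.ball p r) N) → ∃ K G, K ⊆ Metric.ball p r ∧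
        IsAmbientVariation M N K G ∧
        (∀ q, ‖velocity G q‖ ≤ (Metric.ball p r).indicator (fun q => C * radialWeight p s q) q) ∧
        (∀ q, ‖fderiv ℝ (velocity G) q‖ ≤
          (Metric.ball p r).indicator (fun q => C * radialWeight p s q ^ 2) q) ∧
        (∀ q, ‖fderiv ℝ (fderiv ℝ (velocity G)) q‖ ≤
          (Metric.ball p r).indicator (fun q => C * radialWeight p s q ^ 3) q) ∧
        ∀ q, ∀ u : Fin 2 → Euc Q, Orthonormal ℝ u →
          (Metric.ball p r).indicator (fun q =>
            (Metric.ball p s).indicator (fun _ => 1 / (2 * s ^ 2)) q - C / r ^ 2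
              - C * (‖q - p‖ * radialWeight p s q ^ 2)) q ≤
            ⟪fderiv ℝ (velocity G) q (u 0), u 0⟫_ℝ + ⟪fderiv ℝ (velocity G) q (u 1), u 1⟫_ℝ := by
  obtain ⟨c, hc, hw⟩ := exists_radial_weight
  refine ⟨20 * (c + 1) * (1 + C₀), by positivity, ?_⟩
  intro M N p r₀ V hV hr₀ s r hs hsr hr hp
  obtain ⟨h, h₁, h₂, hd, hsm, hout, hbd, hlow, hlow'⟩ := hw r s hs hsr
  have hr0 : 0 < r := by linarith
  let η : Euc Q → ℝ := fun q => h (‖q - p‖ ^ 2)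
  have hη : ContDiff ℝ ∞ η := by
    rw [contDiff_iff_contDiffAt]
    intro q
    exact (hsm _ (sq_nonneg _)).comp q (f := fun q => ‖q - p‖ ^ 2)
      ((contDiff_id.sub contDiff_const).norm_sq ℝ).contDiffAt
  -- Since (9/10)² > 2/3, the weight vanishes outside this closed ball. It is compact inside the
  -- open ball, so the velocity vanishes near every point outside the latter, and so do its
  -- derivatives.
  let K := Metric.closedBall p (9 / 10 * r)
  have hKb : K ⊆ Metric.ball p r := Metric.closedBall_subset_ball (by linarith)
  have hηK : ∀ q ∉ K, η q = 0 := by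
    intro q hq
    rw [Metric.mem_closedBall, not_le, dist_eq_norm] at hq
    exact hout _ (by nlinarith)
  obtain ⟨G, hG, hvel⟩ := hV.variation K (hKb.trans (Metric.ball_subset_ball hr))
    (isCompact_closedBall _ _) (hp.imp_right fun h => h.mono_left hKb) η hη hηK
  have hzero : ∀ q ∉ Metric.ball p r, velocity G =ᶠ[𝓝 q] fun _ => 0 := by
    intro q hq
    filter_upwards [Metric.isClosed_closedBall.isOpen_compl.mem_nhds
      (show q ∈ Kᶜ from fun hK => hq (hKb hK))] with z hz
    exact hG.velocity_eq_zero hz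
  have hzero1 : ∀ q ∉ Metric.ball p r, fderiv ℝ (velocity G) =ᶠ[𝓝 q] fun _ => 0 := by
    intro q hq
    filter_upwards [eventually_eventually_nhds.2 (hzero q hq)] with z hz
    have hz' : velocity G =ᶠ[𝓝 z] fun _ => 0 := hz
    rw [hz'.fderiv_eq, fderiv_fun_const]
    rfl
  have main : ∀ q ∈ Metric.ball p r,
      ‖velocity G q‖ ≤ 20 * (c + 1) * (1 + C₀) * radialWeight p s q ∧
      ‖fderiv ℝ (velocity G) q‖ ≤ 20 * (c + 1) * (1 + C₀) * radialWeight p s q ^ 2 ∧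
      ‖fderiv ℝ (fderiv ℝ (velocity G)) q‖ ≤ 20 * (c + 1) * (1 + C₀) * radialWeight p s q ^ 3 ∧
      ∀ u : Fin 2 → Euc Q, Orthonormal ℝ u →
        (Metric.ball p s).indicator (fun _ => 1 / (2 * s ^ 2)) q
          - 20 * (c + 1) * (1 + C₀) / r ^ 2
              - 20 * (c + 1) * (1 + C₀) * (‖q - p‖ * radialWeight p s q ^ 2) ≤
            ⟪fderiv ℝ (velocity G) q (u 0), u 0⟫_ℝ + ⟪fderiv ℝ (velocity G) q (u 1), u 1⟫_ℝ := by
    intro q hq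
    have hq₀ := Metric.ball_subset_ball hr hq
    have hVs := hV.smooth.contDiffAt (Metric.isOpen_ball.mem_nhds hq₀)
    obtain ⟨f1, f2⟩ := norm_fderiv_fderiv_smul_le hη hVs
    obtain ⟨g1, g2⟩ := radial_function_bounds hd p q
    obtain ⟨b0, b1, b2, b3⟩ := hbd _ (sq_nonneg ‖q - p‖)
    have v0 := hV.norm_sub_le q hq₀
    have v1 := hV.norm_fderiv_sub_le q hq₀
    have v2 := hV.norm_fderiv_fderiv_le q hq₀
    rw [← radialWeight_sq] at b1 b2 b3
    have hqr : ‖q - p‖ < r := by rwa [← dist_eq_norm]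
    have hκ := radialWeight_pos p hs q
    have hκh := half_le_radialWeight (p := p) (q := q) hs (by linarith) (by linarith)
    have hρκ := norm_mul_radialWeight_le p s q
    have hl := hlow _ (sq_nonneg ‖q - p‖)
    have hl' := hlow' _ (sq_nonneg ‖q - p‖)
    have hρ := norm_nonneg (q - p)
    have hx := norm_innerCLM_apply_le (q - p)
    rw [← show η = fun q => h (‖q - p‖ ^ 2) from rfl] at g1 g2
    rw [← hvel] at f1 f2
    have hηq : η q = h (‖q - p‖ ^ 2) := rfl
    rw [hηq] at f1 f2
    set κ := radialWeight p s q
    set ρ := ‖q - p‖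
    have hρ1 : ρ ≤ 1 := by linarith
    have hVn : ‖V q‖ ≤ (1 + C₀) * ρ := by
      calc ‖V q‖ = ‖V q - (q - p) + (q - p)‖ := by rw [sub_add_cancel]
        _ ≤ C₀ * ρ ^ 2 + ρ := (norm_add_le _ _).trans (add_le_add_left v0 _)
        _ ≤ _ := by linarith [mul_le_mul_of_nonneg_left hρ1 (mul_nonneg hC₀ hρ)]
    have hVd : ‖fderiv ℝ V q‖ ≤ 1 + C₀ := by
      calc ‖fderiv ℝ V q‖ = ‖fderiv ℝ V q - ContinuousLinearMap.id ℝ (Euc Q)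
            + ContinuousLinearMap.id ℝ (Euc Q)‖ := by rw [sub_add_cancel]
        _ ≤ C₀ * ρ + 1 := (norm_add_le _ _).trans
          (add_le_add v1 ContinuousLinearMap.norm_id_le)
        _ ≤ _ := by linarith [mul_le_of_le_one_right hC₀ hρ1]
    have hb2' : |h₁ (ρ ^ 2)| ≤ c * κ ^ 4 := by linarith [show (κ ^ 2) ^ 2 = κ ^ 4 by ring]
    have hb3' : |h₂ (ρ ^ 2)| ≤ c * κ ^ 6 := by linarith [show (κ ^ 2) ^ 3 = κ ^ 6 by ring]
    have hηd : ‖fderiv ℝ η q‖ ≤ 2 * c * κ ^ 3 := by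
      rw [g1, norm_smul, Real.norm_eq_abs, abs_mul, abs_of_pos (two_pos : (0 : ℝ) < 2)]
      calc 2 * |h₁ (ρ ^ 2)| * ‖innerCLM Q (q - p)‖ ≤ 2 * (c * κ ^ 4) * ρ := by gcongr
        _ = 2 * c * κ ^ 3 * (ρ * κ) := by ring
        _ ≤ _ := mul_le_of_le_one_right (by positivity) hρκ
    have hηdd : ‖fderiv ℝ (fderiv ℝ η) q‖ ≤ 6 * c * κ ^ 4 := by
      calc ‖fderiv ℝ (fderiv ℝ η) q‖ ≤ 2 * (c * κ ^ 4) + 4 * (c * κ ^ 6) * ρ ^ 2 :=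
            g2.trans (by gcongr)
        _ = 2 * c * κ ^ 4 + 4 * c * κ ^ 4 * (ρ * κ) ^ 2 := by ring
        _ ≤ 2 * c * κ ^ 4 + 4 * c * κ ^ 4 * 1 := by
          gcongr
          exact pow_le_one₀ (by positivity) hρκ
        _ = _ := by ring
    obtain ⟨t0, t1, t2⟩ := radial_products_le hC₀ hc.le b0 b1 (norm_nonneg _) hVn (norm_nonneg _)
      hVd v2 hηd hηdd hκh hρκ
    refine ⟨?_, ?_, ?_, fun u hu => ?_⟩
    · rw [hvel]
      exact (norm_smul _ _).trans_le (by rwa [Real.norm_of_nonneg b0])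
    · rw [f1]
      refine (norm_add_le _ _).trans ?_
      rwa [norm_smul, Real.norm_of_nonneg b0, ContinuousLinearMap.norm_smulRight_apply]
    · rw [abs_of_nonneg b0] at f2
      exact f2.trans t2
    -- Bessel's inequality: the projection of q - p to the plane is no longer than q - p, as
    -- required by the bounds for the weight.
    · have hbes : ⟪q - p, u 0⟫_ℝ ^ 2 + ⟪q - p, u 1⟫_ℝ ^ 2 ≤ ρ ^ 2 := by
        have h1 := hu.sum_inner_products_le (q - p) (s := Finset.univ)
        simp only [Fin.sum_univ_two, Real.norm_eq_abs, sq_abs] at h1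
        rwa [real_inner_comm, real_inner_comm (q - p)] at h1
      have hτ : 0 ≤ ⟪q - p, u 0⟫_ℝ ^ 2 + ⟪q - p, u 1⟫_ℝ ^ 2 := by positivity
      have htr := inner_add_inner_ge hC₀ hc.le hκ.le v1 v0 b0 b1 hb2' hρκ
        (D := fderiv ℝ (velocity G) q) (fun v => by rw [f1, g1]; rfl) hu
      have herr : (2 + 4 * c) * C₀ * (ρ * κ ^ 2) ≤ 20 * (c + 1) * (1 + C₀) * (ρ * κ ^ 2) :=
        mul_le_mul_of_nonneg_right (mul_le_mul (by linarith) (by linarith) hC₀ (by positivity))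
          (by positivity)
      have hcr : c / r ^ 2 ≤ 20 * (c + 1) * (1 + C₀) / r ^ 2 :=
        div_le_div_of_nonneg_right (by linarith [mul_nonneg hc.le hC₀]) (by positivity)
      by_cases hqs : q ∈ Metric.ball p s
      · rw [indicator_of_mem hqs]
        rw [Metric.mem_ball, dist_eq_norm] at hqs
        have hρs : ρ ^ 2 ≤ s ^ 2 := pow_le_pow_left₀ hρ hqs.le 2
        have := hl' hρs _ hτ hbes
        linarith
      · rw [indicator_of_notMem hqs]
        have := hl _ hτ hbes
        linarith
  refine ⟨K, G, hKb, hG, fun q => ?_, fun q => ?_, fun q => ?_, fun q u hu => ?_⟩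
  · by_cases hq : q ∈ Metric.ball p r
    · rw [indicator_of_mem hq]
      exact (main q hq).1
    · rw [indicator_of_notMem hq, (hzero q hq).self_of_nhds, norm_zero]
  · by_cases hq : q ∈ Metric.ball p r
    · rw [indicator_of_mem hq]
      exact (main q hq).2.1
    · rw [indicator_of_notMem hq, (hzero1 q hq).self_of_nhds, norm_zero]
  · by_cases hq : q ∈ Metric.ball p r
    · rw [indicator_of_mem hq]
      exact (main q hq).2.2.1
    · rw [indicator_of_notMem hq, (hzero1 q hq).fderiv_eq, fderiv_fun_const]
      exact (norm_zero (E := Euc Q →L[ℝ] Euc Q →L[ℝ] Euc Q)).le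
  · by_cases hq : q ∈ Metric.ball p r
    · rw [indicator_of_mem hq]
      exact (main q hq).2.2.2 u hu
    · rw [indicator_of_notMem hq, (hzero1 q hq).self_of_nhds]
      simp

end RadialDeformations

/-! ### The push-forward measures -/

section PushForward

variable {Q : ℕ} {M N : Set (Euc Q)} {S : Type*} [TopologicalSpace S]
  [ChartedSpace (EuclideanHalfSpace 2) S] [IsManifold (𝓡∂ 2) ∞ S]

theorem extChartAt_symm_mem_boundary {c : S} {t : ℝ}
    (ht : !₂[0, t] ∈ (extChartAt (𝓡∂ 2) c).target) :
    (extChartAt (𝓡∂ 2) c).symm !₂[0, t] ∈ (𝓡∂ 2).boundary S := by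
  have hs := (extChartAt (𝓡∂ 2) c).map_target ht
  rw [extChartAt_source] at hs
  refine ((𝓡∂ 2).isBoundaryPoint_iff_of_mem_atlas (n := ∞) (by simp) (chart_mem_atlas _ c)
    hs).2 ?_
  change extChartAt (𝓡∂ 2) c ((extChartAt (𝓡∂ 2) c).symm !₂[0, t])
    ∈ frontier (extChartAt (𝓡∂ 2) c).target
  rw [(extChartAt (𝓡∂ 2) c).right_inv ht]
  refine ⟨subset_closure ht, fun hi => ?_⟩
  have h1 : (!₂[0, t] : Euc 2) ∈ frontier (range (𝓡∂ 2)) := by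
    rw [frontier_range_modelWithCornersEuclideanHalfSpace]
    simp
  exact h1.2 (interior_mono (extChartAt_target_subset_range c) hi)

variable [CompactSpace S] [T2Space S] [MeasurableSpace S] [BorelSpace S] {Φ : S → Euc Q}
  {U : Set S} {σ : ℝ}

theorem ae_lengthMeasure_mem_boundary (Φ : S → Euc Q) :
    ∀ᵐ x ∂(lengthMeasure Φ), x ∈ (𝓡∂ 2).boundary S := by
  have hm : MeasurableSet ((𝓡∂ 2).boundary S) :=
    ((𝓡∂ 2).isClosed_boundary (n := ∞) (by simp)).measurableSet
  rw [lengthMeasure]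
  refine (Measure.ae_sum_iff' (p := fun x => x ∈ (𝓡∂ 2).boundary S) hm).2 fun c => ?_
  by_cases hae : AEMeasurable (fun t : ℝ => (extChartAt (𝓡∂ 2) c).symm !₂[0, t])
    ((volume.restrict {t : ℝ | !₂[0, t] ∈ (extChartAt (𝓡∂ 2) c).target}).withDensity fun t =>
      ENNReal.ofReal (chartPU S c ((extChartAt (𝓡∂ 2) c).symm !₂[0, t]) *
        ‖pd (inChart Φ c) !₂[0, t] 1‖))
  · refine (ae_map_iff (p := fun x => x ∈ (𝓡∂ 2).boundary S) hae hm).2 ?_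
    refine (withDensity_absolutelyContinuous _ _).ae_le ?_
    filter_upwards [ae_restrict_mem (isClosedEmbedding_boundaryLine.continuous.measurable
      (measurableSet_target c))] with t ht
    exact extChartAt_symm_mem_boundary ht
  · rw [Measure.map_of_not_aemeasurable hae]
    simp

/-- The length measure is carried by the boundary, so restricting it further to the boundary changes
nothing. -/
theorem lambdaMeasure_eq (M : Set (Euc Q)) (σ : ℝ) (Φ : S → Euc Q) (U : Set S) :
    lambdaMeasure M σ Φ U = ENNReal.ofReal σ • ((lengthMeasure Φ).restrict U).map Φ
      + (((areaMeasure Φ).withDensity fun x =>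
        ENNReal.ofReal (σ ^ 4 * ffSq M Φ x ^ 2)).restrict U).map Φ := by
  have h : ((𝓡∂ 2).boundary S ∩ U : Set S) =ᵐ[lengthMeasure Φ] U := by
    filter_upwards [ae_lengthMeasure_mem_boundary Φ] with x hx
    exact propext ⟨fun h => h.2, fun h => ⟨hx, h⟩⟩
  rw [lambdaMeasure, Measure.restrict_congr_set h]

theorem IsAdmissible.isFiniteMeasure_muMeasure (hΦ : IsAdmissible M N Φ) :
    IsFiniteMeasure (muMeasure Φ U) := by
  have := hΦ.isFiniteMeasure_area
  exact Measure.isFiniteMeasure_map _ _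

theorem IsAdmissible.isFiniteMeasure_withDensity {k : ℕ} (hM : IsSmoothSubmanifold k M)
    (hMc : IsClosed M) (hΦ : IsAdmissible M N Φ) :
    IsFiniteMeasure ((areaMeasure Φ).withDensity fun x =>
      ENNReal.ofReal (σ ^ 4 * ffSq M Φ x ^ 2)) := by
  have := hΦ.isFiniteMeasure_area
  have hc : Continuous fun x => σ ^ 4 * ffSq M Φ x ^ 2 :=
    continuous_const.mul ((hΦ.continuous_ffSq hM hMc).pow 2)
  exact isFiniteMeasure_withDensity_ofReal
    (hc.integrable_of_hasCompactSupport (HasCompactSupport.of_compactSpace _)).2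

theorem IsAdmissible.isFiniteMeasure_lambdaMeasure {k : ℕ} (hM : IsSmoothSubmanifold k M)
    (hMc : IsClosed M) (hΦ : IsAdmissible M N Φ) :
    IsFiniteMeasure (lambdaMeasure M σ Φ U) := by
  have := hΦ.isFiniteMeasure_length
  have := hΦ.isFiniteMeasure_withDensity hM hMc (σ := σ)
  rw [lambdaMeasure_eq]
  have : IsFiniteMeasure (ENNReal.ofReal σ • ((lengthMeasure Φ).restrict U).map Φ) :=
    Measure.smul_finite _ ENNReal.ofReal_ne_top
  infer_instance

theorem integral_muMeasure (hΦ : Continuous Φ) {g : Euc Q → ℝ} (hg : Measurable g) :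
    ∫ q, g q ∂(muMeasure Φ U) = ∫ x in U, g (Φ x) ∂(areaMeasure Φ) :=
  integral_map hΦ.measurable.aemeasurable hg.aestronglyMeasurable

theorem IsAdmissible.integral_lambdaMeasure {k : ℕ} (hM : IsSmoothSubmanifold k M)
    (hMc : IsClosed M) (hΦ : IsAdmissible M N Φ) (hσ : 0 ≤ σ) (hU : IsOpen U) {g : Euc Q → ℝ}
    (hg : Measurable g) {b : ℝ} (hb : ∀ q, |g q| ≤ b) :
    ∫ q, g q ∂(lambdaMeasure M σ Φ U) = σ * ∫ x in U, g (Φ x) ∂(lengthMeasure Φ)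
      + σ ^ 4 * ∫ x in U, g (Φ x) * ffSq M Φ x ^ 2 ∂(areaMeasure Φ) := by
  have h1 := hΦ.isFiniteMeasure_length
  have h2 := hΦ.isFiniteMeasure_withDensity hM hMc (σ := σ)
  have h3 : IsFiniteMeasure (ENNReal.ofReal σ • ((lengthMeasure Φ).restrict U).map Φ) :=
    Measure.smul_finite _ ENNReal.ofReal_ne_top
  have hi : ∀ ν : Measure (Euc Q), IsFiniteMeasure ν → Integrable g ν := fun ν _ =>
    Integrable.of_bound hg.aestronglyMeasurable b (Eventually.of_forall hb)
  have hΦm := hΦ.smooth.continuous.measurable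
  have hc : Continuous fun x => σ ^ 4 * ffSq M Φ x ^ 2 :=
    continuous_const.mul ((hΦ.continuous_ffSq hM hMc).pow 2)
  rw [lambdaMeasure_eq, integral_add_measure (hi _ h3) (hi _ inferInstance), integral_smul_measure,
    ENNReal.toReal_ofReal hσ, integral_map hΦm.aemeasurable hg.aestronglyMeasurable,
    integral_map hΦm.aemeasurable hg.aestronglyMeasurable, smul_eq_mul,
    restrict_withDensity hU.measurableSet,
    integral_withDensity_eq_integral_toReal_smul hc.measurable.ennreal_ofReal
      (Eventually.of_forall fun x => ENNReal.ofReal_lt_top), ← integral_const_mul (σ ^ 4)]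
  congr 1
  refine integral_congr_ae (Eventually.of_forall fun x => ?_)
  simp only [smul_eq_mul]
  rw [ENNReal.toReal_ofReal (by positivity)]
  ring

end PushForward

/-! ### The weighted estimate -/

section WeightedEstimate

variable {Q : ℕ} {M N K : Set (Euc Q)} {G : ℝ → Euc Q → Euc Q} {k : ℕ}
  {pr : Euc Q → Euc Q →L[ℝ] Euc Q} {S : Type*} [TopologicalSpace S]
  [ChartedSpace (EuclideanHalfSpace 2) S] [IsManifold (𝓡∂ 2) ∞ S] {Φ : S → Euc Q} {U : Set S}

/-- In an orthonormal frame the invariant expression is a sum of squares. -/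
theorem IsAdmissible.ffSq_nonneg (hM : IsSmoothSubmanifold k M) (hMc : IsClosed M)
    (hΦ : IsAdmissible M N Φ) (x : S) : 0 ≤ ffSq M Φ x := by
  obtain ⟨pr, hprs, hpr⟩ := hM.exists_smooth_tanProj hMc
  have hx := mem_extChartAt_source (I := 𝓡∂ 2) x
  have hy := (extChartAt (𝓡∂ 2) x).map_source hx
  have h1 := hΦ.ffSq_symm_eq hM hpr hy
  rw [(extChartAt (𝓡∂ 2) x).left_inv hx] at h1
  obtain ⟨T, Γ, j₀, hT, he, hj₀, ho, -, -⟩ :=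
    (hΦ.isTangentJet hM hprs hpr hy).exists_normalized hpr
  have h2 : ffOf (pr j₀.1) (jetChange T Γ j₀).2.1 (jetChange T Γ j₀).2.2
      = ffOf (pr j₀.1) j₀.2.1 j₀.2.2 := ffOf_jetChange hT Γ fun i => by
    rw [hpr _ hj₀.mem, tanProj_eq_self (hj₀.tangent i)]
  rw [h1, he, show (jetChange T Γ j₀).1 = j₀.1 from rfl, h2, ffOf, gramOf_eq_one ho, normSq₂_one]
  positivity

/-- Here y stands for |II|. Young's inequality splits the mixed term κ³y³ into κ²y⁴, which is
integrated against λ, and κ⁶, which is integrated against μ. Terms with too few factors κ are raised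
by 2κ ≥ 1. -/
theorem ff_weight_le {C c₀ κ y : ℝ} (hC : 0 ≤ C) (hc₀ : 0 ≤ c₀) (hκ : 1 / 2 ≤ κ) (hy : 0 ≤ y) :
    130 * (C * κ ^ 2) * (y ^ 2) ^ 2 +
        64 * ((c₀ * (C * κ) + C * κ ^ 2) * (y + c₀) + C * κ ^ 3) * (y ^ 2 * y) ≤
      64 * C * (5 + 3 * c₀) ^ 2 * (κ ^ 2 * (y ^ 2) ^ 2 + κ ^ 6) := by
  have hκ0 : 0 < κ := by linarith
  have h1 : c₀ * (C * κ) + C * κ ^ 2 ≤ C * (1 + 2 * c₀) * κ ^ 2 := by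
    have : c₀ * C * κ * 1 ≤ c₀ * C * κ * (2 * κ) :=
      mul_le_mul_of_nonneg_left (by linarith) (by positivity)
    linarith
  have h2 : κ ^ 2 ≤ 2 * κ ^ 3 := by
    have : κ ^ 2 * 1 ≤ κ ^ 2 * (2 * κ) := mul_le_mul_of_nonneg_left (by linarith) (by positivity)
    linarith
  have h3 : y ^ 3 * κ ≤ y ^ 4 + κ ^ 4 := by
    rcases le_total κ y with h | h
    · have := mul_le_mul_of_nonneg_left h (pow_nonneg hy 3)
      nlinarith [pow_nonneg hκ0.le 4]
    · have h4 := pow_le_pow_left₀ hy h 3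
      have := mul_le_mul_of_nonneg_right h4 hκ0.le
      nlinarith [pow_nonneg hy 4]
  have h5 : κ ^ 3 * y ^ 3 ≤ κ ^ 2 * (y ^ 2) ^ 2 + κ ^ 6 := by
    have := mul_le_mul_of_nonneg_left h3 (sq_nonneg κ)
    linarith
  have h6 : (c₀ * (C * κ) + C * κ ^ 2) * (y + c₀) + C * κ ^ 3 ≤
      C * (1 + 2 * c₀) * κ ^ 2 * y + C * (1 + 2 * c₀ + 4 * c₀ ^ 2) * κ ^ 3 := by
    have h7 := mul_le_mul_of_nonneg_right h1 (show 0 ≤ y + c₀ by positivity)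
    have h8 := mul_le_mul_of_nonneg_left h2 (show 0 ≤ C * (1 + 2 * c₀) * c₀ by positivity)
    linarith
  have h9 := mul_le_mul_of_nonneg_right h6 (show 0 ≤ 64 * (y ^ 2 * y) by positivity)
  have h10 := mul_le_mul_of_nonneg_left h5
    (show 0 ≤ 64 * C * (1 + 2 * c₀ + 4 * c₀ ^ 2) by positivity)
  have p1 : 0 ≤ C * (κ ^ 2 * (y ^ 2) ^ 2) := by positivity
  have p2 : 0 ≤ C * c₀ * (κ ^ 2 * (y ^ 2) ^ 2) := by positivity
  have p3 : 0 ≤ C * c₀ ^ 2 * (κ ^ 2 * (y ^ 2) ^ 2) := by positivity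
  have q1 : 0 ≤ C * κ ^ 6 := by positivity
  have q2 : 0 ≤ C * c₀ * κ ^ 6 := by positivity
  have q3 : 0 ≤ C * c₀ ^ 2 * κ ^ 6 := by positivity
  linarith

theorem hess_weight_le {C c₀ κ y : ℝ} (hC : 0 ≤ C) (hc₀ : 0 ≤ c₀) (hκ : 1 / 2 ≤ κ) (hy : 0 ≤ y) :
    2 * (c₀ * (C * κ ^ 2) + C * κ ^ 3 + C * κ ^ 2 * (y + c₀)) ≤
      2 * C * (1 + 4 * c₀) * (κ ^ 3 + κ ^ 2 * y) := by
  have hκ0 : 0 < κ := by linarith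
  have h2 : κ ^ 2 ≤ 2 * κ ^ 3 := by
    have : κ ^ 2 * 1 ≤ κ ^ 2 * (2 * κ) := mul_le_mul_of_nonneg_left (by linarith) (by positivity)
    linarith
  have h3 := mul_le_mul_of_nonneg_left h2 (show 0 ≤ 4 * (C * c₀) by positivity)
  have h4 : 0 ≤ C * c₀ * (κ ^ 2 * y) := by positivity
  linarith

/-- The L⁴ norm of the Hessian needs fourth powers. A factor κ⁶ ≤ s⁻⁶ is pulled out so that the same
two densities as in the variation of ∫|II|⁴ remain. -/
theorem hess_weight_pow_le {κ y s : ℝ} (hκ : 0 ≤ κ) (hκs : κ ≤ s⁻¹) (hy : 0 ≤ y) :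
    (κ ^ 3 + κ ^ 2 * y) ^ 4 ≤ 8 * s⁻¹ ^ 6 * (κ ^ 2 * (y ^ 2) ^ 2 + κ ^ 6) := by
  have h1 : (κ ^ 3 + κ ^ 2 * y) ^ 4 ≤ 8 * ((κ ^ 3) ^ 4 + (κ ^ 2 * y) ^ 4) := by
    refine (add_pow_le (by positivity) (by positivity) 4).trans (le_of_eq ?_)
    norm_num
  have h2 : κ ^ 6 ≤ s⁻¹ ^ 6 := pow_le_pow_left₀ hκ hκs 6
  have h3 := mul_le_mul_of_nonneg_right h2
    (show 0 ≤ κ ^ 2 * (y ^ 2) ^ 2 + κ ^ 6 by positivity)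
  linarith

variable [CompactSpace S] [T2Space S] [MeasurableSpace S] [BorelSpace S]

theorem radialWeight_indicator_bounds (p : Euc Q) {s : ℝ} (hs : 0 < s) (B : Set (Euc Q)) (j : ℕ)
    (q : Euc Q) : 0 ≤ B.indicator (fun q => radialWeight p s q ^ j) q ∧
      B.indicator (fun q => radialWeight p s q ^ j) q ≤ s⁻¹ ^ j := by
  have h1 := (radialWeight_pos p hs q).le
  refine ⟨indicator_nonneg (fun q _ => pow_nonneg (radialWeight_pos p hs q).le j) q, ?_⟩
  refine indicator_apply_le' (fun _ => pow_le_pow_left₀ h1 (radialWeight_le p hs q) j) fun _ => ?_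
  positivity

theorem measurable_indicator_radialWeight (p : Euc Q) {s : ℝ} (hs : 0 < s) (r : ℝ) (j : ℕ) :
    Measurable ((Metric.ball p r).indicator fun q => radialWeight p s q ^ j) :=
  ((continuous_radialWeight p hs).pow j).measurable.indicator Metric.isOpen_ball.measurableSet

/-- Testing the almost criticality of the surface with a truncated radial deformation. -/
theorem weighted_estimate (hM : IsSmoothSubmanifold k M) (hMc : IsClosed M)
    (hprs : ContDiff ℝ ∞ pr) (hpr : ∀ q ∈ M, pr q = tanProj M q) {c₀ : ℝ} (hc₀ : 0 ≤ c₀)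
    (hc : ∀ q ∈ M, ‖fderiv ℝ pr q‖ ≤ c₀) {C : ℝ} (hC : 0 ≤ C) {p : Euc Q} {s r σ : ℝ}
    (hσ : 0 < σ) (hσs : σ ≤ s) (hsr : s ≤ r) (hr : r ≤ 1)
    (hKr : K ⊆ Metric.ball p r) (hG : IsAmbientVariation M N K G)
    (hx : ∀ q, ‖velocity G q‖ ≤ (Metric.ball p r).indicator (fun q => C * radialWeight p s q) q)
    (hℓ : ∀ q, ‖fderiv ℝ (velocity G) q‖ ≤
      (Metric.ball p r).indicator (fun q => C * radialWeight p s q ^ 2) q)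
    (hd : ∀ q, ‖fderiv ℝ (fderiv ℝ (velocity G)) q‖ ≤
      (Metric.ball p r).indicator (fun q => C * radialWeight p s q ^ 3) q)
    (hL : ∀ q, ∀ u : Fin 2 → Euc Q, Orthonormal ℝ u →
      (Metric.ball p r).indicator (fun q =>
        (Metric.ball p s).indicator (fun _ => 1 / (2 * s ^ 2)) q - C / r ^ 2
          - C * (‖q - p‖ * radialWeight p s q ^ 2)) q ≤
        ⟪fderiv ℝ (velocity G) q (u 0), u 0⟫_ℝ + ⟪fderiv ℝ (velocity G) q (u 1), u 1⟫_ℝ)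
    (hΦ : IsEpsCritical M N σ (σ ^ 5) Φ) (hU : IsOpen U)
    (hfr : ∀ x ∈ frontier U, Φ x ∉ Metric.ball p r) :
    (muMeasure Φ U).real (Metric.ball p s) / (2 * s ^ 2) ≤
      C * ((muMeasure Φ U).real (Metric.ball p r) / r ^ 2)
      + C * ∫ q in Metric.ball p r, ‖q - p‖ * radialWeight p s q ^ 2 ∂(muMeasure Φ U)
      + (C + 64 * C * (5 + 3 * c₀) ^ 2 + 8 * (2 * C * (1 + 4 * c₀)) ^ 4) *
        (∫ q in Metric.ball p r, radialWeight p s q ^ 2 ∂(lambdaMeasure M σ Φ U)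
          + σ ^ 4 * ∫ q in Metric.ball p r, radialWeight p s q ^ 6 ∂(muMeasure Φ U))
      + (3 * C + 1) * σ ^ 2 := by
  have hs : 0 < s := hσ.trans_le hσs
  have hr0 : 0 < r := hs.trans_le hsr
  have hfm := hΦ.1.isFiniteMeasure_area
  have hfμ := hΦ.1.isFiniteMeasure_muMeasure (U := U)
  have hcont := hΦ.1.smooth.continuous
  have hBm : MeasurableSet (Metric.ball p r) := Metric.isOpen_ball.measurableSet
  set B := Metric.ball p r with hB
  set κ := radialWeight p s with hκ
  set C₂ := 64 * C * (5 + 3 * c₀) ^ 2 with hC₂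
  set C₃ := 2 * C * (1 + 4 * c₀) with hC₃
  have hC₂0 : 0 ≤ C₂ := by positivity
  have hC₃0 : 0 ≤ C₃ := by positivity
  have hg := radialWeight_indicator_bounds p hs B
  have hgm := measurable_indicator_radialWeight p hs r
  have hf0 := hΦ.1.ffSq_nonneg hM hMc
  have hfc := hΦ.1.continuous_ffSq hM hMc
  obtain ⟨F, hF⟩ := isCompact_univ.exists_bound_of_continuousOn hfc.continuousOn
  have hF' : ∀ x, ffSq M Φ x ≤ F := fun x => (le_abs_self _).trans (hF x (mem_univ x))
  have hκh : ∀ q ∈ B, 1 / 2 ≤ κ q := fun q hq => half_le_radialWeight hs (hsr.trans hr) (by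
    rw [← dist_eq_norm]
    exact (Metric.mem_ball.1 hq).le.trans hr)
  have hsq : ∀ x, Real.sqrt (ffSq M Φ x) ^ 2 = ffSq M Φ x := fun x => Real.sq_sqrt (hf0 x)
  set g₂ := B.indicator fun q => κ q ^ 2 with hg₂
  set g₃ := B.indicator fun q => κ q ^ 3 with hg₃
  set g₆ := B.indicator fun q => κ q ^ 6 with hg₆
  have e₂ : B.indicator (fun q => C * κ q ^ 2) = fun q => C * g₂ q := by
    ext1 q
    by_cases hq : q ∈ B <;> simp [hg₂, hq]
  -- The function `h` dominates the variation of ∫|II|⁴ and `H` the Hessian of the test field. Both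
  -- vanish off the preimage of B.
  let h : S → ℝ := fun x => C₂ * (g₂ (Φ x) * ffSq M Φ x ^ 2 + g₆ (Φ x))
  let H : S → ℝ := fun x => C₃ * (g₃ (Φ x) + g₂ (Φ x) * Real.sqrt (ffSq M Φ x))
  have hm : Measurable h := by
    refine Measurable.const_mul ?_ _
    exact (((hgm 2).comp hcont.measurable).mul (hfc.pow 2).measurable).add
      ((hgm 6).comp hcont.measurable)
  have hHm : Measurable H := by
    refine Measurable.const_mul ?_ _
    exact ((hgm 3).comp hcont.measurable).add
      (((hgm 2).comp hcont.measurable).mul (Real.continuous_sqrt.comp hfc).measurable)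
  have hh0 : ∀ x, 0 ≤ h x := fun x => mul_nonneg hC₂0
    (add_nonneg (mul_nonneg (hg 2 _).1 (sq_nonneg _)) (hg 6 _).1)
  have hH0 : ∀ x, 0 ≤ H x := fun x => mul_nonneg hC₃0
    (add_nonneg (hg 3 _).1 (mul_nonneg (hg 2 _).1 (Real.sqrt_nonneg _)))
  have hhb : ∀ x, |h x| ≤ C₂ * (s⁻¹ ^ 2 * F ^ 2 + s⁻¹ ^ 6) := by
    intro x
    rw [abs_of_nonneg (hh0 x)]
    refine mul_le_mul_of_nonneg_left (add_le_add ?_ (hg 6 _).2) hC₂0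
    exact mul_le_mul (hg 2 _).2 (pow_le_pow_left₀ (hf0 x) (hF' x) 2) (sq_nonneg _) (by positivity)
  have hHb : ∀ x, |H x| ≤ C₃ * (s⁻¹ ^ 3 + s⁻¹ ^ 2 * Real.sqrt F) := by
    intro x
    rw [abs_of_nonneg (hH0 x)]
    refine mul_le_mul_of_nonneg_left (add_le_add (hg 3 _).2 ?_) hC₃0
    exact mul_le_mul (hg 2 _).2 (Real.sqrt_le_sqrt (hF' x)) (Real.sqrt_nonneg _) (by positivity)
  have hh : ∀ x ∈ U, 130 * B.indicator (fun q => C * κ q ^ 2) (Φ x) * ffSq M Φ x ^ 2 +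
      64 * ((c₀ * B.indicator (fun q => C * κ q) (Φ x) + B.indicator (fun q => C * κ q ^ 2) (Φ x)) *
        (Real.sqrt (ffSq M Φ x) + c₀) + B.indicator (fun q => C * κ q ^ 3) (Φ x)) *
          (ffSq M Φ x * Real.sqrt (ffSq M Φ x)) ≤ h x := by
    intro x _
    by_cases hq : Φ x ∈ B
    · have := ff_weight_le hC hc₀ (hκh _ hq) (Real.sqrt_nonneg (ffSq M Φ x))
      rw [hsq] at this
      simpa only [h, hg₂, hg₆, indicator_of_mem hq] using this
    · simp [h, hg₂, hg₆, indicator_of_notMem hq]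
  have hHH : ∀ x ∈ U, 2 * (c₀ * B.indicator (fun q => C * κ q ^ 2) (Φ x)
      + B.indicator (fun q => C * κ q ^ 3) (Φ x) + B.indicator (fun q => C * κ q ^ 2) (Φ x) *
        (Real.sqrt (ffSq M Φ x) + c₀)) ≤ H x := by
    intro x _
    by_cases hq : Φ x ∈ B
    · have := hess_weight_le hC hc₀ (hκh _ hq) (Real.sqrt_nonneg (ffSq M Φ x))
      simpa only [H, hg₂, hg₃, indicator_of_mem hq] using this
    · simp [H, hg₂, hg₃, indicator_of_notMem hq]
  have hH4 : ∀ x, H x ^ 4 ≤ 8 * C₃ ^ 4 * s⁻¹ ^ 6 * (g₂ (Φ x) * ffSq M Φ x ^ 2 + g₆ (Φ x)) := by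
    intro x
    by_cases hq : Φ x ∈ B
    · have h1 := hess_weight_pow_le (radialWeight_pos p hs (Φ x)).le
        (radialWeight_le p hs (Φ x)) (Real.sqrt_nonneg (ffSq M Φ x))
      rw [hsq] at h1
      simp only [H, hg₂, hg₃, hg₆, indicator_of_mem hq]
      rw [mul_pow]
      calc _ ≤ C₃ ^ 4 * (8 * s⁻¹ ^ 6 * (κ (Φ x) ^ 2 * ffSq M Φ x ^ 2 + κ (Φ x) ^ 6)) :=
            mul_le_mul_of_nonneg_left h1 (by positivity)
        _ = _ := by ring
    · simp [H, hg₂, hg₃, hg₆, indicator_of_notMem hq]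
  set L : Euc Q → ℝ := B.indicator (fun q =>
        (Metric.ball p s).indicator (fun _ => 1 / (2 * s ^ 2)) q - C / r ^ 2
          - C * (‖q - p‖ * κ q ^ 2)) with hLdef
  have hρm : Measurable fun q => ‖q - p‖ * κ q ^ 2 :=
    (Continuous.mul (by fun_prop) ((continuous_radialWeight p hs).pow 2)).measurable
  have hρb : ∀ q, |‖q - p‖ * κ q ^ 2| ≤ s⁻¹ := by
    intro q
    have h1 := norm_mul_radialWeight_le p s q
    have h2 := radialWeight_le p hs q
    have h3 := radialWeight_pos p hs q
    rw [abs_of_nonneg (by positivity)]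
    calc ‖q - p‖ * κ q ^ 2 = ‖q - p‖ * κ q * κ q := by ring
      _ ≤ 1 * κ q := mul_le_mul_of_nonneg_right h1 h3.le
      _ ≤ s⁻¹ := by rwa [one_mul]
  have hLm : Measurable L := by
    refine Measurable.indicator ?_ hBm
    exact ((measurable_const.indicator Metric.isOpen_ball.measurableSet).sub
      measurable_const).sub (hρm.const_mul C)
  have hLb : ∀ q, |L q| ≤ 1 / (2 * s ^ 2) + C / r ^ 2 + C * s⁻¹ := by
    intro q
    have h0 : 0 ≤ 1 / (2 * s ^ 2) := by positivity
    have h1 : 0 ≤ C / r ^ 2 := by positivity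
    by_cases hq : q ∈ B
    · simp only [hLdef, indicator_of_mem hq]
      refine (abs_sub _ _).trans (add_le_add ((abs_sub _ _).trans (add_le_add ?_ ?_)) ?_)
      · rw [abs_of_nonneg (indicator_nonneg (fun _ _ => h0) q)]
        exact indicator_apply_le' (fun _ => le_rfl) fun _ => h0
      · exact (abs_of_nonneg h1).le
      · rw [abs_mul, abs_of_nonneg hC]
        exact mul_le_mul_of_nonneg_left (hρb q) hC
    · simp only [hLdef, indicator_of_notMem hq, abs_zero]
      positivity
  have hKU : ∀ x ∈ frontier U, Φ x ∉ K := fun x hx hK => hfr x hx (hKr hK)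
  have hA : ∀ q ∈ M, ‖velocity G q‖ ≤ C * s⁻¹ := fun q _ => (hx q).trans
    (indicator_apply_le' (fun _ => mul_le_mul_of_nonneg_left (radialWeight_le p hs q) hC)
      fun _ => by positivity)
  have hB' : ∀ q ∈ M, ‖fderiv ℝ (velocity G) q‖ ≤ C * s⁻¹ ^ 2 := fun q _ => (hℓ q).trans
    (by rw [e₂]; exact mul_le_mul_of_nonneg_left (hg 2 q).2 hC)
  set I := ∫ x in U, H x ^ 4 ∂(areaMeasure Φ) with hI
  have hI0 : 0 ≤ I := integral_nonneg fun x => by positivity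
  have hsec := sectionNorm_localVar_le hM hprs hpr hG hΦ.1 hU hKU hc hA hB' (fun q _ => hℓ q)
    (fun q _ => hd q) hHm hHb hHH
  have hfv := first_variation_le hM hMc hprs hpr hG hσ (by positivity) hΦ hU hKU hc
    (fun q _ => hx q) (fun q _ => hℓ q) (fun q _ => hd q) (fun q _ => hL q) hLm hLb
    (by rw [e₂]; exact (hgm 2).const_mul C)
    (b₂ := C * s⁻¹ ^ 2) (fun q => by
      rw [e₂, abs_of_nonneg (mul_nonneg hC (hg 2 q).1)]
      exact mul_le_mul_of_nonneg_left (hg 2 q).2 hC) hm hhb hh (by positivity) hsec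
  have hint : ∀ g : S → ℝ, Measurable g → (∃ b, ∀ x, |g x| ≤ b) →
      IntegrableOn g U (areaMeasure Φ) := by
    rintro g hg ⟨b, hb⟩
    exact (Integrable.of_bound hg.aestronglyMeasurable b (Eventually.of_forall hb)).integrableOn
  have hiμ : ∀ g : Euc Q → ℝ, Measurable g → (∃ b, ∀ x, |g x| ≤ b) →
      Integrable g (muMeasure Φ U) := by
    rintro g hg ⟨b, hb⟩
    exact Integrable.of_bound hg.aestronglyMeasurable b (Eventually.of_forall hb)
  set a := ∫ x in U, g₂ (Φ x) ∂(lengthMeasure Φ) with ha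
  set b := ∫ x in U, g₂ (Φ x) * ffSq M Φ x ^ 2 ∂(areaMeasure Φ) with hb
  set d := ∫ x in U, g₆ (Φ x) ∂(areaMeasure Φ) with hdd
  have ha0 : 0 ≤ a := integral_nonneg fun x => (hg 2 _).1
  have hb0 : 0 ≤ b := integral_nonneg fun x => mul_nonneg (hg 2 _).1 (sq_nonneg _)
  have hd0 : 0 ≤ d := integral_nonneg fun x => (hg 6 _).1
  have hbi : IntegrableOn (fun x => g₂ (Φ x) * ffSq M Φ x ^ 2) U (areaMeasure Φ) :=
    hint _ (((hgm 2).comp hcont.measurable).mul (hfc.pow 2).measurable)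
      ⟨s⁻¹ ^ 2 * F ^ 2, fun x => by
        rw [abs_of_nonneg (mul_nonneg (hg 2 _).1 (sq_nonneg _))]
        exact mul_le_mul (hg 2 _).2 (pow_le_pow_left₀ (hf0 x) (hF' x) 2) (sq_nonneg _)
          (by positivity)⟩
  have hdi : IntegrableOn (fun x => g₆ (Φ x)) U (areaMeasure Φ) :=
    hint _ ((hgm 6).comp hcont.measurable) ⟨s⁻¹ ^ 6, fun x => by
      rw [abs_of_nonneg (hg 6 _).1]
      exact (hg 6 _).2⟩
  have hbd : ∫ x in U, (g₂ (Φ x) * ffSq M Φ x ^ 2 + g₆ (Φ x)) ∂(areaMeasure Φ) = b + d :=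
    integral_add hbi hdi
  have hlam : ∫ q in B, κ q ^ 2 ∂(lambdaMeasure M σ Φ U) = σ * a + σ ^ 4 * b := by
    rw [← integral_indicator hBm]
    exact hΦ.1.integral_lambdaMeasure hM hMc hσ.le hU (hgm 2) (b := s⁻¹ ^ 2) fun q => by
      rw [abs_of_nonneg (hg 2 q).1]
      exact (hg 2 q).2
  have hmu6 : ∫ q in B, κ q ^ 6 ∂(muMeasure Φ U) = d := by
    rw [← integral_indicator hBm]
    exact integral_muMeasure hcont (hgm 6)
  have hLint : ∫ x in U, L (Φ x) ∂(areaMeasure Φ) =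
      (muMeasure Φ U).real (Metric.ball p s) / (2 * s ^ 2)
        - C * ((muMeasure Φ U).real B / r ^ 2) - C * ∫ q in B, ‖q - p‖ * κ q ^ 2
          ∂(muMeasure Φ U) := by
    rw [← integral_muMeasure hcont hLm, hLdef, integral_indicator hBm, integral_sub, integral_sub,
      integral_const_mul, integral_indicator Metric.isOpen_ball.measurableSet,
      Measure.restrict_restrict Metric.isOpen_ball.measurableSet,
      inter_eq_self_of_subset_left (Metric.ball_subset_ball hsr), setIntegral_const,
      setIntegral_const, smul_eq_mul, smul_eq_mul]
    · ring
    · exact ((integrable_const _).indicator Metric.isOpen_ball.measurableSet)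
    · exact integrable_const _
    · exact ((integrable_const _).indicator Metric.isOpen_ball.measurableSet).sub
        (integrable_const _)
    · exact ((hiμ _ hρm ⟨_, hρb⟩).const_mul C).integrableOn
  have hhint : ∫ x in U, h x ∂(areaMeasure Φ) = C₂ * (b + d) := by
    rw [← hbd, ← integral_const_mul]
  have hIle : I ≤ 8 * C₃ ^ 4 * s⁻¹ ^ 6 * (b + d) := by
    rw [← hbd, ← integral_const_mul]
    refine integral_mono_of_nonneg (Eventually.of_forall fun x => by positivity)
      ((hbi.add hdi).const_mul _) (Eventually.of_forall hH4)
  have hℓint : ∫ x in U, B.indicator (fun q => C * κ q ^ 2) (Φ x) ∂(lengthMeasure Φ) = C * a := by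
    rw [e₂, ← integral_const_mul]
  rw [hLint, hhint, hℓint] at hfv
  rw [hlam, hmu6]
  have hσ1 : σ ≤ 1 := (hσs.trans hsr).trans hr
  have hσs' : σ * s⁻¹ ≤ 1 := by
    rw [← div_eq_mul_inv]
    exact div_le_one_of_le₀ hσs hs.le
  have hσs0 : 0 ≤ σ * s⁻¹ := by positivity
  -- From σ ≤ s ≤ 1, every negative power of s is paid for by a power of σ, leaving at least σ².
  have hZ1 : σ ^ 5 * (C * s⁻¹) ≤ C * σ ^ 2 := by
    have h2 : σ ^ 4 ≤ σ ^ 2 := pow_le_pow_of_le_one hσ.le hσ1 (by norm_num)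
    calc σ ^ 5 * (C * s⁻¹) = C * σ ^ 4 * (σ * s⁻¹) := by ring
      _ ≤ C * σ ^ 4 := mul_le_of_le_one_right (by positivity) hσs'
      _ ≤ C * σ ^ 2 := mul_le_mul_of_nonneg_left h2 hC
  have hZ2 : σ ^ 5 * (2 * (C * s⁻¹ ^ 2)) ≤ 2 * C * σ ^ 2 := by
    have h2 : σ ^ 3 ≤ σ ^ 2 := pow_le_pow_of_le_one hσ.le hσ1 (by norm_num)
    calc σ ^ 5 * (2 * (C * s⁻¹ ^ 2)) = 2 * C * σ ^ 3 * (σ * s⁻¹) ^ 2 := by ring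
      _ ≤ 2 * C * σ ^ 3 := mul_le_of_le_one_right (by positivity) (pow_le_one₀ hσs0 hσs')
      _ ≤ 2 * C * σ ^ 2 := mul_le_mul_of_nonneg_left h2 (by positivity)
  -- With y⁴ = I, the inequality z ≤ 1 + z⁴ is applied to z = σ³y. The resulting σ¹⁴ compensates s⁻⁶
  -- and leaves σ⁸ ≤ σ⁴, the factor with which the energy already carries these integrals.
  have hZ3 : σ ^ 5 * I ^ (1 / 4 : ℝ) ≤ σ ^ 2 + 8 * C₃ ^ 4 * (σ ^ 4 * b + σ ^ 4 * d) := by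
    set y := I ^ (1 / 4 : ℝ) with hy
    have hy0 : 0 ≤ y := by positivity
    have hy4 : y ^ 4 = I := by
      rw [hy, ← Real.rpow_natCast, ← Real.rpow_mul hI0]
      norm_num
    have h1 : σ ^ 3 * y ≤ 1 + (σ ^ 3 * y) ^ 4 := by
      rcases le_total (σ ^ 3 * y) 1 with h | h
      · exact h.trans (le_add_of_nonneg_right (by positivity))
      · exact (le_self_pow₀ h (by norm_num)).trans (le_add_of_nonneg_left zero_le_one)
    have h2 : σ ^ 8 ≤ σ ^ 4 := pow_le_pow_of_le_one hσ.le hσ1 (by norm_num)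
    calc σ ^ 5 * y = σ ^ 2 * (σ ^ 3 * y) := by ring
      _ ≤ σ ^ 2 * (1 + (σ ^ 3 * y) ^ 4) := mul_le_mul_of_nonneg_left h1 (by positivity)
      _ = σ ^ 2 + σ ^ 14 * I := by rw [← hy4]; ring
      _ ≤ σ ^ 2 + σ ^ 14 * (8 * C₃ ^ 4 * s⁻¹ ^ 6 * (b + d)) :=
        add_le_add le_rfl (mul_le_mul_of_nonneg_left hIle (by positivity))
      _ = σ ^ 2 + 8 * C₃ ^ 4 * (b + d) * σ ^ 8 * (σ * s⁻¹) ^ 6 := by ring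
      _ ≤ σ ^ 2 + 8 * C₃ ^ 4 * (b + d) * σ ^ 8 :=
        add_le_add le_rfl (mul_le_of_le_one_right (by positivity) (pow_le_one₀ hσs0 hσs'))
      _ ≤ σ ^ 2 + 8 * C₃ ^ 4 * (b + d) * σ ^ 4 :=
        add_le_add le_rfl (mul_le_mul_of_nonneg_left h2 (by positivity))
      _ = _ := by ring
  have t1 : 0 ≤ C * (σ ^ 4 * b) := by positivity
  have t2 : 0 ≤ C * (σ ^ 4 * d) := by positivity
  have t3 : 0 ≤ C₂ * (σ * a) := by positivity
  have t4 : 0 ≤ 8 * C₃ ^ 4 * (σ * a) := by positivity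
  calc _ = ((muMeasure Φ U).real (Metric.ball p s) / (2 * s ^ 2)
        - C * ((muMeasure Φ U).real B / r ^ 2) - C * ∫ q in B, ‖q - p‖ * κ q ^ 2
          ∂(muMeasure Φ U)) + C * ((muMeasure Φ U).real B / r ^ 2)
            + C * ∫ q in B, ‖q - p‖ * κ q ^ 2 ∂(muMeasure Φ U) := by ring
    _ ≤ (σ * (C * a) + σ ^ 4 * (C₂ * (b + d))
        + σ ^ 5 * (C * s⁻¹ + 2 * (C * s⁻¹ ^ 2) + I ^ (1 / 4 : ℝ)))
          + C * ((muMeasure Φ U).real B / r ^ 2)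
            + C * ∫ q in B, ‖q - p‖ * κ q ^ 2 ∂(muMeasure Φ U) := by gcongr
    _ ≤ _ := by linarith

end WeightedEstimate

/-- The estimate bounding the density ratio of `μ` at scale `s` by the one at scale `r`. -/
def WeightedBound {Q : ℕ} (μ lam : Measure (Euc Q)) (p : Euc Q) (C σ s r : ℝ) : Prop :=
  μ.real (Metric.ball p s) / s ^ 2 ≤ C * (μ.real (Metric.ball p r) / r ^ 2
    + ∫ q in Metric.ball p r, ‖q - p‖ * radialWeight p s q ^ 2 ∂μ
    + ∫ q in Metric.ball p r, radialWeight p s q ^ 2 ∂lam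
    + σ ^ 4 * ∫ q in Metric.ball p r, radialWeight p s q ^ 6 ∂μ + σ ^ 2)

/-- Uniformity is the point: the radial fields, the extension of the tangential projection and the
bound for its derivative are chosen from M and N alone, before any surface is given. -/
theorem exists_weightedBound {Q m n : ℕ} {M N : Set (Euc Q)} (hMc : IsCompact M)
    (hM : IsSmoothSubmanifold m M) (hN : IsSmoothSubmanifold n N) (hNc : IsClosed N)
    (hNM : N ⊆ M) : ∃ C ≥ 1, ∃ r₀ > 0, ∀ (S : Type*) [TopologicalSpace S]
      [ChartedSpace (EuclideanHalfSpace 2) S]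
      [IsManifold (𝓡∂ 2) ∞ S] [CompactSpace S] [T2Space S] [MeasurableSpace S] [BorelSpace S]
      (σ : ℝ) (Φ : S → Euc Q) (U : Set S) (p : Euc Q) (s r : ℝ), 0 < σ →
      IsEpsCritical M N σ (σ ^ 5) Φ → IsOpen U → p ∈ M → σ ≤ s → 2 * s ≤ r → r ≤ r₀ →
      (p ∈ N ∨ Disjoint (Metric.ball p r) N) → (∀ x ∈ frontier U, Φ x ∉ Metric.ball p r) →
      WeightedBound (muMeasure Φ U) (lambdaMeasure M σ Φ U) p C σ s r := by
  obtain ⟨C₀, hC₀, r₀, hr₀, hrad⟩ := exists_isRadialField hMc hM hN hNc hNM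
  obtain ⟨pr, hprs, hpr⟩ := hM.exists_smooth_tanProj hMc.isClosed
  obtain ⟨c₁, hc₁⟩ := hMc.exists_bound_of_continuousOn
    (f := fun q => ‖fderiv ℝ pr q‖) (hprs.continuous_fderiv (by simp)).norm.continuousOn
  obtain ⟨C, hC, hdef⟩ := exists_radial_deformation (Q := Q) hC₀.le
  set c₀ := max c₁ 0 with hc₀
  have hc : ∀ q ∈ M, ‖fderiv ℝ pr q‖ ≤ c₀ := fun q hq =>
    ((le_abs_self _).trans (hc₁ q hq)).trans (le_max_left _ _)
  have hc0 : 0 ≤ c₀ := le_max_right _ _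
  set C' := C + 64 * C * (5 + 3 * c₀) ^ 2 + 8 * (2 * C * (1 + 4 * c₀)) ^ 4 with hC'
  have hC'0 : C ≤ C' := by
    have h1 : 0 ≤ 64 * C * (5 + 3 * c₀) ^ 2 := by positivity
    have h2 : 0 ≤ 8 * (2 * C * (1 + 4 * c₀)) ^ 4 := by positivity
    linarith
  -- The tested estimate bounds half of the density ratio. Doubling it gives 2C' for the integrals
  -- and 2(3C + 1) ≤ 6C' + 2 for σ².
  refine ⟨6 * C' + 2, by linarith, min r₀ 1, lt_min hr₀ one_pos, ?_⟩
  intro S _ _ _ _ _ _ _ σ Φ U p s r hσ hΦ hU hp hσs hsr hr hpN hfr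
  have hs : 0 < s := hσ.trans_le hσs
  have hr1 : r ≤ 1 := hr.trans (min_le_right _ _)
  obtain ⟨V, hV⟩ := hrad p hp
  obtain ⟨K, G, hK, hG, hx, hℓ, hd, hL⟩ := hdef M N p (min r₀ 1) V
    (hV.mono (min_le_left _ _) le_rfl) (min_le_right _ _) s r hs hsr hr hpN
  have h := weighted_estimate hM hMc.isClosed hprs hpr hc0 hc hC.le hσ hσs (by linarith) hr1 hK hG
    hx hℓ hd hL hΦ hU hfr
  rw [← hC'] at h
  have t1 : 0 ≤ (muMeasure Φ U).real (Metric.ball p r) / r ^ 2 := by positivity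
  have t2 : 0 ≤ ∫ q in Metric.ball p r, ‖q - p‖ * radialWeight p s q ^ 2 ∂(muMeasure Φ U) :=
    integral_nonneg fun q => by positivity
  have t3 : 0 ≤ ∫ q in Metric.ball p r, radialWeight p s q ^ 2 ∂(lambdaMeasure M σ Φ U) :=
    integral_nonneg fun q => by positivity
  have t4 : 0 ≤ σ ^ 4 * ∫ q in Metric.ball p r, radialWeight p s q ^ 6 ∂(muMeasure Φ U) :=
    mul_nonneg (by positivity) (integral_nonneg fun q => by positivity)
  have t5 : 0 ≤ σ ^ 2 := by positivity
  have e : (muMeasure Φ U).real (Metric.ball p s) / s ^ 2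
      = 2 * ((muMeasure Φ U).real (Metric.ball p s) / (2 * s ^ 2)) := by
    field_simp
  rw [WeightedBound, e]
  set a := (muMeasure Φ U).real (Metric.ball p r) / r ^ 2
  set b := ∫ q in Metric.ball p r, ‖q - p‖ * radialWeight p s q ^ 2 ∂(muMeasure Φ U)
  set c := ∫ q in Metric.ball p r, radialWeight p s q ^ 2 ∂(lambdaMeasure M σ Φ U)
  set d := σ ^ 4 * ∫ q in Metric.ball p r, radialWeight p s q ^ 6 ∂(muMeasure Φ U)
  have k1 := mul_le_mul_of_nonneg_right hC'0 t1
  have k2 := mul_le_mul_of_nonneg_right hC'0 t2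
  have k5 := mul_le_mul_of_nonneg_right hC'0 t5
  have hC'1 : 0 < C' := hC.trans_le hC'0
  have l1 := mul_nonneg hC'1.le t1
  have l2 := mul_nonneg hC'1.le t2
  have l3 := mul_nonneg hC'1.le t3
  have l4 := mul_nonneg hC'1.le t4
  have l5 := mul_nonneg hC'1.le t5
  linarith

/-! ### Dyadic iteration of the weighted bound -/

section Dyadic

variable {Q : ℕ} {p : Euc Q}

theorem radialWeight_le_inv {s t : ℝ} (ht : 0 < t) {q : Euc Q} (hq : t ≤ ‖q - p‖) :
    radialWeight p s q ≤ t⁻¹ := by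
  have h := radialWeight_sq p s q
  have h0 : 0 ≤ radialWeight p s q := by rw [radialWeight]; positivity
  refine le_of_sq_le_sq ?_ (by positivity)
  rw [h, inv_pow]
  have h1 : t ^ 2 ≤ ‖q - p‖ ^ 2 := by gcongr
  gcongr
  linarith [sq_nonneg s]

/-- Every point of a large ball lies in a dyadic ball whose radius controls the radial weight. -/
theorem exists_dyadic_radialWeight_le {s : ℝ} (hs : 0 < s) {J : ℕ} {q : Euc Q}
    (hq : q ∈ Metric.ball p (2 ^ J * s)) :
    ∃ j ≤ J, q ∈ Metric.ball p (2 ^ j * s) ∧ radialWeight p s q ≤ 2 * (2 ^ j * s)⁻¹ := by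
  classical
  have hex : ∃ j, q ∈ Metric.ball p (2 ^ j * s) := ⟨J, hq⟩
  refine ⟨Nat.find hex, Nat.find_min' hex hq, Nat.find_spec hex, ?_⟩
  rcases h : Nat.find hex with _ | j
  · have := radialWeight_le p hs q
    have h2 : 0 < s⁻¹ := by positivity
    simp only [pow_zero, one_mul]
    linarith
  · have hj : q ∉ Metric.ball p (2 ^ j * s) := Nat.find_min hex (by omega)
    rw [Metric.mem_ball, not_lt, dist_eq_norm] at hj
    refine (radialWeight_le_inv (by positivity) hj).trans_eq ?_
    rw [pow_succ]
    field_simp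

/-- A function bounded by a constant on each dyadic shell is integrated shell by shell. -/
theorem setIntegral_le_dyadic_sum (ν : Measure (Euc Q)) [IsFiniteMeasure ν] {s : ℝ} {J : ℕ}
    {f : Euc Q → ℝ} {c : ℕ → ℝ} (hf : ∀ q, 0 ≤ f q) (hc : ∀ j, 0 ≤ c j)
    (h : ∀ q ∈ Metric.ball p (2 ^ J * s), ∃ j ≤ J, q ∈ Metric.ball p (2 ^ j * s) ∧ f q ≤ c j) :
    ∫ q in Metric.ball p (2 ^ J * s), f q ∂ν
      ≤ ∑ j ∈ Finset.range (J + 1), c j * ν.real (Metric.ball p (2 ^ j * s)) := by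
  have hi : ∀ j ∈ Finset.range (J + 1), Integrable
      (fun q => (Metric.ball p (2 ^ j * s)).indicator (fun _ => c j) q)
      (ν.restrict (Metric.ball p (2 ^ J * s))) := fun j _ =>
    (integrable_const _).indicator measurableSet_ball
  calc ∫ q in Metric.ball p (2 ^ J * s), f q ∂ν
      ≤ ∫ q in Metric.ball p (2 ^ J * s), ∑ j ∈ Finset.range (J + 1),
          (Metric.ball p (2 ^ j * s)).indicator (fun _ => c j) q ∂ν := by
        refine integral_mono_of_nonneg (Eventually.of_forall hf) (integrable_finsetSum _ hi) ?_
        filter_upwards [ae_restrict_mem measurableSet_ball] with q hq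
        obtain ⟨j, hj, hqj, hfj⟩ := h q hq
        refine hfj.trans ?_
        have := Finset.single_le_sum (f := fun j =>
          (Metric.ball p (2 ^ j * s)).indicator (fun _ => c j) q)
          (fun k _ => indicator_nonneg (fun _ _ => hc k) q)
          (Finset.mem_range.2 (Nat.lt_succ_of_le hj))
        simpa [indicator_of_mem hqj] using this
    _ = ∑ j ∈ Finset.range (J + 1), c j *
          (ν.restrict (Metric.ball p (2 ^ J * s))).real (Metric.ball p (2 ^ j * s)) := by
        rw [integral_finsetSum _ hi]
        refine Finset.sum_congr rfl fun j _ => ?_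
        rw [integral_indicator_const _ measurableSet_ball, smul_eq_mul, mul_comm]
    _ ≤ _ := by
        refine Finset.sum_le_sum fun j _ => mul_le_mul_of_nonneg_left ?_ (hc j)
        exact ENNReal.toReal_mono (measure_ne_top _ _) (Measure.restrict_apply_le _ _)

theorem sum_inv_two_pow_four_le (n : ℕ) :
    ∑ j ∈ Finset.range n, (((2 : ℝ) ^ j) ^ 4)⁻¹ ≤ 2 := by
  have h : ∀ j : ℕ, (((2 : ℝ) ^ j) ^ 4)⁻¹ = (16⁻¹ : ℝ) ^ j := fun j => by
    rw [← pow_mul, mul_comm, pow_mul, inv_pow]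
    norm_num
  simp only [h]
  rw [geom_sum_eq (by norm_num)]
  have : (0 : ℝ) ≤ (16⁻¹ : ℝ) ^ n := by positivity
  rw [div_le_iff_of_neg (by norm_num)]
  linarith

variable {μ lam : Measure (Euc Q)} [IsFiniteMeasure μ] [IsFiniteMeasure lam] {C σ δ : ℝ} {i : ℕ}

/-- The weighted bound under a uniform bound `D` for the density ratios. -/
theorem WeightedBound.le_of_ratio_le {s D : ℝ} {J : ℕ} (hs : 0 < s) (hC : 0 ≤ C)
    (hδ : 0 ≤ δ) (hw : WeightedBound μ lam p C σ s (2 ^ J * s))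
    (hlam : ∀ j ≤ J, lam.real (Metric.ball p (2 ^ j * s))
      ≤ δ * μ.real (Metric.ball p (2 ^ (j + i) * s)))
    (hD : ∀ j ≤ J + i, μ.real (Metric.ball p (2 ^ j * s)) ≤ D * (2 ^ j * s) ^ 2) :
    μ.real (Metric.ball p s) / s ^ 2 ≤ C * (μ.real (Metric.ball p (2 ^ J * s)) / (2 ^ J * s) ^ 2
      + 4 * (2 ^ J * s) * D + 4 ^ (i + 1) * δ * (J + 1) * D + 128 * (σ / s) ^ 4 * D + σ ^ 2) := by
  have hD0 : 0 ≤ D := by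
    have := (measureReal_nonneg (μ := μ)).trans (hD 0 (by omega))
    have h2 : 0 < (2 ^ 0 * s) ^ 2 := by positivity
    exact nonneg_of_mul_nonneg_left this h2
  have hκ : ∀ q, 0 < radialWeight p s q := radialWeight_pos p hs
  -- As ρκ ≤ 1, the integrand is at most κ, of size 1/t on the shell of radius t, which has mass at
  -- most Dt². The sum is geometric and dominated by the largest radius.
  have h1 : ∫ q in Metric.ball p (2 ^ J * s), ‖q - p‖ * radialWeight p s q ^ 2 ∂μ
      ≤ 4 * (2 ^ J * s) * D := by
    refine (setIntegral_le_dyadic_sum μ (c := fun j => 2 * (2 ^ j * s)⁻¹)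
      (fun q => by have := hκ q; positivity) (fun j => by positivity) fun q hq => ?_).trans ?_
    · obtain ⟨j, hj, hqj, hk⟩ := exists_dyadic_radialWeight_le hs hq
      refine ⟨j, hj, hqj, le_trans ?_ hk⟩
      have := mul_le_mul_of_nonneg_right (norm_mul_radialWeight_le p s q) (hκ q).le
      rw [pow_two, ← mul_assoc]
      linarith
    · calc _ ≤ ∑ j ∈ Finset.range (J + 1), 2 ^ j * (2 * s * D) := by
            refine Finset.sum_le_sum fun j hj => ?_
            have := mul_le_mul_of_nonneg_left (hD j (by have := Finset.mem_range.1 hj; omega))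
              (by positivity : 0 ≤ 2 * (2 ^ j * s)⁻¹)
            refine this.trans_eq ?_
            field_simp
        _ = (2 ^ (J + 1) - 1) * (2 * s * D) := by
            rw [← Finset.sum_mul, geom_sum_eq (by norm_num)]
            norm_num
        _ ≤ _ := by
            have : 0 ≤ 2 * s * D := by positivity
            rw [pow_succ]
            linarith
  -- This is the scale invariant term: each of the J + 1 shells contributes the same amount 4^(i+1)
  -- δ D, which produces the logarithm in the final estimate.
  have h2 : ∫ q in Metric.ball p (2 ^ J * s), radialWeight p s q ^ 2 ∂lam
      ≤ 4 ^ (i + 1) * δ * (J + 1) * D := by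
    refine (setIntegral_le_dyadic_sum lam (c := fun j => (2 * (2 ^ j * s)⁻¹) ^ 2)
      (fun q => by positivity) (fun j => by positivity) fun q hq => ?_).trans ?_
    · obtain ⟨j, hj, hqj, hk⟩ := exists_dyadic_radialWeight_le hs hq
      have := (hκ q).le
      exact ⟨j, hj, hqj, by gcongr⟩
    · calc _ ≤ ∑ j ∈ Finset.range (J + 1), 4 ^ (i + 1) * δ * D := by
            refine Finset.sum_le_sum fun j hj => ?_
            have hj' := Finset.mem_range.1 hj
            have h3 := mul_le_mul_of_nonneg_left ((hlam j (by omega)).trans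
              (mul_le_mul_of_nonneg_left (hD (j + i) (by omega)) hδ))
              (by positivity : 0 ≤ (2 * (2 ^ j * s)⁻¹) ^ 2)
            refine h3.trans_eq ?_
            have h4 : (4 : ℝ) ^ (i + 1) = 4 * (2 ^ i) ^ 2 := by
              rw [← pow_mul, mul_comm i, pow_mul, pow_succ]
              norm_num [mul_comm]
            rw [h4, pow_add]
            field_simp
            ring
        _ = _ := by
            rw [Finset.sum_const, Finset.card_range, nsmul_eq_mul]
            push_cast
            ring
  -- On the shell of radius t the integral is of order D t⁻⁴. The series converges and is dominated
  -- by the smallest radius s, with sum at most 2.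
  have h3 : σ ^ 4 * ∫ q in Metric.ball p (2 ^ J * s), radialWeight p s q ^ 6 ∂μ
      ≤ 128 * (σ / s) ^ 4 * D := by
    have h4 : ∫ q in Metric.ball p (2 ^ J * s), radialWeight p s q ^ 6 ∂μ
        ≤ 64 * (s ^ 4)⁻¹ * D * 2 := by
      refine (setIntegral_le_dyadic_sum μ (c := fun j => (2 * (2 ^ j * s)⁻¹) ^ 6)
        (fun q => by have := hκ q; positivity) (fun j => by positivity) fun q hq => ?_).trans ?_
      · obtain ⟨j, hj, hqj, hk⟩ := exists_dyadic_radialWeight_le hs hq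
        have := (hκ q).le
        exact ⟨j, hj, hqj, by gcongr⟩
      · calc _ ≤ ∑ j ∈ Finset.range (J + 1), 64 * (s ^ 4)⁻¹ * D * (((2 : ℝ) ^ j) ^ 4)⁻¹ := by
              refine Finset.sum_le_sum fun j hj => ?_
              have := mul_le_mul_of_nonneg_left (hD j (by have := Finset.mem_range.1 hj; omega))
                (by positivity : 0 ≤ (2 * (2 ^ j * s)⁻¹) ^ 6)
              refine this.trans_eq ?_
              field_simp
              ring
          _ ≤ _ := by
              rw [← Finset.mul_sum]
              exact mul_le_mul_of_nonneg_left (sum_inv_two_pow_four_le _) (by positivity)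
    refine (mul_le_mul_of_nonneg_left h4 (by positivity)).trans_eq ?_
    rw [div_pow]
    field_simp
    ring
  exact hw.trans (mul_le_mul_of_nonneg_left (by linarith) hC)

/-- Growth of the density ratio along dyadic radii. -/
theorem dyadic_growth {s K : ℝ} {J : ℕ} (hσ : 0 < σ) (hC : 1 ≤ C) (hδ : 0 ≤ δ) (hK : 0 < K)
    (hCK : 512 * C ≤ K ^ 4) (hKs : K * σ ≤ s) (hJs : 16 * C * (2 ^ J * s) ≤ 1)
    (hlam : ∀ j ≤ J, lam.real (Metric.ball p (2 ^ j * s))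
      ≤ δ * μ.real (Metric.ball p (2 ^ (j + i) * s)))
    (hw : ∀ j < J, WeightedBound μ lam p C σ (2 ^ j * s) (2 ^ J * s)) :
    (1 / (2 * C) - 4 ^ (i + 1) * δ * (J + 1)) * (μ.real (Metric.ball p s) / s ^ 2) - σ ^ 2
      ≤ 4 ^ i * (μ.real (Metric.ball p (2 ^ (J + i) * s)) / (2 ^ (J + i) * s) ^ 2) := by
  have hs : 0 < s := (mul_pos hK hσ).trans_le hKs
  set A : ℕ → ℝ := fun j => μ.real (Metric.ball p (2 ^ j * s)) / (2 ^ j * s) ^ 2 with hA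
  have hA0 : ∀ j, 0 ≤ A j := fun j => by simp only [hA]; positivity
  have hgrow : ∀ k l, A k ≤ 4 ^ l * A (k + l) := fun k l => by
    have h1 : μ.real (Metric.ball p (2 ^ k * s)) ≤ μ.real (Metric.ball p (2 ^ (k + l) * s)) := by
      refine measureReal_mono (Metric.ball_subset_ball ?_)
      gcongr
      · norm_num
      · omega
    have h4 : (4 : ℝ) ^ l = (2 ^ l) ^ 2 := by
      rw [← pow_mul, mul_comm l, pow_mul]
      norm_num
    simp only [hA]
    rw [h4, pow_add, ← mul_div_assoc, div_le_div_iff₀ (by positivity) (by positivity)]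
    rw [pow_add] at h1
    calc _ ≤ μ.real (Metric.ball p (2 ^ k * 2 ^ l * s)) * (2 ^ k * 2 ^ l * s) ^ 2 := by gcongr
      _ = _ := by ring
  -- The weighted bound is applied from the scale where the ratio is largest. There the uniform
  -- bound D is the left side itself, so terms with a small coefficient times D can be absorbed.
  obtain ⟨k, hk, hmax⟩ := Finset.exists_max_image (Finset.range (J + i + 1)) A ⟨0, by simp⟩
  have hA00 : μ.real (Metric.ball p s) / s ^ 2 = A 0 := by simp [hA]
  have h0k : A 0 ≤ A k := hmax 0 (by simp)
  have hk' : k ≤ J + i := by have := Finset.mem_range.1 hk; omega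
  rw [hA00]
  change _ ≤ 4 ^ i * A (J + i)
  have hδJ : 0 ≤ 4 ^ (i + 1) * δ * (J + 1) := by positivity
  rcases lt_or_ge k J with hkJ | hkJ
  · obtain ⟨l, rfl⟩ : ∃ l, J = l + k := ⟨J - k, by omega⟩
    have hrad : (2 : ℝ) ^ (l + k) * s = 2 ^ l * (2 ^ k * s) := by rw [pow_add]; ring
    have hrad' : ∀ j, (2 : ℝ) ^ j * (2 ^ k * s) = 2 ^ (j + k) * s := fun j => by
      rw [pow_add]; ring
    have hwk := hw k hkJ
    rw [hrad] at hwk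
    have key := hwk.le_of_ratio_le (by positivity) (by linarith) hδ (i := i)
      (D := A k) (fun j hj => by
        rw [hrad', hrad', show j + i + k = (j + k) + i by omega]
        exact hlam (j + k) (by omega))
      (fun j hj => by
        rw [hrad']
        have := hmax (j + k) (Finset.mem_range.2 (by omega))
        rwa [← div_le_iff₀ (by positivity)])
    rw [← hrad] at key
    change A k ≤ C * (A (l + k) + _ + _ + _ + _) at key
    -- The smallness of the outer radius and the choice 512 C ≤ K⁴ make two of the errors at most a
    -- quarter of the left side each; half of it remains.
    have e1 : C * (4 * (2 ^ (l + k) * s) * A k) ≤ A k / 4 := by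
      have := mul_le_mul_of_nonneg_right hJs (hA0 k)
      linarith
    have e2 : C * (128 * (σ / (2 ^ k * s)) ^ 4 * A k) ≤ A k / 4 := by
      have h5 : σ / (2 ^ k * s) ≤ K⁻¹ := by
        rw [div_le_iff₀ (by positivity), inv_mul_eq_div, le_div_iff₀ hK]
        have : (1 : ℝ) ≤ 2 ^ k := one_le_pow₀ (by norm_num)
        have := mul_le_mul_of_nonneg_right this hs.le
        linarith
      have h6 : (σ / (2 ^ k * s)) ^ 4 ≤ (K ^ 4)⁻¹ := by
        rw [← inv_pow]
        gcongr
      have h7 : 512 * C * (σ / (2 ^ k * s)) ^ 4 ≤ 1 := by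
        calc _ ≤ K ^ 4 * (K ^ 4)⁻¹ := by gcongr
          _ = 1 := mul_inv_cancel₀ (by positivity)
      have := mul_le_mul_of_nonneg_right h7 (hA0 k)
      linarith
    have e3 : 4 ^ (i + 1) * δ * (l + 1) * A k ≤ 4 ^ (i + 1) * δ * ((l + k : ℕ) + 1) * A k := by
      have := hA0 k
      gcongr
      have : (0 : ℝ) ≤ k := by positivity
      linarith
    have e4 : (1 / (2 * C) - 4 ^ (i + 1) * δ * ((l + k : ℕ) + 1)) * A k - σ ^ 2 ≤ A (l + k) := by
      have h8 : A k / 2 ≤ C * (A (l + k) + 4 ^ (i + 1) * δ * ((l + k : ℕ) + 1) * A k + σ ^ 2) := by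
        have := mul_le_mul_of_nonneg_left e3 (by linarith : 0 ≤ C)
        linarith
      have h9 : 1 / (2 * C) * A k = A k / 2 / C := by field_simp
      have h10 := (div_le_iff₀' (by linarith : 0 < C)).2 h8
      linarith
    refine le_trans ?_ (hgrow (l + k) i)
    -- Replacing the maximal ratio by the one at the initial scale needs a nonnegative coefficient.
    -- A negative coefficient makes the claim trivial.
    rcases le_total 0 (1 / (2 * C) - 4 ^ (i + 1) * δ * ((l + k : ℕ) + 1)) with h | h
    · have := mul_le_mul_of_nonneg_left h0k h
      linarith
    · have := mul_nonpos_of_nonpos_of_nonneg h (hA0 0)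
      have := hA0 (l + k)
      have := sq_nonneg σ
      linarith
  -- If the maximum occurs at one of the last i + 1 scales, it is compared with the outermost ratio
  -- by inclusion of balls, at the cost of a factor 4^i.
  · obtain ⟨l, hl⟩ : ∃ l, J + i = k + l := ⟨J + i - k, by omega⟩
    have h1 := hgrow k l
    have h2 : (4 : ℝ) ^ l ≤ 4 ^ i := pow_le_pow_right₀ (by norm_num) (by omega)
    have h3 := mul_le_mul_of_nonneg_right h2 (hA0 (k + l))
    rw [hl]
    have h4 : 1 / (2 * C) ≤ 1 := by
      rw [div_le_one (by positivity)]
      linarith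
    have h5 := mul_le_mul_of_nonneg_right
      (show 1 / (2 * C) - 4 ^ (i + 1) * δ * (J + 1) ≤ 1 by linarith) (hA0 0)
    have := sq_nonneg σ
    linarith

end Dyadic

/-! ### Growth of density ratios between two radii -/

section Growth

variable {Q : ℕ}

/-- The density ratio `μ(B_t(p)) / t²` of Euclidean balls. -/
def ballRatio (μ : Measure (Euc Q)) (p : Euc Q) (t : ℝ) : ℝ :=
  μ.real (Metric.ball p t) / t ^ 2

variable {μ lam : Measure (Euc Q)}

theorem ballRatio_nonneg (p : Euc Q) (t : ℝ) : 0 ≤ ballRatio μ p t := by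
  rw [ballRatio]
  positivity

variable [IsFiniteMeasure μ] [IsFiniteMeasure lam]

/-- Inclusion of balls, possibly with different centres: the ratio grows by at most the square of
the quotient of the radii. -/
theorem ballRatio_le_mul {p q : Euc Q} {s t k : ℝ} (hs : 0 < s) (ht : 0 < t)
    (htk : t ≤ k * s) (hpq : s + dist p q ≤ t) : ballRatio μ p s ≤ k ^ 2 * ballRatio μ q t := by
  have h1 : μ.real (Metric.ball p s) ≤ μ.real (Metric.ball q t) :=
    measureReal_mono (Metric.ball_subset_ball' hpq)
  have h2 : t ^ 2 ≤ (k * s) ^ 2 := by gcongr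
  rw [ballRatio, ballRatio, ← mul_div_assoc, div_le_div_iff₀ (by positivity) (by positivity)]
  calc μ.real (Metric.ball p s) * t ^ 2 ≤ μ.real (Metric.ball q t) * (k * s) ^ 2 := by gcongr
    _ = _ := by ring

/-- The constant in the growth estimate for density ratios. -/
def growthConst (C : ℝ) (i : ℕ) : ℝ := (4 ^ (i + 1) * (512 * C) ^ 2 * (2 * C))⁻¹

theorem growthConst_pos {C : ℝ} (hC : 1 ≤ C) (i : ℕ) : 0 < growthConst C i := by
  rw [growthConst]
  positivity

theorem growthConst_le_one {C : ℝ} (hC : 1 ≤ C) (i : ℕ) : growthConst C i ≤ 1 := by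
  refine inv_le_one_of_one_le₀ ?_
  refine one_le_mul_of_one_le_of_one_le (one_le_mul_of_one_le_of_one_le ?_ ?_) ?_
  · exact one_le_pow₀ (by norm_num)
  · exact one_le_pow₀ (by linarith)
  · linarith

/-- Almost monotonicity of the density ratio at a fixed centre. -/
theorem ballRatio_growth {p : Euc Q} {C σ δ a b : ℝ} {i : ℕ} (hC : 1 ≤ C) (hσ : 0 < σ)
    (hδ : 0 ≤ δ) (hσa : σ ≤ a) (hab : a ≤ b) (hb : 16 * C * b ≤ 1)
    (hlam : ∀ t, a ≤ t → t ≤ b →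
      lam.real (Metric.ball p t) ≤ δ * μ.real (Metric.ball p (2 ^ i * t)))
    (hw : ∀ s r, a ≤ s → 2 * s ≤ r → r ≤ b → WeightedBound μ lam p C σ s r) :
    (growthConst C i - 2 * δ * (1 + Real.log (b / a))) * ballRatio μ p a - 2 * σ ^ 2
      ≤ ballRatio μ p b := by
  have ha : 0 < a := hσ.trans_le hσa
  have hb0 : 0 < b := ha.trans_le hab
  have hlog : 0 ≤ Real.log (b / a) := Real.log_nonneg ((one_le_div ha).2 hab)
  have hA := ballRatio_nonneg (μ := μ) p a
  have hB := ballRatio_nonneg (μ := μ) p b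
  have hσ2 := sq_nonneg σ
  -- The iteration starts at radius Ka rather than a, so that the initial scale is at least Kσ with
  -- K⁴ ≥ 512 C; the comparison of the two radii costs K².
  set K := 512 * C with hKdef
  have hK1 : 1 ≤ K := by linarith
  have hK : 0 < K := by linarith
  set x := δ * (1 + Real.log (b / a)) with hx
  have hx0 : 0 ≤ x := by positivity
  have h2i : (1 : ℝ) ≤ 2 ^ i := one_le_pow₀ (by norm_num)
  have h4i : (4 : ℝ) ^ (i + 1) = 4 * (2 ^ i) ^ 2 := by
    rw [← pow_mul, mul_comm i, pow_mul, pow_succ]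
    norm_num [mul_comm]
  -- When the radii differ by a bounded factor, inclusion of balls suffices. Otherwise J is the
  -- largest number of dyadic steps for which J + i steps from Ka stay below b.
  rcases lt_or_ge b (2 ^ i * (K * a)) with hcase | hcase
  · have h1 := ballRatio_le_mul (μ := μ) (p := p) (q := p) (k := 2 ^ i * K) ha hb0
      (by linarith) (by simpa using hab)
    have h2 : growthConst C i * (2 ^ i * K) ^ 2 ≤ 1 := by
      rw [growthConst, ← hKdef, h4i, inv_mul_le_one₀ (by positivity)]
      have h3 : 0 ≤ (2 ^ i * K) ^ 2 := by positivity
      have h4 := mul_le_mul_of_nonneg_left (by linarith : 1 ≤ 4 * (2 * C)) h3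
      linarith
    have h3 := mul_le_mul_of_nonneg_left h1 (growthConst_pos hC i).le
    have h4 := mul_le_mul_of_nonneg_right h2 hB
    have h5 := mul_nonneg hx0 hA
    rw [show (growthConst C i - 2 * δ * (1 + Real.log (b / a))) * ballRatio μ p a
      = growthConst C i * ballRatio μ p a - 2 * (x * ballRatio μ p a) by rw [hx]; ring]
    linarith
  · have hKa : 0 < K * a := by positivity
    obtain ⟨J, hJ1, hJ2⟩ := exists_nat_pow_near (x := b / (2 ^ i * (K * a))) (y := (2 : ℝ))
      ((one_le_div (by positivity)).2 hcase) (by norm_num)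
    rw [le_div_iff₀ (by positivity)] at hJ1
    rw [div_lt_iff₀ (by positivity)] at hJ2
    have hJi : (2 : ℝ) ^ (J + i) * (K * a) ≤ b := by rw [pow_add, mul_assoc]; exact hJ1
    have hJb : (2 : ℝ) ^ J * (K * a) ≤ b := by
      refine le_trans ?_ hJi
      gcongr
      · norm_num
      · omega
    have haK : a ≤ K * a := le_mul_of_one_le_left ha.le hK1
    have hale : ∀ j : ℕ, a ≤ 2 ^ j * (K * a) := fun j =>
      haK.trans (le_mul_of_one_le_left hKa.le (one_le_pow₀ (by norm_num)))
    have key := dyadic_growth (μ := μ) (lam := lam) (p := p) (C := C) (δ := δ) (i := i)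
      (s := K * a) (K := K) (J := J) hσ hC hδ hK (le_self_pow₀ hK1 (by norm_num))
      (by gcongr) (le_trans (by gcongr) hb)
      (fun j hj => by
        rw [show (2 : ℝ) ^ (j + i) * (K * a) = 2 ^ i * (2 ^ j * (K * a)) by rw [pow_add]; ring]
        refine hlam _ (hale j) (le_trans ?_ hJb)
        gcongr
        norm_num)
      (fun j hj => hw _ _ (hale j) (by
        rw [← mul_assoc, ← pow_succ']
        gcongr
        · norm_num
        · omega) hJb)
    change _ * ballRatio μ p (K * a) - _ ≤ _ * ballRatio μ p _ at key
    have h1 : ballRatio μ p (2 ^ (J + i) * (K * a)) ≤ 2 ^ 2 * ballRatio μ p b :=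
      ballRatio_le_mul (by positivity) hb0 (by
        rw [pow_succ] at hJ2
        rw [pow_add]
        linarith) (by simpa using hJi)
    have h2 : ballRatio μ p a ≤ K ^ 2 * ballRatio μ p (K * a) :=
      ballRatio_le_mul ha hKa le_rfl (by simpa using haK)
    have hJlog : (J : ℝ) ≤ 2 * Real.log (b / a) := by
      have h3 : (2 : ℝ) ^ J ≤ b / a := by
        rw [le_div_iff₀ ha]
        exact le_trans (by gcongr) hJb
      have h4 := Real.log_le_log (by positivity) h3
      rw [Real.log_pow] at h4
      have h5 := Real.log_two_gt_d9
      have h6 : (J : ℝ) * (1 / 2) ≤ J * Real.log 2 := by gcongr; linarith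
      linarith
    have h3 : δ * (J + 1) ≤ 2 * x := by
      rw [hx]
      have := mul_le_mul_of_nonneg_left (by linarith : (J : ℝ) + 1 ≤ 2 * (1 + Real.log (b / a))) hδ
      linarith
    have hc : growthConst C i = (1 / (2 * C)) * (4 ^ (i + 1) * K ^ 2)⁻¹ := by
      rw [growthConst, ← hKdef]
      field_simp
    have h5 : (4 : ℝ) ^ i * ballRatio μ p (2 ^ (J + i) * (K * a))
        ≤ 4 ^ (i + 1) * ballRatio μ p b := by
      have := mul_le_mul_of_nonneg_left h1 (by positivity : (0 : ℝ) ≤ 4 ^ i)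
      rw [pow_succ (4 : ℝ) i]
      linarith
    rcases le_total 0 (1 / (2 * C) - 4 ^ (i + 1) * (2 * x)) with h | h
    · have h6 : (1 / (2 * C) - 4 ^ (i + 1) * (2 * x)) * ballRatio μ p (K * a) - σ ^ 2
          ≤ 4 ^ (i + 1) * ballRatio μ p b := by
        refine le_trans ?_ (key.trans h5)
        have h7 : 1 / (2 * C) - 4 ^ (i + 1) * (2 * x)
            ≤ 1 / (2 * C) - 4 ^ (i + 1) * δ * (J + 1) := by
          have := mul_le_mul_of_nonneg_left h3 (by positivity : (0 : ℝ) ≤ 4 ^ (i + 1))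
          linarith
        have := mul_le_mul_of_nonneg_right h7 (ballRatio_nonneg (μ := μ) p (K * a))
        linarith
      have h8 := mul_le_mul_of_nonneg_left h2 h
      have h9 : (1 / (2 * C) - 4 ^ (i + 1) * (2 * x)) * ballRatio μ p a
          ≤ K ^ 2 * (4 ^ (i + 1) * ballRatio μ p b + σ ^ 2) := by
        have := mul_le_mul_of_nonneg_left h6 (by positivity : 0 ≤ K ^ 2)
        linarith
      have h10 := mul_le_mul_of_nonneg_left h9
        (by positivity : 0 ≤ ((4 : ℝ) ^ (i + 1) * K ^ 2)⁻¹)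
      have h11 : ((4 : ℝ) ^ (i + 1) * K ^ 2)⁻¹ * (K ^ 2 * (4 ^ (i + 1) * ballRatio μ p b + σ ^ 2))
          = ballRatio μ p b + ((4 : ℝ) ^ (i + 1))⁻¹ * σ ^ 2 := by field_simp
      have h12 : ((4 : ℝ) ^ (i + 1) * K ^ 2)⁻¹
          * ((1 / (2 * C) - 4 ^ (i + 1) * (2 * x)) * ballRatio μ p a)
          = growthConst C i * ballRatio μ p a - (K ^ 2)⁻¹ * (2 * x * ballRatio μ p a) := by
        rw [hc]
        field_simp
      have h13 : ((4 : ℝ) ^ (i + 1))⁻¹ * σ ^ 2 ≤ 1 * σ ^ 2 := by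
        gcongr
        exact inv_le_one_of_one_le₀ (one_le_pow₀ (by norm_num))
      have h14 : (K ^ 2)⁻¹ * (2 * x * ballRatio μ p a) ≤ 1 * (2 * x * ballRatio μ p a) := by
        gcongr
        exact inv_le_one_of_one_le₀ (one_le_pow₀ hK1)
      rw [show (growthConst C i - 2 * δ * (1 + Real.log (b / a))) * ballRatio μ p a
        = growthConst C i * ballRatio μ p a - 2 * x * ballRatio μ p a by rw [hx]; ring]
      linarith
    -- When the dyadic coefficient is not positive, the logarithmic loss already exceeds the growth
    -- constant and the claim is trivial.
    · have h6 : growthConst C i ≤ 2 * x := by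
        have h4p : (0 : ℝ) < 4 ^ (i + 1) := by positivity
        have h7 : 1 / (2 * C) * (4 ^ (i + 1))⁻¹ ≤ 2 * x := by
          rw [← div_eq_mul_inv, div_le_iff₀ h4p]
          linarith
        refine le_trans ?_ h7
        rw [hc, mul_inv]
        have h8 : ((4 : ℝ) ^ (i + 1))⁻¹ * (K ^ 2)⁻¹ ≤ (4 ^ (i + 1))⁻¹ * 1 := by
          gcongr
          exact inv_le_one_of_one_le₀ (one_le_pow₀ hK1)
        rw [mul_one] at h8
        gcongr
      have h7 := mul_le_mul_of_nonneg_right h6 hA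
      rw [show (growthConst C i - 2 * δ * (1 + Real.log (b / a))) * ballRatio μ p a
        = growthConst C i * ballRatio μ p a - 2 * x * ballRatio μ p a by rw [hx]; ring]
      linarith

end Growth

/-! ### Geodesic and Euclidean balls -/

section GeodesicBalls

variable {Q k : ℕ} {M : Set (Euc Q)}

/-- A chord is no longer than any curve joining its endpoints. -/
theorem geodBall_subset_ball (p : Euc Q) (t : ℝ) : geodBall M p t ⊆ Metric.ball p t := by
  rintro q ⟨-, hq⟩
  rw [← Metric.eball_ofReal, Metric.mem_eball, edist_comm]
  refine lt_of_le_of_lt ?_ hq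
  refine le_iInf fun γ => le_iInf fun hγ => le_iInf fun _ => le_iInf fun h0 => le_iInf fun h1 => ?_
  rw [← h0, ← h1, edist_comm, edist_eq_enorm_sub]
  exact enorm_sub_le_lintegral_deriv_of_contDiffOn_Icc hγ zero_le_one

/-- Near a point of a submanifold, the intrinsic distance is controlled by the Euclidean one. -/
theorem IsSmoothSubmanifold.eventually_geodEDist_le (hM : IsSmoothSubmanifold k M) {p₀ : Euc Q}
    (hp₀ : p₀ ∈ M) : ∃ Λ ≥ (0 : ℝ), ∃ r > 0, ∀ p ∈ Metric.ball p₀ r ∩ M,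
      ∀ q ∈ Metric.ball p₀ r ∩ M, geodEDist M p q ≤ ENNReal.ofReal (Λ * dist q p) := by
  obtain ⟨W, hW⟩ := hM.exists_isStraightening
  obtain ⟨e, hpe, he⟩ := hW p₀ hp₀
  obtain ⟨K, T, hT, hK⟩ := ((he.contDiffAt_symm (e.map_source hpe)).of_le
    (m := 1) (by simp)).exists_lipschitzOnWith
  obtain ⟨K', T', hT', hK'⟩ := ((he.contDiffAt hpe).of_le
    (m := 1) (by simp)).exists_lipschitzOnWith
  obtain ⟨ε, hε, hεT⟩ := Metric.mem_nhds_iff.1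
    (inter_mem hT (e.open_target.mem_nhds (e.map_source hpe)))
  obtain ⟨r, hr, hrT⟩ := Metric.mem_nhds_iff.1 (inter_mem (inter_mem hT'
    (e.open_source.mem_nhds hpe)) ((he.contDiffAt hpe).continuousAt.preimage_mem_nhds
      (Metric.ball_mem_nhds (e p₀) hε)))
  refine ⟨K * K', by positivity, r, hr, fun p hp q hq => ?_⟩
  have hp' := hrT hp.1
  have hq' := hrT hq.1
  -- The competitor curve is the preimage of a segment in straightened coordinates. It stays in M
  -- because W is linear, and its speed is bounded by the Lipschitz constants of the chart and of
  -- its inverse.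
  let z : ℝ → Euc Q := fun t => e p + t • (e q - e p)
  have hz : ∀ t ∈ Icc (0 : ℝ) 1, z t ∈ Metric.ball (e p₀) ε := fun t ht =>
    (convex_ball (e p₀) ε).add_smul_sub_mem hp'.2 hq'.2 ht
  have hzs : ContDiff ℝ 1 z := by fun_prop
  have hzL : LipschitzWith ‖e q - e p‖₊ z := LipschitzWith.of_dist_le_mul fun t u => by
    simp only [z, dist_eq_norm, coe_nnnorm]
    rw [add_sub_add_left_eq_sub, ← sub_smul, norm_smul, mul_comm]
  have hγ : ContDiffOn ℝ 1 (fun t => e.symm (z t)) (Icc 0 1) := fun t ht =>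
    (((he.contDiffAt_symm (hεT (hz t ht)).2).of_le (by simp)).comp t
      hzs.contDiffAt).contDiffWithinAt
  have hγM : MapsTo (fun t => e.symm (z t)) (Icc 0 1) M := fun t ht => by
    have hzt := (hεT (hz t ht)).2
    refine (he.mem_iff _ (e.map_target hzt)).2 ?_
    rw [e.right_inv hzt]
    have h1 := (he.mem_iff _ hp'.1.2).1 hp.2
    have h2 := (he.mem_iff _ hq'.1.2).1 hq.2
    exact W.add_mem h1 (W.smul_mem _ (W.sub_mem h2 h1))
  have hd : ∀ t ∈ Icc (0 : ℝ) 1, ‖deriv (fun t => e.symm (z t)) t‖ₑ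
      ≤ ENNReal.ofReal (K * K' * dist q p) := fun t ht => by
    have hn : z ⁻¹' Metric.ball (e p₀) ε ∈ 𝓝 t :=
      hzs.continuous.continuousAt.preimage_mem_nhds (Metric.isOpen_ball.mem_nhds (hz t ht))
    have hL : LipschitzOnWith (K * ‖e q - e p‖₊) (fun t => e.symm (z t))
        (z ⁻¹' Metric.ball (e p₀) ε) :=
      hK.comp (hzL.lipschitzOnWith) fun u hu => (hεT hu).1
    have h1 := norm_deriv_le_of_lipschitzOn hn hL
    have h2 := hK'.dist_le_mul q hq'.1.1 p hp'.1.1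
    rw [← ofReal_norm]
    refine ENNReal.ofReal_le_ofReal (h1.trans ?_)
    rw [dist_eq_norm (e q)] at h2
    push_cast
    rw [mul_assoc]
    exact mul_le_mul_of_nonneg_left h2 K.2
  calc geodEDist M p q ≤ ∫⁻ t in Icc (0 : ℝ) 1, ‖deriv (fun t => e.symm (z t)) t‖ₑ :=
        iInf_le_of_le _ (iInf_le_of_le hγ (iInf_le_of_le hγM (iInf_le_of_le
          (by simp [z, e.left_inv hp'.1.2]) (iInf_le_of_le (by simp [z, e.left_inv hq'.1.2])
          le_rfl))))
    _ ≤ ∫⁻ _ in Icc (0 : ℝ) 1, ENNReal.ofReal (K * K' * dist q p) :=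
        setLIntegral_mono measurable_const hd
    _ = _ := by simp

/-- Small Euclidean balls of a compact submanifold lie in geodesic balls of comparable radius. -/
theorem IsSmoothSubmanifold.exists_ball_inter_subset_geodBall (hM : IsSmoothSubmanifold k M)
    (hMc : IsCompact M) : ∃ Λ ≥ (1 : ℝ), ∃ r > 0, ∀ p ∈ M, ∀ t, t ≤ r →
      Metric.ball p t ∩ M ⊆ geodBall M p (Λ * t) := by
  have key : ∃ Λ ≥ (1 : ℝ), ∃ r > 0, ∀ p ∈ M, ∀ q ∈ M, dist q p < r →
      geodEDist M p q ≤ ENNReal.ofReal (Λ * dist q p) := by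
    refine hMc.induction_on (p := fun s => ∃ Λ ≥ (1 : ℝ), ∃ r > 0, ∀ p ∈ s, ∀ q ∈ M,
      dist q p < r → geodEDist M p q ≤ ENNReal.ofReal (Λ * dist q p)) ?_ ?_ ?_ ?_
    · exact ⟨1, le_rfl, 1, one_pos, by simp⟩
    · rintro s t hst ⟨Λ, hΛ, r, hr, h⟩
      exact ⟨Λ, hΛ, r, hr, fun p hp => h p (hst hp)⟩
    · rintro s t ⟨Λ, hΛ, r, hr, h⟩ ⟨Λ', hΛ', r', hr', h'⟩
      refine ⟨max Λ Λ', le_max_of_le_left hΛ, min r r', lt_min hr hr', ?_⟩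
      rintro p (hp | hp) q hq hd
      · refine (h p hp q hq (hd.trans_le (min_le_left _ _))).trans (ENNReal.ofReal_le_ofReal ?_)
        gcongr
        exact le_max_left _ _
      · refine (h' p hp q hq (hd.trans_le (min_le_right _ _))).trans (ENNReal.ofReal_le_ofReal ?_)
        gcongr
        exact le_max_right _ _
    · intro p₀ hp₀
      obtain ⟨Λ, -, r, hr, h⟩ := hM.eventually_geodEDist_le hp₀
      refine ⟨Metric.ball p₀ (r / 2) ∩ M, inter_mem
        (mem_nhdsWithin_of_mem_nhds (Metric.ball_mem_nhds _ (by positivity)))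
        self_mem_nhdsWithin, max Λ 1, le_max_right _ _, r / 2, by positivity, ?_⟩
      intro p hp q hq hd
      have hp2 := hp.1
      rw [Metric.mem_ball] at hp2
      refine (h p ⟨Metric.ball_subset_ball (by linarith) hp.1, hp.2⟩ q ⟨?_, hq⟩).trans
        (ENNReal.ofReal_le_ofReal ?_)
      · rw [Metric.mem_ball]
        linarith [dist_triangle q p p₀]
      · gcongr
        exact le_max_left _ _
  obtain ⟨Λ, hΛ, r, hr, h⟩ := key
  refine ⟨Λ, hΛ, r, hr, fun p hp t ht q hq => ⟨hq.2, ?_⟩⟩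
  have hd : dist q p < t := hq.1
  refine (h p hp q hq.2 (hd.trans_le ht)).trans_lt ?_
  have ht0 : 0 < t := dist_nonneg.trans_lt hd
  rw [ENNReal.ofReal_lt_ofReal_iff (by positivity)]
  gcongr

end GeodesicBalls

/-! ### Growth of density ratios at an arbitrary centre -/

section FreeBoundaryGrowth

variable {Q : ℕ}

/-- Two growth estimates are chained through an intermediate change of centre, with factor 4 at each
junction. In the product, (c - x)(c - y) ≥ c² - c(x + y), so the losses add up. If one of the
factors is not positive the conclusion is trivial. -/
theorem two_step_growth {c x y S A₀ A₁ B₁ B₂ A₂ : ℝ} (hc : 0 ≤ c) (hc1 : c ≤ 1) (hx : 0 ≤ x)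
    (hy : 0 ≤ y) (hS : 0 ≤ S) (hA₀ : 0 ≤ A₀) (hA₂ : 0 ≤ A₂)
    (h₁ : (c - x) * A₀ - 2 * S ≤ A₁) (h₂ : A₁ ≤ 4 * B₁) (h₃ : (c - y) * B₁ - 2 * S ≤ B₂)
    (h₄ : B₂ ≤ 4 * A₂) : (c ^ 2 / 16 - (x + y)) * A₀ - 3 * S ≤ A₂ := by
  have hcc : c ^ 2 ≤ c := by
    rw [pow_two]
    exact mul_le_of_le_one_left hc hc1
  have hneg : c ≤ x + y → (c ^ 2 / 16 - (x + y)) * A₀ - 3 * S ≤ A₂ := fun h => by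
    have : (c ^ 2 / 16 - (x + y)) * A₀ ≤ 0 :=
      mul_nonpos_of_nonpos_of_nonneg (by linarith) hA₀
    linarith
  rcases le_total c x with hcx | hcx
  · exact hneg (by linarith)
  rcases le_total c y with hcy | hcy
  · exact hneg (by linarith)
  have h5 : (c - y) * ((c - x) * A₀ - 2 * S) ≤ (c - y) * (4 * B₁) :=
    mul_le_mul_of_nonneg_left (h₁.trans h₂) (by linarith)
  have h6 : (c - y) * S ≤ 1 * S := mul_le_mul_of_nonneg_right (by linarith) hS
  have h7 : 0 ≤ x * y * A₀ := by positivity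
  have h8 : c * ((x + y) * A₀) ≤ 1 * ((x + y) * A₀) :=
    mul_le_mul_of_nonneg_right hc1 (by positivity)
  have h9 : 0 ≤ (x + y) * A₀ := by positivity
  linarith

variable {μ lam : Measure (Euc Q)} [IsFiniteMeasure μ] [IsFiniteMeasure lam]

/-- Almost monotonicity of the density ratio at any point of `M`: passing to the nearest point of
`N` once the radius exceeds the distance to `N`. -/
theorem ballRatio_growth_of_mem {M N : Set (Euc Q)} (hN : IsCompact N) (hNM : N ⊆ M) {p : Euc Q}
    {C σ δ k s b : ℝ} {i : ℕ} (hpM : p ∈ M) (hC : 1 ≤ C) (hσ : 0 < σ) (hδ : 0 ≤ δ) (hk : 0 ≤ k)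
    (hki : 2 * k + 1 ≤ 2 ^ i) (hσs : σ ≤ s) (hsb : s ≤ b) (hb : 16 * C * b ≤ 1)
    (hlam : ∀ t, 0 < t → t ≤ b →
      lam.real (Metric.ball p t) ≤ δ * μ.real (Metric.ball p (k * t)))
    (hw : ∀ q ∈ M, ∀ s r, σ ≤ s → 2 * s ≤ r → r ≤ b → (q ∈ N ∨ Disjoint (Metric.ball q r) N) →
      Metric.ball q r ⊆ Metric.ball p b → WeightedBound μ lam q C σ s r) :
    (growthConst C i ^ 2 / 16 - 4 * δ * (1 + Real.log (b / s))) * ballRatio μ p s - 3 * σ ^ 2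
      ≤ ballRatio μ p b := by
  have hs : 0 < s := hσ.trans_le hσs
  have hb0 : 0 < b := hs.trans_le hsb
  have hc0 := growthConst_pos hC i
  have hc1 := growthConst_le_one hC i
  set c := growthConst C i with hcdef
  set ℓ := Real.log (b / s) with hℓ
  have hℓ0 : 0 ≤ ℓ := Real.log_nonneg ((one_le_div hs).2 hsb)
  have hlog : ∀ y, 0 < y → y ≤ b / s → Real.log y ≤ ℓ := fun y hy h => Real.log_le_log hy h
  have hσ2 := sq_nonneg σ
  have hA := ballRatio_nonneg (μ := μ) p s
  have hB := ballRatio_nonneg (μ := μ) p b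
  -- All radii used lie between s and b, so the logarithm in each run is at most ℓ and one common
  -- loss x serves for both.
  set x := 2 * δ * (1 + ℓ) with hx
  have hx0 : 0 ≤ x := by positivity
  have hxx : x + x = 4 * δ * (1 + ℓ) := by rw [hx]; ring
  rw [← hxx]
  have hlam' : ∀ t, 0 < t → t ≤ b →
      lam.real (Metric.ball p t) ≤ δ * μ.real (Metric.ball p (2 ^ i * t)) := fun t ht htb => by
    refine (hlam t ht htb).trans (mul_le_mul_of_nonneg_left ?_ hδ)
    refine measureReal_mono (Metric.ball_subset_ball ?_)
    gcongr
    linarith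
  have hstep : ∀ q a b', s ≤ a → a ≤ b' → b' ≤ b →
      (∀ t, a ≤ t → t ≤ b' →
        lam.real (Metric.ball q t) ≤ δ * μ.real (Metric.ball q (2 ^ i * t))) →
      (∀ s r, a ≤ s → 2 * s ≤ r → r ≤ b' → WeightedBound μ lam q C σ s r) →
      (c - x) * ballRatio μ q a - 2 * σ ^ 2 ≤ ballRatio μ q b' := by
    intro q a b' hsa hab hb' hl hw'
    have ha : 0 < a := hs.trans_le hsa
    have hb'0 : 0 < b' := ha.trans_le hab
    have h1 := ballRatio_growth hC hσ hδ (hσs.trans hsa) hab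
      (le_trans (by gcongr) hb) hl hw'
    refine le_trans ?_ h1
    have h2 : Real.log (b' / a) ≤ ℓ := hlog _ (by positivity) (by gcongr)
    have h3 : c - x ≤ c - 2 * δ * (1 + Real.log (b' / a)) := by
      have := mul_le_mul_of_nonneg_left h2 hδ
      rw [hx]
      linarith
    have := mul_le_mul_of_nonneg_right h3 (ballRatio_nonneg (μ := μ) q a)
    linarith
  by_cases hcase : p ∈ N ∨ Disjoint (Metric.ball p b) N
  · have h1 := hstep p s b le_rfl hsb le_rfl (fun t ht htb => hlam' t (hs.trans_le ht) htb)
      (fun s' r' hs' hr' hrb => hw p hpM s' r' (hσs.trans hs') hr' hrb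
        (hcase.imp_right fun h => h.mono_left (Metric.ball_subset_ball hrb))
        (Metric.ball_subset_ball hrb))
    have h2 : c ^ 2 / 16 - (x + x) ≤ c - x := by
      have : c ^ 2 ≤ c := by
        rw [pow_two]
        exact mul_le_of_le_one_left hc0.le hc1
      linarith
    have := mul_le_mul_of_nonneg_right h2 hA
    linarith
  · rw [not_or, not_disjoint_iff] at hcase
    obtain ⟨hpN, q₀, hq₀b, hq₀⟩ := hcase
    obtain ⟨p', hp'N, hp'⟩ := hN.exists_infDist_eq_dist ⟨q₀, hq₀⟩ p
    set d := dist p p' with hd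
    have hdmin : ∀ y ∈ N, d ≤ dist y p := fun y hy => by
      rw [← hp', dist_comm]
      exact Metric.infDist_le_dist_of_mem hy
    have hdb : d ≤ b := (hdmin q₀ hq₀).trans (Metric.mem_ball.1 hq₀b).le
    have hdisj : Disjoint (Metric.ball p d) N := disjoint_left.2 fun y hy hyN =>
      absurd (Metric.mem_ball.1 hy) (not_lt.2 (hdmin y hyN))
    -- Up to the distance d to N, balls centred at p do not meet N and the test fields at p are
    -- admissible. Beyond it the nearest point of N serves as centre. If s ≥ d the first run is
    -- void.
    set a := max s d with ha
    have hsa : s ≤ a := le_max_left _ _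
    have hda : d ≤ a := le_max_right _ _
    have hab : a ≤ b := max_le hsb hdb
    have ha0 : 0 < a := hs.trans_le hsa
    have h₁ : (c - x) * ballRatio μ p s - 2 * σ ^ 2 ≤ ballRatio μ p a := by
      rcases le_total d s with hds | hsd
      · rw [ha, max_eq_left hds]
        have := mul_le_mul_of_nonneg_right (by linarith : c - x ≤ 1) hA
        linarith
      · rw [ha, max_eq_right hsd]
        exact hstep p s d le_rfl hsd hdb
          (fun t ht htd => hlam' t (hs.trans_le ht) (htd.trans hdb))
          (fun s' r' hs' hr' hrd => hw p hpM s' r' (hσs.trans hs') hr' (hrd.trans hdb)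
            (Or.inr (hdisj.mono_left (Metric.ball_subset_ball hrd)))
            (Metric.ball_subset_ball (hrd.trans hdb)))
    -- If the second range of radii is too short, inclusion of balls bridges it; auxiliary
    -- intermediate values bring this into the form of the two-step estimate.
    rcases lt_or_ge b (4 * a) with h4 | h4
    · have h2 : ballRatio μ p a ≤ 4 ^ 2 * ballRatio μ p b :=
        ballRatio_le_mul ha0 hb0 h4.le (by simpa using hab)
      refine two_step_growth (B₁ := ballRatio μ p a / 4) (B₂ := 4 * ballRatio μ p b)
        hc0.le hc1 hx0 hx0 hσ2 hA hB h₁ (by linarith) ?_ le_rfl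
      have h3 := mul_le_mul_of_nonneg_right (by linarith : c - x ≤ 1)
        (by have := ballRatio_nonneg (μ := μ) p a; positivity : 0 ≤ ballRatio μ p a / 4)
      linarith
    -- Since the centres are at distance d ≤ a, the ball of radius a about p lies in that of radius
    -- 2a about p', and the ball of radius b/2 about p' lies in that of radius b about p.
    · have h2 : ballRatio μ p a ≤ 2 ^ 2 * ballRatio μ p' (2 * a) :=
        ballRatio_le_mul ha0 (by positivity) le_rfl (by linarith)
      have h5 : ballRatio μ p' (b / 2) ≤ 2 ^ 2 * ballRatio μ p b :=
        ballRatio_le_mul (by positivity) hb0 (by linarith) (by rw [dist_comm, ← hd]; linarith)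
      refine two_step_growth hc0.le hc1 hx0 hx0 hσ2 hA hB h₁ (by linarith)
        (hstep p' (2 * a) (b / 2) (by linarith) (by linarith) (by linarith) ?_ ?_) (by linarith)
      -- The hypothesis on λ is known only at p. For t ≥ 2a, passing from p' to p at most doubles
      -- the radius, and returning adds d ≤ t, so the enlargement factor is at most 2k + 1 ≤ 2^i.
      · intro t ht htb
        have ht0 : 0 < t := by linarith
        have e1 : lam.real (Metric.ball p' t) ≤ lam.real (Metric.ball p (2 * t)) :=
          measureReal_mono (Metric.ball_subset_ball' (by rw [dist_comm, ← hd]; linarith))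
        have e2 : μ.real (Metric.ball p (k * (2 * t))) ≤ μ.real (Metric.ball p' (2 ^ i * t)) := by
          refine measureReal_mono (Metric.ball_subset_ball' ?_)
          have := mul_le_mul_of_nonneg_right hki ht0.le
          rw [← hd]
          linarith
        exact (e1.trans (hlam _ (by positivity) (by linarith))).trans
          (mul_le_mul_of_nonneg_left e2 hδ)
      · intro s' r' hs' hr' hrb
        refine hw p' (hNM hp'N) s' r' (by linarith) hr' (by linarith) (Or.inl hp'N)
          (Metric.ball_subset_ball' ?_)
        rw [dist_comm, ← hd]
        linarith

end FreeBoundaryGrowth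

/-! ### The push-forward measures are carried by M -/

section Support

variable {Q : ℕ} {M N : Set (Euc Q)} {S : Type*} [TopologicalSpace S]
  [ChartedSpace (EuclideanHalfSpace 2) S] [MeasurableSpace S] [BorelSpace S] {Φ : S → Euc Q}

theorem IsAdmissible.map_compl_eq_zero (hΦ : IsAdmissible M N Φ) (hM : IsClosed M)
    (ν : Measure S) : ν.map Φ Mᶜ = 0 := by
  rw [Measure.map_apply hΦ.smooth.continuous.measurable hM.measurableSet.compl]
  have : Φ ⁻¹' Mᶜ = ∅ := eq_empty_of_forall_notMem fun x hx => hx (hΦ.mem_ambient x)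
  rw [this, measure_empty]

variable [IsManifold (𝓡∂ 2) ∞ S] [CompactSpace S] [T2Space S] {U : Set S} {σ : ℝ}

theorem IsAdmissible.muMeasure_inter (hΦ : IsAdmissible M N Φ) (hM : IsClosed M)
    (A : Set (Euc Q)) : muMeasure Φ U (A ∩ M) = muMeasure Φ U A :=
  measure_inter_conull (hΦ.map_compl_eq_zero hM _)

theorem IsAdmissible.lambdaMeasure_inter (hΦ : IsAdmissible M N Φ) (hM : IsClosed M)
    (A : Set (Euc Q)) : lambdaMeasure M σ Φ U (A ∩ M) = lambdaMeasure M σ Φ U A := by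
  refine measure_inter_conull ?_
  rw [lambdaMeasure, Measure.add_apply, Measure.smul_apply, hΦ.map_compl_eq_zero hM,
    hΦ.map_compl_eq_zero hM]
  simp

end Support

/-- Passage from Euclidean to geodesic density ratios; `β` is the area of the geodesic ball. -/
theorem ratio_growth_of_comparison {β : ℝ → ℝ} {A c c₁ θ δ σ s b r : ℝ} (hs : 0 < s) (hsr : s < r)
    (hδ : 0 ≤ δ) (hβ : 0 ≤ β s) (hβr : β s ≤ β r) (hθ : 0 ≤ θ) (hθ1 : θ ≤ 1) (hc₁ : c₁ ≤ 1)
    (hcθ : c ≤ θ ^ 2 * c₁) (hc9 : c ≤ 1 / 9) (hθb : θ * r ≤ b) (hbr : b ≤ r)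
    (hA : s < b → β s / s ^ 2 ≤ A ∧
      (c₁ - 4 * δ * (1 + Real.log (b / s))) * A - 3 * σ ^ 2 ≤ β r / b ^ 2) :
    (c - 8 * δ * Real.log (r / s)) * (β s / s ^ 2) - 8 * σ ^ 2 ≤ β r / r ^ 2 := by
  have hr : 0 < r := hs.trans hsr
  have hX0 : 0 ≤ β s / s ^ 2 := by positivity
  have hβr0 : 0 ≤ β r := hβ.trans hβr
  have hY0 : 0 ≤ β r / r ^ 2 := by positivity
  have hℓ0 : 0 ≤ Real.log (r / s) := Real.log_nonneg ((one_le_div hs).2 hsr.le)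
  set ℓ := Real.log (r / s) with hℓ
  have hσ2 := sq_nonneg σ
  have hδℓ : 0 ≤ δ * ℓ := by positivity
  -- When s is comparable to r, monotonicity of β in the radius is enough.
  have hdirect : ∀ k, 0 ≤ k → k * r ≤ s → c ≤ k ^ 2 →
      (c - 8 * δ * ℓ) * (β s / s ^ 2) - 8 * σ ^ 2 ≤ β r / r ^ 2 := fun k hk hks hck => by
    have h1 : (k * r) ^ 2 ≤ s ^ 2 := by gcongr
    have h2 : k ^ 2 * (β s / s ^ 2) ≤ β r / r ^ 2 := by
      rw [← mul_div_assoc, div_le_div_iff₀ (by positivity) (by positivity)]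
      calc k ^ 2 * β s * r ^ 2 = β s * (k * r) ^ 2 := by ring
        _ ≤ β r * s ^ 2 := by gcongr
    have h3 := mul_le_mul_of_nonneg_right (by linarith : c - 8 * δ * ℓ ≤ k ^ 2) hX0
    linarith
  rcases le_or_gt b s with hbs | hsb
  · refine hdirect θ hθ (hθb.trans hbs) (hcθ.trans ?_)
    exact mul_le_of_le_one_right (by positivity) hc₁
  -- If log(r/s) < 1 then r < 3s and the direct comparison applies with factor 1/9. Otherwise 1 ≤
  -- log(r/s), which absorbs the additive constant in 1 + log(b/s) and doubles the coefficient 4 to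
  -- 8.
  rcases lt_or_ge ℓ 1 with hℓ1 | hℓ1
  · refine hdirect (1 / 3) (by norm_num) ?_ (by linarith)
    have h1 : r / s < Real.exp 1 := (Real.log_lt_iff_lt_exp (by positivity)).1 hℓ1
    have h2 := Real.exp_one_lt_d9
    rw [div_lt_iff₀ hs] at h1
    have h3 := mul_le_mul_of_nonneg_right (by linarith : Real.exp 1 ≤ 3) hs.le
    linarith
  obtain ⟨hXA, hgr⟩ := hA hsb
  have hb : 0 < b := hs.trans hsb
  have hlog : Real.log (b / s) ≤ ℓ := Real.log_le_log (by positivity) (by gcongr)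
  have hθ2 : θ ^ 2 ≤ 1 := pow_le_one₀ hθ hθ1
  rcases le_total (c₁ - 8 * (δ * ℓ)) 0 with hneg | hpos
  · have h1 : c ≤ 8 * (δ * ℓ) := by
      have h2 := mul_le_mul_of_nonneg_left (by linarith : c₁ ≤ 8 * (δ * ℓ)) (sq_nonneg θ)
      have h3 := mul_le_mul_of_nonneg_right hθ2 hδℓ
      linarith
    have := mul_nonpos_of_nonpos_of_nonneg (by linarith : c - 8 * δ * ℓ ≤ 0) hX0
    linarith
  · have h1 : (c₁ - 8 * (δ * ℓ)) * (β s / s ^ 2) - 3 * σ ^ 2 ≤ β r / b ^ 2 := by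
      refine le_trans ?_ hgr
      have h2 : c₁ - 8 * (δ * ℓ) ≤ c₁ - 4 * δ * (1 + Real.log (b / s)) := by
        have := mul_le_mul_of_nonneg_left (by linarith : 1 + Real.log (b / s) ≤ 2 * ℓ) hδ
        linarith
      have h3 := mul_le_mul_of_nonneg_left hXA hpos
      have h4 := mul_le_mul_of_nonneg_right h2 (hX0.trans hXA)
      linarith
    have h2 : θ ^ 2 * (β r / b ^ 2) ≤ β r / r ^ 2 := by
      rw [← mul_div_assoc, div_le_div_iff₀ (by positivity) (by positivity)]
      calc θ ^ 2 * β r * r ^ 2 = β r * (θ * r) ^ 2 := by ring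
        _ ≤ β r * b ^ 2 := by gcongr
    have h3 := mul_le_mul_of_nonneg_left h1 (sq_nonneg θ)
    have h4 := mul_le_mul_of_nonneg_right hθ2 (by positivity : 0 ≤ δ * ℓ * (β s / s ^ 2))
    have h5 := mul_le_mul_of_nonneg_right hθ2 hσ2
    have h6 := mul_le_mul_of_nonneg_right hcθ hX0
    linarith

end FreeBoundary

end

/-! ### Choice of constants and passage to geodesic balls -/

theorem mainTheorem5 {Q m n : ℕ} (hn : 1 ≤ n) (hnm : n < m)
    (M N : Set (FreeBoundary.Euc Q))
    (hM : IsCompact M) (hMs : FreeBoundary.IsSmoothSubmanifold m M)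
    (hN : IsCompact N) (hNs : FreeBoundary.IsSmoothSubmanifold n N) (hNM : N ⊆ M)
    (R : ℝ) :
    ∃ c C : ℝ, 0 < c ∧ 0 < C ∧
      ∀ (S : Type*) [TopologicalSpace S] [ChartedSpace (EuclideanHalfSpace 2) S]
        [IsManifold (𝓡∂ 2) ∞ S] [CompactSpace S] [T2Space S] [MeasurableSpace S] [BorelSpace S]
        (σ : ℝ) (Φ : S → FreeBoundary.Euc Q) (x : S) (U : Set S) (δ r s : ℝ),
        0 < σ → FreeBoundary.IsEpsCritical M N σ (σ ^ 5) Φ →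
        IsOpen U → x ∈ U → 0 < δ → δ < 1 →
        (∀ t : ℝ, 0 < t →
          FreeBoundary.lambdaMeasure M σ Φ U (FreeBoundary.geodBall M (Φ x) t) ≤
            ENNReal.ofReal δ *
              FreeBoundary.muMeasure Φ U (FreeBoundary.geodBall M (Φ x) (5 * t))) →
        σ ≤ s → s < r → r ≤ R →
        Disjoint (FreeBoundary.geodBall M (Φ x) r) (Φ '' frontier U) →
        (c - C * δ * Real.log (r / s)) *
            ((FreeBoundary.muMeasure Φ U).real (FreeBoundary.geodBall M (Φ x) s) / s ^ 2)
            - C * σ ^ 2 ≤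
          (FreeBoundary.muMeasure Φ U).real (FreeBoundary.geodBall M (Φ x) r) / r ^ 2 := by
  obtain ⟨C, hC, r₀, hr₀, hwb⟩ := FreeBoundary.exists_weightedBound hM hMs hNs hN.isClosed hNM
  obtain ⟨Λ, hΛ, r₂, hr₂, hgeod⟩ := hMs.exists_ball_inter_subset_geodBall hM
  -- In Euclidean balls the hypothesis on λ holds with enlargement factor 5Λ instead of 5. The
  -- exponent i leaves room for the further change of centre.
  obtain ⟨i, hi⟩ := pow_unbounded_of_one_lt (2 * (5 * Λ) + 1) (one_lt_two : (1 : ℝ) < 2)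
  have hc0 := FreeBoundary.growthConst_pos hC i
  have hc1 := FreeBoundary.growthConst_le_one hC i
  set c₁ := FreeBoundary.growthConst C i ^ 2 / 16 with hc₁
  have hc₁0 : 0 < c₁ := by positivity
  have hc₁1 : c₁ ≤ 1 := by
    have : FreeBoundary.growthConst C i ^ 2 ≤ 1 := pow_le_one₀ hc0.le hc1
    linarith
  -- Below R₁ the test fields exist, Euclidean and geodesic balls are comparable, and the curvature
  -- error can be absorbed.
  set R₁ := min (min r₀ r₂) (1 / (16 * C)) with hR₁
  have hR₁0 : 0 < R₁ := lt_min (lt_min hr₀ hr₂) (by positivity)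
  have hR1 : 0 < max R 1 := lt_max_of_lt_right one_pos
  -- The fraction θ is chosen so that θr is at most min(R₁, r/Λ) for every r ≤ R. Replacing the
  -- radius b by r costs a factor θ², which is how the constant depends on R.
  set θ := min (R₁ / max R 1) (1 / Λ) with hθ
  have hθ0 : 0 < θ := lt_min (by positivity) (by positivity)
  have hθ1 : θ ≤ 1 := (min_le_right _ _).trans ((div_le_one (by positivity)).2 hΛ)
  refine ⟨min (θ ^ 2 * c₁) (1 / 9), 8, lt_min (by positivity) (by norm_num), by norm_num, ?_⟩
  intro S _ _ _ _ _ _ _ σ Φ x U δ r s hσ hΦ hU hx hδ hδ1 hlam hσs hsr hrR hdisj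
  have hs : 0 < s := hσ.trans_le hσs
  have hr : 0 < r := hs.trans hsr
  have hΛ0 : 0 < Λ := by linarith
  set p := Φ x with hp
  have hpM : p ∈ M := hΦ.1.mem_ambient x
  have := hΦ.1.isFiniteMeasure_muMeasure (U := U)
  have := hΦ.1.isFiniteMeasure_lambdaMeasure hMs hM.isClosed (U := U) (σ := σ)
  set μ := FreeBoundary.muMeasure Φ U with hμ
  set lam := FreeBoundary.lambdaMeasure M σ Φ U with hlamdef
  -- The part of the Euclidean ball of radius b in M lies in the geodesic ball of radius r, which
  -- avoids the image of the frontier of U.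
  set b := min R₁ (r / Λ) with hb
  have hb0 : 0 < b := lt_min hR₁0 (by positivity)
  have hbR : b ≤ R₁ := min_le_left _ _
  have hbr₀ : b ≤ r₀ := hbR.trans ((min_le_left _ _).trans (min_le_left _ _))
  have hbr₂ : b ≤ r₂ := hbR.trans ((min_le_left _ _).trans (min_le_right _ _))
  have hbC : 16 * C * b ≤ 1 := by
    have h := hbR.trans (min_le_right _ _)
    rw [le_div_iff₀ (by positivity)] at h
    linarith
  have hΛb : Λ * b ≤ r := by
    have h : b ≤ r / Λ := min_le_right _ _
    rw [le_div_iff₀ hΛ0] at h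
    linarith
  have hbr : b ≤ r := le_trans (le_mul_of_one_le_left hb0.le hΛ) hΛb
  have hθb : θ * r ≤ b := by
    refine le_min ?_ ?_
    · calc θ * r ≤ R₁ / max R 1 * max R 1 := by
            gcongr
            · exact min_le_left _ _
            · exact hrR.trans (le_max_left _ _)
        _ = R₁ := by field_simp
    · calc θ * r ≤ 1 / Λ * r := by
            gcongr
            exact min_le_right _ _
        _ = r / Λ := by ring
  have hmono : ∀ {t u : ℝ}, t ≤ u → FreeBoundary.geodBall M p t ⊆ FreeBoundary.geodBall M p u :=
    fun htu q hq => ⟨hq.1, hq.2.trans_le (ENNReal.ofReal_le_ofReal htu)⟩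
  have hsub : ∀ {q : FreeBoundary.Euc Q}, q ∈ Metric.ball p b → q ∈ M →
      q ∈ FreeBoundary.geodBall M p r := fun hqb hqM =>
    hmono hΛb (hgeod p hpM b hbr₂ ⟨hqb, hqM⟩)
  have hlamE : ∀ t, 0 < t → t ≤ b →
      lam.real (Metric.ball p t) ≤ δ * μ.real (Metric.ball p (5 * Λ * t)) := fun t ht htb => by
    have h1 : lam (Metric.ball p t) ≤ ENNReal.ofReal δ * μ (Metric.ball p (5 * Λ * t)) := by
      -- Since λ is carried by M, only the trace of the Euclidean ball on M matters. It is enclosed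
      -- in the geodesic ball of radius Λt, where the hypothesis applies.
      rw [hlamdef, ← hΦ.1.lambdaMeasure_inter hM.isClosed]
      refine (measure_mono (hgeod p hpM t (htb.trans hbr₂))).trans
        ((hlam (Λ * t) (by positivity)).trans ?_)
      gcongr
      rw [mul_assoc]
      exact FreeBoundary.geodBall_subset_ball _ _
    have h2 := ENNReal.toReal_mono
      (ENNReal.mul_ne_top ENNReal.ofReal_ne_top (measure_ne_top _ _)) h1
    rwa [ENNReal.toReal_mul, ENNReal.toReal_ofReal hδ.le] at h2
  refine FreeBoundary.ratio_growth_of_comparison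
    (β := fun t => μ.real (FreeBoundary.geodBall M p t)) (A := FreeBoundary.ballRatio μ p s)
    hs hsr hδ.le measureReal_nonneg (measureReal_mono (hmono hsr.le)) hθ0.le hθ1 hc₁1
    (min_le_left _ _) (min_le_right _ _) hθb hbr
    fun hsb => ⟨?_, ?_⟩
  · rw [FreeBoundary.ballRatio]
    gcongr
    exacts [measure_ne_top _ _, FreeBoundary.geodBall_subset_ball _ _]
  · refine (FreeBoundary.ballRatio_growth_of_mem hN hNM hpM hC hσ hδ.le (by positivity) hi.le hσs
      hsb.le hbC hlamE fun q hq s' r' hs' hr' hrb hqN hqb => ?_).trans ?_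
    -- Every ball used in the iteration, including those centred at the nearest point of N, lies in
    -- the Euclidean ball of radius b about p and therefore contains no image of a frontier point.
    · refine hwb S σ Φ U q s' r' hσ hΦ hU hq hs' hr' (hrb.trans hbr₀) hqN fun y hy hyq => ?_
      exact disjoint_left.1 hdisj (hsub (hqb hyq) (hΦ.1.mem_ambient y)) (mem_image_of_mem Φ hy)
    · refine div_le_div_of_nonneg_right ?_ (by positivity)
      rw [measureReal_def, measureReal_def, hμ, ← hΦ.1.muMeasure_inter hM.isClosed]
      exact ENNReal.toReal_mono (measure_ne_top _ _) (measure_mono fun q hq => hsub hq.1 hq.2)
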